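/- Let $\beta\approx 0.745$ be the Kertz bound, i.e. the solution $\beta\in(0,1)$ of $$\int_0^1\bigl[(\beta^{-1}-1)-y(\log y-1)\bigr]^{-1}\,dy=1 .$$ For a finite set $\mathbf S$ of independent nonnegative random variables with finite expectations and known distributions ("boxes"), let $\mathsf{MAX}(\mathbf S)=\mathbb E[\max_{X\in\mathbf S}X]$ (with $\mathsf{MAX}(\emptyset)=0$), and let $\mathsf{OPT}_{\mathsf{free}}(\mathbf S)$ be the supremum of the expected rewards of all online policies that inspect boxes of $\mathbf S$ one at a time, each at most once, choose the next box adaptively from what has been observed, and after each inspection either take the observed value and stop or discard it forever. There are absolute constants $C,c_1,c_2,K>0$ and $d\in\mathbb N$ and a single algorithm such that the following holds. Let $\mathbf X=\{X_1,\dots,X_n\}$ be independent nonnegative random variables with finite expectations, let $0<\varepsilon\le\frac12$, and put $L=\varepsilon^{-1}\log\varepsilon^{-1}$. Then there is a subset $\mathbf X'\subseteq\mathbf X$ with $$\min\{n,\,c_1L^2\}\ \le\ n-|\mathbf X'|\ \le\ c_2L^2 \qquad\text{and}\qquad \mathsf{OPT}_{\mathsf{free}}(\mathbf X')\ \ge\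 (\beta-C\varepsilon)\cdot\mathsf{MAX}(\mathbf X').$$ Moreover, such a subset and a policy achieving the guarantee can be constructed in polynomial time: given $n$ and $\varepsilon$, and access to the distributions through queries for $\Pr[X_i\le x]$ and $\mathbb E[X_i]$, the algorithm (a program for a deterministic real random access machine in which each arithmetic operation, comparison, memory access and query has unit cost) halts after at most $K\,(n+\varepsilon^{-1})^d$ steps and outputs an ordering of $\mathbf X'$ together with a real threshold for each of its variables, such that the policy that inspects $\mathbf X'$ in this order and takes the first value exceeding its threshold has expected reward at least $(\beta-C\varepsilon)\cdot\mathsf{MAX}(\mathbf X')$. -/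

import Mathlib

open MeasureTheory ProbabilityTheory

/-- `β` is the Kertz bound (about `0.745`): the solution of
`∫₀¹ [(β⁻¹ - 1) - y (log y - 1)]⁻¹ dy = 1`. -/
def IsKertzBound (β : ℝ) : Prop :=
  0 < β ∧ β < 1 ∧
    ∫ y in (0 : ℝ)..1, ((β⁻¹ - 1) - y * (Real.log y - 1))⁻¹ = 1

namespace FreeOrder

/-! ### Online policies that choose the inspection order -/

/-- A (fully adaptive) free-order policy for boxes labelled by `ι`. Either it ends the game without
a reward, or it inspects box `i`: if the value found lies in `accept` it takes that value and the
game ends; if the value found is some other `v`, the box is lost and it goes on with `next v`.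
Nesting makes every decision depend on everything observed so far. -/
inductive Policy (ι : Type) : Type where
  | quit : Policy ι
  | inspect (i : ι) (accept : Set ℝ) (next : ℝ → Policy ι) : Policy ι

namespace Policy

variable {ι : Type}

open Classical in
/-- The reward collected by a policy when the boxes contain the values `x`. -/
noncomputable def reward : Policy ι → (ι → ℝ) → ℝ
  | quit, _ => 0
  | inspect i accept next, x => if x i ∈ accept then x i else reward (next (x i)) x

/-- The policy only inspects boxes in `S`, each of them at most once. -/
def Feasible [DecidableEq ι] : Policy ι → Finset ι → Prop
  | quit, _ => True
  | inspect i _ next, S => i ∈ S ∧ ∀ v, Feasible (next v) (S.erase i)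

/-- The policy that inspects the listed boxes in the listed order, and takes the first value that
exceeds the threshold listed with its box. -/
def ofThresholds : List (ι × ℝ) → Policy ι
  | [] => quit
  | (i, τ) :: l => inspect i (Set.Ioi τ) (fun _ => ofThresholds l)

end Policy

variable {ι : Type} {Ω : Type*} [MeasurableSpace Ω]

/-- The expected reward of a policy on the boxes `X`. -/
noncomputable def expReward (P : Measure Ω) (X : ι → Ω → ℝ) (p : Policy ι) : ℝ :=
  ∫ ω, p.reward (fun i => X i ω) ∂P

/-- The free-order optimum of the sub-instance `S`: the supremum of the expected rewards of all
policies for the boxes in `S` (the reward has to be a measurable function of the values). -/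
noncomputable def optFree [DecidableEq ι] (P : Measure Ω) (X : ι → Ω → ℝ) (S : Finset ι) : ℝ :=
  sSup {r | ∃ p : Policy ι, p.Feasible S ∧ Measurable p.reward ∧ r = expReward P X p}

/-- The prophet's reward `𝔼[max_{i ∈ S} X i]` (for nonnegative `X`; it is `0` for empty `S`). -/
noncomputable def prophet (P : Measure Ω) (X : ι → Ω → ℝ) (S : Finset ι) : ℝ :=
  ∫ ω, S.fold max 0 (fun i => X i ω) ∂P

end FreeOrder

/-! ### A real random access machine with access to the distributions

Programs of a while-language over natural numbers (used for counting and indexing; only addition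
and truncated subtraction) and real numbers (exact field operations and comparisons; no rounding,
and only natural constants). Every operation, memory access, test and query has unit cost. -/
namespace RealRAM

/-- The queries that a program may ask about the boxes: `cdf i x` is `Pr[X i ≤ x]`, and `mean i` is
the expectation of `X i`. -/
structure Oracle where
  cdf : ℕ → ℝ → ℝ
  mean : ℕ → ℝ

/-- Memory: variables and arrays of natural numbers and of real numbers. -/
structure State where
  natVar : ℕ → ℕ
  natArr : ℕ → ℕ → ℕ
  realVar : ℕ → ℝ
  realArr : ℕ → ℕ → ℝ

/-- Expressions of type natural number. -/
inductive NExpr : Type where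
  | const (k : ℕ)
  | var (x : ℕ)
  | arr (a : ℕ) (i : NExpr)
  | add (e f : NExpr)
  | sub (e f : NExpr)

/-- Expressions of type real number. -/
inductive RExpr : Type where
  | ofNat (e : NExpr)
  | var (x : ℕ)
  | arr (a : ℕ) (i : NExpr)
  | add (e f : RExpr)
  | sub (e f : RExpr)
  | mul (e f : RExpr)
  | div (e f : RExpr)
  | cdf (i : NExpr) (e : RExpr)
  | mean (i : NExpr)

/-- Tests. -/
inductive Test : Type where
  | natLe (e f : NExpr)
  | realLe (e f : RExpr)

/-- Programs. -/
inductive Cmd : Type where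
  | skip
  | setNat (x : ℕ) (e : NExpr)
  | setNatArr (a : ℕ) (i e : NExpr)
  | setReal (x : ℕ) (e : RExpr)
  | setRealArr (a : ℕ) (i : NExpr) (e : RExpr)
  | seq (c d : Cmd)
  | cond (b : Test) (c d : Cmd)
  | loop (b : Test) (c : Cmd)

def NExpr.eval (s : State) : NExpr → ℕ
  | const k => k
  | var x => s.natVar x
  | arr a i => s.natArr a (i.eval s)
  | add e f => e.eval s + f.eval s
  | sub e f => e.eval s - f.eval s

/-- The number of operations in an expression. -/
def NExpr.cost : NExpr → ℕ
  | const _ => 1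
  | var _ => 1
  | arr _ i => i.cost + 1
  | add e f => e.cost + f.cost + 1
  | sub e f => e.cost + f.cost + 1

noncomputable def RExpr.eval (O : Oracle) (s : State) : RExpr → ℝ
  | ofNat e => (e.eval s : ℝ)
  | var x => s.realVar x
  | arr a i => s.realArr a (i.eval s)
  | add e f => e.eval O s + f.eval O s
  | sub e f => e.eval O s - f.eval O s
  | mul e f => e.eval O s * f.eval O s
  | div e f => e.eval O s / f.eval O s
  | cdf i e => O.cdf (i.eval s) (e.eval O s)
  | mean i => O.mean (i.eval s)

def RExpr.cost : RExpr → ℕ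
  | ofNat e => e.cost + 1
  | var _ => 1
  | arr _ i => i.cost + 1
  | add e f => e.cost + f.cost + 1
  | sub e f => e.cost + f.cost + 1
  | mul e f => e.cost + f.cost + 1
  | div e f => e.cost + f.cost + 1
  | cdf i e => i.cost + e.cost + 1
  | mean i => i.cost + 1

def Test.Holds (O : Oracle) (s : State) : Test → Prop
  | natLe e f => e.eval s ≤ f.eval s
  | realLe e f => e.eval O s ≤ f.eval O s

def Test.cost : Test → ℕ
  | natLe e f => e.cost + f.cost + 1
  | realLe e f => e.cost + f.cost + 1

def State.setNat (s : State) (x v : ℕ) : State :=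
  { s with natVar := Function.update s.natVar x v }

def State.setNatArr (s : State) (a i v : ℕ) : State :=
  { s with natArr := Function.update s.natArr a (Function.update (s.natArr a) i v) }

noncomputable def State.setReal (s : State) (x : ℕ) (v : ℝ) : State :=
  { s with realVar := Function.update s.realVar x v }

noncomputable def State.setRealArr (s : State) (a i : ℕ) (v : ℝ) : State :=
  { s with realArr := Function.update s.realArr a (Function.update (s.realArr a) i v) }

/-- `Exec O c s s' t`: started in state `s`, with queries answered by `O`, the program `c` halts in
state `s'` after `t` steps. -/
inductive Exec (O : Oracle) : Cmd → State → State → ℕ → Prop where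
  | skip (s : State) : Exec O Cmd.skip s s 1
  | setNat (x : ℕ) (e : NExpr) (s : State) :
      Exec O (Cmd.setNat x e) s (s.setNat x (e.eval s)) (e.cost + 1)
  | setNatArr (a : ℕ) (i e : NExpr) (s : State) :
      Exec O (Cmd.setNatArr a i e) s (s.setNatArr a (i.eval s) (e.eval s)) (i.cost + e.cost + 1)
  | setReal (x : ℕ) (e : RExpr) (s : State) :
      Exec O (Cmd.setReal x e) s (s.setReal x (e.eval O s)) (e.cost + 1)
  | setRealArr (a : ℕ) (i : NExpr) (e : RExpr) (s : State) :
      Exec O (Cmd.setRealArr a i e) s (s.setRealArr a (i.eval s) (e.eval O s))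
        (i.cost + e.cost + 1)
  | seq (c d : Cmd) (s s₁ s₂ : State) (t₁ t₂ : ℕ) :
      Exec O c s s₁ t₁ → Exec O d s₁ s₂ t₂ → Exec O (Cmd.seq c d) s s₂ (t₁ + t₂)
  | condTrue (b : Test) (c d : Cmd) (s s' : State) (t : ℕ) :
      b.Holds O s → Exec O c s s' t → Exec O (Cmd.cond b c d) s s' (b.cost + t)
  | condFalse (b : Test) (c d : Cmd) (s s' : State) (t : ℕ) :
      ¬ b.Holds O s → Exec O d s s' t → Exec O (Cmd.cond b c d) s s' (b.cost + t)
  | loopDone (b : Test) (c : Cmd) (s : State) :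
      ¬ b.Holds O s → Exec O (Cmd.loop b c) s s b.cost
  | loopStep (b : Test) (c : Cmd) (s s₁ s₂ : State) (t₁ t₂ : ℕ) :
      b.Holds O s → Exec O c s s₁ t₁ → Exec O (Cmd.loop b c) s₁ s₂ t₂ →
        Exec O (Cmd.loop b c) s s₂ (b.cost + t₁ + t₂)

/-- The initial memory: the number `n` of boxes and the accuracy `ε`; everything else is `0`. -/
noncomputable def input (n : ℕ) (ε : ℝ) : State where
  natVar := Function.update (fun _ => 0) 0 n
  natArr := fun _ _ => 0
  realVar := Function.update (fun _ => 0) 0 ε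
  realArr := fun _ _ => 0

/-- The final memory `s` holds the list `l` of boxes and thresholds: its length in the first
natural variable, the boxes in the first array of naturals, the thresholds in the first array of
reals. -/
def IsOutput {n : ℕ} (s : State) (l : List (Fin n × ℝ)) : Prop :=
  s.natVar 0 = l.length ∧
    ∀ (j : ℕ) (hj : j < l.length), s.natArr 0 j = (l[j].1 : ℕ) ∧ s.realArr 0 j = l[j].2

/-- The answers about the boxes `X`; queries about boxes that do not exist are answered by `0`. -/
noncomputable def boxOracle {Ω : Type*} [MeasurableSpace Ω] (P : Measure Ω) {n : ℕ}
    (X : Fin n → Ω → ℝ) : Oracle where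
  cdf := fun i x => if h : i < n then P.real {ω | X ⟨i, h⟩ ω ≤ x} else 0
  mean := fun i => if h : i < n then ∫ ω, X ⟨i, h⟩ ω ∂P else 0

end RealRAM

/-! Each box is first capped: its threshold is raised to about its upper ε-quantile `q i`, with a
coin between two neighbouring grid points, so that it is accepted with probability at most 2ε. Let
A(x) be the sum of the capped tails. Then ∫ (1 - exp(-A)) is the expected maximum in the limit of
many small boxes, and it serves as a relaxed benchmark. Against this benchmark the constant β is
attainable: every box independently draws a slot j with probability d_j, boxes are inspected slot by
slot, and in slot j all boxes use a common level at which the total acceptance mass is jε. Since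
∫₀^∞ e^{-r} min(a, r) dr = 1 - e^{-a}, the reward is nearly κ ∫ (1 - exp(-A)) if d_j times the
survival probability equals κ times the gap between (1+ε)^{-j} and (1+ε)^{-(j+1)}. Survival down to
the level y = (1+ε)^{-j} is then about 1 - κ (1 - y + y log y), so the sum of the d_j is a Riemann
sum of the Kertz integral, and the Kertz equation permits κ = β - O(ε). This is carried by
`sum_geoGap_min_ge'`, `sum_slotWeight_le`, `surv_le_prod` and `blend_ge`.

Capping may make the benchmark much smaller than the prophet's reward, and this is why boxes are
removed. Let J be the number of slots, of order ε⁻¹ log ε⁻¹, with (1+ε)^{-J} ≤ ε². The boxes are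
sorted by decreasing quantile and the first k are removed, where J² + 1 ≤ k ≤ 3J² + 1. If some k is
flat, meaning that the quantiles of ranks k and k + J differ by a factor of at most 1 + ε, then J
boxes have mass at least ε each just below the top quantile; hence 1 - exp(-A) is nearly 1 there,
and nothing is lost (`Data.flat`). If the top quantile is at most ε times the value of the policy,
capping is negligible (`Data.rich`). If neither ever happens, the quantiles drop by the factor ε⁴
between ranks J² and 3J² + 1, while the remaining boxes are worth at most O(ε⁻²) times their top
quantile. Then the single box of rank J² outweighs them all by a factor of order ε⁻¹ (`Data.poor`).
It is kept and inspected first with threshold 0.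

The policy is derandomized by conditional expectations. Its computed value `blend` is affine in the
data of each box (`blend_update`), so slot and coins can be fixed box by box without decreasing it,
and for a fixed order it is a lower bound for the true reward (`blend_le_listVal`).

The machine knows neither β nor J. It finds J by counting, and takes for κ the largest multiple of ε
that passes the inequalities needed in the analysis; only an integer M ≥ 1/(1-β) is built into the
program. Quantiles, levels and truncated means are computed on a grid of B = (n + E)⁴ points, where
E is about ε⁻¹. The program is written in a language of bounded loops, sums and products: its
semantics is a function, its running time is polynomial in the loop ranges, and it is compiled to
the machine by `Prog.comp_exec`. -/

namespace RealRAM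

/-! ### A structured language on top of the machine -/

section StateLemmas
variable (s : State) (x a i v : ℕ) (r : ℝ)

@[simp] theorem setNat_natVar : (s.setNat x v).natVar = Function.update s.natVar x v := rfl
@[simp] theorem setNat_natArr : (s.setNat x v).natArr = s.natArr := rfl
@[simp] theorem setNat_realVar : (s.setNat x v).realVar = s.realVar := rfl
@[simp] theorem setNat_realArr : (s.setNat x v).realArr = s.realArr := rfl
@[simp] theorem setNatArr_natVar : (s.setNatArr a i v).natVar = s.natVar := rfl
@[simp] theorem setNatArr_natArr : (s.setNatArr a i v).natArr =
    Function.update s.natArr a (Function.update (s.natArr a) i v) := rfl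
@[simp] theorem setNatArr_realVar : (s.setNatArr a i v).realVar = s.realVar := rfl
@[simp] theorem setNatArr_realArr : (s.setNatArr a i v).realArr = s.realArr := rfl
@[simp] theorem setReal_natVar : (s.setReal x r).natVar = s.natVar := rfl
@[simp] theorem setReal_natArr : (s.setReal x r).natArr = s.natArr := rfl
@[simp] theorem setReal_realVar : (s.setReal x r).realVar = Function.update s.realVar x r := rfl
@[simp] theorem setReal_realArr : (s.setReal x r).realArr = s.realArr := rfl
@[simp] theorem setRealArr_natVar : (s.setRealArr a i r).natVar = s.natVar := rfl
@[simp] theorem setRealArr_natArr : (s.setRealArr a i r).natArr = s.natArr := rfl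
@[simp] theorem setRealArr_realVar : (s.setRealArr a i r).realVar = s.realVar := rfl
@[simp] theorem setRealArr_realArr : (s.setRealArr a i r).realArr =
    Function.update s.realArr a (Function.update (s.realArr a) i r) := rfl

end StateLemmas

/-- Arithmetic operations. -/
inductive BinOp : Type where
  | add | sub | mul | div

noncomputable def BinOp.eval : BinOp → ℝ → ℝ → ℝ
  | add, u, v => u + v
  | sub, u, v => u - v
  | mul, u, v => u * v
  | div, u, v => u / v

def BinOp.toRExpr : BinOp → RExpr → RExpr → RExpr
  | add, e, f => .add e f
  | sub, e, f => .sub e f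
  | mul, e, f => .mul e f
  | div, e, f => .div e f

theorem BinOp.eval_toRExpr (op : BinOp) (O : Oracle) (s : State) (e f : RExpr) :
    (op.toRExpr e f).eval O s = op.eval (e.eval O s) (f.eval O s) := by
  cases op <;> rfl

theorem BinOp.cost_toRExpr (op : BinOp) (e f : RExpr) :
    (op.toRExpr e f).cost = e.cost + f.cost + 1 := by
  cases op <;> rfl

/-- Real expressions with finite sums and products. At depth `d` the bound variable of a sum or
product is the natural variable `d`; its range is given by a natural variable. -/
inductive HExpr : Type where
  | nat (x : ℕ)
  | const (k : ℕ)
  | real (x : ℕ)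
  | narr (a x : ℕ)
  | rarr (a x : ℕ)
  | bin (op : BinOp) (e f : HExpr)
  | cdf (x : ℕ) (e : HExpr)
  | mean (x : ℕ)
  | ite (e f g h : HExpr)
  | fold (isProd : Bool) (b : ℕ) (e : HExpr)

/-- A sum or a product over `range N`. -/
noncomputable def bigOp (isProd : Bool) (N : ℕ) (f : ℕ → ℝ) : ℝ :=
  match isProd with
  | true => ∏ k ∈ Finset.range N, f k
  | false => ∑ k ∈ Finset.range N, f k

namespace HExpr

open Classical in
/-- The value of an expression at depth `d`. -/
noncomputable def eval (O : Oracle) : HExpr → ℕ → State → ℝ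
  | nat x, _, s => s.natVar x
  | const k, _, _ => k
  | real x, _, s => s.realVar x
  | narr a x, _, s => s.natArr a (s.natVar x)
  | rarr a x, _, s => s.realArr a (s.natVar x)
  | bin op e f, d, s => op.eval (e.eval O d s) (f.eval O d s)
  | cdf x e, d, s => O.cdf (s.natVar x) (e.eval O d s)
  | mean x, _, s => O.mean (s.natVar x)
  | ite e f g h, d, s =>
      if e.eval O d s ≤ f.eval O d s then g.eval O d s else h.eval O d s
  | fold m b e, d, s => bigOp m (s.natVar b) fun k => e.eval O (d + 1) (s.setNat d k)

/-- The expression only reads natural variables below its depth and real variables below `R`, and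
the ranges of its sums and products are given by the variables `1` and `2`. -/
def ok (R : ℕ) : HExpr → ℕ → Bool
  | nat x, d => decide (x < d)
  | const _, _ => true
  | real x, _ => decide (x < R)
  | narr _ x, d => decide (x < d)
  | rarr _ x, d => decide (x < d)
  | bin _ e f, d => e.ok R d && f.ok R d
  | cdf x e, d => decide (x < d) && e.ok R d
  | mean x, d => decide (x < d)
  | ite e f g h, d => e.ok R d && f.ok R d && g.ok R d && h.ok R d
  | fold _ b e, d => (b == 1 || b == 2) && e.ok R (d + 1)

/-- The program computing an expression into the real variable `r`. -/
def comp : HExpr → ℕ → ℕ → Cmd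
  | nat x, _, r => .setReal r (.ofNat (.var x))
  | const k, _, r => .setReal r (.ofNat (.const k))
  | real x, _, r => .setReal r (.var x)
  | narr a x, _, r => .setReal r (.ofNat (.arr a (.var x)))
  | rarr a x, _, r => .setReal r (.arr a (.var x))
  | bin op e f, d, r =>
      .seq (e.comp d r) (.seq (f.comp d (r + 1)) (.setReal r (op.toRExpr (.var r) (.var (r + 1)))))
  | cdf x e, d, r => .seq (e.comp d r) (.setReal r (.cdf (.var x) (.var r)))
  | mean x, _, r => .setReal r (.mean (.var x))
  | ite e f g h, d, r =>
      .seq (e.comp d r) (.seq (f.comp d (r + 1))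
        (.cond (.realLe (.var r) (.var (r + 1))) (g.comp d r) (h.comp d r)))
  | fold m b e, d, r =>
      -- `m.toNat` is the neutral element: 1 for a product and 0 for a sum.
      .seq (.setReal r (.ofNat (.const m.toNat))) (.seq (.setNat d (.const 0))
        (.loop (.natLe (.add (.var d) (.const 1)) (.var b))
          (.seq (.seq (e.comp (d + 1) (r + 1))
            (.setReal r ((if m then BinOp.mul else BinOp.add).toRExpr (.var r) (.var (r + 1)))))
            (.setNat d (.add (.var d) (.const 1))))))

/-- A bound on the number of steps if all ranges are at most `N`. -/
def cost (N : ℕ) : HExpr → ℕ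
  | nat _ => 10
  | const _ => 10
  | real _ => 10
  | narr _ _ => 10
  | rarr _ _ => 10
  | bin _ e f => e.cost N + f.cost N + 10
  | cdf _ e => e.cost N + 10
  | mean _ => 10
  | ite e f g h => e.cost N + f.cost N + g.cost N + h.cost N + 10
  | fold _ _ e => N * (e.cost N + 20) + 20

end HExpr

/-- The memories agree on the arrays and on the variables below `D` and `R`. -/
structure Agree (D R : ℕ) (s s' : State) : Prop where
  natVar : ∀ x < D, s.natVar x = s'.natVar x
  natArr : s.natArr = s'.natArr
  realVar : ∀ x < R, s.realVar x = s'.realVar x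
  realArr : s.realArr = s'.realArr

namespace Agree
variable {D R D' R' : ℕ} {s s' s'' : State}

theorem refl (D R : ℕ) (s : State) : Agree D R s s := ⟨fun _ _ => rfl, rfl, fun _ _ => rfl, rfl⟩

theorem symm (h : Agree D R s s') : Agree D R s' s :=
  ⟨fun x hx => (h.natVar x hx).symm, h.natArr.symm, fun x hx => (h.realVar x hx).symm,
    h.realArr.symm⟩

theorem trans (h : Agree D R s s') (h' : Agree D R s' s'') : Agree D R s s'' :=
  ⟨fun x hx => (h.natVar x hx).trans (h'.natVar x hx), h.natArr.trans h'.natArr,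
    fun x hx => (h.realVar x hx).trans (h'.realVar x hx), h.realArr.trans h'.realArr⟩

theorem mono (h : Agree D R s s') (hD : D' ≤ D) (hR : R' ≤ R) : Agree D' R' s s' :=
  ⟨fun x hx => h.natVar x (hx.trans_le hD), h.natArr, fun x hx => h.realVar x (hx.trans_le hR),
    h.realArr⟩

theorem setNat (h : Agree D R s s') (x v : ℕ) : Agree D R (s.setNat x v) (s'.setNat x v) := by
  refine ⟨fun y hy => ?_, h.natArr, h.realVar, h.realArr⟩
  by_cases hxy : y = x
  · subst hxy; simp
  · simp [hxy, h.natVar y hy]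

theorem setNat_succ (h : Agree D R s s') (v : ℕ) :
    Agree (D + 1) R (s.setNat D v) (s'.setNat D v) := by
  refine ⟨fun y hy => ?_, h.natArr, h.realVar, h.realArr⟩
  by_cases hxy : y = D
  · subst hxy; simp
  · simp [hxy, h.natVar y (by omega)]

theorem setNatArr (h : Agree D R s s') (a i v : ℕ) :
    Agree D R (s.setNatArr a i v) (s'.setNatArr a i v) :=
  ⟨h.natVar, by simp [h.natArr], h.realVar, h.realArr⟩

theorem setReal (h : Agree D R s s') (x : ℕ) (v : ℝ) :
    Agree D R (s.setReal x v) (s'.setReal x v) := by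
  refine ⟨h.natVar, h.natArr, fun y hy => ?_, h.realArr⟩
  by_cases hxy : y = x
  · subst hxy; simp
  · simp [hxy, h.realVar y hy]

theorem setRealArr (h : Agree D R s s') (a i : ℕ) (v : ℝ) :
    Agree D R (s.setRealArr a i v) (s'.setRealArr a i v) :=
  ⟨h.natVar, h.natArr, h.realVar, by simp [h.realArr]⟩

theorem setReal_scratch (s : State) {x : ℕ} (v : ℝ) (hx : R ≤ x) :
    Agree D R s (s.setReal x v) := by
  refine ⟨fun _ _ => rfl, rfl, fun y hy => ?_, rfl⟩
  simp [show y ≠ x by omega]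

theorem setNat_scratch (s : State) {x : ℕ} (v : ℕ) (hx : D ≤ x) :
    Agree D R s (s.setNat x v) := by
  refine ⟨fun y hy => ?_, rfl, fun _ _ => rfl, rfl⟩
  simp [show y ≠ x by omega]

end Agree

theorem bigOp_congr {m : Bool} {N : ℕ} {f g : ℕ → ℝ} (h : ∀ k < N, f k = g k) :
    bigOp m N f = bigOp m N g := by
  cases m
  · exact Finset.sum_congr rfl fun k hk => h k (Finset.mem_range.1 hk)
  · exact Finset.prod_congr rfl fun k hk => h k (Finset.mem_range.1 hk)

theorem bigOp_zero (m : Bool) (f : ℕ → ℝ) : bigOp m 0 f = (m.toNat : ℕ) := by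
  cases m <;> simp [bigOp]

theorem bigOp_succ (m : Bool) (N : ℕ) (f : ℕ → ℝ) :
    bigOp m (N + 1) f =
      (if m then BinOp.mul else BinOp.add).eval (bigOp m N f) (f N) := by
  cases m
  · simp [bigOp, BinOp.eval, Finset.sum_range_succ]
  · simp [bigOp, BinOp.eval, Finset.prod_range_succ]

/-- The condition 3 ≤ d keeps the range variables 1 and 2 among those on which the memories agree.
-/
theorem HExpr.eval_congr (O : Oracle) (R : ℕ) (e : HExpr) :
    ∀ {d : ℕ} {s s' : State}, e.ok R d = true → 3 ≤ d → Agree d R s s' →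
      e.eval O d s = e.eval O d s' := by
  induction e with
  | nat x => intro d s s' h _ hs; simp [HExpr.eval, hs.natVar x (by simpa [HExpr.ok] using h)]
  | const k => intros; rfl
  | real x => intro d s s' h _ hs; simp [HExpr.eval, hs.realVar x (by simpa [HExpr.ok] using h)]
  | narr a x =>
    intro d s s' h _ hs
    simp [HExpr.eval, hs.natVar x (by simpa [HExpr.ok] using h), hs.natArr]
  | rarr a x =>
    intro d s s' h _ hs
    simp [HExpr.eval, hs.natVar x (by simpa [HExpr.ok] using h), hs.realArr]
  | bin op e f he hf =>
    intro d s s' h hd hs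
    simp only [HExpr.ok, Bool.and_eq_true] at h
    simp only [HExpr.eval, he h.1 hd hs, hf h.2 hd hs]
  | cdf x e he =>
    intro d s s' h hd hs
    simp only [HExpr.ok, Bool.and_eq_true, decide_eq_true_eq] at h
    simp only [HExpr.eval, he h.2 hd hs, hs.natVar x h.1]
  | mean x => intro d s s' h _ hs; simp [HExpr.eval, hs.natVar x (by simpa [HExpr.ok] using h)]
  | ite e f g k he hf hg hk =>
    intro d s s' h hd hs
    simp only [HExpr.ok, Bool.and_eq_true] at h
    simp only [HExpr.eval, he h.1.1.1 hd hs, hf h.1.1.2 hd hs, hg h.1.2 hd hs, hk h.2 hd hs]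
  | fold m b e he =>
    intro d s s' h hd hs
    simp only [HExpr.ok, Bool.and_eq_true, Bool.or_eq_true, beq_iff_eq] at h
    have hb : s.natVar b = s'.natVar b := hs.natVar b (by omega)
    simp only [HExpr.eval, hb]
    exact bigOp_congr fun k _ => he h.2 (by omega) (hs.setNat_succ k)

/-- Counting loops. -/
theorem exec_loop {O : Oracle} (x b : ℕ) (c : Cmd) (M T : ℕ) (I : ℕ → State → Prop)
    (hI : ∀ k s, I k s → s.natVar x = k ∧ s.natVar b = M)
    (step : ∀ k < M, ∀ s, I k s → ∃ s' t, Exec O c s s' t ∧ I (k + 1) s' ∧ t ≤ T)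
    (s : State) (h0 : I 0 s) :
    ∃ s' t, Exec O (.loop (.natLe (.add (.var x) (.const 1)) (.var b)) c) s s' t ∧
      I M s' ∧ t ≤ M * (T + 5) + 5 := by
  -- A loop unfolds from its first iteration, so the induction is on the number j of iterations
  -- still to come.
  have key : ∀ j k, k + j = M → ∀ s, I k s → ∃ s' t,
      Exec O (.loop (.natLe (.add (.var x) (.const 1)) (.var b)) c) s s' t ∧
      I M s' ∧ t ≤ j * (T + 5) + 5 := by
    intro j
    induction j with
    | zero =>
      intro k hk s hs
      have hkM : k = M := by omega
      subst hkM
      refine ⟨s, _, Exec.loopDone _ _ _ ?_, hs, ?_⟩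
      · simp [Test.Holds, NExpr.eval, hI _ _ hs]
      · simp [Test.cost, NExpr.cost]
    | succ j ih =>
      intro k hk s hs
      obtain ⟨s₁, t₁, h₁, hs₁, ht₁⟩ := step k (by omega) s hs
      obtain ⟨s₂, t₂, h₂, hs₂, ht₂⟩ := ih (k + 1) (by omega) s₁ hs₁
      refine ⟨s₂, _, Exec.loopStep _ _ _ _ _ _ _ ?_ h₁ h₂, hs₂, ?_⟩
      · simp [Test.Holds, NExpr.eval, hI _ _ hs]; omega
      · simp [Test.cost, NExpr.cost]; nlinarith
  exact key M 0 (by omega) s h0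

/-- Stack discipline: code for depth d and target r touches only natural variables from d on and
real variables from r on. An intermediate result in r therefore survives while the next one is
computed into r + 1. -/
theorem HExpr.comp_exec (O : Oracle) (R N : ℕ) (e : HExpr) :
    ∀ (d r : ℕ) (s : State), e.ok R d = true → 3 ≤ d → R ≤ r → s.natVar 1 ≤ N → s.natVar 2 ≤ N →
      ∃ s' t, Exec O (e.comp d r) s s' t ∧ s'.realVar r = e.eval O d s ∧ Agree d r s s' ∧
        t ≤ e.cost N := by
  induction e with
  | nat x | const x | real x | mean x =>
    intro d r s h _ _ _ _
    exact ⟨_, _, Exec.setReal _ _ _, by simp [HExpr.eval, RExpr.eval, NExpr.eval],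
      Agree.setReal_scratch _ _ le_rfl, by simp [HExpr.cost, RExpr.cost, NExpr.cost]⟩
  | narr a x | rarr a x =>
    intro d r s h _ _ _ _
    exact ⟨_, _, Exec.setReal _ _ _, by simp [HExpr.eval, RExpr.eval, NExpr.eval],
      Agree.setReal_scratch _ _ le_rfl, by simp [HExpr.cost, RExpr.cost, NExpr.cost]⟩
  | bin op e f he hf =>
    intro d r s h hd hr h1 h2
    simp only [HExpr.ok, Bool.and_eq_true] at h
    obtain ⟨s₁, t₁, x₁, v₁, a₁, c₁⟩ := he d r s h.1 hd hr h1 h2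
    obtain ⟨s₂, t₂, x₂, v₂, a₂, c₂⟩ := hf d (r + 1) s₁ h.2 hd (by omega)
      (by rwa [← a₁.natVar 1 (by omega)]) (by rwa [← a₁.natVar 2 (by omega)])
    refine ⟨_, _, Exec.seq _ _ _ _ _ _ _ x₁ (Exec.seq _ _ _ _ _ _ _ x₂ (Exec.setReal _ _ _)),
      ?_, ?_, ?_⟩
    · simp only [setReal_realVar, Function.update_self, BinOp.eval_toRExpr, RExpr.eval, v₂,
        HExpr.eval]
      rw [← a₂.realVar r (by omega), v₁, ← eval_congr O R f h.2 hd (a₁.mono le_rfl hr)]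
    · exact (a₁.trans (a₂.mono le_rfl (by omega))).trans (Agree.setReal_scratch _ _ le_rfl)
    · simp only [BinOp.cost_toRExpr, RExpr.cost, HExpr.cost]; omega
  | cdf x e he =>
    intro d r s h hd hr h1 h2
    simp only [HExpr.ok, Bool.and_eq_true, decide_eq_true_eq] at h
    obtain ⟨s₁, t₁, x₁, v₁, a₁, c₁⟩ := he d r s h.2 hd hr h1 h2
    refine ⟨_, _, Exec.seq _ _ _ _ _ _ _ x₁ (Exec.setReal _ _ _), ?_,
      a₁.trans (Agree.setReal_scratch _ _ le_rfl), ?_⟩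
    · simp [RExpr.eval, NExpr.eval, HExpr.eval, v₁, a₁.natVar x h.1]
    · simp only [RExpr.cost, NExpr.cost, HExpr.cost]; omega
  | ite e f g k he hf hg hk =>
    intro d r s h hd hr h1 h2
    simp only [HExpr.ok, Bool.and_eq_true] at h
    obtain ⟨⟨⟨oe, of⟩, og⟩, ok'⟩ := h
    obtain ⟨s₁, t₁, x₁, v₁, a₁, c₁⟩ := he d r s oe hd hr h1 h2
    have h11 : s₁.natVar 1 ≤ N := by rwa [← a₁.natVar 1 (by omega)]
    have h12 : s₁.natVar 2 ≤ N := by rwa [← a₁.natVar 2 (by omega)]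
    obtain ⟨s₂, t₂, x₂, v₂, a₂, c₂⟩ := hf d (r + 1) s₁ of hd (by omega) h11 h12
    have h21 : s₂.natVar 1 ≤ N := by rwa [← a₂.natVar 1 (by omega)]
    have h22 : s₂.natVar 2 ≤ N := by rwa [← a₂.natVar 2 (by omega)]
    have a₁₂ : Agree d r s s₂ := a₁.trans (a₂.mono le_rfl (by omega))
    have e1 : s₂.realVar r = e.eval O d s := by rw [← a₂.realVar r (by omega), v₁]
    have e2 : s₂.realVar (r + 1) = f.eval O d s := by
      rw [v₂, ← eval_congr O R f of hd (a₁.mono le_rfl hr)]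
    by_cases hc : e.eval O d s ≤ f.eval O d s
    · obtain ⟨s₃, t₃, x₃, v₃, a₃, c₃⟩ := hg d r s₂ og hd hr h21 h22
      refine ⟨_, _, Exec.seq _ _ _ _ _ _ _ x₁ (Exec.seq _ _ _ _ _ _ _ x₂
        (Exec.condTrue _ _ _ _ _ _ ?_ x₃)), ?_, a₁₂.trans a₃, ?_⟩
      · simpa [Test.Holds, RExpr.eval, e1, e2] using hc
      · rw [v₃, ← eval_congr O R g og hd (a₁₂.mono le_rfl hr)]; simp [HExpr.eval, hc]
      · simp only [Test.cost, RExpr.cost, HExpr.cost]; omega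
    · obtain ⟨s₃, t₃, x₃, v₃, a₃, c₃⟩ := hk d r s₂ ok' hd hr h21 h22
      refine ⟨_, _, Exec.seq _ _ _ _ _ _ _ x₁ (Exec.seq _ _ _ _ _ _ _ x₂
        (Exec.condFalse _ _ _ _ _ _ ?_ x₃)), ?_, a₁₂.trans a₃, ?_⟩
      · simpa [Test.Holds, RExpr.eval, e1, e2] using hc
      · rw [v₃, ← eval_congr O R k ok' hd (a₁₂.mono le_rfl hr)]; simp [HExpr.eval, hc]
      · simp only [Test.cost, RExpr.cost, HExpr.cost]; omega
  | fold m b e he =>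
    intro d r s h hd hr h1 h2
    simp only [HExpr.ok, Bool.and_eq_true, Bool.or_eq_true, beq_iff_eq] at h
    obtain ⟨hb, oe⟩ := h
    have hbd : b < d := by omega
    have hbN : s.natVar b ≤ N := by rcases hb with rfl | rfl <;> assumption
    -- Loop invariant: the counter is k, nothing below depth d or target r has changed, and r holds
    -- the fold over the first k indices.
    let I : ℕ → State → Prop := fun k σ => σ.natVar d = k ∧ Agree d r s σ ∧
      σ.realVar r = bigOp m k fun k => e.eval O (d + 1) (s.setNat d k)
    have step : ∀ k < s.natVar b, ∀ σ, I k σ → ∃ s' t, Exec O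
        (.seq (.seq (e.comp (d + 1) (r + 1))
            (.setReal r ((if m then BinOp.mul else BinOp.add).toRExpr (.var r) (.var (r + 1)))))
            (.setNat d (.add (.var d) (.const 1)))) σ s' t ∧ I (k + 1) s' ∧ t ≤ e.cost N + 8 := by
      rintro k - σ ⟨hk, hσ, hv⟩
      obtain ⟨s₁, t₁, x₁, v₁, a₁, c₁⟩ := he (d + 1) (r + 1) σ oe (by omega) (by omega)
        (by rwa [← hσ.natVar 1 (by omega)]) (by rwa [← hσ.natVar 2 (by omega)])
      refine ⟨_, _, Exec.seq _ _ _ _ _ _ _ (Exec.seq _ _ _ _ _ _ _ x₁ (Exec.setReal _ _ _))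
        (Exec.setNat _ _ _), ⟨?_, ?_, ?_⟩, ?_⟩
      · simp [NExpr.eval, ← a₁.natVar d (by omega), hk]
      · refine (hσ.trans (a₁.mono (by omega) (by omega))).trans ?_
        exact (Agree.setReal_scratch _ _ le_rfl).trans (Agree.setNat_scratch _ _ le_rfl)
      · rw [bigOp_succ, ← hv]
        simp only [setNat_realVar, setReal_realVar, Function.update_self, BinOp.eval_toRExpr,
          RExpr.eval, v₁]
        rw [← a₁.realVar r (by omega)]
        congr 1
        refine eval_congr O R e oe (by omega) ?_
        have := (hσ.mono le_rfl hr).symm.setNat_succ k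
        have h' : σ.setNat d k = σ := by
          simp [State.setNat, ← hk]
        rwa [h'] at this
      · simp only [BinOp.cost_toRExpr, RExpr.cost, NExpr.cost]; omega
    obtain ⟨s', t, x', ⟨-, a', v'⟩, c'⟩ := exec_loop d b _ (s.natVar b) _ I
      (fun k σ hσ => ⟨hσ.1, (hσ.2.1.natVar b hbd).symm⟩) step
      ((s.setReal r (m.toNat : ℕ)).setNat d 0)
      ⟨by simp, (Agree.setReal_scratch _ _ le_rfl).trans (Agree.setNat_scratch _ _ le_rfl),
        by simp [bigOp_zero]⟩
    refine ⟨s', _, Exec.seq _ _ _ _ _ _ _ (Exec.setReal _ _ _)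
      (Exec.seq _ _ _ _ _ _ _ (Exec.setNat _ _ _) x'), v', a', ?_⟩
    simp only [RExpr.cost, NExpr.cost, HExpr.cost]
    have : s.natVar b * (e.cost N + 8 + 5) ≤ N * (e.cost N + 20) :=
      Nat.mul_le_mul hbN (by omega)
    omega

/-- Structured programs. -/
inductive Prog : Type where
  | setNat (x : ℕ) (e : NExpr)
  | setNatArr (a : ℕ) (i e : NExpr)
  | setReal (x : ℕ) (e : HExpr)
  | setRealArr (a : ℕ) (i : NExpr) (e : HExpr)
  | seq (p q : Prog)
  | ite (e f : HExpr) (p q : Prog)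
  | loop (x b : ℕ) (p : Prog)

/-- Names of variables and arrays. -/
inductive Loc : Type where
  | natVar (x : ℕ)
  | natArr (a : ℕ)
  | realVar (x : ℕ)
  | realArr (a : ℕ)
deriving DecidableEq

/-- All natural variables read by the expression are below `D`. -/
def NExpr.ok (D : ℕ) : NExpr → Bool
  | const _ => true
  | var x => decide (x < D)
  | arr _ i => i.ok D
  | add e f => e.ok D && f.ok D
  | sub e f => e.ok D && f.ok D

theorem NExpr.eval_congr {D R : ℕ} {s s' : State} (h : Agree D R s s') (e : NExpr)
    (he : e.ok D = true) : e.eval s = e.eval s' := by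
  induction e with
  | const k => rfl
  | var x => exact h.natVar x (by simpa [NExpr.ok] using he)
  | arr a i ih => simp [NExpr.eval, ih he, h.natArr]
  | add e f ihe ihf | sub e f ihe ihf =>
    simp only [NExpr.ok, Bool.and_eq_true] at he
    simp [NExpr.eval, ihe he.1, ihf he.2]

/-- Iteration of `f` with a counter in the natural variable `x`. -/
def iterate (f : State → State) (x : ℕ) (s : State) : ℕ → State
  | 0 => s.setNat x 0
  -- Setting the counter to k + 1 agrees with incrementing it, because `Prog.ok` forbids the loop
  -- body to write it.
  | k + 1 => (f (iterate f x s k)).setNat x (k + 1)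

namespace Prog

/-- The locations that a program may change. -/
def writes : Prog → Loc → Bool
  | setNat x _, l => l == .natVar x
  | setNatArr a _ _, l => l == .natArr a
  | setReal x _, l => l == .realVar x
  | setRealArr a _ _, l => l == .realArr a
  | seq p q, l => p.writes l || q.writes l
  | ite _ _ p q, l => p.writes l || q.writes l
  | loop x _ p, l => l == .natVar x || p.writes l

open Classical in
/-- The final memory of a program. -/
noncomputable def run (O : Oracle) (D : ℕ) : Prog → State → State
  | setNat x e, s => s.setNat x (e.eval s)
  | setNatArr a i e, s => s.setNatArr a (i.eval s) (e.eval s)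
  | setReal x e, s => s.setReal x (e.eval O D s)
  | setRealArr a i e, s => s.setRealArr a (i.eval s) (e.eval O D s)
  | seq p q, s => q.run O D (p.run O D s)
  | ite e f p q, s => if e.eval O D s ≤ f.eval O D s then p.run O D s else q.run O D s
  | loop x b p, s => iterate (p.run O D) x s (s.natVar b)

/-- Variables are within bounds, the variables `1` and `2` are not changed and give the ranges of
all loops, and loop counters are not changed in the bodies of loops. -/
def ok (D R : ℕ) : Prog → Bool
  | setNat x e => decide (x < D) && (x != 1 && x != 2) && e.ok D
  | setNatArr _ i e => i.ok D && e.ok D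
  | setReal x e => decide (x < R) && e.ok R D
  | setRealArr _ i e => i.ok D && e.ok R D
  | seq p q => p.ok D R && q.ok D R
  | ite e f p q => e.ok R D && f.ok R D && p.ok D R && q.ok D R
  | loop x b p => (decide (x < D) && (x != 1 && x != 2)) && (b == 1 || b == 2) &&
      !p.writes (.natVar x) && p.ok D R

/-- Compilation. -/
def comp (D R : ℕ) : Prog → Cmd
  | setNat x e => .setNat x e
  | setNatArr a i e => .setNatArr a i e
  | setReal x e => .seq (e.comp D R) (.setReal x (.var R))
  | setRealArr a i e => .seq (e.comp D R) (.setRealArr a i (.var R))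
  | seq p q => .seq (p.comp D R) (q.comp D R)
  | ite e f p q => .seq (e.comp D R) (.seq (f.comp D (R + 1))
      (.cond (.realLe (.var R) (.var (R + 1))) (p.comp D R) (q.comp D R)))
  | loop x b p => .seq (.setNat x (.const 0))
      (.loop (.natLe (.add (.var x) (.const 1)) (.var b))
        (.seq (p.comp D R) (.setNat x (.add (.var x) (.const 1)))))

/-- A bound on the number of steps if all ranges are at most `N`. -/
def cost (N : ℕ) : Prog → ℕ
  | setNat _ e => e.cost + 10
  | setNatArr _ i e => i.cost + e.cost + 10
  | setReal _ e => e.cost N + 10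
  | setRealArr _ i e => i.cost + e.cost N + 10
  | seq p q => p.cost N + q.cost N
  | ite e f p q => e.cost N + f.cost N + p.cost N + q.cost N + 10
  | loop _ _ p => N * (p.cost N + 20) + 20

variable (O : Oracle) (D R : ℕ)

/-- Frame rule. Since `writes` is computable, its hypothesis is closed by `rfl` for concrete
programs; the same holds for the three analogues below. -/
theorem run_natVar (p : Prog) {x : ℕ} (h : p.writes (.natVar x) = false) (s : State) :
    (p.run O D s).natVar x = s.natVar x := by
  induction p generalizing s with
  | setNat y e =>
    have : x ≠ y := by simpa [writes] using h
    simp [run, this]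
  | setNatArr | setReal | setRealArr => simp [run]
  | seq p q hp hq =>
    simp only [writes, Bool.or_eq_false_iff] at h
    simp [run, hp h.1, hq h.2]
  | ite e f p q hp hq =>
    simp only [writes, Bool.or_eq_false_iff] at h
    simp only [run]; split_ifs
    exacts [hp h.1 s, hq h.2 s]
  | loop y b p hp =>
    simp only [writes, Bool.or_eq_false_iff, beq_eq_false_iff_ne, ne_eq, Loc.natVar.injEq] at h
    simp only [run]
    induction s.natVar b with
    | zero => simp [iterate, h.1]
    | succ k ih => simp [iterate, h.1, hp h.2, ih]

theorem run_natArr (p : Prog) {a : ℕ} (h : p.writes (.natArr a) = false) (s : State) :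
    (p.run O D s).natArr a = s.natArr a := by
  induction p generalizing s with
  | setNatArr y e =>
    have : a ≠ y := by simpa [writes] using h
    simp [run, this]
  | setNat | setReal | setRealArr => simp [run]
  | seq p q hp hq =>
    simp only [writes, Bool.or_eq_false_iff] at h
    simp [run, hp h.1, hq h.2]
  | ite e f p q hp hq =>
    simp only [writes, Bool.or_eq_false_iff] at h
    simp only [run]; split_ifs
    exacts [hp h.1 s, hq h.2 s]
  | loop y b p hp =>
    simp only [writes, Bool.or_eq_false_iff] at h
    simp only [run]
    induction s.natVar b with
    | zero => simp [iterate]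
    | succ k ih => simp [iterate, hp h.2, ih]

theorem run_realVar (p : Prog) {x : ℕ} (h : p.writes (.realVar x) = false) (s : State) :
    (p.run O D s).realVar x = s.realVar x := by
  induction p generalizing s with
  | setReal y e =>
    have : x ≠ y := by simpa [writes] using h
    simp [run, this]
  | setNat | setNatArr | setRealArr => simp [run]
  | seq p q hp hq =>
    simp only [writes, Bool.or_eq_false_iff] at h
    simp [run, hp h.1, hq h.2]
  | ite e f p q hp hq =>
    simp only [writes, Bool.or_eq_false_iff] at h
    simp only [run]; split_ifs
    exacts [hp h.1 s, hq h.2 s]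
  | loop y b p hp =>
    simp only [writes, Bool.or_eq_false_iff] at h
    simp only [run]
    induction s.natVar b with
    | zero => simp [iterate]
    | succ k ih => simp [iterate, hp h.2, ih]

theorem run_realArr (p : Prog) {a : ℕ} (h : p.writes (.realArr a) = false) (s : State) :
    (p.run O D s).realArr a = s.realArr a := by
  induction p generalizing s with
  | setRealArr y e =>
    have : a ≠ y := by simpa [writes] using h
    simp [run, this]
  | setNat | setReal | setNatArr => simp [run]
  | seq p q hp hq =>
    simp only [writes, Bool.or_eq_false_iff] at h
    simp [run, hp h.1, hq h.2]
  | ite e f p q hp hq =>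
    simp only [writes, Bool.or_eq_false_iff] at h
    simp only [run]; split_ifs
    exacts [hp h.1 s, hq h.2 s]
  | loop y b p hp =>
    simp only [writes, Bool.or_eq_false_iff] at h
    simp only [run]
    induction s.natVar b with
    | zero => simp [iterate]
    | succ k ih => simp [iterate, hp h.2, ih]

theorem not_writes_range (p : Prog) (h : p.ok D R = true) :
    p.writes (.natVar 1) = false ∧ p.writes (.natVar 2) = false := by
  induction p with
  | setNat x e =>
    simp only [ok, Bool.and_eq_true, bne_iff_ne] at h
    simp [writes, h.1.2.1.symm, h.1.2.2.symm]
  | setNatArr | setReal | setRealArr => simp [writes]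
  | seq p q hp hq =>
    simp only [ok, Bool.and_eq_true] at h
    simp [writes, hp h.1, hq h.2]
  | ite e f p q hp hq =>
    simp only [ok, Bool.and_eq_true] at h
    simp [writes, hp h.1.2, hq h.2]
  | loop x b p hp =>
    simp only [ok, Bool.and_eq_true, bne_iff_ne] at h
    simp [writes, h.1.1.1.2.1.symm, h.1.1.1.2.2.symm, hp h.2]

/-- The machine simulates the function `run` up to scratch variables from D and R on. The simulation
starts from any σ that agrees with s below these bounds, because earlier code leaves arbitrary
values in the scratch area. -/
theorem comp_exec (N : ℕ) (hD : 3 ≤ D) (p : Prog) :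
    ∀ (s σ : State), p.ok D R = true → s.natVar 1 ≤ N → s.natVar 2 ≤ N → Agree D R s σ →
      ∃ σ' t, Exec O (p.comp D R) σ σ' t ∧ Agree D R (p.run O D s) σ' ∧ t ≤ p.cost N := by
  induction p with
  | setNat x e =>
    intro s σ h h1 h2 hs
    simp only [ok, Bool.and_eq_true] at h
    refine ⟨_, _, Exec.setNat _ _ _, ?_, by simp [cost]⟩
    rw [← NExpr.eval_congr hs e h.2]
    exact hs.setNat _ _
  | setNatArr a i e =>
    intro s σ h h1 h2 hs
    simp only [ok, Bool.and_eq_true] at h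
    refine ⟨_, _, Exec.setNatArr _ _ _ _, ?_, by simp [cost]⟩
    rw [← NExpr.eval_congr hs e h.2, ← NExpr.eval_congr hs i h.1]
    exact hs.setNatArr _ _ _
  | setReal x e =>
    intro s σ h h1 h2 hs
    simp only [ok, Bool.and_eq_true] at h
    obtain ⟨s₁, t₁, x₁, v₁, a₁, c₁⟩ := e.comp_exec O R N D R σ h.2 hD le_rfl
      (by rwa [← hs.natVar 1 (by omega)]) (by rwa [← hs.natVar 2 (by omega)])
    refine ⟨_, _, Exec.seq _ _ _ _ _ _ _ x₁ (Exec.setReal _ _ _), ?_, ?_⟩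
    · simp only [RExpr.eval, v₁, ← e.eval_congr O R h.2 hD hs]
      exact (hs.trans a₁).setReal _ _
    · simp only [RExpr.cost, cost]; omega
  | setRealArr a i e =>
    intro s σ h h1 h2 hs
    simp only [ok, Bool.and_eq_true] at h
    obtain ⟨s₁, t₁, x₁, v₁, a₁, c₁⟩ := e.comp_exec O R N D R σ h.2 hD le_rfl
      (by rwa [← hs.natVar 1 (by omega)]) (by rwa [← hs.natVar 2 (by omega)])
    refine ⟨_, _, Exec.seq _ _ _ _ _ _ _ x₁ (Exec.setRealArr _ _ _ _), ?_, ?_⟩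
    · simp only [RExpr.eval, v₁, ← e.eval_congr O R h.2 hD hs,
        ← NExpr.eval_congr (hs.trans a₁) i h.1]
      exact (hs.trans a₁).setRealArr _ _ _
    · simp only [RExpr.cost, cost]; omega
  | seq p q hp hq =>
    intro s σ h h1 h2 hs
    simp only [ok, Bool.and_eq_true] at h
    obtain ⟨σ₁, t₁, x₁, a₁, c₁⟩ := hp s σ h.1 h1 h2 hs
    have hw := not_writes_range D R p h.1
    obtain ⟨σ₂, t₂, x₂, a₂, c₂⟩ := hq _ σ₁ h.2 (by rwa [run_natVar O D p hw.1])
      (by rwa [run_natVar O D p hw.2]) a₁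
    exact ⟨σ₂, _, Exec.seq _ _ _ _ _ _ _ x₁ x₂, a₂, by simp only [cost]; omega⟩
  | ite e f p q hp hq =>
    intro s σ h h1 h2 hs
    simp only [ok, Bool.and_eq_true] at h
    obtain ⟨⟨⟨oe, of⟩, op⟩, oq⟩ := h
    obtain ⟨s₁, t₁, x₁, v₁, a₁, c₁⟩ := e.comp_exec O R N D R σ oe hD le_rfl
      (by rwa [← hs.natVar 1 (by omega)]) (by rwa [← hs.natVar 2 (by omega)])
    have b₁ := hs.trans a₁
    obtain ⟨s₂, t₂, x₂, v₂, a₂, c₂⟩ := f.comp_exec O R N D (R + 1) s₁ of hD (by omega)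
      (by rwa [← b₁.natVar 1 (by omega)]) (by rwa [← b₁.natVar 2 (by omega)])
    have b₂ : Agree D R s s₂ := b₁.trans (a₂.mono le_rfl (by omega))
    have e1 : s₂.realVar R = e.eval O D s := by
      rw [← a₂.realVar R (by omega), v₁, ← e.eval_congr O R oe hD hs]
    have e2 : s₂.realVar (R + 1) = f.eval O D s := by
      rw [v₂, ← f.eval_congr O R of hD b₁]
    by_cases hc : e.eval O D s ≤ f.eval O D s
    · obtain ⟨σ', t, x', a', c'⟩ := hp s s₂ op h1 h2 b₂
      refine ⟨σ', _, Exec.seq _ _ _ _ _ _ _ x₁ (Exec.seq _ _ _ _ _ _ _ x₂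
        (Exec.condTrue _ _ _ _ _ _ ?_ x')), ?_, ?_⟩
      · simpa [Test.Holds, RExpr.eval, e1, e2] using hc
      · simpa [run, hc] using a'
      · simp only [Test.cost, RExpr.cost, cost]; omega
    · obtain ⟨σ', t, x', a', c'⟩ := hq s s₂ oq h1 h2 b₂
      refine ⟨σ', _, Exec.seq _ _ _ _ _ _ _ x₁ (Exec.seq _ _ _ _ _ _ _ x₂
        (Exec.condFalse _ _ _ _ _ _ ?_ x')), ?_, ?_⟩
      · simpa [Test.Holds, RExpr.eval, e1, e2] using hc
      · simpa [run, hc] using a'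
      · simp only [Test.cost, RExpr.cost, cost]; omega
  | loop x b p hp =>
    intro s σ h h1 h2 hs
    simp only [ok, Bool.and_eq_true, Bool.or_eq_true, beq_iff_eq, bne_iff_ne,
      decide_eq_true_eq, Bool.not_eq_true'] at h
    obtain ⟨⟨⟨⟨hxD, hx1, hx2⟩, hb⟩, hw⟩, op⟩ := h
    have hbN : s.natVar b ≤ N := by rcases hb with rfl | rfl <;> assumption
    have hwr := not_writes_range D R p op
    have hit : ∀ k, (iterate (p.run O D) x s k).natVar x = k ∧
        (iterate (p.run O D) x s k).natVar 1 = s.natVar 1 ∧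
        (iterate (p.run O D) x s k).natVar 2 = s.natVar 2 := by
      intro k
      induction k with
      | zero => simp [iterate, hx1.symm, hx2.symm]
      | succ k ih =>
        simp [iterate, hx1.symm, hx2.symm, run_natVar O D p hwr.1, run_natVar O D p hwr.2, ih]
    obtain ⟨σ', t, x', a', c'⟩ := exec_loop (O := O) x b
      (.seq (p.comp D R) (.setNat x (.add (.var x) (.const 1)))) (s.natVar b) (p.cost N + 4)
      (fun k τ => Agree D R (iterate (p.run O D) x s k) τ)
      (by
        intro k τ hτ
        refine ⟨by rw [← hτ.natVar x hxD, (hit k).1], ?_⟩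
        rw [← hτ.natVar b (by omega)]
        rcases hb with rfl | rfl
        exacts [(hit k).2.1, (hit k).2.2])
      (by
        intro k _ τ hτ
        obtain ⟨τ', t, y', b', d'⟩ := hp _ τ op (by rwa [(hit k).2.1]) (by rwa [(hit k).2.2]) hτ
        refine ⟨_, _, Exec.seq _ _ _ _ _ _ _ y' (Exec.setNat _ _ _), ?_, ?_⟩
        · have : τ'.natVar x = k := by
            rw [← b'.natVar x hxD, run_natVar O D p hw, (hit k).1]
          simp only [NExpr.eval, this]
          exact b'.setNat _ _
        · simp only [NExpr.cost]; omega)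
      (σ.setNat x 0) (hs.setNat x 0)
    refine ⟨σ', _, Exec.seq _ _ _ _ _ _ _ (Exec.setNat _ _ _) x', a', ?_⟩
    simp only [NExpr.cost, cost]
    have : s.natVar b * (p.cost N + 4 + 5) ≤ N * (p.cost N + 20) := Nat.mul_le_mul hbN (by omega)
    omega

end Prog

/-- Functions bounded by a polynomial. -/
def PolyBounded (f : ℕ → ℕ) : Prop := ∃ K d : ℕ, ∀ N, f N ≤ K * (N + 1) ^ d

namespace PolyBounded

theorem const (c : ℕ) : PolyBounded fun _ => c := ⟨c, 0, by simp⟩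

theorem add {f g : ℕ → ℕ} (hf : PolyBounded f) (hg : PolyBounded g) :
    PolyBounded fun N => f N + g N := by
  obtain ⟨K, d, h⟩ := hf
  obtain ⟨K', d', h'⟩ := hg
  refine ⟨K + K', d + d', fun N => ?_⟩
  have h1 : (N + 1) ^ d ≤ (N + 1) ^ (d + d') := Nat.pow_le_pow_right (by omega) (by omega)
  have h2 : (N + 1) ^ d' ≤ (N + 1) ^ (d + d') := Nat.pow_le_pow_right (by omega) (by omega)
  calc f N + g N ≤ K * (N + 1) ^ d + K' * (N + 1) ^ d' := Nat.add_le_add (h N) (h' N)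
    _ ≤ K * (N + 1) ^ (d + d') + K' * (N + 1) ^ (d + d') :=
        Nat.add_le_add (Nat.mul_le_mul_left _ h1) (Nat.mul_le_mul_left _ h2)
    _ = _ := by ring

theorem id_mul {f : ℕ → ℕ} (hf : PolyBounded f) : PolyBounded fun N => N * f N := by
  obtain ⟨K, d, h⟩ := hf
  refine ⟨K, d + 1, fun N => ?_⟩
  calc N * f N ≤ (N + 1) * (K * (N + 1) ^ d) := Nat.mul_le_mul (by omega) (h N)
    _ = _ := by ring

end PolyBounded

theorem HExpr.polyBounded_cost (e : HExpr) : PolyBounded fun N => e.cost N := by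
  induction e with
  | nat | const | real | narr | rarr | mean => exact .const _
  | bin _ _ _ he hf => exact (he.add hf).add (.const _)
  | cdf _ _ he => exact he.add (.const _)
  | ite _ _ _ _ he hf hg hh => exact (((he.add hf).add hg).add hh).add (.const _)
  | fold _ _ _ he => exact ((he.add (.const _)).id_mul).add (.const _)

theorem Prog.polyBounded_cost (p : Prog) : PolyBounded fun N => p.cost N := by
  induction p with
  | setNat | setNatArr => exact .const _
  | setReal _ e => exact e.polyBounded_cost.add (.const _)
  | setRealArr _ i e => exact ((PolyBounded.const _).add e.polyBounded_cost).add (.const _)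
  | seq _ _ hp hq => exact hp.add hq
  | ite e f _ _ hp hq =>
    exact (((e.polyBounded_cost.add f.polyBounded_cost).add hp).add hq).add (.const _)
  | loop _ _ _ hp => exact ((hp.add (.const _)).id_mul).add (.const _)

end RealRAM

namespace FreeOrder

/-! ### A discretization of the Kertz equation -/

/-- Geometric levels for the distribution function of the maximum. -/
noncomputable def geo (ε : ℝ) (j : ℕ) : ℝ := (1 / (1 + ε)) ^ j

/-- Written without the next grid point, so that the program obtains it from a single table entry,
even at the end of the table. -/
noncomputable def geoGap (ε : ℝ) (j : ℕ) : ℝ := geo ε j - geo ε j / (1 + ε)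

theorem geo_zero (ε : ℝ) : geo ε 0 = 1 := by simp [geo]

theorem geo_succ (ε : ℝ) (j : ℕ) : geo ε (j + 1) = geo ε j / (1 + ε) := by
  simp only [geo, pow_succ]; ring

theorem geoGap_eq (ε : ℝ) (j : ℕ) : geoGap ε j = geo ε j - geo ε (j + 1) := by
  rw [geoGap, geo_succ]

theorem log_geo (ε : ℝ) (j : ℕ) : Real.log (geo ε j) = -(j * Real.log (1 + ε)) := by
  simp [geo, Real.log_pow]

section
variable {ε : ℝ} (hε : 0 < ε)
include hε

theorem geo_pos (j : ℕ) : 0 < geo ε j := by unfold geo; positivity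

theorem geo_antitone : Antitone (geo ε) := by
  refine antitone_nat_of_succ_le fun j => ?_
  rw [geo_succ]
  exact div_le_self (geo_pos hε j).le (by linarith)

theorem geo_le_one (j : ℕ) : geo ε j ≤ 1 := by
  simpa [geo_zero] using geo_antitone hε (Nat.zero_le j)

theorem geoGap_nonneg (j : ℕ) : 0 ≤ geoGap ε j := by
  rw [geoGap_eq]; linarith [geo_antitone hε (Nat.le_succ j)]

/-- Together with `log_le'` this exchanges log (1 + ε) and ε at the cost of a factor 1 + ε. -/
theorem le_mul_log : ε ≤ (1 + ε) * Real.log (1 + ε) := by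
  have h := Real.one_sub_inv_le_log_of_pos (show 0 < 1 + ε by linarith)
  have : (1 + ε) * (1 - (1 + ε)⁻¹) = ε := by field_simp; ring
  nlinarith

theorem log_le' : Real.log (1 + ε) ≤ ε := by
  have := Real.log_le_sub_one_of_pos (show 0 < 1 + ε by linarith)
  linarith

theorem exp_le_geo (j : ℕ) : Real.exp (-(j * ε)) ≤ geo ε j := by
  rw [← Real.exp_log (geo_pos hε j), log_geo]
  apply Real.exp_le_exp.2
  have := log_le' hε
  have hj : (0 : ℝ) ≤ j := j.cast_nonneg
  nlinarith

theorem mul_geo_le (j : ℕ) : j * ε * geo ε j ≤ 1 := by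
  have h : 1 + j * ε ≤ (1 + ε) ^ j := one_add_mul_le_pow (by linarith) j
  have h2 : geo ε j * (1 + ε) ^ j = 1 := by
    rw [geo, ← mul_pow, one_div, inv_mul_cancel₀ (by linarith), one_pow]
  nlinarith [geo_pos hε j]

theorem geoGap_mul_le (j : ℕ) : geoGap ε j * (j * ε) ≤ ε := by
  have h := mul_geo_le hε j
  have : geoGap ε j ≤ ε * geo ε j := by
    rw [geoGap]
    have : geo ε j - geo ε j / (1 + ε) = ε / (1 + ε) * geo ε j := by field_simp; ring
    rw [this]
    exact mul_le_mul_of_nonneg_right (div_le_self hε.le (by linarith)) (geo_pos hε j).le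
  have hj : 0 ≤ (j : ℝ) * ε := by positivity
  nlinarith

/-- The partial sums dominate the corresponding integral. -/
theorem sum_geoGap_min_ge {a : ℝ} (ha : 0 ≤ a) (m : ℕ) :
    (1 - Real.exp (-(min a (m * ε)))) / (1 + ε) ≤
      ∑ j ∈ Finset.range (m + 1), geoGap ε j * min a (j * ε) + geo ε (m + 1) * min a (m * ε) := by
  induction m with
  | zero => simp [ha]
  | succ m ih =>
    rw [Finset.sum_range_succ]
    set u := min a (m * ε) with hu
    set v := min a ((m + 1 : ℕ) * ε) with hv
    have huv : u ≤ v := by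
      apply min_le_min le_rfl
      push_cast; nlinarith
    -- Summation by parts: passing from m to m + 1 increases sum plus boundary term by exactly `geo
    -- ε (m + 1) * (v - u)`. If u = mε, then e^{-u} - e^{-v} ≤ e^{-u}(v - u) and e^{-u} ≤ `geo ε m`;
    -- otherwise u = v = a.
    have key : (Real.exp (-u) - Real.exp (-v)) / (1 + ε) ≤ geo ε (m + 1) * (v - u) := by
      rcases le_total a (m * ε) with h | h
      · have h1 : u = a := min_eq_left h
        have h2 : v = a := min_eq_left (h.trans (by push_cast; nlinarith))
        simp [h1, h2]
      · have h1 : u = m * ε := min_eq_right h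
        have h3 : Real.exp (-v) = Real.exp (-u) * Real.exp (-(v - u)) := by
          rw [← Real.exp_add]; ring_nf
        have h4 : 1 - (v - u) ≤ Real.exp (-(v - u)) := by
          have := Real.add_one_le_exp (-(v - u)); linarith
        have h5 : Real.exp (-u) - Real.exp (-v) ≤ Real.exp (-u) * (v - u) := by
          rw [h3]; nlinarith [Real.exp_pos (-u)]
        have h6 : Real.exp (-u) ≤ geo ε m := by rw [h1]; exact exp_le_geo hε m
        rw [geo_succ, div_mul_eq_mul_div]
        apply div_le_div_of_nonneg_right _ (by linarith)
        exact h5.trans (mul_le_mul_of_nonneg_right h6 (by linarith))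
    rw [geoGap_eq]
    have : (1 - Real.exp (-v)) / (1 + ε) =
        (1 - Real.exp (-u)) / (1 + ε) + (Real.exp (-u) - Real.exp (-v)) / (1 + ε) := by ring
    rw [this]
    linarith

/-- The crude bound log ε⁻¹ ≤ ε⁻¹ - 1 suffices, because the result is only used after multiplication
by ε². -/
theorem slots_mul_le {m : ℕ} (hm : ε ^ 2 < geo ε m) : m * ε ≤ 2 / ε := by
  have h1 : Real.log (ε ^ 2) < Real.log (geo ε m) := Real.log_lt_log (by positivity) hm
  rw [log_geo, Real.log_pow] at h1
  have h2 := le_mul_log hε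
  have h3 : Real.log ε⁻¹ ≤ ε⁻¹ - 1 := Real.log_le_sub_one_of_pos (by positivity)
  rw [Real.log_inv] at h3
  push_cast at h1
  have hm0 : (0 : ℝ) ≤ m := m.cast_nonneg
  have h4 : m * Real.log (1 + ε) ≤ 2 * (ε⁻¹ - 1) := by linarith
  have h5 : m * ε ≤ (1 + ε) * (2 * (ε⁻¹ - 1)) := by nlinarith
  have h6 : (1 + ε) * (2 * (ε⁻¹ - 1)) = 2 / ε - 2 * ε := by field_simp; ring
  linarith

/-- The discrete form of ∫ e^{-r} min(a, r) dr = 1 - e^{-a}, cut off where the grid falls below ε².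
All errors must be relative to 1 - e^{-a}, since a will be A(x) for every x: the cut-off and the
division by 1 + ε cost 2ε, the boundary term costs 3ε. -/
theorem sum_geoGap_min_ge' (hε1 : ε ≤ 1 / 4) {a : ℝ} (ha : 0 ≤ a) {m : ℕ}
    (hm : ε ^ 2 < geo ε m) (hm' : geo ε (m + 1) ≤ ε ^ 2) :
    (1 - 5 * ε) * (1 - Real.exp (-a)) ≤
      ∑ j ∈ Finset.range (m + 1), geoGap ε j * min a (j * ε) := by
  have h := sum_geoGap_min_ge hε ha m
  have hsl := slots_mul_le hε hm
  set R : ℝ := m * ε with hR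
  have hR0 : 0 ≤ R := by positivity
  have hea : Real.exp (-a) ≤ 1 := Real.exp_le_one_iff.2 (by linarith)
  have h1 : (1 - ε) * (1 - Real.exp (-a)) ≤ 1 - Real.exp (-(min a R)) := by
    rcases le_total a R with h' | h'
    · rw [min_eq_left h']; nlinarith
    · rw [min_eq_right h']
      have h2 : Real.exp (-R) ≤ geo ε m := exp_le_geo hε m
      have h3 : geo ε m ≤ (1 + ε) * ε ^ 2 := by
        rw [geo_succ, div_le_iff₀ (by linarith)] at hm'
        linarith
      have h4 : (1 + ε) * ε ^ 2 ≤ ε := by nlinarith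
      nlinarith [Real.exp_pos (-a)]
  -- From 1 + b ≤ e^b one gets b ≤ (1 + b)(1 - e^{-b}). This makes the boundary term a multiple of 1
  -- - e^{-a}.
  have h2 : min a R ≤ (1 + R) * (1 - Real.exp (-a)) := by
    have key : ∀ b : ℝ, 0 ≤ b → b ≤ (1 + b) * (1 - Real.exp (-b)) := by
      intro b hb
      have h3 : (1 + b) * Real.exp (-b) ≤ 1 := by
        rw [Real.exp_neg]
        have := Real.add_one_le_exp b
        rw [mul_inv_le_iff₀ (Real.exp_pos b)]; linarith
      nlinarith
    have h3 := key (min a R) (le_min ha hR0)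
    have h4 : Real.exp (-a) ≤ Real.exp (-(min a R)) :=
      Real.exp_le_exp.2 (neg_le_neg (min_le_left _ _))
    have h5 : min a R ≤ R := min_le_right _ _
    have h6 : Real.exp (-(min a R)) ≤ 1 := Real.exp_le_one_iff.2 (by simp [ha, hR0])
    calc min a R ≤ (1 + min a R) * (1 - Real.exp (-(min a R))) := h3
      _ ≤ (1 + R) * (1 - Real.exp (-(min a R))) := by nlinarith
      _ ≤ _ := by nlinarith
  have h3 : geo ε (m + 1) * min a R ≤ 3 * ε * (1 - Real.exp (-a)) := by
    have h4 : ε ^ 2 * (1 + R) ≤ 3 * ε := by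
      have : ε ^ 2 * (2 / ε) = 2 * ε := by field_simp
      nlinarith
    calc geo ε (m + 1) * min a R ≤ ε ^ 2 * min a R :=
          mul_le_mul_of_nonneg_right hm' (le_min ha hR0)
      _ ≤ ε ^ 2 * ((1 + R) * (1 - Real.exp (-a))) := mul_le_mul_of_nonneg_left h2 (by positivity)
      _ ≤ _ := by nlinarith
  have h4 : (1 - 2 * ε) * (1 - Real.exp (-a)) ≤ (1 - Real.exp (-(min a R))) / (1 + ε) := by
    rw [le_div_iff₀ (by linarith)]
    nlinarith [mul_nonneg (sq_nonneg ε) (sub_nonneg.2 hea)]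
  nlinarith

end

/-- The survival probability up to slot `j`. -/
noncomputable def surv (ε κ : ℝ) (j : ℕ) : ℝ :=
  -- The factor 1 + 2ε pays for bounding 1 - z from below by an exponential in `exp_neg_le_one_sub`.
  1 - (1 + 2 * ε) * κ * ∑ l ∈ Finset.range j, geoGap ε l * (l * ε)

/-- The fraction of time spent in slot `j`. -/
noncomputable def slotWeight (ε κ : ℝ) (j : ℕ) : ℝ := κ * geoGap ε j / surv ε κ j

section Psi

/-- The derivative of y - y log y is -log y, which is nonnegative on (0, 1]. Hence the Kertz
integrand is decreasing. -/
theorem sub_mul_log_mono {y z : ℝ} (hy : 0 < y) (hyz : y ≤ z) (hz : z ≤ 1) :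
    y - y * Real.log y ≤ z - z * Real.log z := by
  have hz0 : 0 < z := hy.trans_le hyz
  have h1 : Real.log z ≤ 0 := Real.log_nonpos hz0.le hz
  have h2 : Real.log (z / y) ≤ z / y - 1 := Real.log_le_sub_one_of_pos (by positivity)
  rw [Real.log_div hz0.ne' hy.ne'] at h2
  have h3 : y * (Real.log z - Real.log y) ≤ z - y := by
    calc y * (Real.log z - Real.log y) ≤ y * (z / y - 1) := mul_le_mul_of_nonneg_left h2 hy.le
      _ = z - y := by field_simp
  nlinarith

variable {ε : ℝ} (hε : 0 < ε)
include hε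

/-- Up to the factor 1 + ε, the sum is a lower Riemann sum of -log t over [y, 1] with y = `geo ε j`,
and that integral is 1 - (y - y log y). -/
theorem sum_geoGap_le (j : ℕ) :
    ∑ l ∈ Finset.range j, geoGap ε l * (l * ε) ≤
      (1 + ε) * (1 - (geo ε j - geo ε j * Real.log (geo ε j))) := by
  induction j with
  | zero => simp [geo_zero]
  | succ j ih =>
    rw [Finset.sum_range_succ]
    have key : geoGap ε j * (j * ε) ≤ (1 + ε) * ((geo ε j - geo ε j * Real.log (geo ε j)) -
        (geo ε (j + 1) - geo ε (j + 1) * Real.log (geo ε (j + 1)))) := by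
      have h0 := le_mul_log hε
      have h1 := log_le' hε
      have hg := geoGap_nonneg hε j
      have hp := geo_pos hε (j + 1)
      have hj : (0 : ℝ) ≤ j := j.cast_nonneg
      have hgg : geoGap ε j = ε * geo ε (j + 1) := by
        rw [geoGap_eq, geo_succ]; field_simp; ring
      have hge : geo ε j = geo ε (j + 1) + geoGap ε j := by rw [geoGap_eq]; ring
      have h2 : geoGap ε j * (j * ε) ≤ geoGap ε j * (j * ((1 + ε) * Real.log (1 + ε))) := by
        gcongr
      refine h2.trans ?_
      rw [log_geo, log_geo, hge, hgg]
      push_cast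
      nlinarith [mul_pos hp hε]
    linarith

/-- The lower bound is β times the denominator of the Kertz integrand at y = `geo ε j`. -/
theorem surv_ge {β κ : ℝ} (hκ : κ * ((1 + 2 * ε) * (1 + ε)) ≤ β) (hκ0 : 0 ≤ κ) (j : ℕ) :
    1 - β * (1 - (geo ε j - geo ε j * Real.log (geo ε j))) ≤ surv ε κ j := by
  have h1 := sum_geoGap_le hε j
  have h2 : geo ε j - geo ε j * Real.log (geo ε j) ≤ 1 := by
    simpa using sub_mul_log_mono (geo_pos hε j) (geo_le_one hε j) le_rfl
  have h3 : (1 + 2 * ε) * κ * ∑ l ∈ Finset.range j, geoGap ε l * (l * ε) ≤ (1 + 2 * ε) * κ *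
      ((1 + ε) * (1 - (geo ε j - geo ε j * Real.log (geo ε j)))) :=
    mul_le_mul_of_nonneg_left h1 (by positivity)
  unfold surv
  nlinarith

/-- The place where the Kertz equation enters. By `surv_ge` each weight is at most the gap times the
integrand at the right end of its interval. The integrand is decreasing, so this is at most its
integral over the interval, and all these integrals together are at most 1. -/
theorem sum_slotWeight_le {β : ℝ} (hβ : IsKertzBound β) {κ : ℝ}
    (hκ : κ * ((1 + 2 * ε) * (1 + ε)) ≤ β) (hκ0 : 0 ≤ κ) (J : ℕ) :
    ∑ j ∈ Finset.range J, slotWeight ε κ j ≤ 1 := by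
  obtain ⟨hβ0, hβ1, hint⟩ := hβ
  set f : ℝ → ℝ := fun y => ((β⁻¹ - 1) - y * (Real.log y - 1))⁻¹ with hf
  have hc : 0 < β⁻¹ - 1 := by
    have := (one_lt_inv₀ hβ0).2 hβ1; linarith
  have hden : ∀ y ∈ Set.Icc (0 : ℝ) 1, 0 < (β⁻¹ - 1) - y * (Real.log y - 1) := by
    rintro y ⟨h0, h1⟩
    have := Real.log_nonpos h0 h1
    nlinarith
  have hcont : ContinuousOn f (Set.Icc 0 1) := by
    apply ContinuousOn.inv₀
    · have : (fun y : ℝ => (β⁻¹ - 1) - y * (Real.log y - 1)) =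
          fun y => (β⁻¹ - 1) - (y * Real.log y - y) := by ext y; ring
      rw [this]
      exact (continuous_const.sub (Real.continuous_mul_log.sub continuous_id)).continuousOn
    · intro y hy; exact (hden y hy).ne'
  have hii : ∀ a b : ℝ, 0 ≤ a → a ≤ b → b ≤ 1 → IntervalIntegrable f volume a b := by
    intro a b ha hab hb
    apply ContinuousOn.intervalIntegrable
    rw [Set.uIcc_of_le hab]
    exact hcont.mono (Set.Icc_subset_Icc ha hb)
  have hw : ∀ j, slotWeight ε κ j ≤ ∫ y in (geo ε (j + 1))..(geo ε j), f y := by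
    intro j
    have hjp := geo_pos hε j
    have hj1 := geo_le_one hε j
    have hjp' := geo_pos hε (j + 1)
    have hjj := geo_antitone hε (Nat.le_succ j)
    have hs := surv_ge hε hκ hκ0 j
    have hd := hden (geo ε j) ⟨hjp.le, hj1⟩
    have hs' : β * ((β⁻¹ - 1) - geo ε j * (Real.log (geo ε j) - 1)) ≤ surv ε κ j := by
      have : β * ((β⁻¹ - 1) - geo ε j * (Real.log (geo ε j) - 1)) =
        1 - β * (1 - (geo ε j - geo ε j * Real.log (geo ε j))) := by field_simp; ring
      rw [this]; exact hs
    have hκβ : κ ≤ β := (le_mul_of_one_le_right hκ0 (by nlinarith)).trans hκ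
    have h1 : slotWeight ε κ j ≤ geoGap ε j * f (geo ε j) := by
      have h2 : 0 < β * ((β⁻¹ - 1) - geo ε j * (Real.log (geo ε j) - 1)) := by positivity
      calc slotWeight ε κ j ≤ β * geoGap ε j /
            (β * ((β⁻¹ - 1) - geo ε j * (Real.log (geo ε j) - 1))) := by
            unfold slotWeight
            have := geoGap_nonneg hε j
            gcongr
        _ = geoGap ε j * f (geo ε j) := by
            rw [hf]; field_simp
    refine h1.trans ?_
    have h3 : ∫ _y in (geo ε (j + 1))..(geo ε j), f (geo ε j) = geoGap ε j * f (geo ε j) := by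
      rw [intervalIntegral.integral_const, geoGap_eq, smul_eq_mul]
    rw [← h3]
    apply intervalIntegral.integral_mono_on hjj (by simp) (hii _ _ hjp'.le hjj hj1)
    rintro y ⟨hy0, hy1⟩
    apply inv_anti₀ (hden y ⟨by linarith, by linarith⟩)
    have := sub_mul_log_mono (by linarith) hy1 hj1
    nlinarith
  have htot : ∑ j ∈ Finset.range J, ∫ y in (geo ε (j + 1))..(geo ε j), f y =
      ∫ y in (geo ε J)..1, f y := by
    induction J with
    | zero => simp [geo_zero]
    | succ J ih =>
      rw [Finset.sum_range_succ, ih, add_comm]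
      have hjj := geo_antitone hε (Nat.le_succ J)
      exact intervalIntegral.integral_add_adjacent_intervals
        (hii _ _ (geo_pos hε _).le hjj (geo_le_one hε _))
        (hii _ _ (geo_pos hε _).le (geo_le_one hε _) le_rfl)
  calc ∑ j ∈ Finset.range J, slotWeight ε κ j
      ≤ ∑ j ∈ Finset.range J, ∫ y in (geo ε (j + 1))..(geo ε j), f y :=
        Finset.sum_le_sum fun j _ => hw j
    _ = ∫ y in (geo ε J)..1, f y := htot
    _ ≤ (∫ y in (0 : ℝ)..(geo ε J), f y) + ∫ y in (geo ε J)..1, f y := by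
        have : 0 ≤ ∫ y in (0 : ℝ)..(geo ε J), f y := by
          apply intervalIntegral.integral_nonneg (geo_pos hε _).le
          rintro y ⟨hy0, hy1⟩
          exact (inv_pos.2 (hden y ⟨hy0, hy1.trans (geo_le_one hε _)⟩)).le
        linarith
    _ = 1 := by
        rw [intervalIntegral.integral_add_adjacent_intervals
          (hii _ _ le_rfl (geo_pos hε _).le (geo_le_one hε _))
          (hii _ _ (geo_pos hε _).le (geo_le_one hε _) le_rfl), hint]

end Psi

end FreeOrder

namespace FreeOrder

/-! ### Tail functions -/

/-- `p x = Pr[X > x]` for a nonnegative random variable with mean `m`. -/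
structure IsTail (p : ℝ → ℝ) (m : ℝ) : Prop where
  anti : Antitone p
  nonneg : ∀ x, 0 ≤ p x
  le_one : ∀ x, p x ≤ 1
  neg : ∀ x < 0, p x = 1
  -- Needed for boxes of mean zero, for which the grid step εm of the quantile search degenerates.
  zero : m = 0 → p 0 = 0
  int : IntegrableOn p (Set.Ioi 0)
  integral : ∫ x in Set.Ioi 0, p x = m

namespace IsTail

variable {p : ℝ → ℝ} {m : ℝ} (h : IsTail p m)
include h

theorem mean_nonneg : 0 ≤ m := by
  rw [← h.integral]; exact integral_nonneg h.nonneg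

theorem intervalIntegrable (a b : ℝ) : IntervalIntegrable p volume a b :=
  h.anti.intervalIntegrable

theorem integral_Ioi {θ : ℝ} (hθ : 0 ≤ θ) :
    ∫ x in Set.Ioi θ, p x = m - ∫ x in (0 : ℝ)..θ, p x := by
  have := intervalIntegral.integral_interval_add_Ioi h.int
    (h.int.mono_set (Set.Ioi_subset_Ioi hθ))
  rw [h.integral] at this
  linarith

theorem markov {x : ℝ} (hx : 0 ≤ x) : x * p x ≤ m := by
  have h1 : ∫ _y in (0 : ℝ)..x, p x ≤ ∫ y in (0 : ℝ)..x, p y :=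
    intervalIntegral.integral_mono_on hx (by simp) (h.intervalIntegrable _ _)
      fun y hy => h.anti hy.2
  have h2 := h.integral_Ioi hx
  have h3 : 0 ≤ ∫ x in Set.Ioi x, p x := integral_nonneg h.nonneg
  rw [intervalIntegral.integral_const, smul_eq_mul, sub_zero] at h1
  linarith

theorem integrableOn_max (θ : ℝ) : IntegrableOn (fun x => p (max x θ)) (Set.Ioi 0) := by
  have hanti : Antitone fun x => p (max x θ) := fun x y hxy => h.anti (max_le_max hxy le_rfl)
  refine Integrable.mono' h.int hanti.measurable.aestronglyMeasurable (ae_of_all _ fun x => ?_)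
  rw [Real.norm_of_nonneg (h.nonneg _)]
  exact h.anti (le_max_left _ _)

/-- The expectation of `X` on the event `X > θ`. -/
theorem integral_max (θ : ℝ) : ∫ x in Set.Ioi 0, p (max x θ) =
    m - (∫ x in (0 : ℝ)..(max θ 0), p x) + max θ 0 * p (max θ 0) := by
  set τ := max θ 0 with hτ
  have h0 : 0 ≤ τ := le_max_right _ _
  have e1 : ∫ x in Set.Ioi 0, p (max x θ) = ∫ x in Set.Ioi 0, p (max x τ) := by
    refine setIntegral_congr_fun measurableSet_Ioi fun x hx => ?_
    simp only [Set.mem_Ioi] at hx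
    simp only [hτ, max_comm θ 0, ← max_assoc, max_eq_left hx.le]
  rw [e1, ← intervalIntegral.integral_interval_add_Ioi (h.integrableOn_max τ)
    ((h.integrableOn_max τ).mono_set (Set.Ioi_subset_Ioi h0))]
  have e2 : ∫ x in (0 : ℝ)..τ, p (max x τ) = τ * p τ := by
    rw [intervalIntegral.integral_congr (g := fun _ => p τ)]
    · simp
    · intro x hx
      rw [Set.uIcc_of_le h0] at hx
      simp [max_eq_right hx.2]
  have e3 : ∫ x in Set.Ioi τ, p (max x τ) = ∫ x in Set.Ioi τ, p x := by
    refine setIntegral_congr_fun measurableSet_Ioi fun x hx => ?_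
    simp only [Set.mem_Ioi] at hx
    simp [max_eq_left hx.le]
  rw [e2, e3, h.integral_Ioi h0]
  ring

/-- A left Riemann sum of a decreasing function with values in [0, 1] is too large by at most one
cell. Truncated means become computable from finitely many queries in this way. -/
theorem riemann_bounds {θ : ℝ} (hθ : 0 ≤ θ) {B : ℕ} (hB : 0 < B) :
    ∫ x in (0 : ℝ)..θ, p x ≤ θ / B * ∑ t ∈ Finset.range B, p (t * (θ / B)) ∧
    θ / B * ∑ t ∈ Finset.range B, p (t * (θ / B)) ≤ (∫ x in (0 : ℝ)..θ, p x) + θ / B := by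
  rcases hθ.eq_or_lt with rfl | hθ
  · simp
  have hB' : (0 : ℝ) < B := by exact_mod_cast hB
  set c := θ / B with hc
  have hc0 : 0 < c := by positivity
  have hanti : Antitone fun u : ℝ => p (u * c) := fun u v huv =>
    h.anti (mul_le_mul_of_nonneg_right huv hc0.le)
  have hsc : ∫ x in (0 : ℝ)..θ, p x = c * ∫ u in (0 : ℝ)..(0 + (B : ℝ)), p (u * c) := by
    rw [intervalIntegral.integral_comp_mul_right p hc0.ne', smul_eq_mul, ← mul_assoc,
      mul_inv_cancel₀ hc0.ne', one_mul, zero_mul, zero_add, hc, mul_div_cancel₀ _ hB'.ne']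
  have h1 := (hanti.antitoneOn (Set.Icc (0 : ℝ) (0 + (B : ℝ)))).integral_le_sum
  have h2 := (hanti.antitoneOn (Set.Icc (0 : ℝ) (0 + (B : ℝ)))).sum_le_integral
  simp only [zero_add] at h1 h2
  rw [zero_add] at hsc
  have h3 : ∑ t ∈ Finset.range B, p ((t : ℝ) * c) ≤
      ∑ t ∈ Finset.range B, p (((t + 1 : ℕ) : ℝ) * c) + 1 := by
    have e := Finset.sum_range_succ' (fun t : ℕ => p ((t : ℝ) * c)) B
    rw [Finset.sum_range_succ] at e
    have := h.nonneg ((B : ℝ) * c)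
    have := h.le_one (((0 : ℕ) : ℝ) * c)
    linarith
  constructor
  · rw [hsc]; exact mul_le_mul_of_nonneg_left h1 hc0.le
  · rw [hsc]; nlinarith

/-- A computable lower bound for the expectation of `X` on the event `X > θ`. -/
theorem lower_bounds (θ : ℝ) {B : ℕ} (hB : 0 < B) {V : ℝ}
    (hV : V = m - max θ 0 / B * ∑ t ∈ Finset.range B, p (t * (max θ 0 / B)) +
      max θ 0 * p (max θ 0)) :
    V ≤ ∫ x in Set.Ioi 0, p (max x θ) ∧ (∫ x in Set.Ioi 0, p (max x θ)) - max θ 0 / B ≤ V := by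
  obtain ⟨h1, h2⟩ := h.riemann_bounds (le_max_right θ 0) hB
  rw [h.integral_max θ, hV]
  constructor <;> linarith

end IsTail

/-! ### The guarantee of the discretized Kertz policy -/

/-- Turns products of rejection probabilities into exponentials of sums. After inversion the
second-order bound 1 + x + x²/2 ≤ e^x is enough, since z ≤ 2ε. -/
theorem exp_neg_le_one_sub {ε z : ℝ} (hε : ε ≤ 1 / 4) (hz0 : 0 ≤ z) (hz : z ≤ 2 * ε) :
    Real.exp (-((1 + 2 * ε) * z)) ≤ 1 - z := by
  have h1 : Real.exp (-((1 + 2 * ε) * z)) = (Real.exp ((1 + 2 * ε) * z))⁻¹ := Real.exp_neg _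
  rw [h1, inv_le_comm₀ (Real.exp_pos _) (by linarith)]
  have hε0 : 0 ≤ ε := by linarith
  have h2 := Real.quadratic_le_exp_of_nonneg (show 0 ≤ (1 + 2 * ε) * z by positivity)
  refine le_trans ?_ h2
  rw [inv_le_iff_one_le_mul₀ (by linarith)]
  have e : (1 + (1 + 2 * ε) * z + ((1 + 2 * ε) * z) ^ 2 / 2) * (1 - z) = 1 + z * (2 * ε - z) +
      z ^ 2 * (1 + (1 + 2 * ε) ^ 2 * (1 - z) / 2 - (1 + 2 * ε)) := by ring
  rw [e]
  have h4 : 0 ≤ 1 + (1 + 2 * ε) ^ 2 * (1 - z) / 2 - (1 + 2 * ε) := by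
    nlinarith [mul_nonneg hε0 hε0]
  have h5 := mul_nonneg hz0 (sub_nonneg.2 hz)
  have h6 := mul_nonneg (sq_nonneg z) h4
  linarith

/-- The weight times `surv ε κ j` is κ times the gap, so the linear decrease of the survival bound
is also a relative loss proportional to the weight of the slot. -/
theorem surv_succ {ε κ : ℝ} {j : ℕ} (hs : 0 < surv ε κ j) :
    surv ε κ (j + 1) = surv ε κ j * (1 - (1 + 2 * ε) * (slotWeight ε κ j * (j * ε))) := by
  have : surv ε κ (j + 1) = surv ε κ j - (1 + 2 * ε) * κ * (geoGap ε j * (j * ε)) := by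
    simp only [surv, Finset.sum_range_succ]; ring
  rw [this, slotWeight]
  field_simp

theorem surv_antitone {ε κ : ℝ} (hε : 0 < ε) (hκ : 0 ≤ κ) : Antitone (surv ε κ) := by
  refine antitone_nat_of_succ_le fun j => ?_
  simp only [surv, Finset.sum_range_succ]
  have := geoGap_nonneg hε j
  have : 0 ≤ (1 + 2 * ε) * κ * (geoGap ε j * (j * ε)) := by positivity
  nlinarith

/-- Survival: independent items, each of which stops the process with small probability. -/
theorem surv_le_prod {ε κ : ℝ} (hε : 0 < ε) (hε4 : ε ≤ 1 / 4) {J j : ℕ} (hj : j < J)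
    (hs : ∀ l ≤ J, 0 < surv ε κ l) (d : ℕ → ℝ) (hd0 : ∀ l, 0 ≤ d l)
    (hd : ∀ l < J, d l * (l * ε) = slotWeight ε κ l * (l * ε))
    (hd1 : ∑ l ∈ Finset.range J, d l ≤ 1) (S : Finset ℕ) (acc : ℕ → ℕ → ℝ)
    (hacc0 : ∀ i ∈ S, ∀ l, 0 ≤ acc i l) (hacc : ∀ i ∈ S, ∀ l, acc i l ≤ 2 * ε)
    (hsum : ∀ l < J, d l * ∑ i ∈ S, acc i l ≤ d l * (l * ε)) (T : Finset ℕ) (hT : T ⊆ S) :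
    surv ε κ (j + 1) ≤ ∏ i ∈ T, (1 - ∑ l ∈ Finset.range (j + 1), d l * acc i l) := by
  have hz0 : ∀ i ∈ S, 0 ≤ ∑ l ∈ Finset.range (j + 1), d l * acc i l := fun i hi =>
    Finset.sum_nonneg fun l _ => mul_nonneg (hd0 l) (hacc0 i hi l)
  have hz : ∀ i ∈ S, ∑ l ∈ Finset.range (j + 1), d l * acc i l ≤ 2 * ε := by
    intro i hi
    calc ∑ l ∈ Finset.range (j + 1), d l * acc i l
        ≤ ∑ l ∈ Finset.range (j + 1), d l * (2 * ε) :=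
          Finset.sum_le_sum fun l _ => mul_le_mul_of_nonneg_left (hacc i hi l) (hd0 l)
      _ ≤ ∑ l ∈ Finset.range J, d l * (2 * ε) := by
          apply Finset.sum_le_sum_of_subset_of_nonneg
          · intro l; simp only [Finset.mem_range]; omega
          · intro l _ _; exact mul_nonneg (hd0 l) (by positivity)
      _ ≤ 2 * ε := by rw [← Finset.sum_mul]; nlinarith
  -- Each relative loss is bounded by 1 - x ≤ e^{-x}; it remains to compare with the exponential of
  -- the actual acceptance mass.
  have h1 : ∀ k ≤ J, surv ε κ k ≤
      Real.exp (-((1 + 2 * ε) * ∑ l ∈ Finset.range k, d l * (l * ε))) := by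
    intro k
    induction k with
    | zero => intro _; simp [surv]
    | succ k ih =>
      intro hk
      rw [surv_succ (hs k (by omega)), Finset.sum_range_succ, ← hd k (by omega)]
      have e : Real.exp (-((1 + 2 * ε) * (∑ l ∈ Finset.range k, d l * (l * ε) + d k * (k * ε)))) =
          Real.exp (-((1 + 2 * ε) * ∑ l ∈ Finset.range k, d l * (l * ε))) *
          Real.exp (-((1 + 2 * ε) * (d k * (k * ε)))) := by
        rw [← Real.exp_add]; ring_nf
      rw [e]
      have h2 := Real.add_one_le_exp (-((1 + 2 * ε) * (d k * (k * ε))))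
      calc surv ε κ k * (1 - (1 + 2 * ε) * (d k * (k * ε)))
          ≤ surv ε κ k * Real.exp (-((1 + 2 * ε) * (d k * (k * ε)))) :=
            mul_le_mul_of_nonneg_left (by linarith) (hs k (by omega)).le
        _ ≤ _ := mul_le_mul_of_nonneg_right (ih (by omega)) (Real.exp_pos _).le
  refine (h1 (j + 1) (by omega)).trans ?_
  -- After exchanging the sums, slot l contributes its weight times the total mass at its level,
  -- which is at most lε.
  have h2 : ∑ i ∈ T, ∑ l ∈ Finset.range (j + 1), d l * acc i l ≤
      ∑ l ∈ Finset.range (j + 1), d l * (l * ε) := by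
    calc ∑ i ∈ T, ∑ l ∈ Finset.range (j + 1), d l * acc i l
        ≤ ∑ i ∈ S, ∑ l ∈ Finset.range (j + 1), d l * acc i l :=
          Finset.sum_le_sum_of_subset_of_nonneg hT fun i hi _ => hz0 i hi
      _ = ∑ l ∈ Finset.range (j + 1), d l * ∑ i ∈ S, acc i l := by
          rw [Finset.sum_comm]; simp only [Finset.mul_sum]
      _ ≤ _ := Finset.sum_le_sum fun l hl => hsum l (by rw [Finset.mem_range] at hl; omega)
  calc Real.exp (-((1 + 2 * ε) * ∑ l ∈ Finset.range (j + 1), d l * (l * ε)))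
      ≤ Real.exp (∑ i ∈ T, -((1 + 2 * ε) * ∑ l ∈ Finset.range (j + 1), d l * acc i l)) := by
        apply Real.exp_le_exp.2
        rw [Finset.sum_neg_distrib, ← Finset.mul_sum]
        nlinarith
    _ = ∏ i ∈ T, Real.exp (-((1 + 2 * ε) * ∑ l ∈ Finset.range (j + 1), d l * acc i l)) :=
        Real.exp_sum _ _
    _ ≤ _ := Finset.prod_le_prod (fun i _ => (Real.exp_pos _).le) fun i hi =>
        exp_neg_le_one_sub hε4 (hz0 i (hT hi)) (hz i (hT hi))

theorem integrableOn_one_sub_exp {A : ℝ → ℝ} (hA : Antitone A) (hA0 : ∀ x, 0 ≤ A x)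
    (hAi : IntegrableOn A (Set.Ioi 0)) :
    IntegrableOn (fun x => 1 - Real.exp (-(A x))) (Set.Ioi 0) := by
  have hm : Measurable fun x => 1 - Real.exp (-(A x)) :=
    measurable_const.sub (Real.measurable_exp.comp hA.measurable.neg)
  refine Integrable.mono' hAi hm.aestronglyMeasurable (ae_of_all _ fun x => ?_)
  have h1 : Real.exp (-(A x)) ≤ 1 := Real.exp_le_one_iff.2 (by linarith [hA0 x])
  have h2 := Real.add_one_le_exp (-(A x))
  rw [Real.norm_of_nonneg (by linarith)]
  linarith

theorem integrableOn_min {A : ℝ → ℝ} (hA : Antitone A) (hA0 : ∀ x, 0 ≤ A x)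
    (hAi : IntegrableOn A (Set.Ioi 0)) {r : ℝ} (hr : 0 ≤ r) :
    IntegrableOn (fun x => min (A x) r) (Set.Ioi 0) := by
  refine Integrable.mono' hAi (hA.measurable.min measurable_const).aestronglyMeasurable
    (ae_of_all _ fun x => ?_)
  rw [Real.norm_of_nonneg (le_min (hA0 x) hr)]
  exact min_le_left _ _

/-- Rounding the threshold costs at most one unit of the grid. -/
theorem integral_min_le {A φ : ℝ → ℝ} (hA : Antitone A) (hA0 : ∀ x, 0 ≤ A x)
    (hAi : IntegrableOn A (Set.Ioi 0)) (hφi : IntegrableOn φ (Set.Ioi 0)) {r u : ℝ} (hr : 0 ≤ r)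
    (hu : 0 < u) (hφ : ∀ x > 0, min (A (x + u)) r ≤ φ x) :
    ∫ x in Set.Ioi 0, min (A x) r ≤ (∫ x in Set.Ioi 0, φ x) + u * r := by
  have hmi := integrableOn_min hA hA0 hAi hr
  have h1 : ∫ x in Set.Ioi 0, min (A x) r =
      (∫ x in (0 : ℝ)..u, min (A x) r) + ∫ x in Set.Ioi u, min (A x) r :=
    (intervalIntegral.integral_interval_add_Ioi hmi
      (hmi.mono_set (Set.Ioi_subset_Ioi hu.le))).symm
  have hanti : Antitone fun x => min (A x) r := fun x y hxy => min_le_min (hA hxy) le_rfl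
  have h2 : ∫ x in (0 : ℝ)..u, min (A x) r ≤ u * r := by
    calc ∫ x in (0 : ℝ)..u, min (A x) r ≤ ∫ _x in (0 : ℝ)..u, r :=
          intervalIntegral.integral_mono_on hu.le hanti.intervalIntegrable (by simp)
            fun x _ => min_le_right _ _
      _ = u * r := by simp
  have h3 : ∫ x in Set.Ioi u, min (A x) r = ∫ x in Set.Ioi 0, min (A (x + u)) r := by
    have := (measurePreserving_add_right volume u).setIntegral_preimage_emb
      (MeasurableEquiv.addRight u).measurableEmbedding (fun x => min (A x) r) (Set.Ioi u)
    rw [← this]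
    congr 2
    ext x
    simp
  have h4 : ∫ x in Set.Ioi 0, min (A (x + u)) r ≤ ∫ x in Set.Ioi 0, φ x := by
    refine setIntegral_mono_on ?_ hφi measurableSet_Ioi fun x hx => hφ x hx
    refine Integrable.mono' hmi ?_ (ae_of_all _ fun x => ?_)
    · exact (Antitone.measurable (f := fun x => min (A (x + u)) r)
        fun x y hxy => min_le_min (hA (by linarith)) le_rfl).aestronglyMeasurable
    · rw [Real.norm_of_nonneg (le_min (hA0 _) hr)]
      exact min_le_min (hA (by linarith)) le_rfl
  linarith

/-- The expected reward when the items choose their slots at random. -/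
noncomputable def blend (S : Finset ℕ) (B : ℕ) (W F : ℕ → ℕ → ℝ) : ℝ :=
  ∑ i ∈ S, ∑ j ∈ Finset.range B, W i j * ∏ l ∈ S.erase i, F l j

/-- Slot j earns at least d_j · surv_{j+1} · ∫ φ_j up to the errors of the means. Here φ_j dominates
min(A, jε) shifted by u, and d_j · surv_{j+1} is nearly κ times the gap, so summing over j yields
the discrete integral of `sum_geoGap_min_ge'`. The number M bounds the inverse survival probability;
it controls the loss within one slot, because survival is taken at the end of the slot. -/
theorem blend_ge {ε κ M : ℝ} (hε : 0 < ε) (hε4 : ε ≤ 1 / 4) (hM : 2 * M * ε ≤ 1)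
    (hκ0 : 0 ≤ κ) (hκ1 : κ ≤ 1) {B m : ℕ} (hmB : m + 1 ≤ B)
    (hm : ε ^ 2 < geo ε m) (hm' : geo ε (m + 1) ≤ ε ^ 2)
    (hs : 1 ≤ M * surv ε κ (m + 1)) (hM0 : 0 < M) (d : ℕ → ℝ)
    (hd : ∀ j, d j = if j = 0 then 0 else if j < m + 1 then slotWeight ε κ j else 0)
    (hd1 : ∑ j ∈ Finset.range (m + 1), d j ≤ 1)
    (S : Finset ℕ) (acc : ℕ → ℕ → ℝ)
    (hacc0 : ∀ i ∈ S, ∀ j, 0 ≤ acc i j) (hacc : ∀ i ∈ S, ∀ j, acc i j ≤ 2 * ε)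
    (hsum : ∀ j, 1 ≤ j → j < m + 1 → ∑ i ∈ S, acc i j ≤ j * ε)
    {A : ℝ → ℝ} (hA : Antitone A) (hA0 : ∀ x, 0 ≤ A x) (hAi : IntegrableOn A (Set.Ioi 0))
    {φ : ℕ → ℝ → ℝ} (hφi : ∀ j, IntegrableOn (φ j) (Set.Ioi 0)) {u : ℝ} (hu : 0 < u)
    (hφ : ∀ j, 1 ≤ j → j < m + 1 → ∀ x > 0, min (A (x + u)) (j * ε) ≤ φ j x)
    (w v : ℕ → ℕ → ℝ) {err : ℝ} (herr : 0 ≤ err)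
    (hv0 : ∀ i ∈ S, ∀ j, 0 ≤ v i j)
    (hv : ∀ j, 1 ≤ j → j < m + 1 → ∑ i ∈ S, v i j = ∫ x in Set.Ioi 0, φ j x)
    (hw : ∀ i ∈ S, ∀ j, 1 ≤ j → j < m + 1 → v i j - err ≤ w i j) :
    κ * (1 - 2 * M * ε) * (1 - 5 * ε) * (∫ x in Set.Ioi 0, (1 - Real.exp (-(A x)))) - u -
        S.card * err ≤
      blend S B (fun i j => d j * w i j)
        (fun i j => 1 - ∑ l ∈ Finset.range (j + 1), d l * acc i l) := by
  set J := m + 1 with hJ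
  have hsJ : 0 < surv ε κ J := by
    by_contra hcon
    nlinarith
  have hsl : ∀ l ≤ J, 0 < surv ε κ l := fun l hl =>
    hsJ.trans_le (surv_antitone hε hκ0 hl)
  have hsM : ∀ l ≤ J, 1 ≤ M * surv ε κ l := fun l hl =>
    hs.trans (mul_le_mul_of_nonneg_left (surv_antitone hε hκ0 hl) hM0.le)
  have hw0 : ∀ j < J, 0 ≤ slotWeight ε κ j := fun j hj =>
    div_nonneg (mul_nonneg hκ0 (geoGap_nonneg hε j)) (hsl j hj.le).le
  have hd0 : ∀ j, 0 ≤ d j := by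
    intro j; rw [hd]; split_ifs with h1 h2
    exacts [le_rfl, hw0 j h2, le_rfl]
  -- Slot 0 has level mass zero, so dropping its weight does not affect survival.
  have hdr : ∀ j < J, d j * (j * ε) = slotWeight ε κ j * (j * ε) := by
    intro j hj
    rw [hd]; split_ifs with h1
    · simp [h1]
    · rfl
  have hsum' : ∀ j < J, d j * ∑ i ∈ S, acc i j ≤ d j * (j * ε) := by
    intro j hj
    rcases Nat.eq_zero_or_pos j with h0 | h0
    · simp [hd, h0]
    · exact mul_le_mul_of_nonneg_left (hsum j h0 hj) (hd0 j)
  -- survival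
  have hprod : ∀ j, 1 ≤ j → j < J → ∀ i ∈ S, surv ε κ (j + 1) ≤
      ∏ l ∈ S.erase i, (1 - ∑ k ∈ Finset.range (j + 1), d k * acc l k) := fun j _ hj i _ =>
    surv_le_prod hε hε4 hj hsl d hd0 hdr hd1 S acc hacc0 hacc hsum' _ (Finset.erase_subset _ _)
  have hprod1 : ∀ j < J, ∀ i ∈ S,
      ∏ l ∈ S.erase i, (1 - ∑ k ∈ Finset.range (j + 1), d k * acc l k) ≤ 1 := by
    intro j hj i _
    have hz0 : ∀ l ∈ S, 0 ≤ ∑ k ∈ Finset.range (j + 1), d k * acc l k := fun l hl =>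
      Finset.sum_nonneg fun k _ => mul_nonneg (hd0 k) (hacc0 l hl k)
    apply Finset.prod_le_one
    · intro l hl
      have hl' := Finset.mem_of_mem_erase hl
      have : ∑ k ∈ Finset.range (j + 1), d k * acc l k ≤ 1 := by
        calc ∑ k ∈ Finset.range (j + 1), d k * acc l k
            ≤ ∑ k ∈ Finset.range (j + 1), d k * 1 := Finset.sum_le_sum fun k _ =>
              mul_le_mul_of_nonneg_left ((hacc l hl' k).trans (by linarith)) (hd0 k)
          _ ≤ ∑ k ∈ Finset.range J, d k * 1 := by
              apply Finset.sum_le_sum_of_subset_of_nonneg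
              · intro k; simp only [Finset.mem_range]; omega
              · intro k _ _; simpa using hd0 k
          _ ≤ 1 := by simpa using hd1
      linarith
    · intro l hl
      linarith [hz0 l (Finset.mem_of_mem_erase hl)]
  set I : ℕ → ℝ := fun j => ∫ x in Set.Ioi 0, min (A x) (j * ε) with hI
  have hc : 0 ≤ 1 - 2 * M * ε := by linarith
  -- the contribution of a single slot
  have hslot : ∀ j < J, κ * geoGap ε j * (1 - 2 * M * ε) * (I j - u * (j * ε)) -
      S.card * err * d j ≤ ∑ i ∈ S, d j * w i j *
        ∏ l ∈ S.erase i, (1 - ∑ k ∈ Finset.range (j + 1), d k * acc l k) := by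
    intro j hj
    rcases Nat.eq_zero_or_pos j with h0 | h0
    · subst h0
      simp [hd, hI, min_eq_right (hA0 _)]
    have hdj : d j = slotWeight ε κ j := by simp [hd, hj, Nat.pos_iff_ne_zero.1 h0]
    have h1 : ∑ i ∈ S, (d j * surv ε κ (j + 1) * v i j - err * d j) ≤ ∑ i ∈ S, d j * w i j *
        ∏ l ∈ S.erase i, (1 - ∑ k ∈ Finset.range (j + 1), d k * acc l k) := by
      apply Finset.sum_le_sum
      intro i hi
      have p1 := hprod j h0 hj i hi
      have p2 := hprod1 j hj i hi
      set Q := ∏ l ∈ S.erase i, (1 - ∑ k ∈ Finset.range (j + 1), d k * acc l k)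
      have hQ0 : 0 ≤ Q := (hsl (j + 1) (by omega)).le.trans p1
      have a1 : d j * (v i j - err) * Q ≤ d j * w i j * Q := mul_le_mul_of_nonneg_right
        (mul_le_mul_of_nonneg_left (hw i hi j h0 hj) (hd0 j)) hQ0
      have a2 : d j * v i j * surv ε κ (j + 1) ≤ d j * v i j * Q :=
        mul_le_mul_of_nonneg_left p1 (mul_nonneg (hd0 j) (hv0 i hi j))
      have a3 : d j * err * Q ≤ d j * err * 1 :=
        mul_le_mul_of_nonneg_left p2 (mul_nonneg (hd0 j) herr)
      nlinarith
    refine le_trans ?_ h1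
    rw [Finset.sum_sub_distrib, ← Finset.mul_sum, hv j h0 hj, Finset.sum_const, nsmul_eq_mul]
    have h2 : I j ≤ (∫ x in Set.Ioi 0, φ j x) + u * (j * ε) :=
      integral_min_le hA hA0 hAi (hφi j) (by positivity) hu (hφ j h0 hj)
    -- As the gap times jε is at most ε and `surv` is at least 1/M, the relative loss of survival
    -- within one slot is at most (1 + 2ε)Mε ≤ 2Mε.
    have h3 : κ * geoGap ε j * (1 - 2 * M * ε) ≤ d j * surv ε κ (j + 1) := by
      have hx : slotWeight ε κ j * (j * ε) ≤ M * ε := by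
        have e : slotWeight ε κ j * (j * ε) = κ * (geoGap ε j * (j * ε)) / surv ε κ j := by
          rw [slotWeight]; ring
        rw [e, div_le_iff₀ (hsl j hj.le)]
        have b1 := geoGap_mul_le hε j
        have b2 : 0 ≤ geoGap ε j * (j * ε) :=
          mul_nonneg (geoGap_nonneg hε j) (by positivity)
        have b3 := hsM j hj.le
        nlinarith
      rw [surv_succ (hsl j hj.le), hdj, ← mul_assoc]
      have e : slotWeight ε κ j * surv ε κ j = κ * geoGap ε j := by
        rw [slotWeight, div_mul_cancel₀ _ (hsl j hj.le).ne']
      rw [e]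
      apply mul_le_mul_of_nonneg_left _ (mul_nonneg hκ0 (geoGap_nonneg hε j))
      have : 0 ≤ slotWeight ε κ j * (j * ε) := mul_nonneg (hw0 j hj) (by positivity)
      nlinarith
    have hΦ : 0 ≤ ∫ x in Set.Ioi 0, φ j x := by
      rw [← hv j h0 hj]; exact Finset.sum_nonneg fun i hi => hv0 i hi j
    have h4 : 0 ≤ κ * geoGap ε j * (1 - 2 * M * ε) :=
      mul_nonneg (mul_nonneg hκ0 (geoGap_nonneg hε j)) hc
    have h5 := mul_le_mul_of_nonneg_left (show I j - u * (j * ε) ≤ ∫ x in Set.Ioi 0, φ j x by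
      linarith) h4
    have h6 := mul_le_mul_of_nonneg_right h3 hΦ
    linarith
  -- summation over the slots
  have hblend : ∑ j ∈ Finset.range J, ∑ i ∈ S, d j * w i j *
        ∏ l ∈ S.erase i, (1 - ∑ k ∈ Finset.range (j + 1), d k * acc l k) =
      blend S B (fun i j => d j * w i j)
        (fun i j => 1 - ∑ l ∈ Finset.range (j + 1), d l * acc i l) := by
    rw [blend, Finset.sum_comm]
    refine Finset.sum_congr rfl fun i _ => Finset.sum_subset ?_ ?_
    · intro j; simp only [Finset.mem_range]; omega
    · intro j _ hj
      have hj' : ¬ j < J := by simpa using hj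
      have : d j = 0 := by rw [hd, if_neg hj']; simp
      simp [this]
  rw [← hblend]
  refine le_trans ?_ (Finset.sum_le_sum fun j hj => hslot j (Finset.mem_range.1 hj))
  -- Survival stays positive, so this sum is at most 1; hence the rounding of the levels costs at
  -- most u altogether.
  have hgr : κ * ∑ j ∈ Finset.range J, geoGap ε j * (j * ε) ≤ 1 := by
    have h1 : 0 ≤ κ * ∑ j ∈ Finset.range J, geoGap ε j * (j * ε) :=
      mul_nonneg hκ0 (Finset.sum_nonneg fun j _ =>
        mul_nonneg (geoGap_nonneg hε j) (by positivity))
    have h2 : surv ε κ J = 1 - (1 + 2 * ε) * (κ * ∑ j ∈ Finset.range J, geoGap ε j * (j * ε)) := by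
      rw [surv]; ring
    nlinarith
  have hint : (1 - 5 * ε) * (∫ x in Set.Ioi 0, (1 - Real.exp (-(A x)))) ≤
      ∑ j ∈ Finset.range J, geoGap ε j * I j := by
    have hmi : ∀ j : ℕ, IntegrableOn (fun x => min (A x) (j * ε)) (Set.Ioi 0) := fun j =>
      integrableOn_min hA hA0 hAi (by positivity)
    rw [hI, ← integral_const_mul]
    simp only [← integral_const_mul]
    rw [← integral_finsetSum _ fun j _ => (hmi j).const_mul _]
    refine integral_mono ((integrableOn_one_sub_exp hA hA0 hAi).const_mul _)
      (integrable_finsetSum _ fun j _ => (hmi j).const_mul _) fun x => ?_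
    exact sum_geoGap_min_ge' hε hε4 (hA0 x) hm hm'
  have e : ∑ j ∈ Finset.range J, (κ * geoGap ε j * (1 - 2 * M * ε) * (I j - u * (j * ε)) -
      S.card * err * d j) = κ * (1 - 2 * M * ε) * (∑ j ∈ Finset.range J, geoGap ε j * I j) -
      u * ((1 - 2 * M * ε) * (κ * ∑ j ∈ Finset.range J, geoGap ε j * (j * ε))) -
      S.card * err * ∑ j ∈ Finset.range J, d j := by
    simp only [Finset.mul_sum, ← Finset.sum_sub_distrib]
    refine Finset.sum_congr rfl fun j _ => ?_
    ring
  rw [e]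
  have f1 := mul_le_mul_of_nonneg_left hint (mul_nonneg hκ0 hc)
  have f2 : (1 - 2 * M * ε) * (κ * ∑ j ∈ Finset.range J, geoGap ε j * (j * ε)) ≤ 1 := by
    have : 0 ≤ κ * ∑ j ∈ Finset.range J, geoGap ε j * (j * ε) :=
      mul_nonneg hκ0 (Finset.sum_nonneg fun j _ =>
        mul_nonneg (geoGap_nonneg hε j) (by positivity))
    nlinarith [mul_pos hM0 hε]
  have f3 : (S.card : ℝ) * err * ∑ j ∈ Finset.range J, d j ≤ S.card * err * 1 :=
    mul_le_mul_of_nonneg_left hd1 (by positivity)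
  nlinarith

end FreeOrder

namespace FreeOrder

/-! ### Approximate quantiles and capped tails -/

/-- The number of terms of an antitone sequence that exceed `r`. -/
theorem exists_count {f : ℕ → ℝ} (hf : Antitone f) {r : ℝ} {B g₀ : ℕ} (hg : g₀ < B)
    (h0 : f g₀ ≤ r) :
    ∃ N : ℕ, ∑ g ∈ Finset.range B, (if f g ≤ r then (0 : ℝ) else 1) = N ∧ N ≤ g₀ ∧
      f N ≤ r ∧ ∀ g < N, r < f g := by
  classical
  have hex : ∃ g : ℕ, f g ≤ r := ⟨g₀, h0⟩
  refine ⟨Nat.find hex, ?_, Nat.find_min' hex h0, Nat.find_spec hex, fun g hg =>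
    not_le.1 (Nat.find_min hex hg)⟩
  have hle : Nat.find hex ≤ B := (Nat.find_min' hex h0).trans hg.le
  have : ∀ g ∈ Finset.range B, (if f g ≤ r then (0 : ℝ) else 1) =
      if g < Nat.find hex then 1 else 0 := by
    intro g _
    by_cases hgn : g < Nat.find hex
    · rw [if_neg (Nat.find_min hex hgn), if_pos hgn]
    · rw [if_neg hgn, if_pos]
      exact (hf (not_lt.1 hgn)).trans (Nat.find_spec hex)
  rw [Finset.sum_congr rfl this, ← Finset.sum_filter, Finset.sum_const, nsmul_eq_mul, mul_one]
  congr 1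
  have : (Finset.range B).filter (· < Nat.find hex) = Finset.range (Nat.find hex) := by
    ext g; simp only [Finset.mem_filter, Finset.mem_range]; omega
  rw [this, Finset.card_range]

/-- Searching a grid for the point where an antitone function drops below `r`. -/
theorem exists_grid_count {f : ℝ → ℝ} (hf : Antitone f) {u r : ℝ} (hu : 0 ≤ u) {B g₀ : ℕ}
    (hg : g₀ < B) (h0 : f (g₀ * u) ≤ r) :
    ∃ N : ℕ, ∑ g ∈ Finset.range B, (if f (g * u) ≤ r then (0 : ℝ) else 1) = N ∧ N ≤ g₀ ∧
      f (N * u) ≤ r ∧ (N = 0 ∨ r < f (N * u - u)) := by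
  obtain ⟨N, h1, h2, h3, h4⟩ := exists_count (f := fun g : ℕ => f (g * u)) (fun a b hab =>
    hf (mul_le_mul_of_nonneg_right (Nat.cast_le.2 hab) hu)) hg h0
  refine ⟨N, h1, h2, h3, ?_⟩
  rcases Nat.eq_zero_or_pos N with h | h
  · exact Or.inl h
  · right
    have := h4 (N - 1) (by omega)
    rw [Nat.cast_sub h] at this
    rwa [show ((N : ℝ) - (1 : ℕ)) * u = N * u - u by push_cast; ring] at this

/-- An approximate upper `ε`-quantile. -/
noncomputable def quantile (p : ℝ → ℝ) (m ε : ℝ) (B : ℕ) : ℝ :=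
  ε * m * ∑ g ∈ Finset.range B, if p (g * (ε * m)) ≤ ε then 0 else 1

/-- The probability with which the threshold is lowered by one step. -/
noncomputable def coin (p : ℝ → ℝ) (m ε q : ℝ) : ℝ := ε / p (q - ε * m)

/-- The acceptance probability if the threshold `x` is raised to about the quantile. -/
noncomputable def capped (p : ℝ → ℝ) (m ε q c x : ℝ) : ℝ :=
  (1 - c) * p (max x q) + c * p (max x (q - ε * m))

/-- A lower estimate of the expectation of `X` on the event `X > θ`. -/
noncomputable def lowMean (p : ℝ → ℝ) (m : ℝ) (B : ℕ) (θ : ℝ) : ℝ :=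
  m - max θ 0 / B * ∑ t ∈ Finset.range B, p (t * (max θ 0 / B)) + max θ 0 * p (max θ 0)

namespace IsTail

variable {p : ℝ → ℝ} {m ε : ℝ} {B : ℕ} (h : IsTail p m) (hε : 0 < ε) (hB : 1 / ε ^ 2 + 1 < B)
include h

theorem eq_zero (hm : m = 0) {x : ℝ} (hx : 0 ≤ x) : p x = 0 :=
  le_antisymm ((h.anti hx).trans (h.zero hm).le) (h.nonneg x)

include hε hB

/-- By Markov's inequality the tail is at most ε at m/ε, which is 1/ε² grid steps away from 0, so
the search succeeds within B points. -/
theorem exists_quantile : ∃ N : ℕ, quantile p m ε B = ε * m * N ∧ (N : ℝ) ≤ 1 / ε ^ 2 + 1 ∧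
    p (N * (ε * m)) ≤ ε ∧ (N = 0 ∨ ε < p (N * (ε * m) - ε * m)) := by
  have hm := h.mean_nonneg
  have hc : (⌈1 / ε ^ 2⌉₊ : ℝ) < 1 / ε ^ 2 + 1 := Nat.ceil_lt_add_one (by positivity)
  have hg : ⌈1 / ε ^ 2⌉₊ < B := by exact_mod_cast hc.trans hB
  have h0 : p (⌈1 / ε ^ 2⌉₊ * (ε * m)) ≤ ε := by
    rcases hm.eq_or_lt with hm0 | hm0
    · rw [h.eq_zero hm0.symm (by positivity)]; exact hε.le
    · have h1 := h.markov (show 0 ≤ ⌈1 / ε ^ 2⌉₊ * (ε * m) by positivity)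
      have h2 : 1 / ε ^ 2 ≤ ⌈1 / ε ^ 2⌉₊ := Nat.le_ceil _
      have h3 : m / ε ≤ ⌈1 / ε ^ 2⌉₊ * (ε * m) := by
        calc m / ε = 1 / ε ^ 2 * (ε * m) := by field_simp
          _ ≤ _ := mul_le_mul_of_nonneg_right h2 (by positivity)
      have h4 : m / ε * p (⌈1 / ε ^ 2⌉₊ * (ε * m)) ≤ m / ε * ε := by
        calc _ ≤ _ := mul_le_mul_of_nonneg_right h3 (h.nonneg _)
          _ ≤ m := h1
          _ = m / ε * ε := by field_simp
      exact le_of_mul_le_mul_left h4 (by positivity)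
  obtain ⟨N, e, hN, h1, h2⟩ := exists_grid_count h.anti (show 0 ≤ ε * m by positivity) hg h0
  refine ⟨N, by rw [quantile, e], ?_, h1, h2⟩
  have : (N : ℝ) ≤ ⌈1 / ε ^ 2⌉₊ := by exact_mod_cast hN
  linarith

theorem quantile_nonneg : 0 ≤ quantile p m ε B := by
  obtain ⟨N, e, -⟩ := h.exists_quantile hε hB
  have := h.mean_nonneg
  rw [e]; positivity

theorem tail_quantile_le : p (quantile p m ε B) ≤ ε := by
  obtain ⟨N, e, -, h1, -⟩ := h.exists_quantile hε hB
  rw [e, mul_comm]; exact h1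

/-- If the quantile is the grid point 0, one step below is negative, and there the tail equals 1. -/
theorem lt_tail_quantile_sub (hε1 : ε < 1) (hm : 0 < m) : ε < p (quantile p m ε B - ε * m) := by
  obtain ⟨N, e, -, -, h1 | h1⟩ := h.exists_quantile hε hB
  · rw [e, h.neg]
    · exact hε1
    · simp only [h1]; have := mul_pos hε hm; simp; exact this
  · rwa [e, mul_comm]

theorem quantile_le (hε1 : ε ≤ 1) : quantile p m ε B ≤ 2 * m / ε := by
  obtain ⟨N, e, h1, -⟩ := h.exists_quantile hε hB
  have hm := h.mean_nonneg
  rw [e]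
  have h2 : ε * m * N ≤ ε * m * (1 / ε ^ 2 + 1) := mul_le_mul_of_nonneg_left h1 (by positivity)
  have h3 : ε * m * (1 / ε ^ 2 + 1) = m / ε + ε * m := by field_simp
  have h4 : ε * m ≤ m / ε := by
    rw [le_div_iff₀ hε]; nlinarith [mul_nonneg hm hε.le]
  have h5 : 2 * m / ε = m / ε + m / ε := by ring
  linarith

/-- A box with a large quantile has a large mean, by Markov's inequality one step below the
quantile. This is what makes the rescued box valuable. -/
theorem mul_quantile_le (hε1 : ε < 1) : ε * quantile p m ε B ≤ 2 * m := by
  have hm := h.mean_nonneg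
  rcases hm.eq_or_lt with hm0 | hm0
  · simp [quantile, ← hm0]
  have h1 := h.lt_tail_quantile_sub hε hB hε1 hm0
  set q := quantile p m ε B
  rcases le_or_gt (q - ε * m) 0 with h2 | h2
  · nlinarith [mul_pos hε hm0]
  · have h3 := h.markov h2.le
    have h4 : (q - ε * m) * ε ≤ (q - ε * m) * p (q - ε * m) :=
      mul_le_mul_of_nonneg_left h1.le h2.le
    nlinarith [mul_pos hε hm0]

omit h hε hB in
theorem quantile_eq_zero (hm : m = 0) : quantile p m ε B = 0 := by simp [quantile, hm]

theorem coin_mem (hε1 : ε < 1) : 0 ≤ coin p m ε (quantile p m ε B) ∧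
    coin p m ε (quantile p m ε B) ≤ 1 := by
  refine ⟨div_nonneg hε.le (h.nonneg _), ?_⟩
  rcases h.mean_nonneg.eq_or_lt with hm0 | hm0
  · rw [coin, IsTail.quantile_eq_zero hm0.symm, h.eq_zero hm0.symm (by simp [← hm0])]; simp
  · have := h.lt_tail_quantile_sub hε hB hε1 hm0
    exact div_le_one_of_le₀ this.le (h.nonneg _)

theorem coin_mul (hε1 : ε < 1) : coin p m ε (quantile p m ε B) *
    p (quantile p m ε B - ε * m) ≤ ε := by
  rcases h.mean_nonneg.eq_or_lt with hm0 | hm0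
  · rw [IsTail.quantile_eq_zero hm0.symm, h.eq_zero hm0.symm (by simp [← hm0])]; simpa using hε.le
  · have := h.lt_tail_quantile_sub hε hB hε1 hm0
    rw [coin, div_mul_cancel₀ _ (by linarith)]

end IsTail

section Capped

variable {p : ℝ → ℝ} {m ε q c : ℝ} (h : IsTail p m) (hc0 : 0 ≤ c) (hc1 : c ≤ 1)
include h hc0 hc1

theorem capped_antitone : Antitone (capped p m ε q c) := fun x y hxy =>
  add_le_add (mul_le_mul_of_nonneg_left (h.anti (max_le_max hxy le_rfl)) (by linarith))
    (mul_le_mul_of_nonneg_left (h.anti (max_le_max hxy le_rfl)) hc0)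

theorem capped_nonneg (x : ℝ) : 0 ≤ capped p m ε q c x :=
  add_nonneg (mul_nonneg (by linarith) (h.nonneg _)) (mul_nonneg hc0 (h.nonneg _))

theorem capped_le (x : ℝ) : capped p m ε q c x ≤ p x := by
  have h1 := h.anti (le_max_left x q)
  have h2 := h.anti (le_max_left x (q - ε * m))
  have := mul_le_mul_of_nonneg_left h1 (show 0 ≤ 1 - c by linarith)
  have := mul_le_mul_of_nonneg_left h2 hc0
  unfold capped; linarith

omit hc0 hc1 in
theorem capped_eq (hε : 0 ≤ ε) {x : ℝ} (hx : q ≤ x) : capped p m ε q c x = p x := by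
  have : 0 ≤ ε * m := mul_nonneg hε h.mean_nonneg
  rw [capped, max_eq_left hx, max_eq_left (by linarith)]; ring

theorem integrableOn_capped : IntegrableOn (capped p m ε q c) (Set.Ioi 0) := by
  refine Integrable.mono' h.int (capped_antitone h hc0 hc1).measurable.aestronglyMeasurable
    (ae_of_all _ fun x => ?_)
  rw [Real.norm_of_nonneg (capped_nonneg h hc0 hc1 x)]
  exact capped_le h hc0 hc1 x

omit hc0 hc1 in
theorem integral_capped_max (θ : ℝ) : IntegrableOn (fun x => capped p m ε q c (max x θ))
      (Set.Ioi 0) ∧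
    ∫ x in Set.Ioi 0, capped p m ε q c (max x θ) =
      (1 - c) * (∫ x in Set.Ioi 0, p (max x (max θ q))) +
        c * ∫ x in Set.Ioi 0, p (max x (max θ (q - ε * m))) := by
  simp only [capped, max_assoc]
  have h1 := (h.integrableOn_max (max θ q)).const_mul (1 - c)
  have h2 := (h.integrableOn_max (max θ (q - ε * m))).const_mul c
  refine ⟨h1.add h2, ?_⟩
  rw [integral_add h1 h2, integral_const_mul, integral_const_mul]

end Capped

section CappedQuantile

variable {p : ℝ → ℝ} {m ε : ℝ} {B : ℕ} (h : IsTail p m) (hε : 0 < ε) (hB : 1 / ε ^ 2 + 1 < B)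
  (hε1 : ε < 1)
include h hε hB hε1

/-- Both outcomes of the coin contribute at most ε: the tail at the quantile is at most ε, and the
coin is ε divided by the tail one step below. The second contribution is exactly ε for low levels
and positive mean, which gives the lower bound `le_capped_quantile`. -/
theorem capped_quantile_le (x : ℝ) :
    capped p m ε (quantile p m ε B) (coin p m ε (quantile p m ε B)) x ≤ 2 * ε := by
  obtain ⟨c0, c1⟩ := h.coin_mem hε hB hε1
  have h1 := h.tail_quantile_le hε hB
  have h2 := h.coin_mul hε hB hε1
  set q := quantile p m ε B
  set c := coin p m ε q
  have h3 := h.anti (le_max_right x q)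
  have h4 := h.anti (le_max_right x (q - ε * m))
  have h5 := mul_le_mul_of_nonneg_left (h3.trans h1) (show 0 ≤ 1 - c by linarith)
  have h6 := mul_le_mul_of_nonneg_left h4 c0
  unfold capped
  nlinarith

theorem le_capped_quantile (hm : 0 < m) {x : ℝ} (hx : x ≤ quantile p m ε B - ε * m) :
    ε ≤ capped p m ε (quantile p m ε B) (coin p m ε (quantile p m ε B)) x := by
  obtain ⟨c0, c1⟩ := h.coin_mem hε hB hε1
  have h1 := h.lt_tail_quantile_sub hε hB hε1 hm
  rw [capped, max_eq_right hx]
  have h2 : coin p m ε (quantile p m ε B) * p (quantile p m ε B - ε * m) = ε := by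
    rw [coin, div_mul_cancel₀ _ (by linarith)]
  rw [h2]
  have := mul_nonneg (show 0 ≤ 1 - coin p m ε (quantile p m ε B) by linarith)
    (h.nonneg (max x (quantile p m ε B)))
  linarith

end CappedQuantile

end FreeOrder

namespace FreeOrder

/-! ### Levels: thresholds that are common to all boxes -/

/-- The approximate point where `A` drops below `r`. -/
noncomputable def gridLevel (A : ℝ → ℝ) (u r : ℝ) (B : ℕ) : ℝ :=
  u * ∑ g ∈ Finset.range B, if A (g * u) ≤ r then 0 else 1

/-- The probability with which the level is lowered by one step. -/
noncomputable def gridMix (A : ℝ → ℝ) (u r l : ℝ) : ℝ :=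
  if A (l - u) ≤ r then 0 else (r - A l) / (A (l - u) - A l)

section Grid

variable {A : ℝ → ℝ} {u r M : ℝ} {B : ℕ} (hA : Antitone A) (hu : 0 < u) (hr : 0 < r)
  (hM : ∀ x, 0 ≤ x → x * A x ≤ M) (hB : M / (u * r) + 1 < B) (hM0 : 0 < M)
include hA hu hr hM hB hM0

theorem exists_gridLevel : ∃ N : ℕ, gridLevel A u r B = u * N ∧ (N : ℝ) ≤ M / (u * r) + 1 ∧
    A (gridLevel A u r B) ≤ r ∧
    (gridLevel A u r B = 0 ∨ r < A (gridLevel A u r B - u)) := by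
  have hc : (⌈M / (u * r)⌉₊ : ℝ) < M / (u * r) + 1 := Nat.ceil_lt_add_one (by positivity)
  have hg : ⌈M / (u * r)⌉₊ < B := by exact_mod_cast hc.trans hB
  have h0 : A (⌈M / (u * r)⌉₊ * u) ≤ r := by
    have h1 := hM (⌈M / (u * r)⌉₊ * u) (by positivity)
    have h2 : M / (u * r) ≤ ⌈M / (u * r)⌉₊ := Nat.le_ceil _
    have h3 : M / r ≤ ⌈M / (u * r)⌉₊ * u := by
      calc M / r = M / (u * r) * u := by field_simp
        _ ≤ _ := mul_le_mul_of_nonneg_right h2 hu.le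
    by_contra hcon
    push Not at hcon
    have h4 : M ≤ ⌈M / (u * r)⌉₊ * u * r := by rwa [div_le_iff₀ hr] at h3
    have h6 : 0 < ⌈M / (u * r)⌉₊ * u := by
      have : 0 < M / (u * r) := by positivity
      have := this.trans_le h2
      positivity
    nlinarith
  obtain ⟨N, e, hN, h1, h2⟩ := exists_grid_count hA hu.le hg h0
  have e' : gridLevel A u r B = N * u := by rw [gridLevel, e, mul_comm]
  refine ⟨N, by rw [e', mul_comm], ?_, by rw [e']; exact h1, ?_⟩
  · have : (N : ℝ) ≤ ⌈M / (u * r)⌉₊ := by exact_mod_cast hN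
    linarith
  · rw [e']
    exact h2.imp (fun h => by simp [h]) id


theorem gridLevel_le : gridLevel A u r B ≤ M / r + u := by
  obtain ⟨N, e, h1, -⟩ := exists_gridLevel hA hu hr hM hB hM0
  rw [e]
  calc u * N ≤ u * (M / (u * r) + 1) := mul_le_mul_of_nonneg_left h1 hu.le
    _ = M / r + u := by field_simp

theorem gridMix_mem : 0 ≤ gridMix A u r (gridLevel A u r B) ∧
    gridMix A u r (gridLevel A u r B) ≤ 1 := by
  obtain ⟨N, e, -, h1, -⟩ := exists_gridLevel hA hu hr hM hB hM0
  set l := gridLevel A u r B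
  unfold gridMix
  split_ifs with h2
  · simp
  · have h3 : r < A (l - u) := not_le.1 h2
    exact ⟨div_nonneg (by linarith) (by linarith), div_le_one_of_le₀ (by linarith) (by linarith)⟩

/-- The mixture interpolates linearly between two grid points, so the total mass is exactly r even
if A jumps across r. -/
theorem gridMix_eq (h2 : r < A (gridLevel A u r B - u)) :
    (1 - gridMix A u r (gridLevel A u r B)) * A (gridLevel A u r B) +
      gridMix A u r (gridLevel A u r B) * A (gridLevel A u r B - u) = r := by
  obtain ⟨N, e, -, h1, -⟩ := exists_gridLevel hA hu hr hM hB hM0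
  set l := gridLevel A u r B
  rw [gridMix, if_neg (not_le.2 h2)]
  have : A (l - u) - A l ≠ 0 := by intro h; linarith
  field_simp
  ring

theorem gridMix_le :
    (1 - gridMix A u r (gridLevel A u r B)) * A (gridLevel A u r B) +
      gridMix A u r (gridLevel A u r B) * A (gridLevel A u r B - u) ≤ r := by
  obtain ⟨N, e, -, h1, -⟩ := exists_gridLevel hA hu hr hM hB hM0
  rcases le_or_gt (A (gridLevel A u r B - u)) r with h2 | h2
  · rw [gridMix, if_pos h2]; linarith
  · exact (gridMix_eq hA hu hr hM hB hM0 h2).le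

/-- With l the level: for x ≥ l both thresholds are inactive, for x ≤ l - u the mixed mass is
exactly r, and in between x + u ≥ l, so A(x + u) is at most both A(l) and A(x). Only the last range
needs the shift by u. -/
theorem min_le_gridMix {x : ℝ} (hx : 0 < x) : min (A (x + u)) r ≤
    (1 - gridMix A u r (gridLevel A u r B)) * A (max x (gridLevel A u r B)) +
      gridMix A u r (gridLevel A u r B) * A (max x (gridLevel A u r B - u)) := by
  obtain ⟨N, e, -, h1, h2⟩ := exists_gridLevel hA hu hr hM hB hM0
  obtain ⟨b0, b1⟩ := gridMix_mem hA hu hr hM hB hM0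
  have h3 := gridMix_eq hA hu hr hM hB hM0
  set l := gridLevel A u r B
  set b := gridMix A u r l
  rcases le_or_gt l x with h4 | h4
  · rw [max_eq_left h4, max_eq_left (by linarith)]
    have := hA (show x ≤ x + u by linarith)
    refine (min_le_left _ _).trans (this.trans (le_of_eq (by ring)))
  · rw [max_eq_right h4.le]
    rcases le_or_gt x (l - u) with h5 | h5
    · rw [max_eq_right h5, h3]
      · exact min_le_right _ _
      · rcases h2 with h2 | h2
        · linarith
        · exact h2
    · rw [max_eq_left h5.le]
      have h6 := hA (show l ≤ x + u by linarith)
      have h7 := hA h4.le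
      refine (min_le_left _ _).trans ?_
      nlinarith

end Grid

/-! ### The randomized policy -/

section Random

variable (p : ℕ → ℝ → ℝ) (m : ℕ → ℝ) (ε : ℝ) (B : ℕ) (q c : ℕ → ℝ)

/-- The total acceptance probability of capped boxes. -/
noncomputable def mass (S : Finset ℕ) (x : ℝ) : ℝ :=
  ∑ i ∈ S, capped (p i) (m i) ε (q i) (c i) x

/-- The average of a function of the level. -/
noncomputable def mixed (f : ℝ → ℝ) (b l u : ℝ) : ℝ := (1 - b) * f l + b * f (l - u)

/-- The average reward of box `i` at a given level. -/
noncomputable def cappedVal (i : ℕ) (l : ℝ) : ℝ :=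
  (1 - c i) * lowMean (p i) (m i) B (max l (q i)) +
    c i * lowMean (p i) (m i) B (max l (q i - ε * m i))

variable {p m ε B q c} {n : ℕ}

/-- The data of an instance. -/
structure Data (p : ℕ → ℝ → ℝ) (m : ℕ → ℝ) (n : ℕ) (ε : ℝ) (B : ℕ) (q c : ℕ → ℝ) : Prop where
  tail : ∀ i < n, IsTail (p i) (m i)
  pos : 0 < ε
  le : ε ≤ 1 / 4
  npos : 0 < n
  -- With total mean T, each truncated mean is computed up to 2T/(εB), and n of these errors must
  -- stay below the unit εT/n. The bound also makes the quantile and level searches long enough.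
  large : 4 * (n : ℝ) ^ 2 / ε ^ 2 < B
  quant : ∀ i < n, q i = quantile (p i) (m i) ε B
  coin : ∀ i < n, c i = coin (p i) (m i) ε (q i)

namespace Data

variable (D : Data p m n ε B q c)
include D

theorem one_le_n : (1 : ℝ) ≤ n := by exact_mod_cast D.npos

theorem large' : 1 / ε ^ 2 + 1 < B := by
  have h1 := D.large
  have h2 := D.one_le_n
  have h3 := D.pos
  have h4 := D.le
  have h5 : 1 ≤ 1 / ε ^ 2 := by rw [le_div_iff₀ (by positivity)]; nlinarith
  have h6 : 4 * 1 / ε ^ 2 ≤ 4 * (n : ℝ) ^ 2 / ε ^ 2 := by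
    gcongr; nlinarith
  have h7 : 4 * 1 / ε ^ 2 = 4 * (1 / ε ^ 2) := by ring
  linarith

theorem coin_mem {i : ℕ} (hi : i < n) : 0 ≤ c i ∧ c i ≤ 1 := by
  rw [D.coin i hi, D.quant i hi]
  exact (D.tail i hi).coin_mem D.pos D.large' (by linarith [D.le])

theorem capped_le_two {i : ℕ} (hi : i < n) (x : ℝ) :
    capped (p i) (m i) ε (q i) (c i) x ≤ 2 * ε := by
  rw [D.coin i hi, D.quant i hi]
  exact capped_quantile_le (D.tail i hi) D.pos D.large' (by linarith [D.le]) x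

theorem le_capped {i : ℕ} (hi : i < n) (hm : 0 < m i) {x : ℝ} (hx : x ≤ q i - ε * m i) :
    ε ≤ capped (p i) (m i) ε (q i) (c i) x := by
  rw [D.coin i hi]
  rw [D.quant i hi] at hx ⊢
  exact le_capped_quantile (D.tail i hi) D.pos D.large' (by linarith [D.le]) hm hx

theorem quant_nonneg {i : ℕ} (hi : i < n) : 0 ≤ q i := by
  rw [D.quant i hi]; exact (D.tail i hi).quantile_nonneg D.pos D.large'

theorem quant_le {i : ℕ} (hi : i < n) : q i ≤ 2 * m i / ε := by
  rw [D.quant i hi]; exact (D.tail i hi).quantile_le D.pos D.large' (by linarith [D.le])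

theorem mul_quant_le {i : ℕ} (hi : i < n) : ε * q i ≤ 2 * m i := by
  rw [D.quant i hi]; exact (D.tail i hi).mul_quantile_le D.pos D.large' (by linarith [D.le])

theorem tail_quant_le {i : ℕ} (hi : i < n) {x : ℝ} (hx : q i ≤ x) : p i x ≤ ε := by
  refine ((D.tail i hi).anti hx).trans ?_
  rw [D.quant i hi]; exact (D.tail i hi).tail_quantile_le D.pos D.large'

theorem mean_nonneg {i : ℕ} (hi : i < n) : 0 ≤ m i := (D.tail i hi).mean_nonneg

variable {S : Finset ℕ} (hS : ∀ i ∈ S, i < n)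
include hS

theorem mass_antitone : Antitone (mass p m ε q c S) := fun _ _ hxy =>
  Finset.sum_le_sum fun i hi => capped_antitone (D.tail i (hS i hi)) (D.coin_mem (hS i hi)).1
    (D.coin_mem (hS i hi)).2 hxy

theorem mass_nonneg (x : ℝ) : 0 ≤ mass p m ε q c S x :=
  Finset.sum_nonneg fun i hi => capped_nonneg (D.tail i (hS i hi)) (D.coin_mem (hS i hi)).1
    (D.coin_mem (hS i hi)).2 x

theorem integrableOn_mass : IntegrableOn (mass p m ε q c S) (Set.Ioi 0) :=
  integrable_finsetSum _ fun i hi => integrableOn_capped (D.tail i (hS i hi))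
    (D.coin_mem (hS i hi)).1 (D.coin_mem (hS i hi)).2

theorem mul_mass_le {x : ℝ} (hx : 0 ≤ x) : x * mass p m ε q c S x ≤ ∑ i ∈ S, m i := by
  rw [mass, Finset.mul_sum]
  refine Finset.sum_le_sum fun i hi => ?_
  have h1 := capped_le (ε := ε) (q := q i) (D.tail i (hS i hi)) (D.coin_mem (hS i hi)).1
    (D.coin_mem (hS i hi)).2 x
  exact (mul_le_mul_of_nonneg_left h1 hx).trans ((D.tail i (hS i hi)).markov hx)

omit D in
theorem card_le : (S.card : ℝ) ≤ n := by
  have : S ⊆ Finset.range n := fun i hi => Finset.mem_range.2 (hS i hi)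
  have := Finset.card_le_card this
  rw [Finset.card_range] at this
  exact_mod_cast this

omit hS in
theorem large_unit {u : ℝ} {j : ℕ} (hj : 1 ≤ j) (hT : 0 < ∑ i ∈ S, m i)
    (hu : u = ε * (∑ i ∈ S, m i) / n) : (∑ i ∈ S, m i) / (u * (j * ε)) + 1 < B := by
  have h1 := D.large'
  have h2 := D.one_le_n
  have h3 := D.pos
  have hj' : (1 : ℝ) ≤ j := by exact_mod_cast hj
  have e : (∑ i ∈ S, m i) / (u * (j * ε)) = n / (j * ε ^ 2) := by
    rw [hu]; field_simp
  have h4 : (n : ℝ) / (j * ε ^ 2) ≤ n / (1 * ε ^ 2) := by gcongr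
  have h5 := D.large
  have h6 : 4 * (n : ℝ) / ε ^ 2 ≤ 4 * (n : ℝ) ^ 2 / ε ^ 2 := by gcongr; nlinarith
  have h7 : 4 * (n : ℝ) / ε ^ 2 = 4 * (n / (1 * ε ^ 2)) := by rw [one_mul]; ring
  have h8 : 1 ≤ (n : ℝ) / (1 * ε ^ 2) := by
    rw [le_div_iff₀ (by positivity)]; nlinarith [D.le]
  linarith

/-- The randomized policy obtains nearly the fraction `κ` of the relaxed optimum. -/
theorem blend_ge {κ M : ℝ} (hM : 2 * M * ε ≤ 1)
    (hκ0 : 0 ≤ κ) (hκ1 : κ ≤ 1) {k : ℕ} (hkB : k + 1 ≤ B)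
    (hk : ε ^ 2 < geo ε k) (hk' : geo ε (k + 1) ≤ ε ^ 2)
    (hs : 1 ≤ M * surv ε κ (k + 1)) (hM0 : 0 < M) {d : ℕ → ℝ}
    (hd : ∀ j, d j = if j = 0 then 0 else if j < k + 1 then slotWeight ε κ j else 0)
    (hd1 : ∑ j ∈ Finset.range (k + 1), d j ≤ 1) (hT : 0 < ∑ i ∈ S, m i)
    {u : ℝ} (hu : u = ε * (∑ i ∈ S, m i) / n) {l b : ℕ → ℝ}
    (hl : ∀ j < B, l j = gridLevel (mass p m ε q c S) u (j * ε) B)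
    (hb : ∀ j < B, b j = gridMix (mass p m ε q c S) u (j * ε) (l j)) :
    κ * (1 - 2 * M * ε) * (1 - 5 * ε) *
        (∫ x in Set.Ioi 0, (1 - Real.exp (-(mass p m ε q c S x)))) - 2 * u ≤
      blend S B (fun i j => d j * mixed (cappedVal p m ε B q c i) (b j) (l j) u)
        (fun i j => 1 - ∑ t ∈ Finset.range (j + 1),
          d t * mixed (capped (p i) (m i) ε (q i) (c i)) (b t) (l t) u) := by
  have hε := D.pos
  have hε4 := D.le
  set T := ∑ i ∈ S, m i with hTdef
  set A := mass p m ε q c S with hAdef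
  have hA := D.mass_antitone hS
  have hn := D.one_le_n
  have hn0 : (0 : ℝ) < n := by linarith
  have hu0 : 0 < u := by rw [hu]; positivity
  have hA2 : ∀ x, 0 ≤ x → x * A x ≤ T := fun x hx => D.mul_mass_le hS hx
  have hr : ∀ j : ℕ, 1 ≤ j → 0 < (j : ℝ) * ε := fun j hj => by
    have : (0 : ℝ) < j := by exact_mod_cast hj
    positivity
  have hL : ∀ j : ℕ, 1 ≤ j → T / (u * (j * ε)) + 1 < B := fun j hj => D.large_unit hj hT hu
  have hB0 : (0 : ℝ) < B := by
    have := D.large'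
    have : 0 < 1 / ε ^ 2 := by positivity
    linarith
  have hBn : 0 < B := by exact_mod_cast hB0
  set P : ℕ → Prop := fun j => 1 ≤ j ∧ j < k + 1 with hP
  have hbm : ∀ j, P j → 0 ≤ b j ∧ b j ≤ 1 := by
    intro j hj
    have hjB : j < B := by have := hj.2; omega
    rw [hb j hjB, hl j hjB]
    exact gridMix_mem hA hu0 (hr j hj.1) hA2 (hL j hj.1) hT
  classical
  -- Levels and mixtures are controlled only in the slots 1, …, k. Acceptance probabilities and
  -- rewards are set to 0 elsewhere, which is harmless because d vanishes there.
  set acc : ℕ → ℕ → ℝ := fun i j => if P j then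
    mixed (capped (p i) (m i) ε (q i) (c i)) (b j) (l j) u else 0 with hacc
  set e1 : ℕ → ℝ → ℝ := fun i θ =>
    ∫ x in Set.Ioi 0, capped (p i) (m i) ε (q i) (c i) (max x θ) with he1
  set v : ℕ → ℕ → ℝ := fun i j => if P j then mixed (e1 i) (b j) (l j) u else 0 with hv
  set φ : ℕ → ℝ → ℝ := fun j x => mixed (fun y => A (max x y)) (b j) (l j) u with hφ
  have hcapn : ∀ i ∈ S, ∀ x, 0 ≤ capped (p i) (m i) ε (q i) (c i) x := fun i hi x =>
    capped_nonneg (D.tail i (hS i hi)) (D.coin_mem (hS i hi)).1 (D.coin_mem (hS i hi)).2 x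
  have hAint : ∀ θ, IntegrableOn (fun x => A (max x θ)) (Set.Ioi 0) := fun θ =>
    integrable_finsetSum _ fun i hi => (integral_capped_max (D.tail i (hS i hi)) θ).1
  have hsumv : ∀ θ, ∑ i ∈ S, e1 i θ = ∫ x in Set.Ioi 0, A (max x θ) := by
    intro θ
    simp only [he1, hAdef, mass]
    rw [integral_finsetSum _ fun i hi => (integral_capped_max (D.tail i (hS i hi)) θ).1]
  have hmd : ∀ j, d j * (if P j then (1 : ℝ) else 0) = d j := by
    intro j
    by_cases hj : P j
    · simp [hj]
    · rw [if_neg hj, hd j]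
      by_cases h0 : j = 0
      · simp [h0]
      · rw [if_neg h0, if_neg]
        · simp
        · intro h; exact hj ⟨by omega, h⟩
  have hlow : ∀ i ∈ S, ∀ θ, θ ≤ 2 * T / ε →
      (∫ x in Set.Ioi 0, p i (max x θ)) - 2 * T / (ε * B) ≤ lowMean (p i) (m i) B θ := by
    intro i hi θ hθ
    have h1 := ((D.tail i (hS i hi)).lower_bounds θ hBn rfl).2
    have h2 : max θ 0 / B ≤ 2 * T / ε / B := by
      have : max θ 0 ≤ 2 * T / ε := max_le hθ (by positivity)
      gcongr
    rw [div_div] at h2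
    unfold lowMean
    linarith
  have hlle : ∀ j, P j → l j ≤ 2 * T / ε := by
    intro j hj
    have hjB : j < B := by have := hj.2; omega
    have h1 := gridLevel_le hA hu0 (hr j hj.1) hA2 (hL j hj.1) hT
    rw [← hl j hjB] at h1
    have hj' : (1 : ℝ) ≤ j := by exact_mod_cast hj.1
    have h2 : T / (j * ε) ≤ T / (1 * ε) := by gcongr
    rw [one_mul] at h2
    have h3 : u ≤ T / ε := by
      rw [hu, div_le_div_iff₀ hn0 hε]
      have : ε * ε ≤ 1 := by nlinarith
      nlinarith [mul_le_mul_of_nonneg_left this hT.le, mul_le_mul_of_nonneg_left hn hT.le]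
    have h4 : 2 * T / ε = T / ε + T / ε := by ring
    linarith
  have hqle : ∀ i ∈ S, q i ≤ 2 * T / ε := by
    intro i hi
    refine (D.quant_le (hS i hi)).trans ?_
    have : m i ≤ T := Finset.single_le_sum (f := m) (fun i hi => D.mean_nonneg (hS i hi)) hi
    gcongr
  have hcv : ∀ i ∈ S, ∀ y, y ≤ 2 * T / ε →
      e1 i y - 2 * T / (ε * B) ≤ cappedVal p m ε B q c i y := by
    intro i hi y hy
    obtain ⟨c0, c1⟩ := D.coin_mem (hS i hi)
    have hmi : 0 ≤ ε * m i := mul_nonneg hε.le (D.mean_nonneg (hS i hi))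
    have h1 := hlow i hi (max y (q i)) (max_le hy (hqle i hi))
    have h2 := hlow i hi (max y (q i - ε * m i)) (max_le hy (by linarith [hqle i hi]))
    simp only [he1]
    rw [(integral_capped_max (D.tail i (hS i hi)) y).2, cappedVal]
    have := mul_le_mul_of_nonneg_left h1 (show 0 ≤ 1 - c i by linarith)
    have := mul_le_mul_of_nonneg_left h2 c0
    linarith
  have key := FreeOrder.blend_ge (A := A) (φ := φ) hε hε4 hM hκ0 hκ1 hkB hk hk' hs hM0 d hd hd1 S acc
    ?_ ?_ ?_ hA (D.mass_nonneg hS) (D.integrableOn_mass hS) ?_ hu0 ?_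
    (fun i j => mixed (cappedVal p m ε B q c i) (b j) (l j) u) v
    (err := 2 * T / (ε * B)) (by positivity) ?_ ?_ ?_
  -- The accumulated error of the means is another u, which explains the term 2u.
  · have h1 : (S.card : ℝ) * (2 * T / (ε * B)) ≤ u := by
      have h2 : (S.card : ℝ) * (2 * T / (ε * B)) ≤ n * (2 * T / (ε * B)) :=
        mul_le_mul_of_nonneg_right (card_le hS) (by positivity)
      refine h2.trans ?_
      have h3 := D.large
      rw [div_lt_iff₀ (by positivity)] at h3
      rw [hu, mul_div_assoc', div_le_div_iff₀ (by positivity) hn0]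
      nlinarith
    have h2 : blend S B (fun i j => d j * mixed (cappedVal p m ε B q c i) (b j) (l j) u)
        (fun i j => 1 - ∑ t ∈ Finset.range (j + 1),
          d t * mixed (capped (p i) (m i) ε (q i) (c i)) (b t) (l t) u) =
        blend S B (fun i j => d j * mixed (cappedVal p m ε B q c i) (b j) (l j) u)
        (fun i j => 1 - ∑ t ∈ Finset.range (j + 1), d t * acc i t) := by
      congr 1
      funext i j
      congr 1
      refine Finset.sum_congr rfl fun t _ => ?_
      rw [← hmd t, hacc]
      by_cases ht : P t
      · simp only [if_pos ht]
      · simp [if_neg ht]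
    rw [h2]
    linarith
  · intro i hi j
    simp only [hacc]
    split_ifs with hj
    · obtain ⟨b0, b1⟩ := hbm j hj
      exact add_nonneg (mul_nonneg (by linarith) (hcapn i hi _)) (mul_nonneg b0 (hcapn i hi _))
    · exact le_rfl
  · intro i hi j
    simp only [hacc]
    split_ifs with hj
    · obtain ⟨b0, b1⟩ := hbm j hj
      have h1 := mul_le_mul_of_nonneg_left (D.capped_le_two (hS i hi) (l j))
        (show 0 ≤ 1 - b j by linarith)
      have h2 := mul_le_mul_of_nonneg_left (D.capped_le_two (hS i hi) (l j - u)) b0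
      unfold mixed; linarith
    · positivity
  · intro j hj1 hj2
    have hjB : j < B := by omega
    simp only [hacc, if_pos (show P j from ⟨hj1, hj2⟩), mixed]
    rw [Finset.sum_add_distrib, ← Finset.mul_sum, ← Finset.mul_sum]
    have := gridMix_le hA hu0 (hr j hj1) hA2 (hL j hj1) hT
    rw [← hl j hjB, ← hb j hjB] at this
    exact this
  · intro j
    exact ((hAint _).const_mul _).add ((hAint _).const_mul _)
  · intro j hj1 hj2 x hx
    have hjB : j < B := by omega
    have := min_le_gridMix hA hu0 (hr j hj1) hA2 (hL j hj1) hT hx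
    rw [← hl j hjB, ← hb j hjB] at this
    exact this
  · intro i hi j
    simp only [hv]
    split_ifs with hj
    · obtain ⟨b0, b1⟩ := hbm j hj
      have h0 : ∀ y, 0 ≤ e1 i y := fun y => integral_nonneg fun x => hcapn i hi _
      exact add_nonneg (mul_nonneg (by linarith) (h0 _)) (mul_nonneg b0 (h0 _))
    · exact le_rfl
  · intro j hj1 hj2
    simp only [hv, if_pos (show P j from ⟨hj1, hj2⟩), mixed, hφ]
    rw [Finset.sum_add_distrib, ← Finset.mul_sum, ← Finset.mul_sum, hsumv, hsumv,
      integral_add ((hAint _).const_mul _) ((hAint _).const_mul _), integral_const_mul,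
      integral_const_mul]
  · intro i hi j hj1 hj2
    have hj : P j := ⟨hj1, hj2⟩
    obtain ⟨b0, b1⟩ := hbm j hj
    simp only [hv, if_pos hj, mixed]
    have h1 := mul_le_mul_of_nonneg_left (hcv i hi (l j) (hlle j hj))
      (show 0 ≤ 1 - b j by linarith)
    have h2 := mul_le_mul_of_nonneg_left (hcv i hi (l j - u) (by linarith [hlle j hj])) b0
    linarith

end Data

end Random

end FreeOrder

namespace FreeOrder

/-! ### The prophet's reward in terms of tails -/

/-- The expectation of the maximum of independent variables with tails `p i`. -/
noncomputable def maxTail (p : ℕ → ℝ → ℝ) (S : Finset ℕ) : ℝ :=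
  ∫ x in Set.Ioi 0, (1 - ∏ i ∈ S, (1 - p i x))

section MaxTail

variable {p : ℕ → ℝ → ℝ} {m : ℕ → ℝ} {S : Finset ℕ} (hS : ∀ i ∈ S, IsTail (p i) (m i))
include hS

theorem prod_tail_mem (x : ℝ) : 0 ≤ ∏ i ∈ S, (1 - p i x) ∧ ∏ i ∈ S, (1 - p i x) ≤ 1 :=
  ⟨Finset.prod_nonneg fun i hi => by linarith [(hS i hi).le_one x],
    Finset.prod_le_one (fun i hi => by linarith [(hS i hi).le_one x])
      fun i hi => by linarith [(hS i hi).nonneg x]⟩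

theorem one_sub_prod_le (x : ℝ) : 1 - ∏ i ∈ S, (1 - p i x) ≤ ∑ i ∈ S, p i x := by
  induction S using Finset.induction_on with
  | empty => simp
  | insert a T ha ih =>
    have hT : ∀ i ∈ T, IsTail (p i) (m i) := fun i hi => hS i (Finset.mem_insert_of_mem hi)
    rw [Finset.prod_insert ha, Finset.sum_insert ha]
    have h1 := ih hT
    have h2 := prod_tail_mem hT x
    have h3 := (hS a (Finset.mem_insert_self a T)).nonneg x
    nlinarith [mul_le_mul_of_nonneg_left h2.2 h3]

theorem antitone_one_sub_prod : Antitone fun x => 1 - ∏ i ∈ S, (1 - p i x) := fun x y hxy => by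
  have : ∏ i ∈ S, (1 - p i x) ≤ ∏ i ∈ S, (1 - p i y) :=
    Finset.prod_le_prod (fun i hi => by linarith [(hS i hi).le_one x])
      fun i hi => by linarith [(hS i hi).anti hxy]
  simp only; linarith

theorem integrableOn_maxTail :
    IntegrableOn (fun x => 1 - ∏ i ∈ S, (1 - p i x)) (Set.Ioi 0) := by
  have hs : IntegrableOn (fun x => ∑ i ∈ S, p i x) (Set.Ioi 0) :=
    integrable_finsetSum _ fun i hi => (hS i hi).int
  refine Integrable.mono' hs (antitone_one_sub_prod hS).measurable.aestronglyMeasurable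
    (ae_of_all _ fun x => ?_)
  rw [Real.norm_of_nonneg (by linarith [(prod_tail_mem hS x).2])]
  exact one_sub_prod_le hS x

theorem maxTail_nonneg : 0 ≤ maxTail p S :=
  integral_nonneg fun x => by
    have := (prod_tail_mem hS x).2
    simp only [Pi.zero_apply]; linarith

theorem maxTail_le_sum : maxTail p S ≤ ∑ i ∈ S, m i := by
  rw [← Finset.sum_congr rfl fun i hi => (hS i hi).integral,
    ← integral_finsetSum _ fun i hi => (hS i hi).int]
  exact integral_mono (integrableOn_maxTail hS) (integrable_finsetSum _ fun i hi => (hS i hi).int)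
    fun x => one_sub_prod_le hS x

theorem mean_le_maxTail {i : ℕ} (hi : i ∈ S) : m i ≤ maxTail p S := by
  rw [← (hS i hi).integral]
  refine integral_mono (hS i hi).int (integrableOn_maxTail hS) fun x => ?_
  have h1 := prod_tail_mem (fun j hj => hS j (Finset.mem_of_mem_erase hj)) (S := S.erase i) x
  have h2 := Finset.mul_prod_erase S (fun i => 1 - p i x) hi
  have h3 := (hS i hi).le_one x
  simp only at h2 ⊢
  rw [← h2]
  nlinarith [mul_le_mul_of_nonneg_left h1.2 (show 0 ≤ 1 - p i x by linarith)]

theorem maxTail_insert_le {b : ℕ} (hb : IsTail (p b) (m b)) (hbS : b ∉ S) :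
    maxTail p (insert b S) ≤ m b + maxTail p S := by
  have hS' : ∀ i ∈ insert b S, IsTail (p i) (m i) := by
    intro i hi
    rcases Finset.mem_insert.1 hi with rfl | hi
    exacts [hb, hS i hi]
  rw [← hb.integral, maxTail, maxTail, ← integral_add hb.int (integrableOn_maxTail hS)]
  refine integral_mono (integrableOn_maxTail hS') (hb.int.add (integrableOn_maxTail hS))
    fun x => ?_
  have h1 := prod_tail_mem hS x
  have h2 := hb.nonneg x
  simp only [Finset.prod_insert hbS]
  nlinarith [mul_le_mul_of_nonneg_left h1.2 h2]

end MaxTail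

/-- The expectation of the maximum if no value is large. -/
theorem maxTail_le_of_tail_le {p : ℕ → ℝ → ℝ} {m : ℕ → ℝ} {S : Finset ℕ} {ε : ℝ}
    (hS : ∀ i ∈ S, IsTail (p i) (m i)) (hε : 0 < ε) (hε4 : ε ≤ 1 / 4) {A : ℝ → ℝ}
    (hA : Antitone A) (hA0 : ∀ x, 0 ≤ A x) (hAi : IntegrableOn A (Set.Ioi 0)) {Q : ℝ} (hQ : 0 ≤ Q)
    (hp : ∀ i ∈ S, ∀ x, Q ≤ x → p i x ≤ ε) (hpA : ∀ x, Q ≤ x → ∑ i ∈ S, p i x = A x) :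
    maxTail p S ≤ Q + (1 + 2 * ε) * ∫ x in Set.Ioi Q, (1 - Real.exp (-(A x))) := by
  have hi := integrableOn_maxTail hS
  have hi' := integrableOn_one_sub_exp hA hA0 hAi
  rw [maxTail, ← intervalIntegral.integral_interval_add_Ioi hi
    (hi.mono_set (Set.Ioi_subset_Ioi hQ)), ← integral_const_mul]
  refine add_le_add ?_ ?_
  · calc ∫ x in (0 : ℝ)..Q, (1 - ∏ i ∈ S, (1 - p i x)) ≤ ∫ _x in (0 : ℝ)..Q, (1 : ℝ) :=
        intervalIntegral.integral_mono_on hQ (antitone_one_sub_prod hS).intervalIntegrable (by simp)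
          fun x _ => by linarith [(prod_tail_mem hS x).1]
      _ = Q := by simp
  · refine setIntegral_mono_on (hi.mono_set (Set.Ioi_subset_Ioi hQ))
      ((hi'.mono_set (Set.Ioi_subset_Ioi hQ)).const_mul _) measurableSet_Ioi fun x hx => ?_
    have hx' : Q ≤ x := le_of_lt hx
    have h1 : Real.exp (-((1 + 2 * ε) * A x)) ≤ ∏ i ∈ S, (1 - p i x) := by
      rw [← hpA x hx', Finset.mul_sum, ← Finset.sum_neg_distrib, Real.exp_sum]
      exact Finset.prod_le_prod (fun i _ => (Real.exp_pos _).le) fun i hi =>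
        exp_neg_le_one_sub hε4 ((hS i hi).nonneg x) (by linarith [hp i hi x hx'])
    -- Bernoulli's inequality with the real exponent 1 + 2ε, applied to e^{-A}.
    have h2 : 1 + (1 + 2 * ε) * (Real.exp (-(A x)) - 1) ≤ Real.exp (-((1 + 2 * ε) * A x)) := by
      have := one_add_mul_self_le_rpow_one_add (s := Real.exp (-(A x)) - 1)
        (by linarith [Real.exp_pos (-(A x))]) (p := 1 + 2 * ε) (by linarith)
      rw [add_sub_cancel, ← Real.exp_mul] at this
      rwa [show -((1 + 2 * ε) * A x) = -A x * (1 + 2 * ε) by ring]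
    linarith

namespace Data

variable {p : ℕ → ℝ → ℝ} {m : ℕ → ℝ} {n : ℕ} {ε : ℝ} {B : ℕ} {q c : ℕ → ℝ}
  (D : Data p m n ε B q c) {S : Finset ℕ} (hS : ∀ i ∈ S, i < n)
include D hS

/-- Ensures that the unit u = εT/n is at most ε times the prophet's reward. -/
theorem sum_le_maxTail : (∑ i ∈ S, m i) / n ≤ maxTail p S := by
  have h1 := D.one_le_n
  have hT : ∀ i ∈ S, IsTail (p i) (m i) := fun i hi => D.tail i (hS i hi)
  rw [div_le_iff₀ (by linarith)]
  calc ∑ i ∈ S, m i ≤ ∑ _i ∈ S, maxTail p S :=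
        Finset.sum_le_sum fun i hi => mean_le_maxTail hT hi
    _ = S.card * maxTail p S := by simp
    _ ≤ n * maxTail p S := mul_le_mul_of_nonneg_right (card_le hS) (maxTail_nonneg hT)
    _ = _ := mul_comm _ _

theorem maxTail_le {Q : ℝ} (hQ0 : 0 ≤ Q) (hQ : ∀ i ∈ S, q i ≤ Q) : maxTail p S ≤
    Q + (1 + 2 * ε) * ∫ x in Set.Ioi Q, (1 - Real.exp (-(mass p m ε q c S x))) := by
  refine maxTail_le_of_tail_le (fun i hi => D.tail i (hS i hi)) D.pos D.le (D.mass_antitone hS)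
    (D.mass_nonneg hS) (D.integrableOn_mass hS) hQ0
    (fun i hi x hx => D.tail_quant_le (hS i hi) ((hQ i hi).trans hx)) fun x hx => ?_
  refine Finset.sum_congr rfl fun i hi => ?_
  rw [capped_eq (D.tail i (hS i hi)) D.pos.le ((hQ i hi).trans hx)]

theorem integral_mono_Ioi {Q : ℝ} (hQ0 : 0 ≤ Q) :
    ∫ x in Set.Ioi Q, (1 - Real.exp (-(mass p m ε q c S x))) ≤
      ∫ x in Set.Ioi 0, (1 - Real.exp (-(mass p m ε q c S x))) := by
  refine setIntegral_mono_set
    (integrableOn_one_sub_exp (D.mass_antitone hS) (D.mass_nonneg hS) (D.integrableOn_mass hS))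
    (ae_of_all _ fun x => ?_) (Set.Ioi_subset_Ioi hQ0).eventuallyLE
  have := D.mass_nonneg hS x
  have : Real.exp (-(mass p m ε q c S x)) ≤ 1 := Real.exp_le_one_iff.2 (by linarith)
  simp only [Pi.zero_apply]; linarith

/-- If the quantiles decrease slowly, then the relaxed optimum is close to the prophet's reward. -/
theorem flat {Q Q' : ℝ} (hQ0 : 0 ≤ Q) (hQ : ∀ i ∈ S, q i ≤ Q) {R : Finset ℕ} (hR : R ⊆ S)
    (hRq : ∀ i ∈ R, Q' ≤ q i) (hgeo : geo ε R.card ≤ ε ^ 2) (hQQ : Q ≤ (1 + ε) * Q') :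
    (1 - 3 * ε) * maxTail p S ≤
      ∫ x in Set.Ioi 0, (1 - Real.exp (-(mass p m ε q c S x))) := by
  have hε := D.pos
  have hε4 := D.le
  set A := mass p m ε q c S with hAdef
  have h1 := D.maxTail_le hS hQ0 hQ
  have hMX : 0 ≤ maxTail p S := maxTail_nonneg fun i hi => D.tail i (hS i hi)
  set MX := maxTail p S
  have hint := integrableOn_one_sub_exp (D.mass_antitone hS) (D.mass_nonneg hS)
    (D.integrableOn_mass hS)
  set I := ∫ x in Set.Ioi 0, (1 - Real.exp (-(A x))) with hI
  set IQ := ∫ x in Set.Ioi Q, (1 - Real.exp (-(A x))) with hIQ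
  have hpos : ∀ x, 0 ≤ 1 - Real.exp (-(A x)) := fun x => by
    have := D.mass_nonneg hS x
    have : Real.exp (-(A x)) ≤ 1 := Real.exp_le_one_iff.2 (by linarith)
    linarith
  have hIQ0 : 0 ≤ IQ := integral_nonneg fun x => hpos x
  have hanti : Antitone fun x => 1 - Real.exp (-(A x)) := fun x y hxy => by
    have := D.mass_antitone hS hxy
    have : Real.exp (-(A x)) ≤ Real.exp (-(A y)) := Real.exp_le_exp.2 (by linarith)
    simp only; linarith
  have hsplit : I = (∫ x in (0 : ℝ)..Q, (1 - Real.exp (-(A x)))) + IQ :=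
    (intervalIntegral.integral_interval_add_Ioi hint
      (hint.mono_set (Set.Ioi_subset_Ioi hQ0))).symm
  -- R is nonempty, because `geo ε 0` is 1 and exceeds ε².
  have hQ'Q : Q' ≤ Q := by
    rcases R.eq_empty_or_nonempty with h | ⟨i, hi⟩
    · rw [h] at hgeo; simp [geo, abs_of_pos hε] at hgeo; linarith
    · exact (hRq i hi).trans (hQ i (hR hi))
  -- the part below the quantiles
  have h2 : (1 - ε ^ 2) * (Q' - ε * MX) ≤ ∫ x in (0 : ℝ)..Q, (1 - Real.exp (-(A x))) := by
    rcases le_or_gt (Q' - ε * MX) 0 with h0 | h0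
    · have : 0 ≤ ∫ x in (0 : ℝ)..Q, (1 - Real.exp (-(A x))) :=
        intervalIntegral.integral_nonneg hQ0 fun x _ => hpos x
      have : (1 - ε ^ 2) * (Q' - ε * MX) ≤ 0 :=
        mul_nonpos_of_nonneg_of_nonpos (by nlinarith) h0
      linarith
    · have h3 : Q' - ε * MX ≤ Q := by nlinarith
      have h4 : ∀ x ∈ Set.Icc 0 (Q' - ε * MX), 1 - ε ^ 2 ≤ 1 - Real.exp (-(A x)) := by
        intro x hx
        -- Each box of R has capped mass at least ε up to one grid step εm below its quantile, and m
        -- is at most the prophet's reward. Hence A ≥ |R|ε, and e^{-A} ≤ `geo ε R.card` ≤ ε². A box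
        -- of mean zero would have quantile 0, which is excluded in this case.
        have h5 : R.card * ε ≤ A x := by
          calc R.card * ε = ∑ _i ∈ R, ε := by simp
            _ ≤ ∑ i ∈ R, capped (p i) (m i) ε (q i) (c i) x := by
                refine Finset.sum_le_sum fun i hi => ?_
                have hi' := hS i (hR hi)
                have hmi : m i ≤ MX :=
                  mean_le_maxTail (fun i hi => D.tail i (hS i hi)) (hR hi)
                refine D.le_capped hi' ?_ ?_
                · refine lt_of_le_of_ne (D.mean_nonneg hi') fun h => ?_
                  have : q i = 0 := by
                    rw [D.quant i hi', IsTail.quantile_eq_zero h.symm]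
                  have := hRq i hi
                  have := mul_nonneg hε.le hMX
                  linarith
                · have := hRq i hi
                  have := mul_le_mul_of_nonneg_left hmi hε.le
                  linarith [hx.2]
            _ ≤ A x := Finset.sum_le_sum_of_subset_of_nonneg hR fun i hi _ =>
                capped_nonneg (D.tail i (hS i hi)) (D.coin_mem (hS i hi)).1
                  (D.coin_mem (hS i hi)).2 x
        have h6 := (exp_le_geo hε R.card).trans hgeo
        have h7 : Real.exp (-(A x)) ≤ Real.exp (-(R.card * ε)) := Real.exp_le_exp.2 (by linarith)
        linarith
      have h5 : ∫ x in (0 : ℝ)..(Q' - ε * MX), (1 - ε ^ 2) ≤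
          ∫ x in (0 : ℝ)..(Q' - ε * MX), (1 - Real.exp (-(A x))) :=
        intervalIntegral.integral_mono_on h0.le (by simp) hanti.intervalIntegrable h4
      have h6 : (∫ x in (0 : ℝ)..(Q' - ε * MX), (1 - Real.exp (-(A x)))) +
          (∫ x in (Q' - ε * MX)..Q, (1 - Real.exp (-(A x)))) =
          ∫ x in (0 : ℝ)..Q, (1 - Real.exp (-(A x))) :=
        intervalIntegral.integral_add_adjacent_intervals hanti.intervalIntegrable
          hanti.intervalIntegrable
      have h7 : 0 ≤ ∫ x in (Q' - ε * MX)..Q, (1 - Real.exp (-(A x))) :=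
        intervalIntegral.integral_nonneg h3 fun x _ => hpos x
      rw [intervalIntegral.integral_const, smul_eq_mul, sub_zero] at h5
      linarith
  have h3 : (1 - ε) * Q - ε * MX ≤ (1 - ε ^ 2) * (Q' - ε * MX) := by
    have e : (1 - ε) * ((1 + ε) * Q') = (1 - ε ^ 2) * Q' := by ring
    have := mul_le_mul_of_nonneg_left hQQ (show 0 ≤ 1 - ε by linarith)
    have := mul_nonneg (sq_nonneg ε) (mul_nonneg hε.le hMX)
    nlinarith
  -- If the reward is at most Q, the part below Q suffices. Otherwise the part above Q supplies
  -- nearly the missing MX - Q.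
  rcases le_or_gt MX Q with h4 | h4
  · nlinarith
  · have h5 : (1 - 2 * ε) * (MX - Q) ≤ IQ := by
      have h6 : (1 - 2 * ε) * (MX - Q) ≤ (1 - 2 * ε) * ((1 + 2 * ε) * IQ) :=
        mul_le_mul_of_nonneg_left (by linarith) (by linarith)
      nlinarith [mul_nonneg (sq_nonneg ε) hIQ0]
    nlinarith

omit hS in
/-- The relaxed optimum is close to the prophet's reward. -/
theorem guarantee {κ M MX I G u : ℝ} (hM : 2 * M * ε ≤ 1) (hM0 : 0 ≤ M) (hκ0 : 0 ≤ κ) (hκ1 : κ ≤ 1)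
    (hMX : 0 ≤ MX) (hu : u ≤ ε * MX) (hI : (1 - 3 * ε) * MX ≤ I)
    (hG : κ * (1 - 2 * M * ε) * (1 - 5 * ε) * I - 2 * u ≤ G) (h5 : 5 * ε ≤ 1) :
    (κ - (2 * M + 10) * ε) * MX ≤ G := by
  have hε := D.pos
  have a0 : 0 ≤ 2 * M * ε := by positivity
  have h1 : κ * (1 - 2 * M * ε) * (1 - 5 * ε) * ((1 - 3 * ε) * MX) ≤
      κ * (1 - 2 * M * ε) * (1 - 5 * ε) * I :=
    mul_le_mul_of_nonneg_left hI (mul_nonneg (mul_nonneg hκ0 (by linarith)) (by linarith))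
  have h2 : 1 - (2 * M + 8) * ε ≤ (1 - 2 * M * ε) * (1 - 5 * ε) * (1 - 3 * ε) := by
    have h3 : 1 - 8 * ε ≤ (1 - 5 * ε) * (1 - 3 * ε) := by nlinarith
    have h4 := mul_le_mul_of_nonneg_left h3 (show 0 ≤ 1 - 2 * M * ε by linarith)
    have h6 : 0 ≤ 2 * M * ε * (8 * ε) := by positivity
    nlinarith
  have h3 := mul_le_mul_of_nonneg_left h2 hκ0
  have h4 : κ - (2 * M + 8) * ε ≤ κ * (1 - (2 * M + 8) * ε) := by
    have : 0 ≤ (2 * M + 8) * ε := by positivity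
    nlinarith
  have h6 := mul_le_mul_of_nonneg_right (h4.trans h3) hMX
  nlinarith

/-- If the largest quantile is small compared to the reward, then the relaxed optimum is close to
the prophet's reward. -/
theorem rich {Q G : ℝ} (hQ0 : 0 ≤ Q) (hQ : ∀ i ∈ S, q i ≤ Q) (hQG : Q ≤ ε * G)
    (hG : G ≤ maxTail p S) : (1 - 3 * ε) * maxTail p S ≤
      ∫ x in Set.Ioi 0, (1 - Real.exp (-(mass p m ε q c S x))) := by
  have hε := D.pos
  have hε4 := D.le
  have h1 := D.maxTail_le hS hQ0 hQ
  have h2 := D.integral_mono_Ioi hS hQ0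
  have hMX : 0 ≤ maxTail p S := maxTail_nonneg fun i hi => D.tail i (hS i hi)
  set I := ∫ x in Set.Ioi 0, (1 - Real.exp (-(mass p m ε q c S x)))
  have h3 := mul_le_mul_of_nonneg_left hG hε.le
  have h4 := mul_le_mul_of_nonneg_left h2 (show 0 ≤ 1 + 2 * ε by linarith)
  have h5 : (1 - ε) * maxTail p S ≤ (1 + 2 * ε) * I := by linarith
  have h6 : (1 + 2 * ε) * ((1 - 3 * ε) * maxTail p S) ≤ (1 + 2 * ε) * I := by
    have : 0 ≤ ε ^ 2 * maxTail p S := by positivity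
    nlinarith
  exact le_of_mul_le_mul_left h6 (by linarith)

/-- If the largest quantile is tiny compared to the quantile of another box, then this box alone
is nearly optimal. -/
theorem poor {κ M Q G u γ : ℝ} (hQ0 : 0 ≤ Q) (hQ : ∀ i ∈ S, q i ≤ Q)
    (hu : u ≤ ε * maxTail p S)
    (hG : κ * (1 - 2 * M * ε) * (1 - 5 * ε) *
      (∫ x in Set.Ioi 0, (1 - Real.exp (-(mass p m ε q c S x)))) - 2 * u ≤ G)
    (hγ : γ ≤ κ * (1 - 2 * M * ε) * (1 - 5 * ε)) (hγ8 : 8 * ε ≤ γ) (hγ1 : γ ≤ 1)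
    (hGQ : ε * G ≤ Q) {b : ℕ} (hb : b < n) (hbQ : Q ≤ ε ^ 4 * q b) :
    maxTail p S ≤ 2 * ε * m b := by
  have hε := D.pos
  have hε4 := D.le
  have h1 := D.maxTail_le hS hQ0 hQ
  have h2 := D.integral_mono_Ioi hS hQ0
  have hMX : 0 ≤ maxTail p S := maxTail_nonneg fun i hi => D.tail i (hS i hi)
  have hI0 : 0 ≤ ∫ x in Set.Ioi 0, (1 - Real.exp (-(mass p m ε q c S x))) := by
    refine integral_nonneg fun x => ?_
    have := D.mass_nonneg hS x
    have : Real.exp (-(mass p m ε q c S x)) ≤ 1 := Real.exp_le_one_iff.2 (by linarith)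
    simp only [Pi.zero_apply]; linarith
  set I := ∫ x in Set.Ioi 0, (1 - Real.exp (-(mass p m ε q c S x)))
  set MX := maxTail p S
  -- Since γ ≥ 8ε, the terms of order εMX are absorbed and 4εMX ≤ Q + 2G. With εG ≤ Q this gives
  -- 4ε²MX ≤ 3Q, while Q ≤ ε⁴ q_b ≤ 2ε³ m_b.
  have h3 : MX ≤ Q + 2 * I := by nlinarith
  have h4 : γ * I ≤ G + 2 * (ε * MX) := by
    have := mul_le_mul_of_nonneg_right hγ hI0
    linarith
  have hγ0 : 0 < γ := by linarith
  have h5 : γ * MX ≤ Q + 2 * G + 4 * (ε * MX) := by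
    have := mul_le_mul_of_nonneg_left h3 hγ0.le
    nlinarith
  have h6 : 8 * (ε * MX) ≤ γ * MX := by nlinarith
  have h7 : 4 * (ε * MX) ≤ Q + 2 * G := by linarith
  have h8 : 4 * ε ^ 2 * MX ≤ 3 * Q := by nlinarith
  have h9 := D.mul_quant_le hb
  have h10 : 4 * ε ^ 2 * MX ≤ 4 * ε ^ 2 * (2 * ε * m b) := by
    have h11 : ε ^ 3 * (ε * q b) ≤ ε ^ 3 * (2 * m b) :=
      mul_le_mul_of_nonneg_left h9 (by positivity)
    have h12 : 0 ≤ ε ^ 3 * m b := mul_nonneg (by positivity) (D.mean_nonneg hb)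
    nlinarith
  exact le_of_mul_le_mul_left h10 (by positivity)

end Data

end FreeOrder

namespace FreeOrder

/-! ### Removing the randomness -/

section Derandomize

variable {S : Finset ℕ} {B : ℕ} {W F : ℕ → ℕ → ℝ} {i : ℕ}

/-- The value is affine in the rows of box i: its own reward enters linearly, and its survival row
is a factor in the rewards of all other boxes. This is the basis for fixing the random choices one
box at a time. -/
theorem blend_update (hi : i ∈ S) (w f : ℕ → ℝ) :
    blend S B (Function.update W i w) (Function.update F i f) =
      ∑ j ∈ Finset.range B, (w j * (∏ l ∈ S.erase i, F l j) +
        f j * ∑ i' ∈ S.erase i, W i' j * ∏ l ∈ (S.erase i').erase i, F l j) := by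
  rw [blend, Finset.sum_comm]
  refine Finset.sum_congr rfl fun j _ => ?_
  rw [← Finset.add_sum_erase _ _ hi]
  congr 1
  · rw [Function.update_self]
    congr 1
    refine Finset.prod_congr rfl fun l hl => ?_
    rw [Function.update_of_ne (Finset.ne_of_mem_erase hl)]
  · rw [Finset.mul_sum]
    refine Finset.sum_congr rfl fun i' hi' => ?_
    have hne := Finset.ne_of_mem_erase hi'
    rw [Function.update_of_ne hne,
      ← Finset.mul_prod_erase (S.erase i') _ (Finset.mem_erase.2 ⟨hne.symm, hi⟩),
      Function.update_self]
    have : ∏ l ∈ (S.erase i').erase i, Function.update F i f l j =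
        ∏ l ∈ (S.erase i').erase i, F l j :=
      Finset.prod_congr rfl fun l hl => by
        rw [Function.update_of_ne (Finset.ne_of_mem_erase hl)]
    rw [this]; ring

theorem blend_update_of_notMem (hi : i ∉ S) (w f : ℕ → ℝ) :
    blend S B (Function.update W i w) (Function.update F i f) = blend S B W F := by
  refine Finset.sum_congr rfl fun i' hi' => Finset.sum_congr rfl fun j _ => ?_
  have hne : ∀ l ∈ S, l ≠ i := fun l hl h => hi (h ▸ hl)
  rw [Function.update_of_ne (hne i' hi')]
  congr 1
  refine Finset.prod_congr rfl fun l hl => ?_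
  rw [Function.update_of_ne (hne l (Finset.mem_of_mem_erase hl))]

/-- If a row is a mixture, then one of its components is at least as good. -/
theorem blend_le_of_mixture {τ : Type} (T : Finset τ) {wt : τ → ℝ} (h0 : ∀ t ∈ T, 0 ≤ wt t)
    (h1 : ∑ t ∈ T, wt t ≤ 1) {w f : τ → ℕ → ℝ}
    (hW : ∀ j < B, W i j = ∑ t ∈ T, wt t * w t j)
    (hF : ∀ j < B, F i j = 1 - ∑ t ∈ T, wt t * (1 - f t j)) {best : ℝ}
    (hskip : blend S B (Function.update W i fun _ => 0) (Function.update F i fun _ => 1) ≤ best)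
    (hbest : ∀ t ∈ T, blend S B (Function.update W i (w t)) (Function.update F i (f t)) ≤ best) :
    blend S B W F ≤ best := by
  by_cases hi : i ∈ S
  · have e : blend S B W F = blend S B (Function.update W i (W i)) (Function.update F i (F i)) := by
      simp
    rw [e]
    rw [blend_update hi] at hskip ⊢
    simp only [blend_update hi] at hbest
    set P : ℕ → ℝ := fun j => ∏ l ∈ S.erase i, F l j
    set R : ℕ → ℝ := fun j => ∑ i' ∈ S.erase i, W i' j * ∏ l ∈ (S.erase i').erase i, F l j
    -- The weight missing from 1 is given to the rows (0, 1), that is, to skipping the box.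
    have key : ∑ j ∈ Finset.range B, (W i j * P j + F i j * R j) =
        ∑ t ∈ T, wt t * (∑ j ∈ Finset.range B, (w t j * P j + f t j * R j)) +
        (1 - ∑ t ∈ T, wt t) * ∑ j ∈ Finset.range B, (0 * P j + 1 * R j) := by
      simp only [Finset.mul_sum, sub_mul, Finset.sum_mul, one_mul, zero_mul, zero_add]
      rw [Finset.sum_comm (s := T), ← Finset.sum_add_distrib]
      refine Finset.sum_congr rfl fun j hj => ?_
      rw [hW j (Finset.mem_range.1 hj), hF j (Finset.mem_range.1 hj), sub_mul, Finset.sum_mul,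
        Finset.sum_mul]
      have : ∀ t ∈ T, wt t * (w t j * P j + f t j * R j) =
          wt t * w t j * P j + (wt t * R j - wt t * (1 - f t j) * R j) := fun t _ => by ring
      rw [Finset.sum_congr rfl this, Finset.sum_add_distrib, Finset.sum_sub_distrib]
      ring
    rw [key]
    have a1 : ∑ t ∈ T, wt t * (∑ j ∈ Finset.range B, (w t j * P j + f t j * R j)) ≤
        ∑ t ∈ T, wt t * best :=
      Finset.sum_le_sum fun t ht => mul_le_mul_of_nonneg_left (hbest t ht) (h0 t ht)
    have a2 := mul_le_mul_of_nonneg_left hskip (show 0 ≤ 1 - ∑ t ∈ T, wt t by linarith)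
    rw [← Finset.sum_mul] at a1
    linarith
  · rwa [blend_update_of_notMem hi] at hskip

/-- The survival row of a box with threshold `θ` in slot `s`. -/
noncomputable def decF (p : ℝ → ℝ) (s : ℕ) (θ : ℝ) (j : ℕ) : ℝ :=
  if (s : ℝ) ≤ j then 1 - p θ else 1

/-- The reward row of a box with reward `v` in slot `s`. -/
noncomputable def decW (v : ℝ) (s j : ℕ) : ℝ :=
  if (s : ℝ) ≤ j then if (j : ℝ) ≤ s then v else 0 else 0

/-- Equality of slots is expressed by two inequalities between real numbers, which is the only kind
of test in the expression language. -/
theorem decW_eq (v : ℝ) (s j : ℕ) : decW v s j = if s = j then v else 0 := by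
  unfold decW
  simp only [Nat.cast_le]
  split_ifs <;> first | rfl | omega

theorem decF_eq (p : ℝ → ℝ) (s : ℕ) (θ : ℝ) (j : ℕ) :
    1 - decF p s θ j = if s ≤ j then p θ else 0 := by
  unfold decF
  simp only [Nat.cast_le]
  split_ifs <;> ring

/-- Slot B lies behind all slots of the grid and therefore encodes that the box is skipped. -/
theorem decF_skip (p : ℝ → ℝ) (θ : ℝ) {j : ℕ} (hj : j < B) : decF p B θ j = 1 := by
  unfold decF; rw [if_neg]; simpa using hj

theorem blend_congr {W' F' : ℕ → ℕ → ℝ} (hW : ∀ i ∈ S, ∀ j < B, W i j = W' i j)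
    (hF : ∀ i ∈ S, ∀ j < B, F i j = F' i j) : blend S B W F = blend S B W' F' := by
  refine Finset.sum_congr rfl fun i hi => Finset.sum_congr rfl fun j hj => ?_
  rw [hW i hi j (Finset.mem_range.1 hj)]
  congr 1
  exact Finset.prod_congr rfl fun l hl => hF l (Finset.mem_of_mem_erase hl) j (Finset.mem_range.1 hj)

/-- A slot together with a choice of both coins is at least as good as the random choice. -/
theorem blend_le_of_choices {p : ℝ → ℝ} {m ε q c u : ℝ} {d b l : ℕ → ℝ} (hd : ∀ j < B, 0 ≤ d j)
    (hd1 : ∑ j ∈ Finset.range B, d j ≤ 1) (hb : ∀ j < B, d j ≠ 0 → 0 ≤ b j ∧ b j ≤ 1)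
    (hc : 0 ≤ c ∧ c ≤ 1)
    (hW : ∀ j < B, W i j = d j * mixed (fun x => (1 - c) * lowMean p m B (max x q) +
      c * lowMean p m B (max x (q - ε * m))) (b j) (l j) u)
    (hF : ∀ j < B, F i j = 1 - ∑ t ∈ Finset.range (j + 1),
      d t * mixed (capped p m ε q c) (b t) (l t) u) {best : ℝ}
    (hskip : blend S B (Function.update W i (decW (lowMean p m B 0) B))
      (Function.update F i (decF p B 0)) ≤ best)
    (hbest : ∀ j < B, ∀ x, (x = l j ∨ x = l j - u) → ∀ y, (y = q ∨ y = q - ε * m) →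
      blend S B (Function.update W i (decW (lowMean p m B (max x y)) j))
        (Function.update F i (decF p j (max x y))) ≤ best) :
    blend S B W F ≤ best := by
  -- The random choice of a box is a slot, a coin for the common level and a coin for its own
  -- quantile; the weight of a choice is the product of the three probabilities.
  set wa : ℕ → Bool → ℝ := fun j a => if a then b j else 1 - b j with hwa
  set wb : Bool → ℝ := fun a => if a then c else 1 - c with hwb
  set th : ℕ × Bool × Bool → ℝ := fun t =>
    max (if t.2.1 then l t.1 - u else l t.1) (if t.2.2 then q - ε * m else q) with hth
  set T : Finset (ℕ × Bool × Bool) := Finset.range B ×ˢ Finset.univ ×ˢ Finset.univ with hT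
  have hmem : ∀ t ∈ T, t.1 < B := fun t ht => by
    rw [hT, Finset.mem_product] at ht; exact Finset.mem_range.1 ht.1
  have hsumT : ∀ g : ℕ × Bool × Bool → ℝ, ∑ t ∈ T, g t = ∑ j ∈ Finset.range B,
      (g (j, true, true) + g (j, true, false) + (g (j, false, true) + g (j, false, false))) := by
    intro g
    rw [hT, Finset.sum_product]
    refine Finset.sum_congr rfl fun j _ => ?_
    rw [Finset.sum_product]
    simp
  have hpt : ∀ j < B, ∀ a, 0 ≤ d j * wa j a := by
    intro j hj a
    by_cases h : d j = 0
    · simp [h]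
    · obtain ⟨b0, b1⟩ := hb j hj h
      apply mul_nonneg (hd j hj)
      cases a
      · simp only [hwa]; simp; linarith
      · simpa [hwa] using b0
  have hwb0 : ∀ a, 0 ≤ wb a := by
    intro a; cases a
    · simp only [hwb]; simp; exact hc.2
    · simpa [hwb] using hc.1
  refine blend_le_of_mixture (i := i) T (wt := fun t => d t.1 * wa t.1 t.2.1 * wb t.2.2)
    (w := fun t => decW (lowMean p m B (th t)) t.1) (f := fun t => decF p t.1 (th t))
    (fun t ht => mul_nonneg (hpt _ (hmem t ht) _) (hwb0 _)) ?_ ?_ ?_ ?_ ?_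
  · rw [hsumT]
    refine le_trans (le_of_eq (Finset.sum_congr rfl fun j _ => ?_)) hd1
    simp [hwa, hwb]; ring
  · intro j hj
    rw [hW j hj, hsumT]
    simp only [decW_eq]
    rw [Finset.sum_eq_single j]
    · simp [hwa, hwb, hth, mixed]; ring
    · intro j' _ hne; simp [hne]
    · intro h; exact absurd (Finset.mem_range.2 hj) h
  · intro j hj
    rw [hF j hj, hsumT]
    congr 1
    simp only [decF_eq]
    have hsub : Finset.range (j + 1) = (Finset.range B).filter (· ≤ j) := by
      ext t; simp only [Finset.mem_filter, Finset.mem_range]; omega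
    rw [hsub, Finset.sum_filter]
    refine Finset.sum_congr rfl fun t _ => ?_
    split_ifs
    · simp [hwa, hwb, hth, mixed, capped]; ring
    · simp
  · refine le_trans (le_of_eq (blend_congr ?_ ?_)) hskip
    · intro i' _ j hj
      by_cases h : i' = i
      · subst h; simp [decW_eq, hj.ne']
      · simp [h]
    · intro i' _ j hj
      by_cases h : i' = i
      · subst h; simp [decF_skip _ _ hj]
      · simp [h]
  · rintro ⟨j, a, b'⟩ ht
    have hj := hmem _ ht
    refine hbest j hj _ ?_ _ ?_
    · cases a <;> simp
    · cases b' <;> simp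

end Derandomize

/-! ### The reward of a fixed order -/

/-- The expected reward of fixed thresholds in a fixed order. -/
noncomputable def listVal (p : ℕ → ℝ → ℝ) : List (ℕ × ℝ) → ℝ
  | [] => 0
  | (i, θ) :: l => (∫ x in Set.Ioi 0, p i (max x θ)) + (1 - p i θ) * listVal p l

/-- A box is reached if all its predecessors reject, and these have no larger slot. Requiring
rejection by all other boxes of no larger slot, including later ones of the same slot, only
decreases the value, and makes the order within a slot irrelevant. -/
theorem le_listVal {p : ℕ → ℝ → ℝ} {m : ℕ → ℝ} {slot : ℕ → ℕ} {θ : ℕ → ℝ} (L : List ℕ)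
    (hL : ∀ i ∈ L, IsTail (p i) (m i)) (hnd : L.Nodup)
    (hs : L.Pairwise fun i j => slot i ≤ slot j) :
    ∑ i ∈ L.toFinset, (∫ x in Set.Ioi 0, p i (max x (θ i))) *
        ∏ l ∈ L.toFinset.erase i, (if slot l ≤ slot i then 1 - p l (θ l) else 1) ≤
      listVal p (L.map fun i => (i, θ i)) := by
  induction L with
  | nil => simp [listVal]
  | cons a L ih =>
    have ha : a ∉ L.toFinset := by simpa using (List.nodup_cons.1 hnd).1
    have hE : ∀ i ∈ a :: L, 0 ≤ ∫ x in Set.Ioi 0, p i (max x (θ i)) := fun i hi =>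
      integral_nonneg fun x => (hL i hi).nonneg _
    have hfac : ∀ i, ∀ l ∈ a :: L, 0 ≤ (if slot l ≤ slot i then 1 - p l (θ l) else 1) ∧
        (if slot l ≤ slot i then 1 - p l (θ l) else 1) ≤ 1 := by
      intro i l hl
      have h1 := (hL l hl).nonneg (θ l)
      have h2 := (hL l hl).le_one (θ l)
      split_ifs
      · constructor <;> linarith
      · constructor <;> norm_num
    rw [List.toFinset_cons, Finset.sum_insert ha, List.map_cons, listVal]
    refine add_le_add ?_ ?_
    · refine mul_le_of_le_one_right (hE a List.mem_cons_self) (Finset.prod_le_one ?_ ?_)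
      · intro l hl
        exact (hfac a l (by simpa using Finset.mem_of_mem_erase hl)).1
      · intro l hl
        exact (hfac a l (by simpa using Finset.mem_of_mem_erase hl)).2
    · have h1 := ih (fun i hi => hL i (List.mem_cons_of_mem _ hi)) (List.nodup_cons.1 hnd).2
        (List.pairwise_cons.1 hs).2
      have h2 := mul_le_mul_of_nonneg_left h1
        (show 0 ≤ 1 - p a (θ a) by linarith [(hL a List.mem_cons_self).le_one (θ a)])
      refine le_trans (le_of_eq ?_) h2
      rw [Finset.mul_sum]
      refine Finset.sum_congr rfl fun i hi => ?_
      have hne : a ≠ i := fun h => ha (h ▸ hi)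
      rw [Finset.erase_insert_of_ne hne, Finset.prod_insert (by
        intro h; exact ha (Finset.mem_of_mem_erase h)),
        if_pos ((List.pairwise_cons.1 hs).1 i (by simpa using hi))]
      ring

/-- The computed value errs on the safe side: `lowMean` is below the true truncated mean, and
survival is underestimated as in `le_listVal`. -/
theorem blend_le_listVal {p : ℕ → ℝ → ℝ} {m : ℕ → ℝ} {slot : ℕ → ℕ} {θ : ℕ → ℝ} {L : List ℕ} {B : ℕ}
    (hB : 0 < B) (hL : ∀ i ∈ L, IsTail (p i) (m i)) (hnd : L.Nodup)
    (hs : L.Pairwise fun i j => slot i ≤ slot j) :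
    blend L.toFinset B (fun i => decW (lowMean (p i) (m i) B (θ i)) (slot i))
      (fun i => decF (p i) (slot i) (θ i)) ≤ listVal p (L.map fun i => (i, θ i)) := by
  refine le_trans ?_ (le_listVal L hL hnd hs)
  refine Finset.sum_le_sum fun i hi => ?_
  have hT := hL i (by simpa using hi)
  have hprod : 0 ≤ ∏ l ∈ L.toFinset.erase i, (if slot l ≤ slot i then 1 - p l (θ l) else 1) := by
    refine Finset.prod_nonneg fun l hl => ?_
    have := (hL l (by simpa using Finset.mem_of_mem_erase hl)).le_one (θ l)
    split_ifs <;> linarith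
  have hE : 0 ≤ ∫ x in Set.Ioi 0, p i (max x (θ i)) := integral_nonneg fun x => hT.nonneg _
  simp only [decW_eq, decF, Nat.cast_le, ite_mul, zero_mul]
  rw [Finset.sum_ite_eq]
  -- A box whose slot is outside the grid counts as 0, while its true contribution is nonnegative.
  split_ifs
  · exact mul_le_mul_of_nonneg_right (hT.lower_bounds (θ i) hB rfl).1 hprod
  · exact mul_nonneg hE hprod

/-! ### The number of slots -/

/-- By definition of k, (k + 1) log (1 + ε) ≥ 2 log ε⁻¹ > k log (1 + ε), and log (1 + ε) lies
between ε/(1 + ε) and ε. The spare factor on the right absorbs 1 + ε and the last slot. -/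
theorem slots_bounds {ε : ℝ} (hε : 0 < ε) (hε2 : ε ≤ 1 / 2) {k : ℕ} (hk : ε ^ 2 < geo ε k)
    (hk' : geo ε (k + 1) ≤ ε ^ 2) :
    2 * (ε⁻¹ * Real.log ε⁻¹) ≤ (k + 1 : ℕ) ∧ ((k + 1 : ℕ) : ℝ) ≤ 4 * (ε⁻¹ * Real.log ε⁻¹) := by
  have h1 := log_le' hε
  have h2 := le_mul_log hε
  have h3 : Real.log (ε ^ 2) < Real.log (geo ε k) := Real.log_lt_log (by positivity) hk
  have h4 : Real.log (geo ε (k + 1)) ≤ Real.log (ε ^ 2) := Real.log_le_log (geo_pos hε _) hk'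
  rw [log_geo, Real.log_pow] at h3 h4
  have hl : Real.log ε⁻¹ = -Real.log ε := Real.log_inv ε
  set L := Real.log ε⁻¹
  have h5 : Real.log 2 ≤ L := Real.log_le_log (by norm_num) (by
    rw [le_inv_comm₀ (by norm_num) hε]; linarith)
  have h6 := Real.log_two_gt_d9
  push_cast at h3 h4 ⊢
  have hk0 : (0 : ℝ) ≤ k := k.cast_nonneg
  have e : ε * (ε⁻¹ * L) = L := by field_simp
  have hX : 0 ≤ ε⁻¹ * L := mul_nonneg (by positivity) (by linarith)
  set X := ε⁻¹ * L
  constructor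
  · have : ε * (2 * X) ≤ ε * (k + 1) := by nlinarith
    exact le_of_mul_le_mul_left this hε
  · have h7 : k * ε ≤ (1 + ε) * (2 * L) := by nlinarith
    have h8 : ε * k ≤ ε * (3 * X) := by nlinarith
    have h9 := le_of_mul_le_mul_left h8 hε
    have h10 : 1 ≤ X := by nlinarith
    linarith

end FreeOrder

namespace RealRAM

/-! ### Expressions used by the algorithm

Memory layout. Natural variables: `0` length of the output, `1` number of boxes, `2` grid size,
`3` box, `4` slot, `5` counter, `6` number of removed boxes, `7` success flag, `9` best slot.
Real variables: `0` accuracy, `1` scale of the slot weights, `2` total mean, `3` grid unit, `4` value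
of the randomized policy, `5` best value, `6` best threshold, `7` candidate, `8` number of slots.
Real arrays: `0` output, `1` quantiles, `2` ranks, `3` geometric grid, `4` slot weights, `5` levels,
`6` mixtures, `7` thresholds, `8` coins, `9` cumulative sums. Natural arrays: `0` output, `1` slots,
`2` flags of the boxes that are decided. -/

namespace HExpr

instance : Add HExpr := ⟨.bin .add⟩
instance : Sub HExpr := ⟨.bin .sub⟩
instance : Mul HExpr := ⟨.bin .mul⟩
instance : Div HExpr := ⟨.bin .div⟩

section
variable (O : Oracle) (d : ℕ) (s : State)

@[simp] theorem eval_nat (x : ℕ) : (nat x).eval O d s = s.natVar x := rfl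
@[simp] theorem eval_const (k : ℕ) : (const k).eval O d s = k := rfl
@[simp] theorem eval_real (x : ℕ) : (real x).eval O d s = s.realVar x := rfl
@[simp] theorem eval_narr (a x : ℕ) : (narr a x).eval O d s = s.natArr a (s.natVar x) := rfl
@[simp] theorem eval_rarr (a x : ℕ) : (rarr a x).eval O d s = s.realArr a (s.natVar x) := rfl
@[simp] theorem eval_add (e f : HExpr) : (e + f).eval O d s = e.eval O d s + f.eval O d s := rfl
@[simp] theorem eval_sub (e f : HExpr) : (e - f).eval O d s = e.eval O d s - f.eval O d s := rfl
@[simp] theorem eval_mul (e f : HExpr) : (e * f).eval O d s = e.eval O d s * f.eval O d s := rfl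
@[simp] theorem eval_div (e f : HExpr) : (e / f).eval O d s = e.eval O d s / f.eval O d s := rfl
@[simp] theorem eval_cdf (x : ℕ) (e : HExpr) :
    (cdf x e).eval O d s = O.cdf (s.natVar x) (e.eval O d s) := rfl
@[simp] theorem eval_mean (x : ℕ) : (mean x).eval O d s = O.mean (s.natVar x) := rfl
@[simp] theorem eval_ite (e f g h : HExpr) : (ite e f g h).eval O d s =
    if e.eval O d s ≤ f.eval O d s then g.eval O d s else h.eval O d s := rfl
@[simp] theorem eval_sum (b : ℕ) (e : HExpr) : (fold false b e).eval O d s =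
    ∑ k ∈ Finset.range (s.natVar b), e.eval O (d + 1) (s.setNat d k) := rfl
@[simp] theorem eval_prod (b : ℕ) (e : HExpr) : (fold true b e).eval O d s =
    ∏ k ∈ Finset.range (s.natVar b), e.eval O (d + 1) (s.setNat d k) := rfl

end

def max (e f : HExpr) : HExpr := ite e f f e

@[simp] theorem eval_max (O : Oracle) (d : ℕ) (s : State) (e f : HExpr) :
    (max e f).eval O d s = Max.max (e.eval O d s) (f.eval O d s) := by
  rw [max, eval_ite, max_def]

/-- `Pr[X i > x]`. -/
def tail (i : ℕ) (x : HExpr) : HExpr := const 1 - cdf i x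

def step (i : ℕ) : HExpr := real 0 * mean i

def quantile : HExpr :=
  step 3 * fold false 2 (ite (tail 3 (nat 12 * step 3)) (real 0) (const 0) (const 1))

def coin : HExpr := real 0 / tail 3 (rarr 1 3 - step 3)

/-- The number of boxes with a larger quantile, where ties are broken by the index. -/
def rank : HExpr :=
  fold false 1 (ite (rarr 1 12) (rarr 1 3)
    (ite (rarr 1 3) (rarr 1 12) (ite (nat 3) (nat 12) (const 0) (const 1)) (const 0)) (const 1))

def geo : HExpr :=
  fold true 2 (ite (nat 4) (nat 12) (const 1) (const 1 / (const 1 + real 0)))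

def gap (j : ℕ) : HExpr := rarr 3 j - rarr 3 j / (const 1 + real 0)

def cum : HExpr :=
  fold false 2 (ite (nat 4) (nat 12) (const 0) (gap 12 * (nat 12 * real 0)))

def slots : HExpr := fold false 2 (ite (rarr 3 12) (real 0 * real 0) (const 0) (const 1))

def cumEnd : HExpr :=
  fold false 2 (ite (real 8) (nat 12) (const 0) (gap 12 * (nat 12 * real 0)))

def surv (κ cum : HExpr) : HExpr := const 1 - (const 1 + const 2 * real 0) * κ * cum

def weight (κ : HExpr) (j : ℕ) : HExpr :=
  ite (nat j) (const 0) (const 0) (ite (real 8) (nat j) (const 0)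
    (κ * gap j / surv κ (rarr 9 j)))

/-- The test for the scale `κ`, given in the real variable `7`. -/
def admissible (M : ℕ) : HExpr :=
  ite (real 7) (const 1) (ite (fold false 2 (weight (real 7) 12)) (const 1)
    (ite (const 1) (const M * surv (real 7) cumEnd) (const 1) (const 0)) (const 0)) (const 0)

/-- Case distinction whether box `i` belongs to the instance. -/
def sel (i : ℕ) (e f : HExpr) : HExpr := ite (nat 6) (rarr 2 i) e f

def capped (i : ℕ) (x : HExpr) : HExpr :=
  (const 1 - rarr 8 i) * tail i (max x (rarr 1 i)) +
    rarr 8 i * tail i (max x (rarr 1 i - step i))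

def mass (d : ℕ) (x : HExpr) : HExpr := fold false 1 (sel d (capped d x) (const 0))

def total : HExpr := fold false 1 (sel 12 (mean 12) (const 0))

def unit : HExpr := real 0 * real 2 / nat 1

def level : HExpr :=
  real 3 * fold false 2 (ite (mass 13 (nat 12 * real 3)) (nat 4 * real 0) (const 0) (const 1))

def mix : HExpr :=
  ite (mass 12 (rarr 5 4 - real 3)) (nat 4 * real 0) (const 0)
    ((nat 4 * real 0 - mass 12 (rarr 5 4)) /
      (mass 12 (rarr 5 4 - real 3) - mass 12 (rarr 5 4)))

def lowMean (i d : ℕ) (θ : HExpr) : HExpr :=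
  mean i - max θ (const 0) / nat 2 *
    fold false 2 (tail i (nat d * (max θ (const 0) / nat 2))) +
    max θ (const 0) * tail i (max θ (const 0))

def cappedVal (i d : ℕ) (l : HExpr) : HExpr :=
  (const 1 - rarr 8 i) * lowMean i d (max l (rarr 1 i)) +
    rarr 8 i * lowMean i d (max l (rarr 1 i - step i))

/-- The average of a function of the level in slot `j`. -/
def mixed (f : HExpr → HExpr) (j : ℕ) : HExpr :=
  (const 1 - rarr 6 j) * f (rarr 5 j) + rarr 6 j * f (rarr 5 j - real 3)

def rowW (i j d : ℕ) : HExpr :=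
  ite (narr 2 i) (const 0) (rarr 4 j * mixed (cappedVal i d) j)
    (ite (narr 1 i) (nat j) (ite (nat j) (narr 1 i) (lowMean i d (rarr 7 i)) (const 0)) (const 0))

def rowF (i j d : ℕ) : HExpr :=
  ite (narr 2 i) (const 0)
    (const 1 - fold false 2 (ite (nat d) (nat j) (rarr 4 d * mixed (capped i) d) (const 0)))
    (ite (narr 1 i) (nat j) (const 1 - tail i (rarr 7 i)) (const 1))

/-- The value of the partially randomized policy. -/
def blend : HExpr :=
  fold false 1 (sel 12 (fold false 2 (rowW 12 13 14 * fold true 1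
    (ite (nat 14) (nat 12) (ite (nat 12) (nat 14) (const 1) (sel 14 (rowF 14 13 15) (const 1)))
      (sel 14 (rowF 14 13 15) (const 1))))) (const 0))

/-- The quantile of the box of rank `6 + e`. -/
def quantAt (e : HExpr) : HExpr :=
  fold false 1 (ite (rarr 2 12) (nat 6 + e) (ite (nat 6 + e) (rarr 2 12) (rarr 1 12) (const 0))
    (const 0))

/-- The quantiles are flat or small. -/
def good : HExpr :=
  ite (quantAt (const 0)) ((const 1 + real 0) * quantAt (real 8)) (const 1)
    (ite (quantAt (const 0)) (real 0 * real 4) (const 1) (const 0))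

end HExpr

/-- The tails given by an oracle. -/
def Oracle.tail (O : Oracle) (i : ℕ) (x : ℝ) : ℝ := 1 - O.cdf i x

section Eval

variable (O : Oracle) (s : State)

/-- The boxes of the instance. -/
noncomputable def selected (s : State) : Finset ℕ :=
  (Finset.range (s.natVar 1)).filter fun i => (s.natVar 6 : ℝ) ≤ s.realArr 2 i

theorem HExpr.eval_quantile : HExpr.quantile.eval O 12 s =
    FreeOrder.quantile (O.tail (s.natVar 3)) (O.mean (s.natVar 3)) (s.realVar 0) (s.natVar 2) := by
  simp [HExpr.quantile, HExpr.step, HExpr.tail, FreeOrder.quantile, Oracle.tail]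

theorem HExpr.eval_coin : HExpr.coin.eval O 12 s =
    FreeOrder.coin (O.tail (s.natVar 3)) (O.mean (s.natVar 3)) (s.realVar 0)
      (s.realArr 1 (s.natVar 3)) := by
  simp [HExpr.coin, HExpr.step, HExpr.tail, FreeOrder.coin, Oracle.tail]

/-- The total acceptance probability of the selected boxes. -/
noncomputable def massOf : ℝ → ℝ :=
  FreeOrder.mass O.tail O.mean (s.realVar 0) (s.realArr 1) (s.realArr 8) (selected s)

theorem HExpr.eval_total : HExpr.total.eval O 12 s = ∑ i ∈ selected s, O.mean i := by
  simp [HExpr.total, HExpr.sel, selected, Finset.sum_filter]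

theorem HExpr.eval_level : HExpr.level.eval O 12 s =
    FreeOrder.gridLevel (massOf O s) (s.realVar 3) (s.natVar 4 * s.realVar 0) (s.natVar 2) := by
  simp [HExpr.level, HExpr.mass, HExpr.sel, HExpr.capped, HExpr.tail, HExpr.step, selected,
    Finset.sum_filter, massOf, FreeOrder.mass, FreeOrder.capped, FreeOrder.gridLevel, Oracle.tail]

theorem HExpr.eval_mix : HExpr.mix.eval O 12 s =
    FreeOrder.gridMix (massOf O s) (s.realVar 3) (s.natVar 4 * s.realVar 0)
      (s.realArr 5 (s.natVar 4)) := by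
  simp [HExpr.mix, HExpr.mass, HExpr.sel, HExpr.capped, HExpr.tail, HExpr.step, selected,
    Finset.sum_filter, massOf, FreeOrder.mass, FreeOrder.capped, FreeOrder.gridMix, Oracle.tail]

/-- The reward row of a box. -/
noncomputable def rowWOf (i j : ℕ) : ℝ :=
  if (s.natArr 2 i : ℝ) ≤ 0 then
    s.realArr 4 j * FreeOrder.mixed (FreeOrder.cappedVal O.tail O.mean (s.realVar 0) (s.natVar 2)
      (s.realArr 1) (s.realArr 8) i) (s.realArr 6 j) (s.realArr 5 j) (s.realVar 3)
  else FreeOrder.decW (FreeOrder.lowMean (O.tail i) (O.mean i) (s.natVar 2) (s.realArr 7 i))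
    (s.natArr 1 i) j

/-- The survival row of a box. -/
noncomputable def rowFOf (i j : ℕ) : ℝ :=
  if (s.natArr 2 i : ℝ) ≤ 0 then
    1 - ∑ t ∈ Finset.range (s.natVar 2), if (t : ℝ) ≤ j then
      s.realArr 4 t * FreeOrder.mixed (FreeOrder.capped (O.tail i) (O.mean i) (s.realVar 0)
        (s.realArr 1 i) (s.realArr 8 i)) (s.realArr 6 t) (s.realArr 5 t) (s.realVar 3) else 0
  else FreeOrder.decF (O.tail i) (s.natArr 1 i) (s.realArr 7 i) j

theorem HExpr.eval_lowMean (i d : ℕ) (θ : HExpr) (hi : i ≠ d) (hd : 12 ≤ d)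
    (hθ : ∀ t, θ.eval O (d + 1) (s.setNat d t) = θ.eval O d s) :
    (HExpr.lowMean i d θ).eval O d s = FreeOrder.lowMean (O.tail (s.natVar i))
      (O.mean (s.natVar i)) (s.natVar 2) (θ.eval O d s) := by
  have h2 : 2 ≠ d := by omega
  simp [HExpr.lowMean, HExpr.tail, FreeOrder.lowMean, Oracle.tail, hi, h2, hθ]

theorem HExpr.eval_rowW : ∀ s : State, (HExpr.rowW 12 13 14).eval O 14 s =
    rowWOf O s (s.natVar 12) (s.natVar 13) := by
  intro s
  have h := HExpr.eval_lowMean O s 12 14 (.rarr 7 12) (by norm_num) (by norm_num) (by simp)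
  simp [HExpr.rowW, HExpr.mixed, HExpr.cappedVal, HExpr.step, HExpr.eval_lowMean, rowWOf, h,
    FreeOrder.mixed, FreeOrder.cappedVal, FreeOrder.decW]

theorem HExpr.eval_rowF : ∀ s : State, (HExpr.rowF 14 13 15).eval O 15 s =
    rowFOf O s (s.natVar 14) (s.natVar 13) := by
  intro s
  simp [HExpr.rowF, HExpr.mixed, HExpr.capped, HExpr.step, HExpr.tail, rowFOf,
    FreeOrder.mixed, FreeOrder.capped, FreeOrder.decF, Oracle.tail]

theorem HExpr.eval_blend : HExpr.blend.eval O 12 s =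
    FreeOrder.blend (selected s) (s.natVar 2) (rowWOf O s) (rowFOf O s) := by
  have hW : ∀ i j, rowWOf O ((s.setNat 12 i).setNat 13 j) = rowWOf O s := fun i j => by
    funext a b; simp [rowWOf]
  have hF : ∀ i j l, rowFOf O (((s.setNat 12 i).setNat 13 j).setNat 14 l) = rowFOf O s :=
    fun i j l => by funext a b; simp [rowFOf]
  -- Folds of the language run over all boxes, so omitted boxes contribute the factor 1.
  have hprod : ∀ i j, ∏ l ∈ (selected s).erase i, rowFOf O s l j =
      ∏ l ∈ Finset.range (s.natVar 1), if (l : ℝ) ≤ i then if (i : ℝ) ≤ l then 1 else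
        if (s.natVar 6 : ℝ) ≤ s.realArr 2 l then rowFOf O s l j else 1 else
        if (s.natVar 6 : ℝ) ≤ s.realArr 2 l then rowFOf O s l j else 1 := by
    intro i j
    have : (selected s).erase i = (Finset.range (s.natVar 1)).filter fun l =>
        l ≠ i ∧ (s.natVar 6 : ℝ) ≤ s.realArr 2 l := by
      ext l; simp only [selected, Finset.mem_erase, Finset.mem_filter]; tauto
    rw [this, Finset.prod_filter]
    refine Finset.prod_congr rfl fun l _ => ?_
    simp only [Nat.cast_le]
    by_cases h1 : l ≤ i <;> by_cases h2 : i ≤ l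
    · have : l = i := le_antisymm h1 h2
      simp [this]
    all_goals
      have : l ≠ i := by omega
      simp [h1, h2, this]
  simp only [FreeOrder.blend, hprod]
  rw [selected, Finset.sum_filter]
  simp [HExpr.blend, HExpr.sel, HExpr.eval_rowW, HExpr.eval_rowF, hW, hF]

end Eval

end RealRAM

/-! ### Loop invariants and the text of the algorithm -/

namespace RealRAM

theorem iterate_natVar (f : State → State) (x : ℕ) (s : State) (k : ℕ) :
    (iterate f x s k).natVar x = k := by
  cases k <;> simp [iterate]

/-- Induction for counting loops. -/
theorem iterate_induction {f : State → State} {x : ℕ} {s : State} {N : ℕ}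
    (I : ℕ → State → Prop) (h0 : I 0 (s.setNat x 0))
    (step : ∀ k < N, ∀ t, t.natVar x = k → I k t → I (k + 1) ((f t).setNat x (k + 1))) :
    I N (iterate f x s N) := by
  have : ∀ k ≤ N, I k (iterate f x s k) := by
    intro k
    induction k with
    | zero => intro _; exact h0
    | succ k ih => intro hk; exact step k (by omega) _ (iterate_natVar f x s k) (ih (by omega))
  exact this N le_rfl

/-- The memories agree except for the natural variable `x` and the real array `a`. -/
structure Same (x a : ℕ) (s t : State) : Prop where
  natVar : ∀ y, y ≠ x → t.natVar y = s.natVar y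
  natArr : t.natArr = s.natArr
  realVar : t.realVar = s.realVar
  realArr : ∀ b, b ≠ a → t.realArr b = s.realArr b

namespace Prog

/-- Fills a real array. -/
def tabulate (x b a : ℕ) (e : HExpr) : Prog := .loop x b (.setRealArr a (.var x) e)

/-- The program without effect. -/
def nop : Prog := .setReal 7 (.real 7)

@[simp] theorem run_nop (O : Oracle) (D : ℕ) (s : State) : nop.run O D s = s := by
  simp [nop, run, State.setReal]

theorem run_tabulate (O : Oracle) (D : ℕ) {x b a : ℕ} {e : HExpr} {s : State} {v : ℕ → ℝ}
    (he : ∀ t k, k < s.natVar b → Same x a s t → t.natVar x = k → e.eval O D t = v k) :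
    ∀ k < s.natVar b, ((tabulate x b a e).run O D s).realArr a k = v k := by
  have := iterate_induction (f := (setRealArr a (.var x) e).run O D) (x := x) (s := s)
    (N := s.natVar b)
    (fun k t => Same x a s t ∧ ∀ l < k, t.realArr a l = v l)
    ⟨⟨fun y hy => by simp [hy], rfl, rfl, fun _ _ => rfl⟩, by simp⟩ (by
      intro k hk t hx ⟨hs, hv⟩
      refine ⟨⟨fun y hy => ?_, ?_, ?_, fun c hc => ?_⟩, fun l hl => ?_⟩
      · simp [run, hy, hs.natVar y hy]
      · simp [run, hs.natArr]
      · simp [run, hs.realVar]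
      · simp [run, hc, hs.realArr c hc]
      · simp only [run, NExpr.eval, hx, he t k hk hs hx, setNat_realArr, setRealArr_realArr,
          Function.update_self]
        by_cases hlk : l = k
        · simp [hlk]
        · rw [Function.update_of_ne hlk]; exact hv l (by omega))
  exact this.2

end Prog

/-! ### Preparing the tables -/

/-- The test for the scale of the slot weights. -/
def searchScale (M : ℕ) : Prog :=
  .loop 3 2 (.seq (.setReal 7 (.nat 3 * .real 0))
    (.ite (.const 1) (.admissible M) (.setReal 1 (.real 7)) .nop))

def quantileTables : Prog :=
  .seq (.tabulate 3 1 1 .quantile) (.seq (.tabulate 3 1 8 .coin) (.tabulate 3 1 2 .rank))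

def slotTables (M : ℕ) : Prog :=
  .seq (.tabulate 4 2 3 .geo) <| .seq (.tabulate 4 2 9 .cum) <| .seq (.setReal 8 .slots) <|
  .seq (.setReal 1 (.const 0)) <| .seq (searchScale M) (.tabulate 4 2 4 (.weight (.real 1) 4))

/-- Levels, mixtures and the value of the randomized policy. -/
def setup : Prog :=
  .seq (.setReal 2 .total) <| .seq (.setReal 3 .unit) <| .seq (.tabulate 4 2 5 .level) <|
  .seq (.tabulate 4 2 6 .mix) (.setReal 4 .blend)

/-- The window of admissible k has length 2J², enough for 2J consecutive blocks of J ranks. Once the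
success flag is set, the remaining iterations do nothing. -/
def inRange : HExpr :=
  .ite (.nat 7) (.const 0) (.ite (.real 8 * .real 8 + .const 1) (.nat 5)
    (.ite (.nat 5) (.const 3 * (.real 8 * .real 8) + .const 1) (.const 1) (.const 0)) (.const 0))
    (.const 0)

/-- The search for a good number of removed boxes. -/
def search : Prog :=
  .loop 5 1 (.ite (.const 1) inRange
    (.seq (.setNat 6 (.var 5)) (.seq setup
      (.ite (.const 1) .good (.setNat 7 (.const 1)) .nop))) .nop)

def tryThreshold (e : HExpr) : Prog :=
  .seq (.setRealArr 7 (.var 3) e) <| .seq (.setReal 7 .blend) <|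
  .ite (.real 7) (.real 5) .nop <| .seq (.setReal 5 (.real 7)) <| .seq (.setNat 9 (.var 4))
    (.setReal 6 (.rarr 7 3))

/-- All choices of the coins for box `3` in slot `4`. -/
def tryAll : Prog :=
  .seq (.setNatArr 1 (.var 3) (.var 4)) <|
    .seq (tryThreshold (.max (.rarr 5 4) (.rarr 1 3))) <|
    .seq (tryThreshold (.max (.rarr 5 4) (.rarr 1 3 - .step 3))) <|
    .seq (tryThreshold (.max (.rarr 5 4 - .real 3) (.rarr 1 3)))
      (tryThreshold (.max (.rarr 5 4 - .real 3) (.rarr 1 3 - .step 3)))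

/-- The search over choices starts from skipping the box (slot B, threshold 0), so a best candidate
exists from the beginning and the leftover weight of the mixture is covered. -/
def decideBox : Prog :=
  .seq (.setNatArr 2 (.var 3) (.const 1)) <| .seq (.setNatArr 1 (.var 3) (.var 2)) <|
  .seq (.setRealArr 7 (.var 3) (.const 0)) <| .seq (.setReal 5 .blend) <|
  .seq (.setNat 9 (.var 2)) <| .seq (.setReal 6 (.const 0)) <|
  .seq (.loop 4 2 tryAll) <|
  .seq (.setNatArr 1 (.var 3) (.var 9)) (.setRealArr 7 (.var 3) (.real 6))

def decideAll : Prog := .loop 3 1 decideBox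

/-- If the search failed, then a box of large quantile is put in front. -/
def rescue : Prog :=
  .ite (.const 1) (.nat 7) .nop
    (.loop 3 1 (.ite (.const 1)
      (.ite (.rarr 2 3) (.real 8 * .real 8) (.ite (.real 8 * .real 8) (.rarr 2 3)
        (.const 1) (.const 0)) (.const 0))
      -- Raising its rank to n brings the box of rank J² back into the instance; slot 0 puts it in
      -- front, since all other boxes are moved to slot B.
      (.seq (.setRealArr 2 (.var 3) (.nat 1)) <| .seq (.setNatArr 1 (.var 3) (.const 0))
        (.setRealArr 7 (.var 3) (.const 0)))
      (.setNatArr 1 (.var 3) (.var 2))))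

/-- Writes the boxes of a slot to the output. -/
def emitSlot : Prog :=
  .loop 3 1 (.ite (.const 1)
    (.sel 3 (.ite (.narr 1 3) (.nat 4) (.ite (.nat 4) (.narr 1 3) (.const 1) (.const 0)) (.const 0))
      (.const 0))
    (.seq (.setNatArr 0 (.var 0) (.var 3)) <| .seq (.setRealArr 0 (.var 0) (.rarr 7 3))
      (.setNat 0 (.add (.var 0) (.const 1))))
    .nop)

/-- The loop covers the slots below B. Slot B needs a pass of its own, since skipped boxes still
belong to the ordering. -/
def emit : Prog := .seq (.loop 4 2 emitSlot) (.seq (.setNat 4 (.var 2)) emitSlot)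

/-- With at most 3J² + 1 + J boxes everything is removed and the output is empty. Otherwise rank k +
J exists for every k of the window. -/
def main (M : ℕ) : Prog :=
  .seq quantileTables <| .seq (slotTables M) <| .seq (.setNat 0 (.const 0)) <|
  .seq (.setNat 7 (.const 0)) <|
  .ite (.nat 1) (.const 3 * (.real 8 * .real 8) + .const 1 + .real 8) .nop <|
  .seq search <| .seq decideAll <| .seq rescue emit

/-- Here 12 and 9 are the first natural and the first real variable that are left to the compiler as
scratch space. -/
theorem main_ok (M : ℕ) : (main M).ok 12 9 = true := by rfl


end RealRAM

/-! ### Correctness of the tables -/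

namespace RealRAM

/-- The number of boxes with a larger quantile, where ties are broken by the index. -/
noncomputable def rankOf (q : ℕ → ℝ) (n i : ℕ) : ℝ :=
  ∑ l ∈ Finset.range n, if q l ≤ q i then if q i ≤ q l then if (i : ℝ) ≤ l then 0 else 1 else 0
    else 1

/-- The weight of slot `j` if there are `J` slots. -/
noncomputable def slotWeightOf (ε κ : ℝ) (J j : ℕ) : ℝ :=
  if j = 0 then 0 else if j < J then FreeOrder.slotWeight ε κ j else 0

section Tables

variable (O : Oracle) (s : State)

theorem quantileTables_spec :
    (∀ i < s.natVar 1, (quantileTables.run O 12 s).realArr 1 i =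
      FreeOrder.quantile (O.tail i) (O.mean i) (s.realVar 0) (s.natVar 2)) ∧
    (∀ i < s.natVar 1, (quantileTables.run O 12 s).realArr 8 i =
      FreeOrder.coin (O.tail i) (O.mean i) (s.realVar 0)
        ((quantileTables.run O 12 s).realArr 1 i)) ∧
    ∀ i < s.natVar 1, (quantileTables.run O 12 s).realArr 2 i =
      rankOf ((quantileTables.run O 12 s).realArr 1) (s.natVar 1) i := by
  set p₁ : Prog := .tabulate 3 1 1 .quantile with hp₁
  set p₂ : Prog := .tabulate 3 1 8 .coin with hp₂
  set p₃ : Prog := .tabulate 3 1 2 .rank with hp₃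
  set s₁ := p₁.run O 12 s with hs₁
  set s₂ := p₂.run O 12 s₁ with hs₂
  have e : quantileTables.run O 12 s = p₃.run O 12 s₂ := rfl
  have n₁ : s₁.natVar 1 = s.natVar 1 := p₁.run_natVar O 12 rfl s
  have n₂ : s₂.natVar 1 = s.natVar 1 := (p₂.run_natVar O 12 rfl s₁).trans n₁
  have r₁ : s₁.realVar 0 = s.realVar 0 := p₁.run_realVar O 12 rfl s
  have q₂ : s₂.realArr 1 = s₁.realArr 1 := p₂.run_realArr O 12 rfl s₁
  have q₃ : (p₃.run O 12 s₂).realArr 1 = s₁.realArr 1 := (p₃.run_realArr O 12 rfl s₂).trans q₂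
  have c₃ : (p₃.run O 12 s₂).realArr 8 = s₂.realArr 8 := p₃.run_realArr O 12 rfl s₂
  rw [e, q₃, c₃]
  refine ⟨Prog.run_tabulate O 12 fun t k _ ht hk => ?_, ?_, ?_⟩
  · rw [HExpr.eval_quantile, hk, ht.realVar, ht.natVar 2 (by decide)]
  · rw [← n₁]
    refine Prog.run_tabulate O 12 fun t k _ ht hk => ?_
    rw [HExpr.eval_coin, hk, ht.realVar, ht.realArr 1 (by decide), r₁]
  · rw [← n₂]
    refine Prog.run_tabulate O 12 fun t k _ ht hk => ?_
    simp [HExpr.rank, rankOf, hk, ht.natVar 1 (by decide), ht.realArr 1 (by decide), q₂]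

/-- The ranges of folds are fixed variables, so a power is computed as a product over the whole grid
with trailing factors 1. -/
theorem prod_ite_eq_geo (ε : ℝ) {B j : ℕ} (hj : j ≤ B) :
    ∏ g ∈ Finset.range B, (if j ≤ g then (1 : ℝ) else 1 / (1 + ε)) = FreeOrder.geo ε j := by
  have h1 : ∀ g ∈ Finset.range B, (if j ≤ g then (1 : ℝ) else 1 / (1 + ε)) =
      if g < j then 1 / (1 + ε) else 1 := by
    intro g _
    by_cases h : j ≤ g
    · simp [h]
    · simp [h, not_le.1 h]
  rw [Finset.prod_congr rfl h1, ← Finset.prod_filter, Finset.prod_const, FreeOrder.geo]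
  congr 1
  have : (Finset.range B).filter (· < j) = Finset.range j := by
    ext g; simp only [Finset.mem_filter, Finset.mem_range]; omega
  rw [this, Finset.card_range]

theorem sum_ite_le {f : ℕ → ℝ} {B j : ℕ} (hj : j ≤ B) :
    ∑ g ∈ Finset.range B, (if j ≤ g then (0 : ℝ) else f g) = ∑ g ∈ Finset.range j, f g := by
  have h1 : ∀ g ∈ Finset.range B, (if j ≤ g then (0 : ℝ) else f g) = if g < j then f g else 0 := by
    intro g _
    by_cases h : j ≤ g
    · simp [h]
    · simp [h, not_le.1 h]
  rw [Finset.sum_congr rfl h1, ← Finset.sum_filter]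
  congr 1
  ext g; simp only [Finset.mem_filter, Finset.mem_range]; omega

/-- The conditions on the scale of the slot weights. -/
def Admissible (M : ℕ) (ε : ℝ) (J : ℕ) (κ : ℝ) : Prop :=
  κ ≤ 1 ∧ ∑ j ∈ Finset.range J, slotWeightOf ε κ J j ≤ 1 ∧ 1 ≤ M * FreeOrder.surv ε κ J

theorem sum_slotWeightOf (ε κ : ℝ) {B J : ℕ} (hJ : J ≤ B) :
    ∑ j ∈ Finset.range B, slotWeightOf ε κ J j = ∑ j ∈ Finset.range J, slotWeightOf ε κ J j := by
  symm
  refine Finset.sum_subset (fun j => by simp only [Finset.mem_range]; omega) fun j _ hj => ?_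
  have : ¬ j < J := by simpa using hj
  simp [slotWeightOf, this]

/-- The geometric grid is tabulated and `J` is the number of slots. -/
structure GridReady (s : State) (J : ℕ) : Prop where
  le : J ≤ s.natVar 2
  slots : s.realVar 8 = J
  geo : ∀ j < s.natVar 2, s.realArr 3 j = FreeOrder.geo (s.realVar 0) j
  cum : ∀ j < s.natVar 2, s.realArr 9 j =
    ∑ l ∈ Finset.range j, FreeOrder.geoGap (s.realVar 0) l * (l * s.realVar 0)

theorem GridReady.eval_weight {s : State} {J : ℕ} (h : GridReady s J) {d x : ℕ} (κ : HExpr)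
    (hx : s.natVar x < s.natVar 2) : (HExpr.weight κ x).eval O d s =
      slotWeightOf (s.realVar 0) (κ.eval O d s) J (s.natVar x) := by
  have h3 := h.geo _ hx
  have h9 := h.cum _ hx
  simp only [HExpr.weight, HExpr.gap, HExpr.surv, HExpr.eval_ite, HExpr.eval_nat,
    HExpr.eval_const, HExpr.eval_real, HExpr.eval_div, HExpr.eval_mul, HExpr.eval_sub,
    HExpr.eval_add, HExpr.eval_rarr, h3, h9, h.slots, slotWeightOf, FreeOrder.slotWeight,
    FreeOrder.surv, FreeOrder.geoGap, Nat.cast_le, Nat.cast_zero, Nat.cast_one, Nat.cast_ofNat]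
  by_cases h0 : s.natVar x = 0
  · simp [h0]
  · rw [if_neg (by simpa using h0), if_neg h0]
    by_cases h1 : J ≤ s.natVar x
    · rw [if_pos h1, if_neg (not_lt.2 h1)]
    · rw [if_neg h1, if_pos (not_le.1 h1)]

theorem GridReady.congr {s t : State} {J : ℕ} (h : GridReady s J)
    (h2 : t.natVar 2 = s.natVar 2) (h0 : t.realVar 0 = s.realVar 0)
    (h8 : t.realVar 8 = s.realVar 8)
    (h3 : t.realArr 3 = s.realArr 3) (h9 : t.realArr 9 = s.realArr 9) : GridReady t J := by
  refine ⟨?_, ?_, ?_, ?_⟩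
  · rw [h2]; exact h.le
  · rw [h8]; exact h.slots
  · rw [h2, h3, h0]; exact h.geo
  · rw [h2, h9, h0]; exact h.cum

theorem GridReady.eval_admissible {s : State} {J : ℕ} (h : GridReady s J) (M : ℕ) :
    1 ≤ (HExpr.admissible M).eval O 12 s ↔ Admissible M (s.realVar 0) J (s.realVar 7) := by
  have hw : ∀ k ∈ Finset.range (s.natVar 2), (HExpr.weight (.real 7) 12).eval O 13 (s.setNat 12 k) =
      slotWeightOf (s.realVar 0) (s.realVar 7) J k := by
    intro k hk
    have := GridReady.eval_weight O (h.congr (t := s.setNat 12 k) rfl rfl rfl rfl rfl) (d := 13)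
      (x := 12) (.real 7) (by simpa using hk)
    simpa using this
  have hc : HExpr.cumEnd.eval O 12 s =
      ∑ l ∈ Finset.range J, FreeOrder.geoGap (s.realVar 0) l * (l * s.realVar 0) := by
    rw [← sum_ite_le h.le]
    simp only [HExpr.cumEnd, HExpr.gap, HExpr.eval_sum]
    refine Finset.sum_congr rfl fun k hk => ?_
    have := h.geo k (Finset.mem_range.1 hk)
    simp [h.slots, this, FreeOrder.geoGap]
  have hs : (HExpr.surv (.real 7) .cumEnd).eval O 12 s =
      FreeOrder.surv (s.realVar 0) (s.realVar 7) J := by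
    simp [HExpr.surv, hc, FreeOrder.surv]
  simp only [HExpr.admissible, HExpr.eval_ite, HExpr.eval_sum, Finset.sum_congr rfl hw,
    HExpr.eval_mul, hs, HExpr.eval_const, HExpr.eval_real, Nat.cast_one, Nat.cast_zero,
    sum_slotWeightOf _ _ h.le, Admissible]
  split_ifs with h1 h2 h3
  · simp [h1, h2, h3]
  · simp [h3]
  · simp [h2]
  · simp [h1]

end Tables

end RealRAM

namespace RealRAM

namespace Prog

theorem run_seq (O : Oracle) (D : ℕ) (p q : Prog) (s : State) :
    (seq p q).run O D s = q.run O D (p.run O D s) := rfl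

theorem run_ite_pos {O : Oracle} {D : ℕ} {e f : HExpr} {s : State} (p q : Prog)
    (h : e.eval O D s ≤ f.eval O D s) : (ite e f p q).run O D s = p.run O D s := if_pos h

theorem run_ite_neg {O : Oracle} {D : ℕ} {e f : HExpr} {s : State} (p q : Prog)
    (h : ¬ e.eval O D s ≤ f.eval O D s) : (ite e f p q).run O D s = q.run O D s := if_neg h

end Prog

section Tables

variable (O : Oracle) (s : State)

/-- Candidates are tried in increasing order, so the last admissible one is the largest; no
monotonicity of admissibility is needed. The starting value 0 is admissible because it leaves
survival equal to 1. -/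
theorem searchScale_spec {J M : ℕ} (h : GridReady s J) (hκ : s.realVar 1 = 0) (hM : 1 ≤ M) :
    0 ≤ s.realVar 0 → 0 ≤ ((searchScale M).run O 12 s).realVar 1 ∧
      Admissible M (s.realVar 0) J (((searchScale M).run O 12 s).realVar 1) ∧
      ∀ i < s.natVar 2, Admissible M (s.realVar 0) J (i * s.realVar 0) →
        i * s.realVar 0 ≤ ((searchScale M).run O 12 s).realVar 1 := by
  intro hε
  have := iterate_induction
    (f := (Prog.seq (.setReal 7 (.nat 3 * .real 0))
      (.ite (.const 1) (.admissible M) (.setReal 1 (.real 7)) .nop)).run O 12) (x := 3) (s := s)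
    (N := s.natVar 2)
    (fun k t => (t.natVar 2 = s.natVar 2 ∧ t.realVar 0 = s.realVar 0 ∧
      t.realVar 8 = s.realVar 8 ∧ t.realArr 3 = s.realArr 3 ∧ t.realArr 9 = s.realArr 9) ∧
      0 ≤ t.realVar 1 ∧ Admissible M (s.realVar 0) J (t.realVar 1) ∧
      ∀ i < k, Admissible M (s.realVar 0) J (i * s.realVar 0) → i * s.realVar 0 ≤ t.realVar 1)
    ?_ ?_
  · exact this.2
  · refine ⟨⟨by simp, rfl, rfl, rfl, rfl⟩, by simp [hκ], ?_, by simp⟩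
    have hM' : (1 : ℝ) ≤ M := by exact_mod_cast hM
    simp [hκ, Admissible, FreeOrder.surv, hM', slotWeightOf, FreeOrder.slotWeight]
  · intro k hk t hx ⟨⟨f2, f0, f8, f3, f9⟩, h0, ha, hm⟩
    set t' := t.setReal 7 (k * s.realVar 0) with ht'
    have e1 : (Prog.setReal 7 (.nat 3 * .real 0)).run O 12 t = t' := by
      simp [Prog.run, hx, f0, ht']
    have hg : GridReady t' J := h.congr f2 f0 f8 f3 f9
    have e2 : (1 : ℝ) ≤ (HExpr.admissible M).eval O 12 t' ↔
        Admissible M (s.realVar 0) J (k * s.realVar 0) := by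
      rw [hg.eval_admissible O M]
      simp [ht', f0]
    rw [Prog.run_seq, e1]
    by_cases hc : Admissible M (s.realVar 0) J (k * s.realVar 0)
    · rw [Prog.run_ite_pos _ _ (by rw [HExpr.eval_const, Nat.cast_one]; exact e2.2 hc)]
      refine ⟨⟨by simp [ht', Prog.run, f2], by simp [ht', Prog.run, f0],
        by simp [ht', Prog.run, f8], by simp [ht', Prog.run, f3],
        by simp [ht', Prog.run, f9]⟩, ?_, by simpa [ht', Prog.run] using hc, fun i hi _ => ?_⟩
      · simp only [ht', Prog.run]; simp; positivity
      · simp only [ht', Prog.run]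
        simp
        have : (i : ℝ) ≤ k := by exact_mod_cast Nat.lt_succ_iff.1 hi
        exact mul_le_mul_of_nonneg_right this hε
    · rw [Prog.run_ite_neg _ _ (by rw [HExpr.eval_const, Nat.cast_one]; exact fun h => hc (e2.1 h)),
        Prog.run_nop]
      refine ⟨⟨by simp [ht', f2], by simp [ht', f0], by simp [ht', f8], by simp [ht', f3],
        by simp [ht', f9]⟩, by simpa [ht'] using h0, by simpa [ht'] using ha, fun i hi hi' => ?_⟩
      rcases Nat.lt_succ_iff_lt_or_eq.1 hi with h | rfl
      · simpa [ht'] using hm i h hi'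
      · exact absurd hi' hc

theorem slotTables_spec {M : ℕ} (hM : 1 ≤ M) (hε : 0 < s.realVar 0) (hε1 : s.realVar 0 < 1) {g₀ : ℕ}
    (hg : g₀ < s.natVar 2) (hg' : FreeOrder.geo (s.realVar 0) g₀ ≤ s.realVar 0 ^ 2) :
    ∃ (k : ℕ) (κ : ℝ), s.realVar 0 ^ 2 < FreeOrder.geo (s.realVar 0) k ∧
      FreeOrder.geo (s.realVar 0) (k + 1) ≤ s.realVar 0 ^ 2 ∧ k + 1 ≤ s.natVar 2 ∧
      ((slotTables M).run O 12 s).realVar 8 = (k + 1 : ℕ) ∧ 0 ≤ κ ∧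
      Admissible M (s.realVar 0) (k + 1) κ ∧
      (∀ i < s.natVar 2, Admissible M (s.realVar 0) (k + 1) (i * s.realVar 0) →
        i * s.realVar 0 ≤ κ) ∧
      ∀ j < s.natVar 2, ((slotTables M).run O 12 s).realArr 4 j =
        slotWeightOf (s.realVar 0) κ (k + 1) j := by
  set ε := s.realVar 0 with hεdef
  set B := s.natVar 2 with hB
  set p₁ : Prog := .tabulate 4 2 3 .geo with hp₁
  set p₂ : Prog := .tabulate 4 2 9 .cum with hp₂
  set p₃ : Prog := .setReal 8 .slots with hp₃
  set p₄ : Prog := .setReal 1 (.const 0) with hp₄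
  set p₅ : Prog := searchScale M with hp₅
  set p₆ : Prog := .tabulate 4 2 4 (.weight (.real 1) 4) with hp₆
  set s₁ := p₁.run O 12 s with hs₁
  set s₂ := p₂.run O 12 s₁ with hs₂
  set s₃ := p₃.run O 12 s₂ with hs₃
  set s₄ := p₄.run O 12 s₃ with hs₄
  set s₅ := p₅.run O 12 s₄ with hs₅
  have e : (slotTables M).run O 12 s = p₆.run O 12 s₅ := rfl
  rw [e]
  have b₁ : s₁.natVar 2 = B := p₁.run_natVar O 12 rfl s
  have b₂ : s₂.natVar 2 = B := (p₂.run_natVar O 12 rfl s₁).trans b₁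
  have b₄ : s₄.natVar 2 = B := b₂
  have b₅ : s₅.natVar 2 = B := (p₅.run_natVar O 12 rfl s₄).trans b₄
  have ε₁ : s₁.realVar 0 = ε := p₁.run_realVar O 12 rfl s
  have ε₂ : s₂.realVar 0 = ε := (p₂.run_realVar O 12 rfl s₁).trans ε₁
  have ε₃ : s₃.realVar 0 = ε := (p₃.run_realVar O 12 rfl s₂).trans ε₂
  have ε₄ : s₄.realVar 0 = ε := (p₄.run_realVar O 12 rfl s₃).trans ε₃
  have ε₅ : s₅.realVar 0 = ε := (p₅.run_realVar O 12 rfl s₄).trans ε₄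
  have g₁ : ∀ j < B, s₁.realArr 3 j = FreeOrder.geo ε j := by
    refine Prog.run_tabulate O 12 fun t k hk ht hk' => ?_
    rw [← prod_ite_eq_geo ε hk.le]
    simp [HExpr.geo, hk', ht.natVar 2 (by decide), ht.realVar, hεdef]
  have g₂ : s₂.realArr 3 = s₁.realArr 3 := p₂.run_realArr O 12 rfl s₁
  have c₂ : ∀ j < B, s₂.realArr 9 j =
      ∑ l ∈ Finset.range j, FreeOrder.geoGap ε l * (l * ε) := by
    rw [← b₁]
    refine Prog.run_tabulate O 12 fun t k hk ht hk' => ?_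
    rw [b₁] at hk
    rw [← sum_ite_le hk.le]
    simp only [HExpr.cum, HExpr.gap, HExpr.eval_sum, ht.natVar 2 (by decide), b₁]
    refine Finset.sum_congr rfl fun l hl => ?_
    have := g₁ l (Finset.mem_range.1 hl)
    simp [hk', ht.realVar, ht.realArr 3 (by decide), ε₁, this, FreeOrder.geoGap]
  obtain ⟨N, n1, n2, n3, n4⟩ := FreeOrder.exists_count (FreeOrder.geo_antitone hε) hg hg'
  -- Since `geo ε 0` is 1 and exceeds ε², there is at least one slot, so k can be the number of
  -- slots minus 1.
  have hN : N ≠ 0 := by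
    rintro rfl
    rw [FreeOrder.geo_zero] at n3
    nlinarith
  obtain ⟨k, rfl⟩ : ∃ k, N = k + 1 := ⟨N - 1, by omega⟩
  have j₃ : s₃.realVar 8 = (k + 1 : ℕ) := by
    rw [← n1]
    simp only [hs₃, hp₃, Prog.run, setReal_realVar, Function.update_self, HExpr.slots,
      HExpr.eval_sum, b₂]
    refine Finset.sum_congr rfl fun l hl => ?_
    simp [ε₂, g₂, g₁ l (Finset.mem_range.1 hl), pow_two]
  have r₄ : GridReady s₄ (k + 1) := by
    refine ⟨?_, j₃, ?_, ?_⟩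
    · rw [b₄]; omega
    · rw [b₄, ε₄]
      have : s₄.realArr 3 = s₁.realArr 3 := g₂
      rw [this]; exact g₁
    · rw [b₄, ε₄]; exact c₂
  have k₄ : s₄.realVar 1 = 0 := by simp [hs₄, hp₄, Prog.run]
  obtain ⟨k0, k1, k2⟩ := searchScale_spec O s₄ r₄ k₄ hM (by rw [ε₄]; exact hε.le)
  rw [ε₄] at k1 k2
  rw [b₄] at k2
  have r₅ : GridReady s₅ (k + 1) := r₄.congr (b₅.trans b₄.symm) (ε₅.trans ε₄.symm)
    (p₅.run_realVar O 12 rfl s₄) (p₅.run_realArr O 12 rfl s₄) (p₅.run_realArr O 12 rfl s₄)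
  refine ⟨k, s₅.realVar 1, n4 k (by omega), n3, by omega, ?_, k0, k1, k2, ?_⟩
  · rw [← j₃]
    exact (p₆.run_realVar O 12 rfl s₅).trans (p₅.run_realVar O 12 rfl s₄)
  · rw [← b₅]
    refine Prog.run_tabulate O 12 fun t j hj ht hj' => ?_
    have r : GridReady t (k + 1) := r₅.congr (ht.natVar 2 (by decide)) (by rw [ht.realVar])
      (by rw [ht.realVar]) (ht.realArr 3 (by decide)) (ht.realArr 9 (by decide))
    rw [r.eval_weight O (.real 1) (by rw [hj', ht.natVar 2 (by decide)]; exact hj), hj', ht.realVar,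
      ε₅, HExpr.eval_real, ht.realVar]

end Tables

end RealRAM

/-! ### The search for the number of removed boxes -/

namespace RealRAM

section Search

variable (O : Oracle)

/-- The value of the partially randomized policy. -/
noncomputable def valueOf (s : State) : ℝ :=
  FreeOrder.blend (selected s) (s.natVar 2) (rowWOf O s) (rowFOf O s)

/-- The parts of the memory that determine the instance. -/
structure SameInstance (s t : State) : Prop where
  n : t.natVar 1 = s.natVar 1
  grid : t.natVar 2 = s.natVar 2
  removed : t.natVar 6 = s.natVar 6
  eps : t.realVar 0 = s.realVar 0
  quant : t.realArr 1 = s.realArr 1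
  rank : t.realArr 2 = s.realArr 2
  coin : t.realArr 8 = s.realArr 8

theorem SameInstance.selected {s t : State} (h : SameInstance s t) : selected t = selected s := by
  simp [RealRAM.selected, h.n, h.removed, h.rank]

theorem SameInstance.massOf {s t : State} (h : SameInstance s t) :
    massOf O t = massOf O s := by
  simp [RealRAM.massOf, h.selected, h.eps, h.quant, h.coin]

/-- The parts of the memory that determine the randomized policy. -/
structure SamePolicy (s t : State) : Prop extends SameInstance s t where
  unit : t.realVar 3 = s.realVar 3
  weight : t.realArr 4 = s.realArr 4
  level : t.realArr 5 = s.realArr 5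
  mix : t.realArr 6 = s.realArr 6

theorem valueOf_congr {s t : State} (h : SamePolicy s t) (h1 : t.natArr 1 = s.natArr 1)
    (h2 : t.natArr 2 = s.natArr 2) (h7 : t.realArr 7 = s.realArr 7) :
    valueOf O t = valueOf O s := by
  have hW : rowWOf O t = rowWOf O s := by
    funext i j
    simp [rowWOf, h1, h2, h7, h.grid, h.eps, h.quant, h.coin, h.unit, h.weight, h.level, h.mix]
  have hF : rowFOf O t = rowFOf O s := by
    funext i j
    simp [rowFOf, h1, h2, h7, h.grid, h.eps, h.quant, h.coin, h.unit, h.weight, h.level, h.mix]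
  rw [valueOf, valueOf, hW, hF, h.grid, h.selected]

/-- Levels and mixtures are tabulated. -/
structure Ready (s : State) : Prop where
  unit : s.realVar 3 = s.realVar 0 * (∑ i ∈ selected s, O.mean i) / s.natVar 1
  level : ∀ j < s.natVar 2, s.realArr 5 j =
    FreeOrder.gridLevel (massOf O s) (s.realVar 3) (j * s.realVar 0) (s.natVar 2)
  mix : ∀ j < s.natVar 2, s.realArr 6 j =
    FreeOrder.gridMix (massOf O s) (s.realVar 3) (j * s.realVar 0) (s.realArr 5 j)

variable {O} in
theorem Ready.congr {s t : State} (hs : Ready O s) (h : SamePolicy s t) : Ready O t := by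
  refine ⟨?_, ?_, ?_⟩
  · rw [h.unit, h.eps, h.selected, h.n, hs.unit]
  · rw [h.grid, h.level, h.massOf, h.unit, h.eps]; exact hs.level
  · rw [h.grid, h.level, h.massOf, h.unit, h.eps, h.mix]; exact hs.mix

theorem setup_spec (s : State) : Ready O (setup.run O 12 s) ∧
    (setup.run O 12 s).realVar 4 = valueOf O (setup.run O 12 s) := by
  set p₁ : Prog := .setReal 2 .total with hp₁
  set p₂ : Prog := .setReal 3 .unit with hp₂
  set p₃ : Prog := .tabulate 4 2 5 .level with hp₃
  set p₄ : Prog := .tabulate 4 2 6 .mix with hp₄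
  set p₅ : Prog := .setReal 4 .blend with hp₅
  set s₁ := p₁.run O 12 s with hs₁
  set s₂ := p₂.run O 12 s₁ with hs₂
  set s₃ := p₃.run O 12 s₂ with hs₃
  set s₄ := p₄.run O 12 s₃ with hs₄
  have e : setup.run O 12 s = p₅.run O 12 s₄ := rfl
  have i₁ : SameInstance s s₁ := ⟨rfl, rfl, rfl, rfl, rfl, rfl, rfl⟩
  have i₂ : SameInstance s s₂ := ⟨rfl, rfl, rfl, rfl, rfl, rfl, rfl⟩
  have hfr : ∀ (p : Prog) (s : State), p.writes (.natVar 1) = false → p.writes (.natVar 2) = false →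
      p.writes (.natVar 6) = false → p.writes (.realVar 0) = false →
      p.writes (.realArr 1) = false → p.writes (.realArr 2) = false →
      p.writes (.realArr 8) = false → SameInstance s (p.run O 12 s) :=
    fun p s a b c d e f g => ⟨p.run_natVar O 12 a s, p.run_natVar O 12 b s, p.run_natVar O 12 c s,
      p.run_realVar O 12 d s, p.run_realArr O 12 e s, p.run_realArr O 12 f s,
      p.run_realArr O 12 g s⟩
  have i₃ : SameInstance s₂ s₃ := hfr p₃ s₂ rfl rfl rfl rfl rfl rfl rfl
  have i₄ : SameInstance s₃ s₄ := hfr p₄ s₃ rfl rfl rfl rfl rfl rfl rfl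
  have u₂ : s₂.realVar 3 = s₂.realVar 0 * (∑ i ∈ selected s₂, O.mean i) / s₂.natVar 1 := by
    rw [i₂.selected]
    simp [hs₂, hp₂, hs₁, hp₁, Prog.run, HExpr.unit, HExpr.eval_total]
  have u₃ : s₃.realVar 3 = s₂.realVar 3 := p₃.run_realVar O 12 rfl s₂
  have u₄ : s₄.realVar 3 = s₃.realVar 3 := p₄.run_realVar O 12 rfl s₃
  have l₃ : ∀ j < s₃.natVar 2, s₃.realArr 5 j =
      FreeOrder.gridLevel (massOf O s₃) (s₃.realVar 3) (j * s₃.realVar 0) (s₃.natVar 2) := by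
    rw [i₃.massOf, u₃, i₃.grid, i₃.eps]
    refine Prog.run_tabulate O 12 fun t k hk ht hk' => ?_
    have it : SameInstance s₂ t := ⟨ht.natVar 1 (by decide), ht.natVar 2 (by decide),
      ht.natVar 6 (by decide), by rw [ht.realVar], ht.realArr 1 (by decide),
      ht.realArr 2 (by decide), ht.realArr 8 (by decide)⟩
    rw [HExpr.eval_level, it.massOf, it.eps, it.grid, hk', ht.realVar]
  have m₄ : ∀ j < s₃.natVar 2, s₄.realArr 6 j =
      FreeOrder.gridMix (massOf O s₃) (s₃.realVar 3) (j * s₃.realVar 0) (s₃.realArr 5 j) := by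
    refine Prog.run_tabulate O 12 fun t k hk ht hk' => ?_
    have it : SameInstance s₃ t := ⟨ht.natVar 1 (by decide), ht.natVar 2 (by decide),
      ht.natVar 6 (by decide), by rw [ht.realVar], ht.realArr 1 (by decide),
      ht.realArr 2 (by decide), ht.realArr 8 (by decide)⟩
    rw [HExpr.eval_mix, it.massOf, it.eps, hk', ht.realVar, ht.realArr 5 (by decide)]
  have l₄ : s₄.realArr 5 = s₃.realArr 5 := p₄.run_realArr O 12 rfl s₃
  have r₄ : Ready O s₄ := by
    refine ⟨?_, ?_, ?_⟩
    · rw [u₄, u₃, i₄.eps, i₃.eps, i₄.selected, i₃.selected, i₄.n, i₃.n, u₂]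
    · rw [i₄.grid, l₄, i₄.massOf, u₄, i₄.eps]; exact l₃
    · rw [i₄.grid, l₄, i₄.massOf, u₄, i₄.eps]; exact m₄
  have c : SamePolicy s₄ (p₅.run O 12 s₄) := ⟨⟨rfl, rfl, rfl, rfl, rfl, rfl, rfl⟩, rfl, rfl, rfl, rfl⟩
  rw [e]
  refine ⟨r₄.congr c, ?_⟩
  rw [valueOf_congr O c rfl rfl rfl, valueOf, ← HExpr.eval_blend]
  simp [hp₅, Prog.run]

/-- The quantile of the box of rank `k`. -/
noncomputable def quantAtOf (q rk : ℕ → ℝ) (n k : ℕ) : ℝ :=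
  ∑ i ∈ Finset.range n, if rk i ≤ k then if (k : ℝ) ≤ rk i then q i else 0 else 0

theorem eval_quantAt (s : State) {e : HExpr} {r : ℕ} (he : ∀ t, e.eval O 13 (s.setNat 12 t) = r) :
    (HExpr.quantAt e).eval O 12 s =
      quantAtOf (s.realArr 1) (s.realArr 2) (s.natVar 1) (s.natVar 6 + r) := by
  simp [HExpr.quantAt, quantAtOf, he]

/-- The quantiles decrease slowly after rank `k`. -/
def Flat (q rk : ℕ → ℝ) (n J : ℕ) (ε : ℝ) (k : ℕ) : Prop :=
  quantAtOf q rk n k ≤ (1 + ε) * quantAtOf q rk n (k + J)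

/-- The quantile of rank `k` is small compared to `G`. -/
def Rich (q rk : ℕ → ℝ) (n : ℕ) (ε G : ℝ) (k : ℕ) : Prop :=
  quantAtOf q rk n k ≤ ε * G

theorem eval_good {s : State} {J : ℕ} (hJ : s.realVar 8 = J) : 1 ≤ HExpr.good.eval O 12 s ↔
    Flat (s.realArr 1) (s.realArr 2) (s.natVar 1) J (s.realVar 0) (s.natVar 6) ∨
      Rich (s.realArr 1) (s.realArr 2) (s.natVar 1) (s.realVar 0) (s.realVar 4) (s.natVar 6) := by
  have h0 := eval_quantAt O s (e := .const 0) (r := 0) (by simp)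
  have hJ' := eval_quantAt O s (e := .real 8) (r := J) (by simp [hJ])
  simp only [HExpr.good, HExpr.eval_ite, h0, hJ', HExpr.eval_mul, HExpr.eval_add, HExpr.eval_const,
    HExpr.eval_real, Nat.cast_one, Nat.cast_zero, add_zero, Flat, Rich]
  split_ifs with h1 h2
  · simp [h1]
  · simp [h2]
  · simp [h1, h2]

theorem eval_inRange {s : State} {J : ℕ} (hJ : s.realVar 8 = J) :
    1 ≤ inRange.eval O 12 s ↔
      s.natVar 7 = 0 ∧ J ^ 2 + 1 ≤ s.natVar 5 ∧ s.natVar 5 ≤ 3 * J ^ 2 + 1 := by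
  have e1 : ((J : ℝ) * J + 1 ≤ s.natVar 5) ↔ J ^ 2 + 1 ≤ s.natVar 5 := by
    rw [← pow_two]; norm_cast
  have e2 : ((s.natVar 5 : ℝ) ≤ 3 * (J * J) + 1) ↔ s.natVar 5 ≤ 3 * J ^ 2 + 1 := by
    rw [← pow_two]; norm_cast
  simp only [inRange, HExpr.eval_ite, HExpr.eval_nat, HExpr.eval_const, HExpr.eval_mul,
    HExpr.eval_add, HExpr.eval_real, hJ, Nat.cast_one, Nat.cast_zero, Nat.cast_ofNat, e1, e2]
  split_ifs with h1 h2 h3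
  · simp [h2, h3]; simpa using h1
  · simp [h3]
  · simp [h2]
  · have : s.natVar 7 ≠ 0 := by intro h; exact h1 (by simp [h])
    simp [this]

/-- If the search fails, flatness fails at every k of the window, but richness is recorded only at
the last k, whose tables are still in memory. This is all that `poor` requires. -/
theorem search_spec {s : State} {J : ℕ} (hJ : s.realVar 8 = J) (h7 : s.natVar 7 = 0)
    (hn : 3 * J ^ 2 + 1 < s.natVar 1) :
    Ready O (search.run O 12 s) ∧
    (search.run O 12 s).realVar 4 = valueOf O (search.run O 12 s) ∧
    (((search.run O 12 s).natVar 7 = 1 ∧ J ^ 2 + 1 ≤ (search.run O 12 s).natVar 6 ∧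
      (search.run O 12 s).natVar 6 ≤ 3 * J ^ 2 + 1 ∧
      (Flat (s.realArr 1) (s.realArr 2) (s.natVar 1) J (s.realVar 0)
          ((search.run O 12 s).natVar 6) ∨
        Rich (s.realArr 1) (s.realArr 2) (s.natVar 1) (s.realVar 0)
          ((search.run O 12 s).realVar 4) ((search.run O 12 s).natVar 6))) ∨
    ((search.run O 12 s).natVar 7 = 0 ∧ (search.run O 12 s).natVar 6 = 3 * J ^ 2 + 1 ∧
      (∀ k, J ^ 2 + 1 ≤ k → k ≤ 3 * J ^ 2 + 1 →
        ¬ Flat (s.realArr 1) (s.realArr 2) (s.natVar 1) J (s.realVar 0) k) ∧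
      ¬ Rich (s.realArr 1) (s.realArr 2) (s.natVar 1) (s.realVar 0)
          ((search.run O 12 s).realVar 4) (3 * J ^ 2 + 1))) := by
  set fl := Flat (s.realArr 1) (s.realArr 2) (s.natVar 1) J (s.realVar 0)
  set ri := Rich (s.realArr 1) (s.realArr 2) (s.natVar 1) (s.realVar 0)
  set K := 3 * J ^ 2 + 1
  set body : Prog := .ite (.const 1) inRange
    (.seq (.setNat 6 (.var 5)) (.seq setup
      (.ite (.const 1) .good (.setNat 7 (.const 1)) .nop))) .nop with hbody
  have := iterate_induction (f := body.run O 12) (x := 5) (s := s) (N := s.natVar 1)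
    -- After success the stored k and its tables are frozen. Before success, flatness has failed for
    -- all k tried so far, and once the window has been passed the tables are those of its last
    -- point.
    (fun k t => (t.natVar 1 = s.natVar 1 ∧ t.realVar 0 = s.realVar 0 ∧ t.realVar 8 = s.realVar 8 ∧
        t.realArr 1 = s.realArr 1 ∧ t.realArr 2 = s.realArr 2) ∧
      ((t.natVar 7 = 1 ∧ J ^ 2 + 1 ≤ t.natVar 6 ∧ t.natVar 6 ≤ K ∧ Ready O t ∧
          t.realVar 4 = valueOf O t ∧ (fl (t.natVar 6) ∨ ri (t.realVar 4) (t.natVar 6))) ∨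
        (t.natVar 7 = 0 ∧ (∀ k', J ^ 2 + 1 ≤ k' → k' ≤ K → k' < k → ¬ fl k') ∧
          (K < k → t.natVar 6 = K ∧ Ready O t ∧ t.realVar 4 = valueOf O t ∧
            ¬ ri (t.realVar 4) K))))
    ⟨by simp, Or.inr ⟨by simp [h7], by intro _ _ _ h; simp at h, by intro h; simp at h⟩⟩ ?_
  · obtain ⟨-, ⟨h1, h2, h3, h4, h5, h6⟩ | ⟨h1, h2, h3⟩⟩ := this
    · exact ⟨h4, h5, Or.inl ⟨h1, h2, h3, h6⟩⟩
    · obtain ⟨h4, h5, h6, h8⟩ := h3 hn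
      exact ⟨h5, h6, Or.inr ⟨h1, h4, fun k a b => h2 k a b (b.trans_lt hn), h8⟩⟩
  · intro k hk t h5 ⟨⟨f1, f0, f8, a1, a2⟩, hI⟩
    have hfr : (((body.run O 12 t).setNat 5 (k + 1)).natVar 1 = s.natVar 1 ∧
        ((body.run O 12 t).setNat 5 (k + 1)).realVar 0 = s.realVar 0 ∧
        ((body.run O 12 t).setNat 5 (k + 1)).realVar 8 = s.realVar 8 ∧
        ((body.run O 12 t).setNat 5 (k + 1)).realArr 1 = s.realArr 1 ∧
        ((body.run O 12 t).setNat 5 (k + 1)).realArr 2 = s.realArr 2) := by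
      refine ⟨?_, ?_, ?_, ?_, ?_⟩
      · simp [body.run_natVar O 12 (x := 1) rfl t, f1]
      · simp [body.run_realVar O 12 (x := 0) rfl t, f0]
      · simp [body.run_realVar O 12 (x := 8) rfl t, f8]
      · simp [body.run_realArr O 12 (a := 1) rfl t, a1]
      · simp [body.run_realArr O 12 (a := 2) rfl t, a2]
    refine ⟨hfr, ?_⟩
    clear hfr
    have hJt : t.realVar 8 = J := f8.trans hJ
    have same : ∀ t : State, ∀ v : ℕ, SamePolicy t (t.setNat 5 v) := fun t v =>
      ⟨⟨by simp, by simp, by simp, rfl, rfl, rfl, rfl⟩, rfl, rfl, rfl, rfl⟩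
    have hval : ∀ t : State, ∀ v : ℕ, valueOf O (t.setNat 5 v) = valueOf O t := fun t v =>
      valueOf_congr O (same t v) rfl rfl rfl
    by_cases hr : t.natVar 7 = 0 ∧ J ^ 2 + 1 ≤ t.natVar 5 ∧ t.natVar 5 ≤ K
    · rw [hbody, Prog.run_ite_pos _ _ (by
        rw [HExpr.eval_const, Nat.cast_one]; exact (eval_inRange O hJt).2 hr)]
      obtain ⟨hr1, hr2, hr3⟩ := hr
      rw [h5] at hr2 hr3
      have hI' : ∀ k', J ^ 2 + 1 ≤ k' → k' ≤ K → k' < k → ¬ fl k' := by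
        rcases hI with ⟨h1, -⟩ | ⟨-, h2, -⟩
        · omega
        · exact h2
      rw [Prog.run_seq, Prog.run_seq]
      set t₁ := (Prog.setNat 6 (.var 5)).run O 12 t with ht₁
      have k₁ : t₁.natVar 6 = k := by simp [ht₁, Prog.run, NExpr.eval, h5]
      obtain ⟨r₂, v₂⟩ := setup_spec O t₁
      have fk : (setup.run O 12 t₁).natVar 6 = k := (setup.run_natVar O 12 rfl t₁).trans k₁
      have f7 : (setup.run O 12 t₁).natVar 7 = 0 := by
        rw [setup.run_natVar O 12 rfl t₁]; simp [ht₁, Prog.run, hr1]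
      have f1' : (setup.run O 12 t₁).natVar 1 = s.natVar 1 := by
        rw [setup.run_natVar O 12 rfl t₁]; simp [ht₁, Prog.run, f1]
      have f0' : (setup.run O 12 t₁).realVar 0 = s.realVar 0 := by
        rw [setup.run_realVar O 12 rfl t₁]; simp [ht₁, Prog.run, f0]
      have f8' : (setup.run O 12 t₁).realVar 8 = J := by
        rw [setup.run_realVar O 12 rfl t₁]; simp [ht₁, Prog.run, hJt]
      have a1' : (setup.run O 12 t₁).realArr 1 = s.realArr 1 := by
        rw [setup.run_realArr O 12 rfl t₁]; simp [ht₁, Prog.run, a1]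
      have a2' : (setup.run O 12 t₁).realArr 2 = s.realArr 2 := by
        rw [setup.run_realArr O 12 rfl t₁]; simp [ht₁, Prog.run, a2]
      set t₂ := setup.run O 12 t₁
      have hg := eval_good O f8'
      rw [f1', f0', a1', a2', fk] at hg
      by_cases hgood : fl k ∨ ri (t₂.realVar 4) k
      · left
        rw [Prog.run_ite_pos _ _ (by rw [HExpr.eval_const, Nat.cast_one]; exact hg.2 hgood)]
        set t₃ := (Prog.setNat 7 (.const 1)).run O 12 t₂ with ht₃
        have c₃ : SamePolicy t₂ t₃ := ⟨⟨rfl, rfl, rfl, rfl, rfl, rfl, rfl⟩, rfl, rfl, rfl, rfl⟩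
        have k₃ : t₃.natVar 6 = k := c₃.removed.trans fk
        refine ⟨by simp [ht₃, Prog.run, NExpr.eval], by simp [k₃, hr2], by simp [k₃, hr3],
          (r₂.congr c₃).congr (same _ _), ?_, ?_⟩
        · rw [hval, valueOf_congr O c₃ rfl rfl rfl]; exact v₂
        · simp [k₃]; exact hgood
      · right
        rw [Prog.run_ite_neg _ _ (by
          rw [HExpr.eval_const, Nat.cast_one]; exact fun h => hgood (hg.1 h)), Prog.run_nop]
        push Not at hgood
        refine ⟨by simp [f7], fun k' b1 b2 b3 => ?_, fun hKk => ?_⟩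
        · rcases Nat.lt_succ_iff_lt_or_eq.1 b3 with h | rfl
          · exact hI' k' b1 b2 h
          · exact hgood.1
        · have hkK : k = K := by omega
          refine ⟨by simp [fk, hkK], r₂.congr (same _ _), ?_, ?_⟩
          · rw [hval]; exact v₂
          · have := hgood.2; rw [hkK] at this; exact this
    · rw [hbody, Prog.run_ite_neg _ _ (by
        rw [HExpr.eval_const, Nat.cast_one]; exact fun h => hr ((eval_inRange O hJt).1 h)),
        Prog.run_nop]
      rcases hI with ⟨h1, h2, h3, h4, h6, h8⟩ | ⟨h1, h2, h3⟩
      · left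
        exact ⟨by simp [h1], by simp [h2], by simp [h3], h4.congr (same _ _),
          by rw [hval]; exact h6, by simpa using h8⟩
      · right
        have hout : J ^ 2 + 1 ≤ k → K < k := fun h => by
          by_contra hcon
          exact hr ⟨h1, by omega, by omega⟩
        refine ⟨by simp [h1], fun k' b1 b2 b3 => ?_, fun hKk => ?_⟩
        · rcases Nat.lt_succ_iff_lt_or_eq.1 b3 with h | rfl
          · exact h2 k' b1 b2 h
          · have := hout b1; omega
        · have hJK : J ^ 2 + 1 ≤ K := by simp only [K]; omega
          obtain ⟨c1, c2, c3, c4⟩ := h3 (hout (by omega))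
          exact ⟨by simp [c1], c2.congr (same _ _), by rw [hval]; exact c3, by simpa using c4⟩

end Search

end RealRAM

/-! ### Fixing the random choices box by box -/

namespace RealRAM

section Decide

variable (O : Oracle)

/-- The value if box `i` is given the slot `x` and the threshold `y`. -/
noncomputable def valueAt (s : State) (i x : ℕ) (y : ℝ) : ℝ :=
  valueOf O ((s.setNatArr 1 i x).setRealArr 7 i y)

/-- The memories describe the same policy, up to slot and threshold of box `i`. -/
structure SameUpTo (i : ℕ) (s t : State) : Prop extends SamePolicy s t where
  box : t.natVar 3 = s.natVar 3
  decided : t.natArr 2 = s.natArr 2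
  slot : ∀ l, l ≠ i → t.natArr 1 l = s.natArr 1 l
  threshold : ∀ l, l ≠ i → t.realArr 7 l = s.realArr 7 l

theorem SameUpTo.trans {i : ℕ} {s t u : State} (h : SameUpTo i s t) (h' : SameUpTo i t u) :
    SameUpTo i s u :=
  ⟨⟨⟨h'.n.trans h.n, h'.grid.trans h.grid, h'.removed.trans h.removed, h'.eps.trans h.eps,
    h'.quant.trans h.quant, h'.rank.trans h.rank, h'.coin.trans h.coin⟩, h'.unit.trans h.unit,
    h'.weight.trans h.weight, h'.level.trans h.level, h'.mix.trans h.mix⟩, h'.box.trans h.box,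
    h'.decided.trans h.decided, fun l hl => (h'.slot l hl).trans (h.slot l hl),
    fun l hl => (h'.threshold l hl).trans (h.threshold l hl)⟩

theorem update_congr {α : Type*} {f g : ℕ → α} {i : ℕ} (h : ∀ l, l ≠ i → f l = g l) (x : α) :
    Function.update f i x = Function.update g i x := by
  funext l
  by_cases hl : l = i
  · subst hl; simp
  · simp [hl, h l hl]

theorem SameUpTo.valueAt {i : ℕ} {s t : State} (h : SameUpTo i s t) (x : ℕ) (y : ℝ) :
    valueAt O t i x y = valueAt O s i x y :=
  valueOf_congr O ⟨⟨h.n, h.grid, h.removed, h.eps, by simp [h.quant], by simp [h.rank],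
    by simp [h.coin]⟩, h.unit, by simp [h.weight], by simp [h.level], by simp [h.mix]⟩
    (by simp [update_congr h.slot]) (by simp [h.decided]) (by simp [update_congr h.threshold])

theorem valueAt_self (s : State) (i : ℕ) :
    valueAt O s i (s.natArr 1 i) (s.realArr 7 i) = valueOf O s :=
  valueOf_congr O ⟨⟨rfl, rfl, rfl, rfl, rfl, rfl, rfl⟩, rfl, rfl, rfl, rfl⟩ (by simp) rfl (by simp)

/-- The best choice so far is kept. -/
structure Tracked (i : ℕ) (s t : State) : Prop extends SameUpTo i s t where
  best : t.realVar 5 = valueAt O s i (t.natVar 9) (t.realVar 6)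
  bestSlot : t.natVar 9 ≤ s.natVar 2

variable {O}

theorem tryThreshold_spec {i : ℕ} {s t : State} (h : Tracked O i s t) (hi : s.natVar 3 = i)
    (h4 : t.natVar 4 ≤ s.natVar 2) (h1 : t.natArr 1 i = t.natVar 4) (e : HExpr) :
    Tracked O i s ((tryThreshold e).run O 12 t) ∧
    t.realVar 5 ≤ ((tryThreshold e).run O 12 t).realVar 5 ∧
    valueAt O s i (t.natVar 4) (e.eval O 12 t) ≤ ((tryThreshold e).run O 12 t).realVar 5 ∧
    ((tryThreshold e).run O 12 t).natVar 4 = t.natVar 4 ∧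
    ((tryThreshold e).run O 12 t).natArr 1 i = t.natVar 4 := by
  have h3 : t.natVar 3 = i := h.box.trans hi
  set y := e.eval O 12 t with hy
  set t₁ := t.setRealArr 7 i y with ht₁
  have e₁ : (Prog.setRealArr 7 (.var 3) e).run O 12 t = t₁ := by
    simp [Prog.run, NExpr.eval, h3, ht₁, hy]
  have s₁ : SameUpTo i t t₁ := ⟨⟨⟨rfl, rfl, rfl, rfl, by simp [ht₁], by simp [ht₁], by simp [ht₁]⟩,
    rfl, by simp [ht₁], by simp [ht₁], by simp [ht₁]⟩, rfl, rfl, fun _ _ => rfl, fun l hl => by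
      simp [ht₁, hl]⟩
  have v₁ : valueOf O t₁ = valueAt O s i (t.natVar 4) y := by
    rw [← valueAt_self O t₁ i, s₁.valueAt, h.toSameUpTo.valueAt]
    simp [ht₁, h1]
  set t₂ := t₁.setReal 7 (valueOf O t₁) with ht₂
  have e₂ : (Prog.setReal 7 .blend).run O 12 t₁ = t₂ := by
    simp only [Prog.run, HExpr.eval_blend, ht₂, valueOf]
  have s₂ : SameUpTo i t t₂ := s₁.trans ⟨⟨⟨rfl, rfl, rfl, rfl, rfl, rfl, rfl⟩, rfl, rfl, rfl, rfl⟩,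
    rfl, rfl, fun _ _ => rfl, fun _ _ => rfl⟩
  rw [tryThreshold, Prog.run_seq, e₁, Prog.run_seq, e₂]
  by_cases hc : valueOf O t₁ ≤ t.realVar 5
  · rw [Prog.run_ite_pos _ _ (by simpa [ht₂, ht₁] using hc), Prog.run_nop]
    refine ⟨⟨h.toSameUpTo.trans s₂, ?_, ?_⟩, by simp [ht₂, ht₁], ?_, by simp [ht₂, ht₁],
      by simp [ht₂, ht₁, h1]⟩
    · simpa [ht₂, ht₁] using h.best
    · simpa [ht₂, ht₁] using h.bestSlot
    · rw [v₁] at hc; simpa [ht₂, ht₁] using hc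
  · rw [Prog.run_ite_neg _ _ (by simpa [ht₂, ht₁] using hc)]
    set t₃ := ((t₂.setReal 5 (valueOf O t₁)).setNat 9 (t.natVar 4)).setReal 6 y with ht₃
    have e₃ : ((Prog.setReal 5 (.real 7)).seq ((Prog.setNat 9 (.var 4)).seq
        (.setReal 6 (.rarr 7 3)))).run O 12 t₂ = t₃ := by
      simp [Prog.run, NExpr.eval, ht₃, ht₂, ht₁, h3]
    have s₃ : SameUpTo i t₂ t₃ := ⟨⟨⟨rfl, rfl, rfl, rfl, rfl, rfl, rfl⟩, rfl, rfl, rfl, rfl⟩,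
      rfl, rfl, fun _ _ => rfl, fun _ _ => rfl⟩
    rw [e₃]
    have b₃ : t₃.realVar 5 = valueOf O t₁ := by simp [ht₃]
    refine ⟨⟨(h.toSameUpTo.trans s₂).trans s₃, ?_, ?_⟩, ?_, ?_, by simp [ht₃, ht₂, ht₁],
      by simp [ht₃, ht₂, ht₁, h1]⟩
    · rw [b₃, v₁]; simp [ht₃]
    · simpa [ht₃] using h4
    · rw [b₃]; exact (not_le.1 hc).le
    · rw [b₃, v₁]

/-- The conditions that make the slots a probability distribution. -/
structure Proper (s : State) (i : ℕ) : Prop where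
  weight_nonneg : ∀ j < s.natVar 2, 0 ≤ s.realArr 4 j
  sum_le : ∑ j ∈ Finset.range (s.natVar 2), s.realArr 4 j ≤ 1
  mix : ∀ j < s.natVar 2, s.realArr 4 j ≠ 0 → 0 ≤ s.realArr 6 j ∧ s.realArr 6 j ≤ 1
  coin : 0 ≤ s.realArr 8 i ∧ s.realArr 8 i ≤ 1

/-- Deciding box i replaces its two rows and leaves all others alone, which is the form required by
`blend_le_of_choices`. -/
theorem valueAt_decided (s : State) (i x : ℕ) (y : ℝ) :
    valueAt O (s.setNatArr 2 i 1) i x y = FreeOrder.blend (selected s) (s.natVar 2)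
      (Function.update (rowWOf O s) i
        (FreeOrder.decW (FreeOrder.lowMean (O.tail i) (O.mean i) (s.natVar 2) y) x))
      (Function.update (rowFOf O s) i (FreeOrder.decF (O.tail i) x y)) := by
  have hs : selected (((s.setNatArr 2 i 1).setNatArr 1 i x).setRealArr 7 i y) = selected s := by
    simp [selected]
  have hW : rowWOf O (((s.setNatArr 2 i 1).setNatArr 1 i x).setRealArr 7 i y) =
      Function.update (rowWOf O s) i
        (FreeOrder.decW (FreeOrder.lowMean (O.tail i) (O.mean i) (s.natVar 2) y) x) := by
    funext l j
    by_cases hl : l = i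
    · subst hl; simp [rowWOf]
    · simp [rowWOf, hl]
  have hF : rowFOf O (((s.setNatArr 2 i 1).setNatArr 1 i x).setRealArr 7 i y) =
      Function.update (rowFOf O s) i (FreeOrder.decF (O.tail i) x y) := by
    funext l j
    by_cases hl : l = i
    · subst hl; simp [rowFOf]
    · simp [rowFOf, hl]
  rw [valueAt, valueOf, hs, hW, hF]
  rfl

/-- The method of conditional expectations: an upper bound for skipping and for all choices of slot
and coins bounds the random mixture as well. -/
theorem valueOf_le_of_choices {s : State} {i : ℕ} (h : Proper s i) (h2 : s.natArr 2 i = 0) {best : ℝ}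
    (hskip : valueAt O (s.setNatArr 2 i 1) i (s.natVar 2) 0 ≤ best)
    (hbest : ∀ j < s.natVar 2, ∀ x, (x = s.realArr 5 j ∨ x = s.realArr 5 j - s.realVar 3) →
      ∀ y, (y = s.realArr 1 i ∨ y = s.realArr 1 i - s.realVar 0 * O.mean i) →
      valueAt O (s.setNatArr 2 i 1) i j (max x y) ≤ best) : valueOf O s ≤ best := by
  simp only [valueAt_decided] at hskip hbest
  refine FreeOrder.blend_le_of_choices (p := O.tail i) (m := O.mean i) (ε := s.realVar 0)
    (q := s.realArr 1 i) (c := s.realArr 8 i) (u := s.realVar 3) (d := s.realArr 4)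
    (b := s.realArr 6) (l := s.realArr 5) h.weight_nonneg h.sum_le h.mix h.coin ?_ ?_ hskip hbest
  · intro j _
    simp only [rowWOf, h2, Nat.cast_zero, le_refl, if_true]
    rfl
  · intro j hj
    simp only [rowFOf, h2, Nat.cast_zero, le_refl, if_true, Nat.cast_le]
    congr 1
    rw [← Finset.sum_filter]
    congr 1
    ext t; simp only [Finset.mem_filter, Finset.mem_range]; omega

theorem tryAll_spec {i : ℕ} {s t : State} (h : Tracked O i s t) (hi : s.natVar 3 = i)
    (h4 : t.natVar 4 < s.natVar 2) :
    Tracked O i s (tryAll.run O 12 t) ∧ t.realVar 5 ≤ (tryAll.run O 12 t).realVar 5 ∧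
    ∀ x, (x = s.realArr 5 (t.natVar 4) ∨ x = s.realArr 5 (t.natVar 4) - s.realVar 3) →
      ∀ y, (y = s.realArr 1 i ∨ y = s.realArr 1 i - s.realVar 0 * O.mean i) →
      valueAt O s i (t.natVar 4) (max x y) ≤ (tryAll.run O 12 t).realVar 5 := by
  have h3 : t.natVar 3 = i := h.box.trans hi
  set j := t.natVar 4 with hj
  set t₁ := t.setNatArr 1 i j with ht₁
  have e₁ : (Prog.setNatArr 1 (.var 3) (.var 4)).run O 12 t = t₁ := by
    simp [Prog.run, NExpr.eval, h3, ht₁, hj]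
  have s₁ : SameUpTo i t t₁ := ⟨⟨⟨rfl, rfl, rfl, rfl, rfl, rfl, rfl⟩, rfl, rfl, rfl, rfl⟩, rfl,
    by simp [ht₁], fun l hl => by simp [ht₁, hl], fun _ _ => rfl⟩
  have T₁ : Tracked O i s t₁ := ⟨h.toSameUpTo.trans s₁, h.best, h.bestSlot⟩
  have j₁ : t₁.natVar 4 = j := rfl
  have a₁ : t₁.natArr 1 i = j := by simp [ht₁]
  have ev : ∀ t, Tracked O i s t → t.natVar 4 = j →
      (HExpr.max (.rarr 5 4) (.rarr 1 3)).eval O 12 t = max (s.realArr 5 j) (s.realArr 1 i) ∧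
      (HExpr.max (.rarr 5 4) (.rarr 1 3 - .step 3)).eval O 12 t =
        max (s.realArr 5 j) (s.realArr 1 i - s.realVar 0 * O.mean i) ∧
      (HExpr.max (.rarr 5 4 - .real 3) (.rarr 1 3)).eval O 12 t =
        max (s.realArr 5 j - s.realVar 3) (s.realArr 1 i) ∧
      (HExpr.max (.rarr 5 4 - .real 3) (.rarr 1 3 - .step 3)).eval O 12 t =
        max (s.realArr 5 j - s.realVar 3) (s.realArr 1 i - s.realVar 0 * O.mean i) := by
    intro t ht htj
    have : t.natVar 3 = i := ht.box.trans hi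
    simp [HExpr.step, htj, this, ht.level, ht.quant, ht.unit, ht.eps]
  rw [tryAll, Prog.run_seq, e₁, Prog.run_seq, Prog.run_seq, Prog.run_seq]
  obtain ⟨T₂, b₂, v₂, j₂, a₂⟩ := tryThreshold_spec T₁ hi (by rw [j₁]; exact h4.le) (a₁.trans j₁.symm)
    (.max (.rarr 5 4) (.rarr 1 3))
  rw [(ev _ T₁ j₁).1] at v₂
  set t₂ := (tryThreshold (.max (.rarr 5 4) (.rarr 1 3))).run O 12 t₁
  obtain ⟨T₃, b₃, v₃, j₃, a₃⟩ := tryThreshold_spec T₂ hi (by rw [j₂, j₁]; exact h4.le)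
    (a₂.trans j₂.symm) (.max (.rarr 5 4) (.rarr 1 3 - .step 3))
  rw [j₁] at j₂
  rw [(ev _ T₂ j₂).2.1] at v₃
  set t₃ := (tryThreshold (.max (.rarr 5 4) (.rarr 1 3 - .step 3))).run O 12 t₂
  rw [j₂] at j₃ a₃ v₃
  obtain ⟨T₄, b₄, v₄, j₄, a₄⟩ := tryThreshold_spec T₃ hi (by rw [j₃]; exact h4.le)
    (a₃.trans j₃.symm) (.max (.rarr 5 4 - .real 3) (.rarr 1 3))
  rw [(ev _ T₃ j₃).2.2.1] at v₄
  set t₄ := (tryThreshold (.max (.rarr 5 4 - .real 3) (.rarr 1 3))).run O 12 t₃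
  rw [j₃] at j₄ a₄ v₄
  obtain ⟨T₅, b₅, v₅, j₅, a₅⟩ := tryThreshold_spec T₄ hi (by rw [j₄]; exact h4.le)
    (a₄.trans j₄.symm) (.max (.rarr 5 4 - .real 3) (.rarr 1 3 - .step 3))
  rw [(ev _ T₄ j₄).2.2.2, j₄] at v₅
  rw [j₁] at v₂
  have b₁ : t.realVar 5 = t₁.realVar 5 := rfl
  refine ⟨T₅, ?_, ?_⟩
  · rw [b₁]; exact ((b₂.trans b₃).trans b₄).trans b₅
  · rintro x (rfl | rfl) y (rfl | rfl)
    · exact ((v₂.trans b₃).trans b₄).trans b₅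
    · exact (v₃.trans b₄).trans b₅
    · exact v₄.trans b₅
    · exact v₅

theorem decideBox_spec {s : State} {i : ℕ} (hi : s.natVar 3 = i) :
    SamePolicy s (decideBox.run O 12 s) ∧
    (decideBox.run O 12 s).natArr 2 = Function.update (s.natArr 2) i 1 ∧
    (∀ l, l ≠ i → (decideBox.run O 12 s).natArr 1 l = s.natArr 1 l) ∧
    (decideBox.run O 12 s).natArr 1 i ≤ s.natVar 2 ∧
    (Proper s i → s.natArr 2 i = 0 → valueOf O s ≤ valueOf O (decideBox.run O 12 s)) := by
  set s₀ := s.setNatArr 2 i 1 with hs₀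
  set B := s.natVar 2 with hB
  have hi₀ : s₀.natVar 3 = i := hi
  set t₁ := (s₀.setNatArr 1 i B).setRealArr 7 i 0 with ht₁
  set t₂ := ((t₁.setReal 5 (valueOf O t₁)).setNat 9 B).setReal 6 0 with ht₂
  have hrun : decideBox.run O 12 s = ((Prog.setNatArr 1 (.var 3) (.var 9)).seq
      (.setRealArr 7 (.var 3) (.real 6))).run O 12 ((Prog.loop 4 2 tryAll).run O 12 t₂) := by
    have : t₂ = ((((((s.setNatArr 2 (s.natVar 3) 1).setNatArr 1 (s.natVar 3) B).setRealArr 7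
        (s.natVar 3) ((0 : ℕ) : ℝ))).setReal 5 (HExpr.blend.eval O 12
        (((s.setNatArr 2 (s.natVar 3) 1).setNatArr 1 (s.natVar 3) B).setRealArr 7
        (s.natVar 3) ((0 : ℕ) : ℝ)))).setNat 9 B).setReal 6 ((0 : ℕ) : ℝ) := by
      rw [HExpr.eval_blend, hi, Nat.cast_zero]
      rfl
    rw [this]
    rfl
  have s₁ : SameUpTo i s₀ t₁ := ⟨⟨⟨rfl, rfl, rfl, rfl, by simp [ht₁], by simp [ht₁], by simp [ht₁]⟩,
    rfl, by simp [ht₁], by simp [ht₁], by simp [ht₁]⟩, rfl, by simp [ht₁],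
    fun l hl => by simp [ht₁, hl], fun l hl => by simp [ht₁, hl]⟩
  have s₂ : SameUpTo i t₁ t₂ := ⟨⟨⟨rfl, rfl, rfl, rfl, rfl, rfl, rfl⟩, rfl, rfl, rfl, rfl⟩,
    rfl, rfl, fun _ _ => rfl, fun _ _ => rfl⟩
  have b₂ : t₂.realVar 5 = valueAt O s₀ i B 0 := by simp [ht₂]; rfl
  have same4 : ∀ (t : State) (v : ℕ), SameUpTo i t (t.setNat 4 v) := fun t v =>
    ⟨⟨⟨by simp, by simp, by simp, rfl, rfl, rfl, rfl⟩, rfl, rfl, rfl, rfl⟩, by simp, rfl,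
      fun _ _ => rfl, fun _ _ => rfl⟩
  have track4 : ∀ (t : State) (v : ℕ), Tracked O i s₀ t → Tracked O i s₀ (t.setNat 4 v) :=
    fun t v h => ⟨h.toSameUpTo.trans (same4 t v), by simpa using h.best, by simpa using h.bestSlot⟩
  have T₂ : Tracked O i s₀ t₂ := ⟨s₁.trans s₂, by rw [b₂]; simp [ht₂], by simp [ht₂]; rfl⟩
  have key := iterate_induction (f := tryAll.run O 12) (x := 4) (s := t₂) (N := t₂.natVar 2)
    (fun k t => Tracked O i s₀ t ∧ valueAt O s₀ i B 0 ≤ t.realVar 5 ∧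
      ∀ j < k, ∀ x, (x = s₀.realArr 5 j ∨ x = s₀.realArr 5 j - s₀.realVar 3) →
      ∀ y, (y = s₀.realArr 1 i ∨ y = s₀.realArr 1 i - s₀.realVar 0 * O.mean i) →
      valueAt O s₀ i j (max x y) ≤ t.realVar 5)
    ⟨track4 _ _ T₂, by simp [b₂], by simp⟩ (by
      intro k hk t h4 ⟨hT, hb, hv⟩
      have hkB : k < s₀.natVar 2 := by rw [(s₁.trans s₂).grid] at hk; exact hk
      obtain ⟨T', b', v'⟩ := tryAll_spec hT hi₀ (by rw [h4]; exact hkB)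
      refine ⟨track4 _ _ T', hb.trans (by simpa using b'), fun j hj x hx y hy => ?_⟩
      rcases Nat.lt_succ_iff_lt_or_eq.1 hj with h | rfl
      · exact (hv j h x hx y hy).trans (by simpa using b')
      · rw [h4] at v'; simpa using v' x hx y hy)
  have e₃ : (Prog.loop 4 2 tryAll).run O 12 t₂ = iterate (tryAll.run O 12) 4 t₂ (t₂.natVar 2) := rfl
  rw [hrun, e₃]
  set t₃ := iterate (tryAll.run O 12) 4 t₂ (t₂.natVar 2) with ht₃
  obtain ⟨T₃, hb, hv⟩ := key
  have hi₃ : t₃.natVar 3 = i := T₃.box.trans hi₀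
  set t₄ := (t₃.setNatArr 1 i (t₃.natVar 9)).setRealArr 7 i (t₃.realVar 6) with ht₄
  have e₄ : ((Prog.setNatArr 1 (.var 3) (.var 9)).seq
      (.setRealArr 7 (.var 3) (.real 6))).run O 12 t₃ = t₄ := by
    simp [Prog.run, NExpr.eval, hi₃, ht₄]
  rw [e₄]
  have s₄ : SameUpTo i t₃ t₄ := ⟨⟨⟨rfl, rfl, rfl, rfl, by simp [ht₄], by simp [ht₄], by simp [ht₄]⟩,
    rfl, by simp [ht₄], by simp [ht₄], by simp [ht₄]⟩, rfl, by simp [ht₄],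
    fun l hl => by simp [ht₄, hl], fun l hl => by simp [ht₄, hl]⟩
  have s' := T₃.toSameUpTo.trans s₄
  refine ⟨⟨⟨s'.n, s'.grid, s'.removed, s'.eps, s'.quant, s'.rank, s'.coin⟩, s'.unit, s'.weight,
    s'.level, s'.mix⟩, ?_, ?_, ?_, ?_⟩
  · rw [s'.decided]; simp [hs₀]
  · intro l hl; rw [s'.slot l hl]; simp [hs₀]
  · have : t₄.natArr 1 i = t₃.natVar 9 := by simp [ht₄]
    rw [this]; exact T₃.bestSlot
  · intro hP h2
    have hval : valueOf O t₄ = t₃.realVar 5 := by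
      rw [T₃.best, ← T₃.toSameUpTo.valueAt]
      rfl
    rw [hval]
    refine valueOf_le_of_choices hP h2 hb fun j hj => hv j ?_
    rw [(s₁.trans s₂).grid]; exact hj

/-- Only the comparison of values depends on `Proper`: if all remaining means vanish, mixtures are
not known to lie in [0, 1], but the shape of the output is still needed. -/
theorem decideAll_spec {s : State} (h2 : ∀ i < s.natVar 1, s.natArr 2 i = 0) :
    SamePolicy s (decideAll.run O 12 s) ∧
    (∀ i < s.natVar 1, (decideAll.run O 12 s).natArr 2 i = 1) ∧
    (∀ i < s.natVar 1, (decideAll.run O 12 s).natArr 1 i ≤ s.natVar 2) ∧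
    ((∀ i < s.natVar 1, Proper s i) → valueOf O s ≤ valueOf O (decideAll.run O 12 s)) := by
  have key := iterate_induction (f := decideBox.run O 12) (x := 3) (s := s) (N := s.natVar 1)
    (fun k t => SamePolicy s t ∧ (∀ i < k, t.natArr 2 i = 1) ∧
      (∀ i < s.natVar 1, k ≤ i → t.natArr 2 i = 0) ∧
      (∀ i < k, t.natArr 1 i ≤ s.natVar 2) ∧
      ((∀ i < s.natVar 1, Proper s i) → valueOf O s ≤ valueOf O t))
    ⟨⟨⟨rfl, rfl, rfl, rfl, rfl, rfl, rfl⟩, rfl, rfl, rfl, rfl⟩, by simp, by simpa using h2, by simp,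
      fun _ => le_of_eq (valueOf_congr O ⟨⟨rfl, rfl, rfl, rfl, rfl, rfl, rfl⟩, rfl, rfl, rfl, rfl⟩
        rfl rfl rfl).symm⟩ (by
      intro k hk t h3 ⟨hs, hd, hu, hB, hv⟩
      obtain ⟨c1, c2, c3, c4, c5⟩ := decideBox_spec (O := O) h3
      set t' := decideBox.run O 12 t
      have hs' : SamePolicy s t' := ⟨⟨c1.n.trans hs.n, c1.grid.trans hs.grid,
        c1.removed.trans hs.removed, c1.eps.trans hs.eps, c1.quant.trans hs.quant,
        c1.rank.trans hs.rank, c1.coin.trans hs.coin⟩, c1.unit.trans hs.unit,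
        c1.weight.trans hs.weight, c1.level.trans hs.level, c1.mix.trans hs.mix⟩
      have hv' : valueOf O (t'.setNat 3 (k + 1)) = valueOf O t' :=
        valueOf_congr O ⟨⟨rfl, rfl, rfl, rfl, rfl, rfl, rfl⟩, rfl, rfl, rfl, rfl⟩ rfl rfl rfl
      refine ⟨⟨⟨by simp [hs'.n], by simp [hs'.grid], by simp [hs'.removed], hs'.eps, hs'.quant,
        hs'.rank, hs'.coin⟩, hs'.unit, hs'.weight, hs'.level, hs'.mix⟩, ?_, ?_, ?_, ?_⟩
      · intro i hi
        rw [setNat_natArr, c2]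
        rcases Nat.lt_succ_iff_lt_or_eq.1 hi with h | rfl
        · rw [Function.update_of_ne (by omega)]; exact hd i h
        · simp
      · intro i hi hki
        rw [setNat_natArr, c2, Function.update_of_ne (by omega)]
        exact hu i hi (by omega)
      · intro i hi
        rw [setNat_natArr]
        rcases Nat.lt_succ_iff_lt_or_eq.1 hi with h | rfl
        · rw [c3 i (by omega)]; exact hB i h
        · rw [hs.grid] at c4; exact c4
      · intro hP
        rw [hv']
        have hp := hP k hk
        refine (hv hP).trans (c5 ⟨?_, ?_, ?_, ?_⟩ (hu k hk le_rfl))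
        · rw [hs.grid, hs.weight]; exact hp.weight_nonneg
        · rw [hs.grid, hs.weight]; exact hp.sum_le
        · rw [hs.grid, hs.weight, hs.mix]; exact hp.mix
        · rw [hs.coin]; exact hp.coin)
  exact ⟨key.1, key.2.1, key.2.2.2.1, key.2.2.2.2⟩

end Decide

end RealRAM

/-! ### The rescued box and the output -/

namespace RealRAM

section Output

variable (O : Oracle)

theorem rescue_of_found {s : State} (h : 1 ≤ s.natVar 7) : rescue.run O 12 s = s := by
  have : (1 : ℝ) ≤ s.natVar 7 := by exact_mod_cast h
  rw [rescue, Prog.run_ite_pos _ _ (by simpa using this), Prog.run_nop]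

theorem rescue_spec {s : State} {J : ℕ} (hJ : s.realVar 8 = J) (h7 : s.natVar 7 = 0) :
    ∀ i < s.natVar 1,
      (rescue.run O 12 s).realArr 2 i =
        (if s.realArr 2 i = (J ^ 2 : ℕ) then (s.natVar 1 : ℝ) else s.realArr 2 i) ∧
      (rescue.run O 12 s).natArr 1 i = (if s.realArr 2 i = (J ^ 2 : ℕ) then 0 else s.natVar 2) ∧
      (s.realArr 2 i = (J ^ 2 : ℕ) → (rescue.run O 12 s).realArr 7 i = 0) := by
  set body : Prog := .ite (.const 1)
      (.ite (.rarr 2 3) (.real 8 * .real 8) (.ite (.real 8 * .real 8) (.rarr 2 3)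
        (.const 1) (.const 0)) (.const 0))
      (.seq (.setRealArr 2 (.var 3) (.nat 1)) <| .seq (.setNatArr 1 (.var 3) (.const 0))
        (.setRealArr 7 (.var 3) (.const 0)))
      (.setNatArr 1 (.var 3) (.var 2)) with hbody
  have hneg : ¬ (HExpr.const 1).eval O 12 s ≤ (HExpr.nat 7).eval O 12 s := by simp [h7]
  have hrun : rescue.run O 12 s = iterate (body.run O 12) 3 s (s.natVar 1) := by
    rw [rescue, Prog.run_ite_neg _ _ hneg]; rfl
  rw [hrun]
  have key := iterate_induction (f := body.run O 12) (x := 3) (s := s) (N := s.natVar 1)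
    (fun k t => (t.natVar 1 = s.natVar 1 ∧ t.natVar 2 = s.natVar 2 ∧ t.realVar 8 = J) ∧
      -- The loop overwrites ranks while testing them, so the ranks still to be tested must be known
      -- to be the original ones.
      (∀ i, k ≤ i → t.realArr 2 i = s.realArr 2 i) ∧
      ∀ i < k, t.realArr 2 i =
        (if s.realArr 2 i = (J ^ 2 : ℕ) then (s.natVar 1 : ℝ) else s.realArr 2 i) ∧
      t.natArr 1 i = (if s.realArr 2 i = (J ^ 2 : ℕ) then 0 else s.natVar 2) ∧
      (s.realArr 2 i = (J ^ 2 : ℕ) → t.realArr 7 i = 0))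
    ⟨⟨rfl, rfl, hJ⟩, fun _ _ => rfl, by simp⟩ (by
      intro k hk t h3 ⟨⟨f1, f2, f8⟩, hu, hd⟩
      have htest : (HExpr.const 1).eval O 12 t ≤ (HExpr.ite (.rarr 2 3) (.real 8 * .real 8)
          (.ite (.real 8 * .real 8) (.rarr 2 3) (.const 1) (.const 0)) (.const 0)).eval O 12 t ↔
          s.realArr 2 k = (J ^ 2 : ℕ) := by
        simp only [HExpr.eval_ite, HExpr.eval_const, HExpr.eval_rarr, HExpr.eval_mul,
          HExpr.eval_real, h3, f8, hu k le_rfl, Nat.cast_mul, pow_two, Nat.cast_one, Nat.cast_zero]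
        split_ifs with h1 h2
        · simp [le_antisymm h1 h2]
        · constructor
          · intro h; norm_num at h
          · intro h; exact absurd h.ge h2
        · constructor
          · intro h; norm_num at h
          · intro h; exact absurd h.le h1
      by_cases hc : s.realArr 2 k = (J ^ 2 : ℕ)
      · rw [hbody, Prog.run_ite_pos _ _ (htest.2 hc)]
        refine ⟨⟨by simp [Prog.run, f1], by simp [Prog.run, f2], by simp [Prog.run, f8]⟩,
          fun i hi => ?_, fun i hi => ?_⟩
        · simp [Prog.run, NExpr.eval, h3, show i ≠ k by omega, hu i (by omega)]
        · rcases Nat.lt_succ_iff_lt_or_eq.1 hi with h | rfl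
          · simpa [Prog.run, NExpr.eval, h3, show i ≠ k by omega] using hd i h
          · rw [if_pos hc, if_pos hc]
            simp [Prog.run, NExpr.eval, h3, f1]
      · rw [hbody, Prog.run_ite_neg _ _ (fun h => hc (htest.1 h))]
        refine ⟨⟨by simp [Prog.run, f1], by simp [Prog.run, f2], by simp [Prog.run, f8]⟩,
          fun i hi => ?_, fun i hi => ?_⟩
        · simp [Prog.run, hu i (by omega)]
        · rcases Nat.lt_succ_iff_lt_or_eq.1 hi with h | rfl
          · simpa [Prog.run, NExpr.eval, h3, show i ≠ k by omega] using hd i h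
          · rw [if_neg hc, if_neg hc]
            refine ⟨by simp [Prog.run, hu i le_rfl], by simp [Prog.run, NExpr.eval, h3, f2],
              fun h => absurd h hc⟩)
  exact key.2.2

open Classical in
/-- The boxes below `I` of the instance in slot `j`. -/
noncomputable def bucket (s : State) (I j : ℕ) : List ℕ :=
  (List.range I).filter fun i => decide ((s.natVar 6 : ℝ) ≤ s.realArr 2 i ∧ s.natArr 1 i = j)

/-- The output consists of the boxes in `l` with their thresholds in `s`. -/
def Written (s t : State) (l : List ℕ) : Prop :=
  t.natVar 0 = l.length ∧
    ∀ (j : ℕ) (hj : j < l.length), t.natArr 0 j = l[j] ∧ t.realArr 0 j = s.realArr 7 l[j]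

theorem Written.snoc {s t : State} {l : List ℕ} (h : Written s t l) (i : ℕ) :
    Written s (((t.setNatArr 0 (t.natVar 0) i).setRealArr 0 (t.natVar 0)
      (s.realArr 7 i)).setNat 0 (t.natVar 0 + 1)) (l ++ [i]) := by
  refine ⟨by simp [h.1], fun j hj => ?_⟩
  rw [List.length_append, List.length_singleton] at hj
  rcases Nat.lt_succ_iff_lt_or_eq.1 hj with hj' | rfl
  · have hne : j ≠ t.natVar 0 := by rw [h.1]; omega
    simp only [setNat_natArr, setNat_realArr, setRealArr_natArr, setRealArr_realArr,
      setNatArr_natArr, setNatArr_realArr, Function.update_self, Function.update_of_ne hne,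
      List.getElem_append_left hj']
    exact h.2 j hj'
  · simp [h.1]

/-- The parts of the memory that determine the output. -/
structure SameOutput (s t : State) : Prop where
  n : t.natVar 1 = s.natVar 1
  grid : t.natVar 2 = s.natVar 2
  removed : t.natVar 6 = s.natVar 6
  rank : t.realArr 2 = s.realArr 2
  slot : t.natArr 1 = s.natArr 1
  threshold : t.realArr 7 = s.realArr 7

theorem emitSlot_spec {s t : State} {l : List ℕ} (h : SameOutput s t) (hl : Written s t l) :
    SameOutput s (emitSlot.run O 12 t) ∧
      Written s (emitSlot.run O 12 t) (l ++ bucket s (s.natVar 1) (t.natVar 4)) := by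
  set j := t.natVar 4 with hj
  set body : Prog := .ite (.const 1)
    (.sel 3 (.ite (.narr 1 3) (.nat 4) (.ite (.nat 4) (.narr 1 3) (.const 1) (.const 0)) (.const 0))
      (.const 0))
    (.seq (.setNatArr 0 (.var 0) (.var 3)) <| .seq (.setRealArr 0 (.var 0) (.rarr 7 3))
      (.setNat 0 (.add (.var 0) (.const 1))))
    .nop with hbody
  have hrun : emitSlot.run O 12 t = iterate (body.run O 12) 3 t (t.natVar 1) := rfl
  rw [hrun, h.n]
  have key := iterate_induction (f := body.run O 12) (x := 3) (s := t) (N := s.natVar 1)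
    (fun k u => SameOutput s u ∧ u.natVar 4 = j ∧ Written s u (l ++ bucket s k j))
    ⟨⟨by simp [h.n], by simp [h.grid], by simp [h.removed], h.rank, h.slot, h.threshold⟩,
      by simp [hj], by simpa [bucket, Written] using hl⟩ (by
      intro k hk u h3 ⟨hs, h4, hw⟩
      have hb : bucket s (k + 1) j = bucket s k j ++
          if (s.natVar 6 : ℝ) ≤ s.realArr 2 k ∧ s.natArr 1 k = j then [k] else [] := by
        simp only [bucket, List.range_succ, List.filter_append, List.filter_singleton]
        by_cases hc : (s.natVar 6 : ℝ) ≤ s.realArr 2 k ∧ s.natArr 1 k = j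
        · simp [hc]
        · rw [if_neg hc, decide_eq_false hc]; rfl
      have htest : (HExpr.const 1).eval O 12 u ≤ (HExpr.sel 3 (.ite (.narr 1 3) (.nat 4)
          (.ite (.nat 4) (.narr 1 3) (.const 1) (.const 0)) (.const 0)) (.const 0)).eval O 12 u ↔
          (s.natVar 6 : ℝ) ≤ s.realArr 2 k ∧ s.natArr 1 k = j := by
        simp only [HExpr.sel, HExpr.eval_ite, HExpr.eval_const, HExpr.eval_rarr, HExpr.eval_narr,
          HExpr.eval_nat, h3, h4, hs.removed, hs.rank, hs.slot, Nat.cast_le, Nat.cast_one,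
          Nat.cast_zero]
        split_ifs with h1 h2 h5
        · simp [h1, le_antisymm h2 h5]
        · constructor
          · intro h; norm_num at h
          · intro h; omega
        · constructor
          · intro h; norm_num at h
          · intro h; omega
        · constructor
          · intro h; norm_num at h
          · intro h; exact absurd h.1 h1
      by_cases hc : (s.natVar 6 : ℝ) ≤ s.realArr 2 k ∧ s.natArr 1 k = j
      · rw [hbody, Prog.run_ite_pos _ _ (htest.2 hc), hb, if_pos hc, ← List.append_assoc]
        have hw' := hw.snoc k
        set u' := ((u.setNatArr 0 (u.natVar 0) k).setRealArr 0 (u.natVar 0)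
          (s.realArr 7 k)).setNat 0 (u.natVar 0 + 1) with hu'
        have e : ((Prog.setNatArr 0 (.var 0) (.var 3)).seq ((Prog.setRealArr 0 (.var 0)
            (.rarr 7 3)).seq (.setNat 0 (.add (.var 0) (.const 1))))).run O 12 u = u' := by
          simp [Prog.run, NExpr.eval, h3, hu', hs.threshold]
        rw [e]
        refine ⟨⟨by simp [hu', hs.n], by simp [hu', hs.grid], by simp [hu', hs.removed],
          by simp [hu', hs.rank], by simp [hu', hs.slot], by simp [hu', hs.threshold]⟩,
          by simp [hu', h4], ?_⟩
        simpa [Written] using hw'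
      · rw [hbody, Prog.run_ite_neg _ _ (fun h => hc (htest.1 h)), Prog.run_nop, hb, if_neg hc,
          List.append_nil]
        exact ⟨⟨by simp [hs.n], by simp [hs.grid], by simp [hs.removed], hs.rank, hs.slot,
          hs.threshold⟩, by simp [h4], by simpa [Written] using hw⟩)
  exact ⟨key.1, key.2.2⟩

/-- The boxes of the instance, ordered by their slots. -/
noncomputable def outputList (s : State) : List ℕ :=
  (List.range (s.natVar 2 + 1)).flatMap (bucket s (s.natVar 1))

theorem emit_spec {s : State} (h0 : s.natVar 0 = 0) :
    Written s (emit.run O 12 s) (outputList s) := by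
  have key := iterate_induction (f := emitSlot.run O 12) (x := 4) (s := s) (N := s.natVar 2)
    (fun k t => SameOutput s t ∧ Written s t ((List.range k).flatMap (bucket s (s.natVar 1))))
    ⟨⟨rfl, rfl, rfl, rfl, rfl, rfl⟩, by simp [Written, h0]⟩ (by
      intro k hk t h4 ⟨hs, hw⟩
      obtain ⟨a, b⟩ := emitSlot_spec O hs hw
      rw [h4] at b
      refine ⟨⟨by simp [a.n], by simp [a.grid], by simp [a.removed], a.rank, a.slot, a.threshold⟩,
        ?_⟩
      rw [List.range_succ, List.flatMap_append, List.flatMap_singleton]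
      simpa [Written] using b)
  set t := iterate (emitSlot.run O 12) 4 s (s.natVar 2) with ht
  obtain ⟨hs, hw⟩ := key
  have e : emit.run O 12 s = emitSlot.run O 12 (t.setNat 4 (t.natVar 2)) := rfl
  have hs' : SameOutput s (t.setNat 4 (t.natVar 2)) :=
    ⟨by simp [hs.n], by simp [hs.grid], by simp [hs.removed], hs.rank, hs.slot, hs.threshold⟩
  have hw' : Written s (t.setNat 4 (t.natVar 2))
      ((List.range (s.natVar 2)).flatMap (bucket s (s.natVar 1))) := by simpa [Written] using hw
  have := (emitSlot_spec O hs' hw').2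
  rw [e, outputList, List.range_succ, List.flatMap_append, List.flatMap_singleton]
  simpa [hs.grid] using this

theorem mem_bucket {s : State} {I j i : ℕ} : i ∈ bucket s I j ↔
    i < I ∧ (s.natVar 6 : ℝ) ≤ s.realArr 2 i ∧ s.natArr 1 i = j := by
  simp [bucket]

theorem outputList_nodup (s : State) : (outputList s).Nodup := by
  rw [outputList, List.nodup_flatMap]
  refine ⟨fun j _ => List.nodup_range.filter _, ?_⟩
  refine List.nodup_range.imp fun {a b} hab => ?_
  intro i hi hi'
  exact hab ((mem_bucket.1 hi).2.2.symm.trans (mem_bucket.1 hi').2.2)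

theorem outputList_pairwise (s : State) :
    (outputList s).Pairwise fun i j => s.natArr 1 i ≤ s.natArr 1 j := by
  rw [outputList, List.pairwise_flatMap]
  refine ⟨fun j _ => ?_, ?_⟩
  · refine List.pairwise_of_forall_mem_list fun a ha b hb => ?_
    rw [(mem_bucket.1 ha).2.2, (mem_bucket.1 hb).2.2]
  · refine List.pairwise_lt_range.imp fun {a b} hab x hx y hy => ?_
    rw [(mem_bucket.1 hx).2.2, (mem_bucket.1 hy).2.2]
    exact hab.le

theorem outputList_toFinset {s : State} (h : ∀ i < s.natVar 1, s.natArr 1 i ≤ s.natVar 2) :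
    (outputList s).toFinset = selected s := by
  ext i
  simp only [outputList, List.mem_toFinset, List.mem_flatMap, List.mem_range, mem_bucket, selected,
    Finset.mem_filter, Finset.mem_range]
  constructor
  · rintro ⟨j, -, h1, h2, -⟩; exact ⟨h1, h2⟩
  · rintro ⟨h1, h2⟩; exact ⟨_, Nat.lt_succ_of_le (h i h1), h1, h2, rfl⟩

end Output

end RealRAM

/-! ### Ranks of the quantiles -/

namespace RealRAM

section Rank

variable (q : ℕ → ℝ)

/-- Box `l` precedes box `i` in the order of decreasing quantiles. -/
def Precedes (l i : ℕ) : Prop := q i < q l ∨ q l = q i ∧ l < i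

open Classical in
/-- The rank of box `i` among `n` boxes. -/
noncomputable def rankNat (n i : ℕ) : ℕ := ((Finset.range n).filter (Precedes q · i)).card

theorem rankOf_eq (n i : ℕ) : rankOf q n i = rankNat q n i := by
  classical
  rw [rankNat, Finset.card_filter, Nat.cast_sum, rankOf]
  refine Finset.sum_congr rfl fun l _ => ?_
  simp only [Precedes, Nat.cast_le]
  rcases lt_trichotomy (q l) (q i) with h | h | h
  · simp [h.le, h.not_ge, h.not_gt, h.ne]
  · by_cases hli : l < i <;> simp [h, hli]
  · simp [h.not_ge, h]

variable {q} {n : ℕ}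

theorem Precedes.trans {a b c : ℕ} (h : Precedes q a b) (h' : Precedes q b c) : Precedes q a c := by
  rcases h with h | ⟨h, h1⟩ <;> rcases h' with h' | ⟨h', h1'⟩
  · exact Or.inl (h'.trans h)
  · exact Or.inl (h' ▸ h)
  · exact Or.inl (h ▸ h')
  · exact Or.inr ⟨h.trans h', h1.trans h1'⟩

theorem precedes_irrefl (a : ℕ) : ¬ Precedes q a a := by simp [Precedes]

theorem precedes_total {a b : ℕ} (h : a ≠ b) : Precedes q a b ∨ Precedes q b a := by
  rcases lt_trichotomy (q a) (q b) with h1 | h1 | h1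
  · exact Or.inr (Or.inl h1)
  · rcases Nat.lt_or_gt_of_ne h with h2 | h2
    · exact Or.inl (Or.inr ⟨h1, h2⟩)
    · exact Or.inr (Or.inr ⟨h1.symm, h2⟩)
  · exact Or.inl (Or.inl h1)

theorem rankNat_lt_of_precedes {a b : ℕ} (ha : a < n) (h : Precedes q a b) :
    rankNat q n a < rankNat q n b := by
  classical
  refine Finset.card_lt_card ?_
  refine Finset.ssubset_iff_of_subset (fun l hl => ?_) |>.2 ⟨a, ?_, ?_⟩
  · rw [Finset.mem_filter] at hl ⊢
    exact ⟨hl.1, hl.2.trans h⟩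
  · exact Finset.mem_filter.2 ⟨Finset.mem_range.2 ha, h⟩
  · intro h'
    exact precedes_irrefl a (Finset.mem_filter.1 h').2

theorem rankNat_lt {i : ℕ} (hi : i < n) : rankNat q n i < n := by
  classical
  have : rankNat q n i < (Finset.range n).card := by
    refine Finset.card_lt_card ((Finset.ssubset_iff_of_subset (Finset.filter_subset _ _)).2
      ⟨i, Finset.mem_range.2 hi, fun h => precedes_irrefl i (Finset.mem_filter.1 h).2⟩)
  rwa [Finset.card_range] at this

theorem rankNat_injOn : Set.InjOn (rankNat q n) (Finset.range n : Finset ℕ) := by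
  intro a ha b hb hab
  by_contra hne
  rcases precedes_total (q := q) hne with h | h
  · exact absurd (rankNat_lt_of_precedes (by simpa using ha) h) (by omega)
  · exact absurd (rankNat_lt_of_precedes (by simpa using hb) h) (by omega)

theorem image_rankNat : (Finset.range n).image (rankNat q n) = Finset.range n := by
  refine Finset.eq_of_subset_of_card_le (fun k hk => ?_) ?_
  · obtain ⟨i, hi, rfl⟩ := Finset.mem_image.1 hk
    exact Finset.mem_range.2 (rankNat_lt (Finset.mem_range.1 hi))
  · rw [Finset.card_image_of_injOn rankNat_injOn]

theorem exists_rankNat {k : ℕ} (hk : k < n) : ∃ i < n, rankNat q n i = k := by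
  have : k ∈ (Finset.range n).image (rankNat q n) := by
    rw [image_rankNat]; exact Finset.mem_range.2 hk
  obtain ⟨i, hi, h⟩ := Finset.mem_image.1 this
  exact ⟨i, Finset.mem_range.1 hi, h⟩

theorem quant_le_of_rankNat_le {a b : ℕ} (hb : b < n)
    (h : rankNat q n a ≤ rankNat q n b) : q b ≤ q a := by
  by_contra hcon
  push Not at hcon
  exact absurd (rankNat_lt_of_precedes hb (Or.inl hcon : Precedes q b a)) (by omega)

theorem card_rankNat {s : Finset ℕ} (hs : s ⊆ Finset.range n) :
    ((Finset.range n).filter fun i => rankNat q n i ∈ s).card = s.card := by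
  rw [← Finset.card_image_of_injOn (f := rankNat q n)
    (rankNat_injOn.mono fun i hi => (Finset.mem_filter.1 hi).1)]
  congr 1
  ext k
  simp only [Finset.mem_image, Finset.mem_filter, Finset.mem_range]
  constructor
  · rintro ⟨i, ⟨-, h⟩, rfl⟩; exact h
  · intro h
    obtain ⟨i, hi, rfl⟩ := exists_rankNat (q := q) (Finset.mem_range.1 (hs h))
    exact ⟨i, ⟨hi, h⟩, rfl⟩

theorem quantAtOf_eq {rk : ℕ → ℝ} (hrk : ∀ i < n, rk i = rankNat q n i) {i : ℕ} (hi : i < n) :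
    quantAtOf q rk n (rankNat q n i) = q i := by
  rw [quantAtOf, Finset.sum_eq_single i]
  · simp [hrk i hi]
  · intro l hl hne
    rw [hrk l (Finset.mem_range.1 hl)]
    simp only [Nat.cast_le]
    have : rankNat q n l ≠ rankNat q n i := fun h => hne (rankNat_injOn hl
      (by simpa using hi) h)
    split_ifs with h1 h2
    · exact absurd (le_antisymm h1 h2) this
    · rfl
    · rfl
  · intro h; exact absurd (Finset.mem_range.2 hi) h

theorem quantAtOf_antitone {rk : ℕ → ℝ} (hrk : ∀ i < n, rk i = rankNat q n i) {k l : ℕ}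
    (hkl : k ≤ l) (hl : l < n) : quantAtOf q rk n l ≤ quantAtOf q rk n k := by
  obtain ⟨i, hi, rfl⟩ := exists_rankNat (q := q) (hkl.trans_lt hl)
  obtain ⟨j, hj, rfl⟩ := exists_rankNat (q := q) hl
  rw [quantAtOf_eq hrk hi, quantAtOf_eq hrk hj]
  exact quant_le_of_rankNat_le hj hkl

/-- If the quantiles are nowhere flat, then they decrease geometrically. -/
theorem quantAtOf_le_of_not_flat {rk : ℕ → ℝ} (hrk : ∀ i < n, rk i = rankNat q n i) {ε : ℝ}
    (hε : 0 < ε) {J : ℕ} (hJ : 1 ≤ J) (hn : 3 * J ^ 2 + 1 < n)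
    (hq : ∀ i < n, 0 ≤ q i) (hgeo : FreeOrder.geo ε J ≤ ε ^ 2)
    (hf : ∀ k, J ^ 2 + 1 ≤ k → k ≤ 3 * J ^ 2 + 1 → ¬ Flat q rk n J ε k) :
    quantAtOf q rk n (3 * J ^ 2 + 1) ≤ ε ^ 4 * quantAtOf q rk n (J ^ 2) := by
  -- Each of the 2J blocks of J ranks fails to be flat and so lowers the quantile by a factor of at
  -- least 1 + ε.
  have h1 : ∀ a ≤ 2 * J, quantAtOf q rk n (J ^ 2 + 1 + a * J) ≤
      FreeOrder.geo ε a * quantAtOf q rk n (J ^ 2 + 1) := by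
    intro a
    induction a with
    | zero => intro _; simp [FreeOrder.geo_zero]
    | succ a ih =>
      intro ha
      have h2 := ih (by omega)
      have h3 : a * J + J ≤ 2 * J ^ 2 := by nlinarith
      have h4 := hf (J ^ 2 + 1 + a * J) (by omega) (by omega)
      rw [Flat, not_le] at h4
      have e : J ^ 2 + 1 + a * J + J = J ^ 2 + 1 + (a + 1) * J := by ring
      rw [e] at h4
      rw [FreeOrder.geo_succ, div_mul_eq_mul_div, le_div_iff₀ (by linarith)]
      linarith
  have h2 := h1 (2 * J) le_rfl
  have e : J ^ 2 + 1 + 2 * J * J = 3 * J ^ 2 + 1 := by ring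
  rw [e] at h2
  -- The factor for 2J blocks is the square of `geo ε J` ≤ ε².
  have h3 : FreeOrder.geo ε (2 * J) ≤ ε ^ 4 := by
    have : FreeOrder.geo ε (2 * J) = FreeOrder.geo ε J ^ 2 := by
      rw [FreeOrder.geo, FreeOrder.geo, ← pow_mul, mul_comm]
    rw [this]
    calc FreeOrder.geo ε J ^ 2 ≤ (ε ^ 2) ^ 2 :=
          pow_le_pow_left₀ (FreeOrder.geo_pos hε J).le hgeo 2
      _ = ε ^ 4 := by ring
  have h4 := quantAtOf_antitone hrk (Nat.le_succ (J ^ 2)) (l := J ^ 2 + 1) (by omega)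
  have h5 : 0 ≤ quantAtOf q rk n (J ^ 2 + 1) := by
    obtain ⟨i, hi, h⟩ := exists_rankNat (q := q) (show J ^ 2 + 1 < n by omega)
    rw [← h, quantAtOf_eq hrk hi]; exact hq i hi
  calc _ ≤ _ := h2
    _ ≤ ε ^ 4 * quantAtOf q rk n (J ^ 2 + 1) := mul_le_mul_of_nonneg_right h3 h5
    _ ≤ _ := mul_le_mul_of_nonneg_left h4 (by positivity)

end Rank

end RealRAM

namespace FreeOrder

/-! ### Expected rewards in terms of tails -/

namespace Policy

variable {ι : Type}

theorem reward_congr [DecidableEq ι] {x y : ι → ℝ} (p : Policy ι) :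
    ∀ S : Finset ι, p.Feasible S → (∀ i ∈ S, x i = y i) → p.reward x = p.reward y := by
  induction p with
  | quit => intro S _ _; rfl
  | inspect i A next ih =>
    intro S hp hxy
    simp only [Feasible] at hp
    simp only [reward]
    rw [← hxy i hp.1, ih (x i) _ (hp.2 _) fun j hj => hxy j (Finset.mem_of_mem_erase hj)]

theorem reward_mem [DecidableEq ι] {x : ι → ℝ} (hx : ∀ i, 0 ≤ x i) (p : Policy ι) :
    ∀ S : Finset ι, p.Feasible S → 0 ≤ p.reward x ∧ p.reward x ≤ S.fold max 0 x := by
  induction p with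
  | quit => intro S _; exact ⟨le_rfl, (Finset.le_fold_max (c := (0 : ℝ))).2 (Or.inl le_rfl)⟩
  | inspect i A next ih =>
    intro S hp
    simp only [Feasible] at hp
    simp only [reward]
    split_ifs with h
    · exact ⟨hx i, (Finset.le_fold_max _).2 (Or.inr ⟨i, hp.1, le_rfl⟩)⟩
    · refine ⟨(ih (x i) _ (hp.2 _)).1, (ih (x i) _ (hp.2 _)).2.trans ?_⟩
      refine (Finset.fold_max_le _).2 ⟨(Finset.le_fold_max _).2 (Or.inl le_rfl), fun j hj => ?_⟩
      exact (Finset.le_fold_max _).2 (Or.inr ⟨j, Finset.mem_of_mem_erase hj, le_rfl⟩)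

theorem feasible_ofThresholds [DecidableEq ι] (l : List (ι × ℝ)) (hl : (l.map Prod.fst).Nodup) :
    (ofThresholds l).Feasible (l.map Prod.fst).toFinset := by
  induction l with
  | nil => trivial
  | cons a l ih =>
    rw [List.map_cons, List.nodup_cons] at hl
    refine ⟨by simp, fun v => ?_⟩
    have : ((a :: l).map Prod.fst).toFinset.erase a.1 = (l.map Prod.fst).toFinset := by
      rw [List.map_cons, List.toFinset_cons, Finset.erase_insert (by simpa using hl.1)]
    rw [this]
    exact ih hl.2

theorem measurable_reward_ofThresholds (l : List (ι × ℝ)) :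
    Measurable (ofThresholds l).reward := by
  induction l with
  | nil => exact measurable_const
  | cons a l ih =>
    simp only [ofThresholds, reward]
    exact Measurable.ite (measurable_pi_apply a.1 measurableSet_Ioi) (measurable_pi_apply _) ih

end Policy

section Tails

variable {Ω : Type*} [MeasurableSpace Ω] {P : Measure Ω}

/-- The probability that `Y` exceeds `x`. -/
noncomputable def tailOf (P : Measure Ω) (Y : Ω → ℝ) (x : ℝ) : ℝ := P.real {ω | x < Y ω}

theorem integral_eq_tailOf {Y : Ω → ℝ} (hi : Integrable Y P) (h0 : ∀ ω, 0 ≤ Y ω) :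
    ∫ ω, Y ω ∂P = ∫ x in Set.Ioi 0, tailOf P Y x :=
  hi.integral_eq_integral_meas_lt (ae_of_all _ h0)

theorem tailOf_antitone [IsProbabilityMeasure P] (Y : Ω → ℝ) : Antitone (tailOf P Y) := fun _ _ hxy =>
  measureReal_mono fun _ hω => lt_of_le_of_lt hxy hω

theorem isTail_tailOf [IsProbabilityMeasure P] {Y : Ω → ℝ} (hm : Measurable Y) (hi : Integrable Y P) (h0 : ∀ ω, 0 ≤ Y ω) :
    IsTail (tailOf P Y) (∫ ω, Y ω ∂P) where
  anti := tailOf_antitone Y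
  nonneg _ := measureReal_nonneg
  le_one _ := measureReal_le_one
  neg x hx := by
    have : {ω | x < Y ω} = Set.univ := Set.eq_univ_of_forall fun ω => hx.trans_le (h0 ω)
    simp [tailOf, this]
  zero h := by
    have := (integral_eq_zero_iff_of_nonneg h0 hi).1 h
    rw [tailOf, measureReal_eq_zero_iff]
    refine measure_mono_null (fun ω hω => ?_) this
    simpa using (show (0 : ℝ) < Y ω from hω).ne'
  int := by
    have hfin : ∫⁻ x in Set.Ioi 0, P {ω | x < Y ω} < ⊤ := by
      rw [← lintegral_eq_lintegral_meas_lt P (ae_of_all _ h0) hm.aemeasurable]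
      exact (hasFiniteIntegral_iff_ofReal (ae_of_all _ h0)).1 hi.2
    refine ⟨(tailOf_antitone Y).measurable.aestronglyMeasurable, ?_⟩
    rw [hasFiniteIntegral_iff_ofReal (ae_of_all _ fun x => by exact measureReal_nonneg)]
    refine lt_of_le_of_lt (lintegral_mono fun x => ?_) hfin
    exact ENNReal.ofReal_toReal_le
  integral := (integral_eq_tailOf hi h0).symm

theorem integral_indicator_Ioi [IsProbabilityMeasure P] {Y : Ω → ℝ} (hm : Measurable Y) (hi : Integrable Y P)
    (h0 : ∀ ω, 0 ≤ Y ω) (θ : ℝ) :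
    ∫ ω, (if Y ω ∈ Set.Ioi θ then Y ω else 0) ∂P = ∫ x in Set.Ioi 0, tailOf P Y (max x θ) := by
  have hmeas : Measurable fun ω => if Y ω ∈ Set.Ioi θ then Y ω else 0 :=
    Measurable.ite (hm measurableSet_Ioi) hm measurable_const
  rw [integral_eq_tailOf]
  · refine setIntegral_congr_fun measurableSet_Ioi fun x hx => ?_
    simp only [tailOf]
    congr 1
    ext ω
    simp only [Set.mem_Ioi, Set.mem_ofPred_eq, max_lt_iff] at hx ⊢
    split_ifs with h
    · exact ⟨fun hh => ⟨hh, h⟩, fun hh => hh.1⟩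
    · exact ⟨fun hh => absurd (hx.trans hh) (lt_irrefl _), fun hh => absurd hh.2 h⟩
  · refine hi.mono' hmeas.aestronglyMeasurable (ae_of_all _ fun ω => ?_)
    split_ifs
    · exact (Real.norm_of_nonneg (h0 ω)).le
    · simpa using h0 ω
  · intro ω
    split_ifs
    exacts [h0 ω, le_rfl]

variable {n : ℕ} {X : Fin n → Ω → ℝ}

theorem integrable_fold (hi : ∀ i, Integrable (X i) P) (S : Finset (Fin n)) :
    Integrable (fun ω => S.fold max 0 fun i => X i ω) P := by
  induction S using Finset.induction_on with
  | empty => simp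
  | insert a T ha ih =>
    simp only [Finset.fold_insert ha]
    exact (hi a).sup ih

theorem integrable_reward (hm : ∀ i, Measurable (X i)) (h0 : ∀ i ω, 0 ≤ X i ω)
    (hi : ∀ i, Integrable (X i) P) {S : Finset (Fin n)} {p : Policy (Fin n)}
    (hp : p.Feasible S) (hpm : Measurable p.reward) :
    Integrable (fun ω => p.reward fun i => X i ω) P := by
  refine (integrable_fold hi S).mono'
    (hpm.comp (measurable_pi_lambda _ hm)).aestronglyMeasurable (ae_of_all _ fun ω => ?_)
  have := p.reward_mem (fun i => h0 i ω) S hp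
  rw [Real.norm_of_nonneg this.1]
  exact this.2

theorem expReward_le_prophet (hm : ∀ i, Measurable (X i)) (h0 : ∀ i ω, 0 ≤ X i ω)
    (hi : ∀ i, Integrable (X i) P) {S : Finset (Fin n)} {p : Policy (Fin n)}
    (hp : p.Feasible S) (hpm : Measurable p.reward) : expReward P X p ≤ prophet P X S :=
  integral_mono (integrable_reward hm h0 hi hp hpm) (integrable_fold hi S)
    fun ω => (p.reward_mem (fun i => h0 i ω) S hp).2

theorem expReward_le_optFree (hm : ∀ i, Measurable (X i)) (h0 : ∀ i ω, 0 ≤ X i ω)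
    (hi : ∀ i, Integrable (X i) P) {l : List (Fin n × ℝ)} (hl : (l.map Prod.fst).Nodup) :
    expReward P X (Policy.ofThresholds l) ≤ optFree P X (l.map Prod.fst).toFinset :=
  le_csSup ⟨prophet P X (l.map Prod.fst).toFinset, by
      rintro r ⟨p, hp, hpm, rfl⟩
      exact expReward_le_prophet hm h0 hi hp hpm⟩
    ⟨_, Policy.feasible_ofThresholds l hl, Policy.measurable_reward_ofThresholds l, rfl⟩

theorem prophet_nonneg (S : Finset (Fin n)) : 0 ≤ prophet P X S :=
  integral_nonneg fun _ => (Finset.le_fold_max _).2 (Or.inl le_rfl)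

theorem expReward_nonneg (h0 : ∀ i ω, 0 ≤ X i ω) {l : List (Fin n × ℝ)}
    (hl : (l.map Prod.fst).Nodup) : 0 ≤ expReward P X (Policy.ofThresholds l) :=
  integral_nonneg fun ω =>
    ((Policy.ofThresholds l).reward_mem (fun i => h0 i ω) _
      (Policy.feasible_ofThresholds l hl)).1

theorem prophet_eq_maxTail [IsProbabilityMeasure P] (hm : ∀ i, Measurable (X i)) (hi : ∀ i, Integrable (X i) P)
    (hX : iIndepFun X P) {p : ℕ → ℝ → ℝ}
    (hp : ∀ i : Fin n, p i = tailOf P (X i)) (S : Finset (Fin n)) :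
    prophet P X S = maxTail p (S.map Fin.valEmbedding) := by
  rw [prophet, integral_eq_tailOf (integrable_fold hi S)
    fun ω => (Finset.le_fold_max _).2 (Or.inl le_rfl), maxTail]
  refine setIntegral_congr_fun measurableSet_Ioi fun x hx => ?_
  have hcompl : {ω | x < S.fold max 0 fun i => X i ω} = (⋂ i ∈ S, {ω | X i ω ≤ x})ᶜ := by
    ext ω
    simp only [Set.mem_ofPred_eq, Set.mem_compl_iff, Set.mem_iInter, Finset.lt_fold_max, not_forall,
      not_le, exists_prop]
    exact or_iff_right (not_lt.2 (le_of_lt hx))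
  have hset : ∀ i, MeasurableSet {ω | X i ω ≤ x} := fun i => hm i measurableSet_Iic
  have hind : P (⋂ i ∈ S, {ω | X i ω ≤ x}) = ∏ i ∈ S, P {ω | X i ω ≤ x} :=
    hX.meas_biInter fun i _ => ⟨Set.Iic x, measurableSet_Iic, rfl⟩
  rw [tailOf, hcompl, probReal_compl_eq_one_sub (Finset.measurableSet_biInter _ fun i _ => hset i),
    measureReal_def, hind, ENNReal.toReal_prod, Finset.prod_map]
  congr 1
  refine Finset.prod_congr rfl fun i _ => ?_
  rw [Fin.valEmbedding_apply, hp i, tailOf]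
  have : {ω | x < X i ω} = {ω | X i ω ≤ x}ᶜ := by ext; simp
  rw [this, probReal_compl_eq_one_sub (hset i), measureReal_def]
  ring

/-- The reward is the first value if it exceeds its threshold, plus the indicator of rejection times
the reward of the rest. The rest depends only on the other boxes, so the expectation of this product
factors by independence. -/
theorem expReward_eq_listVal [IsProbabilityMeasure P] (hm : ∀ i, Measurable (X i)) (h0 : ∀ i ω, 0 ≤ X i ω)
    (hi : ∀ i, Integrable (X i) P) (hX : iIndepFun X P) {p : ℕ → ℝ → ℝ}
    (hp : ∀ i : Fin n, p i = tailOf P (X i)) (l : List (Fin n × ℝ))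
    (hl : (l.map Prod.fst).Nodup) :
    expReward P X (Policy.ofThresholds l) = listVal p (l.map fun a => ((a.1 : ℕ), a.2)) := by
  induction l with
  | nil => simp [expReward, Policy.ofThresholds, Policy.reward, listVal]
  | cons a l ih =>
    obtain ⟨b, τ⟩ := a
    rw [List.map_cons, List.nodup_cons] at hl
    have ih := ih hl.2
    rw [List.map_cons, listVal, ← ih, hp b]
    set T := (l.map Prod.fst).toFinset with hT
    have hf := Policy.feasible_ofThresholds l hl.2
    -- The reward of the rest as a function of the boxes in T alone; missing coordinates are filled
    -- with 0, which a feasible policy never reads.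
    let F : (T → ℝ) → ℝ := fun z =>
      (Policy.ofThresholds l).reward fun i => if h : i ∈ T then z ⟨i, h⟩ else 0
    have hF : ∀ ω, (Policy.ofThresholds l).reward (fun i => X i ω) = F fun i => X i ω := fun ω =>
      Policy.reward_congr _ T hf fun i h => by simp [h]
    have hFm : Measurable F := by
      refine (Policy.measurable_reward_ofThresholds l).comp (measurable_pi_lambda _ fun i => ?_)
      by_cases h : i ∈ T
      · simpa [h] using measurable_pi_apply (⟨i, h⟩ : T)
      · simp [h]
    let g : (({b} : Finset (Fin n)) → ℝ) → ℝ := fun z =>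
      if z ⟨b, Finset.mem_singleton_self b⟩ ∈ Set.Ioi τ then 0 else 1
    have hgm : Measurable g :=
      Measurable.ite (measurable_pi_apply (⟨b, Finset.mem_singleton_self b⟩ : ({b} : Finset (Fin n)))
        measurableSet_Ioi) measurable_const measurable_const
    have hind := hX.indepFun_finset {b} T
      (Finset.disjoint_singleton_left.2 (by simpa [hT] using hl.1)) hm
    have hprod := hind.integral_fun_comp_mul_comp (f := g) (g := F)
      (Measurable.aemeasurable (by fun_prop)) (Measurable.aemeasurable (by fun_prop))
      hgm.aestronglyMeasurable hFm.aestronglyMeasurable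
    have hsplit : ∀ ω, (Policy.ofThresholds ((b, τ) :: l)).reward (fun i => X i ω) =
        (if X b ω ∈ Set.Ioi τ then X b ω else 0) +
          g (fun i => X i ω) * F fun i => X i ω := fun ω => by
      simp only [Policy.ofThresholds, Policy.reward, g]
      rw [← hF]
      split_ifs <;> simp
    have hgi : ∫ ω, g (fun i => X i ω) ∂P = 1 - tailOf P (X b) τ := by
      have : {ω | τ < X b ω} = {ω | X b ω ≤ τ}ᶜ := by ext; simp
      have hset : MeasurableSet {ω | X b ω ≤ τ} := hm b measurableSet_Iic
      rw [tailOf, this, probReal_compl_eq_one_sub hset, sub_sub_cancel,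
        ← integral_indicator_one hset]
      refine integral_congr_ae (ae_of_all _ fun ω => ?_)
      by_cases h : X b ω ≤ τ
      · simp [g, h]
      · simp [g, h, not_le.1 h]
    have hint : Integrable (fun ω => g (fun i => X i ω) * F fun i => X i ω) P := by
      have hr := integrable_reward hm h0 hi hf (Policy.measurable_reward_ofThresholds l)
      simp only [hF] at hr
      refine hr.mono ((hgm.comp (measurable_pi_lambda _ fun i => hm i.1)).mul
        (hFm.comp (measurable_pi_lambda _ fun i => hm i.1))).aestronglyMeasurable
        (ae_of_all _ fun ω => ?_)
      simp only [g]
      split_ifs <;> simp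
    have hint' : Integrable (fun ω => if X b ω ∈ Set.Ioi τ then X b ω else 0) P := by
      refine (hi b).mono (Measurable.ite (hm b measurableSet_Ioi) (hm b)
        measurable_const).aestronglyMeasurable (ae_of_all _ fun ω => ?_)
      split_ifs <;> simp
    rw [expReward, integral_congr_ae (ae_of_all _ hsplit), integral_add hint' hint, hprod, hgi,
      integral_indicator_Ioi (hm b) (hi b) (h0 b) τ, expReward]
    simp only [hF]

end Tails

end FreeOrder

/-! ### The answers of the oracle as tails -/

namespace RealRAM

variable {Ω : Type*} [MeasurableSpace Ω] {P : Measure Ω} [IsProbabilityMeasure P]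
  {n : ℕ} {X : Fin n → Ω → ℝ}

theorem tail_boxOracle (hm : ∀ i, Measurable (X i)) (i : Fin n) :
    (boxOracle P X).tail i = FreeOrder.tailOf P (X i) := by
  ext x
  have : {ω | x < X i ω} = {ω | X i ω ≤ x}ᶜ := by ext; simp
  have hset : MeasurableSet {ω | X i ω ≤ x} := hm i measurableSet_Iic
  rw [FreeOrder.tailOf, this, probReal_compl_eq_one_sub hset]
  simp [Oracle.tail, boxOracle]

theorem isTail_boxOracle (hm : ∀ i, Measurable (X i)) (h0 : ∀ i ω, 0 ≤ X i ω)
    (hi : ∀ i, Integrable (X i) P) (i : ℕ) (h : i < n) :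
    FreeOrder.IsTail ((boxOracle P X).tail i) ((boxOracle P X).mean i) := by
  have h1 := FreeOrder.isTail_tailOf (hm ⟨i, h⟩) (hi ⟨i, h⟩) (h0 ⟨i, h⟩)
  have h2 := tail_boxOracle (P := P) hm ⟨i, h⟩
  simp only at h2
  rw [h2]
  simpa [boxOracle, h] using h1

end RealRAM

namespace RealRAM

/-! ### Analysis of the main program -/

/-- The scale found by the program is close to the Kertz bound. -/
theorem scale_ge {β ε κ : ℝ} (hβ : IsKertzBound β) (hε : 0 < ε) (hε4 : ε ≤ 1 / 4) {M B k : ℕ}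
    (hM : 1 ≤ M * (1 - β)) (hB : 1 / ε < B)
    (hκ : ∀ i < B, Admissible M ε (k + 1) (i * ε) → i * ε ≤ κ) : β - 5 * ε ≤ κ := by
  obtain ⟨hβ0, hβ1, -⟩ := id hβ
  have hc : 0 < (1 + 2 * ε) * (1 + ε) := by positivity
  have hc1 : 1 ≤ (1 + 2 * ε) * (1 + ε) := by nlinarith
  set x := β / ((1 + 2 * ε) * (1 + ε)) with hx
  have hx0 : 0 ≤ x := by positivity
  have hxβ : x * ((1 + 2 * ε) * (1 + ε)) = β := div_mul_cancel₀ _ hc.ne'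
  have hx1 : x ≤ 1 := by nlinarith
  -- Any scale up to x = β/((1 + 2ε)(1 + ε)) satisfies `sum_slotWeight_le`. The largest multiple of
  -- ε below it is among the candidates, so rounding costs at most ε.
  set i := ⌊x / ε⌋₊ with hi
  have h1 : (i : ℝ) ≤ x / ε := Nat.floor_le (by positivity)
  have h2 : x / ε < i + 1 := Nat.lt_floor_add_one _
  rw [le_div_iff₀ hε] at h1
  rw [div_lt_iff₀ hε] at h2
  have hiB : i < B := by
    have : (i : ℝ) ≤ 1 / ε := by rw [le_div_iff₀ hε]; linarith
    exact_mod_cast this.trans_lt hB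
  have hκ0 : 0 ≤ (i : ℝ) * ε := by positivity
  have hκβ : (i : ℝ) * ε * ((1 + 2 * ε) * (1 + ε)) ≤ β := by
    rw [← hxβ]; exact mul_le_mul_of_nonneg_right h1 hc.le
  -- In `surv_ge` the term y - y log y is nonnegative, so survival never falls below 1 - β, whatever
  -- the slot.
  have hsv : ∀ j, 1 - β ≤ FreeOrder.surv ε (i * ε) j := fun j => by
    have h3 := FreeOrder.surv_ge hε hκβ hκ0 j
    have h4 := FreeOrder.geo_pos hε j
    have h5 : Real.log (FreeOrder.geo ε j) ≤ 0 :=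
      Real.log_nonpos h4.le (FreeOrder.geo_le_one hε j)
    nlinarith [mul_nonneg h4.le (neg_nonneg.2 h5)]
  have hadm : Admissible M ε (k + 1) (i * ε) := by
    refine ⟨h1.trans hx1, ?_, hM.trans (mul_le_mul_of_nonneg_left (hsv _) (Nat.cast_nonneg M))⟩
    refine le_trans (Finset.sum_le_sum fun j hj => ?_)
      (FreeOrder.sum_slotWeight_le hε hβ hκβ hκ0 (k + 1))
    have h6 := FreeOrder.geoGap_nonneg hε j
    have h7 : 0 ≤ FreeOrder.surv ε (i * ε) j := by linarith [hsv j]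
    have h8 : 0 ≤ FreeOrder.slotWeight ε (i * ε) j := by unfold FreeOrder.slotWeight; positivity
    unfold slotWeightOf
    split_ifs
    exacts [h8, le_rfl, h8]
  have := hκ i hiB hadm
  have h9 : β * (1 - 4 * ε) ≤ x := by
    rw [hx, le_div_iff₀ hc]
    have : (1 - 4 * ε) * ((1 + 2 * ε) * (1 + ε)) ≤ 1 := by nlinarith [pow_pos hε 2, pow_pos hε 3]
    nlinarith
  nlinarith

theorem slotWeightOf_nonneg {M : ℕ} {ε κ : ℝ} (hε : 0 < ε) (hκ0 : 0 ≤ κ) {J : ℕ}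
    (h : Admissible M ε J κ) (j : ℕ) : 0 ≤ slotWeightOf ε κ J j := by
  unfold slotWeightOf
  split_ifs with h0 h1
  · exact le_rfl
  · have h2 := FreeOrder.surv_antitone hε hκ0 h1.le
    have h3 : 0 ≤ FreeOrder.surv ε κ J := by
      by_contra hc
      have := mul_nonpos_of_nonneg_of_nonpos (Nat.cast_nonneg (α := ℝ) M) (not_le.1 hc).le
      linarith [h.2.2]
    have h4 := FreeOrder.geoGap_nonneg hε j
    exact div_nonneg (mul_nonneg hκ0 h4) (h3.trans h2)
  · exact le_rfl

section Value

variable {O : Oracle} {s : State} {κ : ℝ} {M k : ℕ}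

/-- The memory holds the tables of an instance. -/
structure Loaded (O : Oracle) (s : State) (M k : ℕ) (κ : ℝ) : Prop where
  data : FreeOrder.Data O.tail O.mean (s.natVar 1) (s.realVar 0) (s.natVar 2) (s.realArr 1)
    (s.realArr 8)
  ready : Ready O s
  weight : ∀ j < s.natVar 2, s.realArr 4 j = slotWeightOf (s.realVar 0) κ (k + 1) j
  undecided : ∀ i < s.natVar 1, s.natArr 2 i = 0
  scale : 0 ≤ κ
  admissible : Admissible M (s.realVar 0) (k + 1) κ
  le : k + 1 ≤ s.natVar 2
  lt_geo : s.realVar 0 ^ 2 < FreeOrder.geo (s.realVar 0) k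
  geo_le : FreeOrder.geo (s.realVar 0) (k + 1) ≤ s.realVar 0 ^ 2
  pos : 0 < ∑ i ∈ selected s, O.mean i

theorem mem_selected {i : ℕ} :
    i ∈ selected s ↔ i < s.natVar 1 ∧ (s.natVar 6 : ℝ) ≤ s.realArr 2 i := by
  simp [selected]

theorem lt_of_mem_selected {i : ℕ} (h : i ∈ selected s) : i < s.natVar 1 := (mem_selected.1 h).1

theorem Loaded.unit_pos (h : Loaded O s M k κ) : 0 < s.realVar 3 := by
  have h1 := h.data.pos
  have h2 := h.data.one_le_n
  have h3 := h.pos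
  rw [h.ready.unit]
  exact div_pos (mul_pos h1 h3) (by linarith)

theorem Loaded.proper (h : Loaded O s M k κ) {i : ℕ} (hi : i < s.natVar 1) : Proper s i where
  weight_nonneg j hj := by
    rw [h.weight j hj]; exact slotWeightOf_nonneg h.data.pos h.scale h.admissible j
  sum_le := by
    rw [Finset.sum_congr rfl fun j hj => h.weight j (Finset.mem_range.1 hj),
      sum_slotWeightOf _ _ h.le]
    exact h.admissible.2.1
  mix j hj hne := by
    have hj1 : 1 ≤ j := by
      rcases Nat.eq_zero_or_pos j with h0 | h0
      · rw [h.weight j hj, h0] at hne; exact absurd (by simp [slotWeightOf]) hne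
      · exact h0
    have hj' : (1 : ℝ) ≤ j := by exact_mod_cast hj1
    rw [h.ready.mix j hj, h.ready.level j hj]
    exact FreeOrder.gridMix_mem (h.data.mass_antitone fun _ => lt_of_mem_selected) h.unit_pos
      (mul_pos (by linarith) h.data.pos)
      (fun x hx => h.data.mul_mass_le (fun _ => lt_of_mem_selected) hx)
      (h.data.large_unit hj1 h.pos h.ready.unit) h.pos
  coin := h.data.coin_mem hi

theorem Loaded.value_ge (h : Loaded O s M k κ) (hM : 1 ≤ M) (hM2 : 2 * M * s.realVar 0 ≤ 1) :
    κ * (1 - 2 * M * s.realVar 0) * (1 - 5 * s.realVar 0) *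
      (∫ x in Set.Ioi 0, (1 - Real.exp (-(massOf O s x)))) - 2 * s.realVar 3 ≤ valueOf O s := by
  have hS : ∀ i ∈ selected s, i < s.natVar 1 := fun _ => lt_of_mem_selected
  have hM0 : (0 : ℝ) < M := by exact_mod_cast hM
  refine (h.data.blend_ge hS hM2 h.scale h.admissible.1 h.le h.lt_geo h.geo_le h.admissible.2.2
    hM0 (d := slotWeightOf (s.realVar 0) κ (k + 1)) (fun j => rfl) h.admissible.2.1 h.pos
    h.ready.unit h.ready.level h.ready.mix).trans (le_of_eq ?_)
  refine FreeOrder.blend_congr (fun i hi j hj => ?_) fun i hi j hj => ?_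
  · rw [rowWOf, if_pos (by simp [h.undecided i (hS i hi)]), h.weight j hj]
  · rw [rowFOf, if_pos (by simp [h.undecided i (hS i hi)]), ← Finset.sum_filter]
    congr 1
    have : (Finset.range (s.natVar 2)).filter (fun t : ℕ => (t : ℝ) ≤ j) =
        Finset.range (j + 1) := by
      ext t
      simp only [Finset.mem_filter, Finset.mem_range, Nat.cast_le]
      omega
    rw [this]
    refine Finset.sum_congr rfl fun t ht => ?_
    rw [h.weight t (by rw [Finset.mem_range] at ht; omega)]

end Value

theorem valueOf_le_listVal {O : Oracle} {s : State} (hB : 0 < s.natVar 2)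
    (hO : ∀ i < s.natVar 1, FreeOrder.IsTail (O.tail i) (O.mean i))
    (hd : ∀ i < s.natVar 1, s.natArr 2 i = 1) (hs : ∀ i < s.natVar 1, s.natArr 1 i ≤ s.natVar 2) :
    valueOf O s ≤
      FreeOrder.listVal O.tail ((outputList s).map fun i => (i, s.realArr 7 i)) := by
  have hL := outputList_toFinset hs
  have hmem : ∀ i ∈ outputList s, i < s.natVar 1 := fun i hi =>
    lt_of_mem_selected (hL ▸ List.mem_toFinset.2 hi)
  refine le_trans (le_of_eq ?_) (FreeOrder.blend_le_listVal (slot := s.natArr 1) hB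
    (fun i hi => hO i (hmem i hi)) (outputList_nodup s) (outputList_pairwise s))
  rw [valueOf, hL]
  refine FreeOrder.blend_congr (fun i hi j hj => ?_) fun i hi j hj => ?_
  · rw [rowWOf, if_neg (by simp [hd i (lt_of_mem_selected hi)])]
  · rw [rowFOf, if_neg (by simp [hd i (lt_of_mem_selected hi)])]

end RealRAM

/-! ### Values of fixed orders against the prophet -/

namespace FreeOrder

section ListValue

variable {p : ℕ → ℝ → ℝ} {m : ℕ → ℝ}

theorem listVal_nonneg (l : List (ℕ × ℝ)) (hl : ∀ a ∈ l, IsTail (p a.1) (m a.1)) :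
    0 ≤ listVal p l := by
  induction l with
  | nil => exact le_rfl
  | cons a l ih =>
    have ha := hl a List.mem_cons_self
    have := ih fun b hb => hl b (List.mem_cons_of_mem _ hb)
    exact add_nonneg (integral_nonneg fun x => ha.nonneg _)
      (mul_nonneg (by linarith [ha.le_one a.2]) this)

/-- The prophet bound on the level of tails, checked pointwise in x. It supplies the hypothesis of
`Data.rich` that the computed value is at most the prophet's reward. -/
theorem listVal_le_maxTail (l : List (ℕ × ℝ)) (hl : ∀ a ∈ l, IsTail (p a.1) (m a.1))
    (hnd : (l.map Prod.fst).Nodup) : listVal p l ≤ maxTail p (l.map Prod.fst).toFinset := by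
  induction l with
  | nil => simp [listVal, maxTail]
  | cons a l ih =>
    have ha := hl a List.mem_cons_self
    rw [List.map_cons, List.nodup_cons] at hnd
    have hih := ih (fun b hb => hl b (List.mem_cons_of_mem _ hb)) hnd.2
    set S := (l.map Prod.fst).toFinset with hS
    have hST : ∀ i ∈ S, IsTail (p i) (m i) := fun i hi => by
      obtain ⟨b, hb, rfl⟩ := List.mem_map.1 (List.mem_toFinset.1 hi)
      exact hl b (List.mem_cons_of_mem _ hb)
    have haS : a.1 ∉ S := by simpa [hS] using hnd.1
    have hins : ∀ i ∈ insert a.1 S, IsTail (p i) (m i) := fun i hi => by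
      rcases Finset.mem_insert.1 hi with rfl | hi
      exacts [ha, hST i hi]
    have h0 : 0 ≤ 1 - p a.1 a.2 := by linarith [ha.le_one a.2]
    rw [List.map_cons, List.toFinset_cons, listVal]
    calc _ ≤ (∫ x in Set.Ioi 0, p a.1 (max x a.2)) + (1 - p a.1 a.2) * maxTail p S := by
          gcongr
      _ = ∫ x in Set.Ioi 0, (p a.1 (max x a.2) +
            (1 - p a.1 a.2) * (1 - ∏ i ∈ S, (1 - p i x))) := by
          rw [integral_add (ha.integrableOn_max a.2) ((integrableOn_maxTail hST).const_mul _),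
            integral_const_mul, maxTail]
      _ ≤ _ := by
          refine integral_mono ((ha.integrableOn_max a.2).add
            ((integrableOn_maxTail hST).const_mul _)) (integrableOn_maxTail hins) fun x => ?_
          simp only
          rw [Finset.prod_insert haS]
          obtain ⟨h1, h2⟩ := prod_tail_mem hST x
          rcases le_total x a.2 with h | h
          · rw [max_eq_right h]
            have := ha.anti h
            nlinarith
          · rw [max_eq_left h]
            have := ha.anti h
            nlinarith

end ListValue

end FreeOrder

/-! ### The guarantee for the final state -/

namespace RealRAM

section Final

variable {O : Oracle} {s : State} {J : ℕ}

/-- The state before the output is written. -/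
noncomputable def finalState (O : Oracle) (s : State) : State :=
  rescue.run O 12 (decideAll.run O 12 (search.run O 12 s))

/-- The expected reward of the policy described by the output. -/
noncomputable def outputVal (O : Oracle) (s : State) : ℝ :=
  FreeOrder.listVal O.tail ((outputList s).map fun i => (i, s.realArr 7 i))

/-- The ranks have been tabulated. -/
def Ranked (s : State) : Prop :=
  ∀ i < s.natVar 1, s.realArr 2 i = rankNat (s.realArr 1) (s.natVar 1) i

theorem Ranked.card_selected (h : Ranked s) :
    (selected s).card = s.natVar 1 - s.natVar 6 := by
  have e : selected s = (Finset.range (s.natVar 1)).filter fun i =>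
      rankNat (s.realArr 1) (s.natVar 1) i ∈ Finset.Ico (s.natVar 6) (s.natVar 1) := by
    ext i
    simp only [selected, Finset.mem_filter, Finset.mem_range, Finset.mem_Ico]
    refine and_congr_right fun hi => ?_
    rw [h i hi, Nat.cast_le]
    exact (and_iff_left (rankNat_lt hi)).symm
  rw [e, card_rankNat fun i hi => Finset.mem_range.2 (Finset.mem_Ico.1 hi).2, Nat.card_Ico]

theorem Ranked.quant_le (h : Ranked s) (h6 : s.natVar 6 < s.natVar 1) {i : ℕ}
    (hi : i ∈ selected s) : s.realArr 1 i ≤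
      quantAtOf (s.realArr 1) (s.realArr 2) (s.natVar 1) (s.natVar 6) := by
  obtain ⟨j, hj, e⟩ := exists_rankNat (q := s.realArr 1) h6
  have := quantAtOf_eq h hj
  rw [e] at this
  rw [this]
  obtain ⟨h1, h2⟩ := mem_selected.1 hi
  refine quant_le_of_rankNat_le h1 ?_
  rw [h i h1, Nat.cast_le] at h2
  omega

theorem Ranked.le_quant (h : Ranked s) {l : ℕ} (hl : l < s.natVar 1) {i : ℕ}
    (hi : rankNat (s.realArr 1) (s.natVar 1) i ≤ l) :
    quantAtOf (s.realArr 1) (s.realArr 2) (s.natVar 1) l ≤ s.realArr 1 i := by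
  obtain ⟨j, hj, e⟩ := exists_rankNat (q := s.realArr 1) hl
  have := quantAtOf_eq h hj
  rw [e] at this
  rw [this]
  exact quant_le_of_rankNat_le hj (by omega)

theorem outputVal_nonneg (hO : ∀ i < s.natVar 1, FreeOrder.IsTail (O.tail i) (O.mean i))
    (hs : ∀ i < s.natVar 1, s.natArr 1 i ≤ s.natVar 2) : 0 ≤ outputVal O s := by
  refine FreeOrder.listVal_nonneg (m := O.mean) _ fun a ha => ?_
  obtain ⟨i, hi, rfl⟩ := List.mem_map.1 ha
  exact hO i (lt_of_mem_selected (outputList_toFinset hs ▸ List.mem_toFinset.2 hi))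

theorem outputVal_le (hO : ∀ i < s.natVar 1, FreeOrder.IsTail (O.tail i) (O.mean i))
    (hs : ∀ i < s.natVar 1, s.natArr 1 i ≤ s.natVar 2) :
    outputVal O s ≤ FreeOrder.maxTail O.tail (selected s) := by
  have e : ((outputList s).map fun i => (i, s.realArr 7 i)).map Prod.fst = outputList s := by
    simp [List.map_map, Function.comp_def]
  have := FreeOrder.listVal_le_maxTail (p := O.tail) (m := O.mean)
    ((outputList s).map fun i => (i, s.realArr 7 i)) (fun a ha => by
      obtain ⟨i, hi, rfl⟩ := List.mem_map.1 ha
      exact hO i (lt_of_mem_selected (outputList_toFinset hs ▸ List.mem_toFinset.2 hi)))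
    (by rw [e]; exact outputList_nodup s)
  rwa [e, outputList_toFinset hs] at this

/-- A box in front of all others with threshold zero is worth its mean. -/
theorem mean_le_outputVal (hO : ∀ i < s.natVar 1, FreeOrder.IsTail (O.tail i) (O.mean i))
    (hs : ∀ i < s.natVar 1, s.natArr 1 i ≤ s.natVar 2) {b : ℕ} (hb : b ∈ selected s)
    (h1 : s.natArr 1 b = 0) (h7 : s.realArr 7 b = 0)
    (h : ∀ i ∈ selected s, i ≠ b → 0 < s.natArr 1 i) : O.mean b ≤ outputVal O s := by
  have hL := outputList_toFinset hs
  have hT : ∀ i ∈ outputList s, FreeOrder.IsTail (O.tail i) (O.mean i) := fun i hi =>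
    hO i (lt_of_mem_selected (hL ▸ List.mem_toFinset.2 hi))
  refine le_trans ?_ (FreeOrder.le_listVal (θ := s.realArr 7) (outputList s) hT
    (outputList_nodup s) (outputList_pairwise s))
  rw [hL]
  refine le_trans (le_of_eq ?_) (Finset.single_le_sum (fun i hi => mul_nonneg
    (integral_nonneg fun x => (hO i (lt_of_mem_selected hi)).nonneg _)
    (Finset.prod_nonneg fun l hl => ?_)) hb)
  · rw [Finset.prod_eq_one fun l hl => ?_, mul_one, h7,
      ← (hO b (lt_of_mem_selected hb)).integral]
    · refine setIntegral_congr_fun measurableSet_Ioi fun x hx => ?_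
      rw [max_eq_left (le_of_lt hx)]
    · have := h l (Finset.mem_of_mem_erase hl) (Finset.ne_of_mem_erase hl)
      rw [if_neg (by omega)]
  · have := (hO l (lt_of_mem_selected (Finset.mem_of_mem_erase hl))).le_one (s.realArr 7 l)
    split_ifs <;> linarith

end Final

end RealRAM

namespace RealRAM

section Final

variable {O : Oracle} {s : State} {J : ℕ}

theorem Ranked.congr {t : State} (h : Ranked s) (h1 : t.natVar 1 = s.natVar 1)
    (hq : t.realArr 1 = s.realArr 1) (hr : t.realArr 2 = s.realArr 2) : Ranked t := by
  intro i hi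
  rw [h1] at hi
  rw [hr, h1, hq]
  exact h i hi

/-- The parts of the memory that the search does not change. -/
structure SameTables (s t : State) : Prop where
  written : t.natVar 0 = s.natVar 0
  n : t.natVar 1 = s.natVar 1
  grid : t.natVar 2 = s.natVar 2
  eps : t.realVar 0 = s.realVar 0
  slots : t.realVar 8 = s.realVar 8
  quant : t.realArr 1 = s.realArr 1
  rank : t.realArr 2 = s.realArr 2
  coin : t.realArr 8 = s.realArr 8
  weight : t.realArr 4 = s.realArr 4

theorem sameTables_search (O : Oracle) (s : State) : SameTables s (search.run O 12 s) :=
  ⟨search.run_natVar O 12 rfl s, search.run_natVar O 12 rfl s, search.run_natVar O 12 rfl s,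
    search.run_realVar O 12 rfl s, search.run_realVar O 12 rfl s, search.run_realArr O 12 rfl s,
    search.run_realArr O 12 rfl s, search.run_realArr O 12 rfl s, search.run_realArr O 12 rfl s⟩

theorem sameTables_decideAll (O : Oracle) (s : State) : SameTables s (decideAll.run O 12 s) :=
  ⟨decideAll.run_natVar O 12 rfl s, decideAll.run_natVar O 12 rfl s,
    decideAll.run_natVar O 12 rfl s, decideAll.run_realVar O 12 rfl s,
    decideAll.run_realVar O 12 rfl s, decideAll.run_realArr O 12 rfl s,
    decideAll.run_realArr O 12 rfl s, decideAll.run_realArr O 12 rfl s,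
    decideAll.run_realArr O 12 rfl s⟩

/-- The state in which a box is put in front. -/
structure Rescued (s r : State) (b : ℕ) : Prop where
  lt : b < s.natVar 1
  rank : rankNat (s.realArr 1) (s.natVar 1) b = J ^ 2
  notMem : b ∉ selected s
  selected : selected r = insert b (selected s)
  slot : r.natArr 1 b = 0
  threshold : r.realArr 7 b = 0
  behind : ∀ i < s.natVar 1, i ≠ b → r.natArr 1 i = s.natVar 2

theorem rescue_run (hJ : s.realVar 8 = J) (h7 : s.natVar 7 = 0) (hR : Ranked s)
    (h6 : s.natVar 6 = 3 * J ^ 2 + 1) (hn : 3 * J ^ 2 + 1 < s.natVar 1) :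
    ∃ b, Rescued (J := J) s (rescue.run O 12 s) b := by
  obtain ⟨b, hb, hbr⟩ := exists_rankNat (q := s.realArr 1) (show J ^ 2 < s.natVar 1 by omega)
  have hspec := rescue_spec O hJ h7
  have hiff : ∀ i < s.natVar 1, s.realArr 2 i = (J ^ 2 : ℕ) ↔ i = b := fun i hi => by
    rw [hR i hi, Nat.cast_inj]
    refine ⟨fun h => rankNat_injOn (q := s.realArr 1) (n := s.natVar 1) (by simpa using hi)
      (by simpa using hb) (h.trans hbr.symm), fun h => h ▸ hbr⟩
  have hnm : b ∉ selected s := fun h => by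
    have := (mem_selected.1 h).2
    rw [hR b hb, hbr, h6, Nat.cast_le] at this
    omega
  have n1 : (rescue.run O 12 s).natVar 1 = s.natVar 1 := rescue.run_natVar O 12 rfl s
  have n6 : (rescue.run O 12 s).natVar 6 = s.natVar 6 := rescue.run_natVar O 12 rfl s
  refine ⟨b, hb, hbr, hnm, ?_, ?_, ?_, fun i hi hne => ?_⟩
  · ext i
    rw [mem_selected, Finset.mem_insert, mem_selected, n1, n6]
    by_cases hi : i < s.natVar 1
    · rw [(hspec i hi).1]
      by_cases hib : i = b
      · rw [if_pos ((hiff i hi).2 hib)]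
        simp only [hib, hb, true_and, true_or, iff_true, Nat.cast_le]
        omega
      · rw [if_neg (fun h => hib ((hiff i hi).1 h))]
        simp [hib]
    · simp only [hi, false_and, or_false, false_iff]
      rintro rfl; exact hi hb
  · rw [(hspec b hb).2.1, if_pos ((hiff b hb).2 rfl)]
  · exact (hspec b hb).2.2 ((hiff b hb).2 rfl)
  · rw [(hspec i hi).2.1, if_neg (fun h => hne ((hiff i hi).1 h))]

/-- After a successful search exactly k boxes are missing; after a rescue it is 3J² + 1 minus the
box that returns. Both numbers lie between J² and 3J² + 1. -/
theorem finalState_spec (hJ : s.realVar 8 = J) (h7 : s.natVar 7 = 0) (hR : Ranked s)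
    (hn : 3 * J ^ 2 + 1 < s.natVar 1) (h2 : ∀ i < s.natVar 1, s.natArr 2 i = 0) :
    (finalState O s).natVar 0 = s.natVar 0 ∧ (finalState O s).natVar 1 = s.natVar 1 ∧
    (finalState O s).natVar 2 = s.natVar 2 ∧
    (∀ i < s.natVar 1, (finalState O s).natArr 1 i ≤ s.natVar 2) ∧
    ∃ c, (selected (finalState O s)).card = s.natVar 1 - c ∧ J ^ 2 ≤ c ∧ c ≤ 3 * J ^ 2 + 1 := by
  have hsearch := (search_spec O hJ h7 hn).2.2
  have e₁ := sameTables_search O s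
  have a₁ : (search.run O 12 s).natArr 2 = s.natArr 2 := search.run_natArr O 12 rfl s
  set t := search.run O 12 s with ht
  have hdec := decideAll_spec (O := O) (s := t) (by rw [e₁.n, a₁]; exact h2)
  have e₂ := sameTables_decideAll O t
  have h7₂ : (decideAll.run O 12 t).natVar 7 = t.natVar 7 := decideAll.run_natVar O 12 rfl t
  obtain ⟨p₂, -, s₂, -⟩ := hdec
  set d := decideAll.run O 12 t with hd
  have hRd : Ranked d :=
    hR.congr (e₂.n.trans e₁.n) (e₂.quant.trans e₁.quant) (e₂.rank.trans e₁.rank)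
  have dn : d.natVar 1 = s.natVar 1 := e₂.n.trans e₁.n
  have e : finalState O s = rescue.run O 12 d := rfl
  refine ⟨(rescue.run_natVar O 12 rfl d).trans (e₂.written.trans e₁.written),
    (rescue.run_natVar O 12 rfl d).trans dn,
    (rescue.run_natVar O 12 rfl d).trans (e₂.grid.trans e₁.grid), ?_⟩
  rw [e]
  rcases hsearch with ⟨f7, f1, f2, -⟩ | ⟨f7, f6, -, -⟩
  · rw [rescue_of_found O (by omega)]
    refine ⟨by rw [← e₁.n, ← e₁.grid]; exact s₂, t.natVar 6, ?_, by omega, f2⟩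
    rw [hRd.card_selected, dn, p₂.removed]
  · have d6 : d.natVar 6 = 3 * J ^ 2 + 1 := p₂.removed.trans f6
    obtain ⟨b, hb⟩ := rescue_run (O := O) (s := d) (J := J)
      (by rw [e₂.slots, e₁.slots, hJ]) (by omega) hRd d6 (by omega)
    refine ⟨fun i hi => ?_, 3 * J ^ 2, ?_, by omega, by omega⟩
    · rw [← dn] at hi
      rw [← e₁.grid, ← e₂.grid]
      by_cases hib : i = b
      · rw [hib, hb.slot]; exact Nat.zero_le _
      · rw [hb.behind i hi hib]
    · rw [hb.selected, Finset.card_insert_of_notMem hb.notMem, hRd.card_selected, d6]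
      omega

/-- Flat and rich instances follow from the relaxed benchmark together with derandomization. In the
remaining case the rescued box alone is nearly optimal, since the other boxes add at most 2ε times
its mean to the prophet's reward. -/
theorem finalState_guarantee {κ : ℝ} {M k : ℕ} (hJ : s.realVar 8 = (k + 1 : ℕ))
    (h7 : s.natVar 7 = 0) (hR : Ranked s) (hn : 3 * (k + 1) ^ 2 + 1 + (k + 1) < s.natVar 1)
    (h2 : ∀ i < s.natVar 1, s.natArr 2 i = 0)
    (hD : FreeOrder.Data O.tail O.mean (s.natVar 1) (s.realVar 0) (s.natVar 2) (s.realArr 1)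
      (s.realArr 8))
    (hw : ∀ j < s.natVar 2, s.realArr 4 j = slotWeightOf (s.realVar 0) κ (k + 1) j)
    (hκ : 0 ≤ κ) (hadm : Admissible M (s.realVar 0) (k + 1) κ) (hk : k + 1 ≤ s.natVar 2)
    (hg : s.realVar 0 ^ 2 < FreeOrder.geo (s.realVar 0) k)
    (hg' : FreeOrder.geo (s.realVar 0) (k + 1) ≤ s.realVar 0 ^ 2)
    (hM : 1 ≤ M) (hM2 : 2 * M * s.realVar 0 ≤ 1) (h5 : 5 * s.realVar 0 ≤ 1)
    (hγ : 8 * s.realVar 0 ≤ κ * (1 - 2 * M * s.realVar 0) * (1 - 5 * s.realVar 0)) :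
    (κ - (2 * M + 10) * s.realVar 0) *
      FreeOrder.maxTail O.tail (selected (finalState O s)) ≤ outputVal O (finalState O s) := by
  set J := k + 1 with hJdef
  have hn' : 3 * J ^ 2 + 1 < s.natVar 1 := by omega
  obtain ⟨-, w1, w2, w3, -⟩ := finalState_spec (O := O) hJ h7 hR hn' h2
  have hO : ∀ i < s.natVar 1, FreeOrder.IsTail (O.tail i) (O.mean i) := hD.tail
  have hB : 0 < s.natVar 2 := by omega
  have hout0 : 0 ≤ outputVal O (finalState O s) :=
    outputVal_nonneg (by rw [w1]; exact hO) (by rw [w1, w2]; exact w3)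
  obtain ⟨hready, h4, hsearch⟩ := search_spec O hJ h7 hn'
  have e₁ := sameTables_search O s
  have a₁ : (search.run O 12 s).natArr 2 = s.natArr 2 := search.run_natArr O 12 rfl s
  set t := search.run O 12 s with ht
  have hload : ∀ hT : 0 < ∑ i ∈ selected t, O.mean i, Loaded O t M k κ := fun hT =>
    ⟨by rw [e₁.n, e₁.eps, e₁.grid, e₁.quant, e₁.coin]; exact hD, hready,
      by rw [e₁.grid, e₁.weight, e₁.eps]; exact hw, by rw [e₁.n, a₁]; exact h2, hκ,
      by rw [e₁.eps]; exact hadm, by rw [e₁.grid]; exact hk, by rw [e₁.eps]; exact hg,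
      by rw [e₁.eps]; exact hg', hT⟩
  obtain ⟨p₂, d₂, s₂, v₂⟩ := decideAll_spec (O := O) (s := t) (by rw [e₁.n, a₁]; exact h2)
  have e₂ := sameTables_decideAll O t
  have h7₂ : (decideAll.run O 12 t).natVar 7 = t.natVar 7 := decideAll.run_natVar O 12 rfl t
  set d := decideAll.run O 12 t with hd
  have hRt : Ranked t := hR.congr e₁.n e₁.quant e₁.rank
  have hRd : Ranked d := hRt.congr e₂.n e₂.quant e₂.rank
  have dn : d.natVar 1 = s.natVar 1 := e₂.n.trans e₁.n
  have dB : d.natVar 2 = s.natVar 2 := e₂.grid.trans e₁.grid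
  have dS : selected d = selected t := p₂.selected
  have hSt : ∀ i ∈ selected t, i < s.natVar 1 := fun i hi => e₁.n ▸ lt_of_mem_selected hi
  have hTt : ∀ i ∈ selected t, FreeOrder.IsTail (O.tail i) (O.mean i) := fun i hi => hO i (hSt i hi)
  have hMX := FreeOrder.maxTail_nonneg hTt
  set ε := s.realVar 0 with hε
  have hε0 := hD.pos
  have hM0 : (0 : ℝ) ≤ M := Nat.cast_nonneg M
  have hMε : 0 ≤ (M : ℝ) * ε := mul_nonneg hM0 hε0.le
  have hsum := FreeOrder.maxTail_le_sum hTt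
  have hu : t.realVar 3 ≤ ε * FreeOrder.maxTail O.tail (selected t) := by
    have := hD.sum_le_maxTail hSt
    rw [hready.unit, e₁.n, e₁.eps, mul_div_assoc]
    exact mul_le_mul_of_nonneg_left this hε0.le
  have hval : 0 < ∑ i ∈ selected t, O.mean i →
      κ * (1 - 2 * M * ε) * (1 - 5 * ε) *
        (∫ x in Set.Ioi 0, (1 - Real.exp (-(FreeOrder.mass O.tail O.mean ε (s.realArr 1)
          (s.realArr 8) (selected t) x)))) - 2 * t.realVar 3 ≤ valueOf O t := fun hT => by
    have := (hload hT).value_ge hM (by rw [e₁.eps]; exact hM2)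
    rw [massOf, e₁.eps, e₁.quant, e₁.coin] at this
    exact this
  have hq0 : ∀ i < s.natVar 1, 0 ≤ s.realArr 1 i := fun i hi => hD.quant_nonneg hi
  have hquant : t.natVar 6 < s.natVar 1 →
      (∀ i ∈ selected t, s.realArr 1 i ≤
        quantAtOf (s.realArr 1) (s.realArr 2) (s.natVar 1) (t.natVar 6)) ∧
      0 ≤ quantAtOf (s.realArr 1) (s.realArr 2) (s.natVar 1) (t.natVar 6) := fun h => by
    refine ⟨fun i hi => ?_, ?_⟩
    · have := hRt.quant_le (by rw [e₁.n]; exact h) hi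
      rwa [e₁.n, e₁.quant, e₁.rank] at this
    · obtain ⟨j, hj, e⟩ := exists_rankNat (q := s.realArr 1) h
      rw [← e, quantAtOf_eq hR hj]
      exact hq0 j hj
  have e : finalState O s = rescue.run O 12 d := rfl
  rcases hsearch with ⟨f7, f1, f2, hgood⟩ | ⟨f7, f6, hnf, hnr⟩
  · have er : rescue.run O 12 d = d := rescue_of_found O (by omega)
    rw [e, er] at hout0 ⊢
    rw [dS]
    -- If all remaining means vanish, the grid unit is 0 and the analysis does not apply, but then
    -- the prophet's reward is 0 too.
    rcases le_or_gt (∑ i ∈ selected t, O.mean i) 0 with hT | hT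
    · have : FreeOrder.maxTail O.tail (selected t) = 0 := by linarith
      rw [this, mul_zero]; exact hout0
    have hds : ∀ i < d.natVar 1, d.natArr 1 i ≤ d.natVar 2 := by rw [e₂.n, e₂.grid]; exact s₂
    have hdO : ∀ i < d.natVar 1, FreeOrder.IsTail (O.tail i) (O.mean i) := by rw [dn]; exact hO
    have hv : valueOf O t ≤ outputVal O d := (v₂ fun i hi => (hload hT).proper hi).trans
      (valueOf_le_listVal (by rw [dB]; exact hB) hdO (by rw [e₂.n]; exact d₂) hds)
    have hvM : valueOf O t ≤ FreeOrder.maxTail O.tail (selected t) := by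
      rw [← dS]; exact hv.trans (outputVal_le hdO hds)
    obtain ⟨q1, q2⟩ := hquant (by omega)
    refine le_trans (hD.guarantee hM2 hM0 hκ hadm.1 hMX hu ?_ (hval hT) h5) hv
    rcases hgood with hfl | hri
    · have hl : t.natVar 6 + J < s.natVar 1 := by omega
      refine hD.flat hSt q2 q1
        (R := (Finset.range (s.natVar 1)).filter fun i =>
          rankNat (s.realArr 1) (s.natVar 1) i ∈ Finset.Ico (t.natVar 6) (t.natVar 6 + J))
        (fun i hi => ?_) (fun i hi => ?_) ?_ hfl
      · rw [Finset.mem_filter, Finset.mem_range, Finset.mem_Ico] at hi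
        rw [mem_selected, e₁.n, e₁.rank]
        refine ⟨hi.1, ?_⟩
        rw [hR i hi.1, Nat.cast_le]
        exact hi.2.1
      · rw [Finset.mem_filter, Finset.mem_Ico] at hi
        exact hR.le_quant hl hi.2.2.le
      · rw [card_rankNat fun i hi => Finset.mem_range.2 ((Finset.mem_Ico.1 hi).2.trans hl),
          Nat.card_Ico, Nat.add_sub_cancel_left]
        exact hg'
    · refine hD.rich hSt q2 q1 (G := valueOf O t) ?_ hvM
      rw [← h4]; exact hri
  · have d6 : d.natVar 6 = 3 * J ^ 2 + 1 := p₂.removed.trans f6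
    obtain ⟨b, hb⟩ := rescue_run (O := O) (s := d) (J := J)
      (by rw [e₂.slots, e₁.slots, hJ]) (by omega) hRd d6 (by omega)
    have hbn : b < s.natVar 1 := dn ▸ hb.lt
    have hbt : b ∉ selected t := dS ▸ hb.notMem
    have hsel : selected (finalState O s) = insert b (selected t) := by rw [e, hb.selected, dS]
    have hmean : O.mean b ≤ outputVal O (finalState O s) := by
      refine mean_le_outputVal (by rw [w1]; exact hO) (by rw [w1, w2]; exact w3)
        (by rw [hsel]; exact Finset.mem_insert_self _ _) hb.slot hb.threshold fun i hi hne => ?_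
      have := lt_of_mem_selected hi
      rw [w1, ← dn] at this
      rw [e, hb.behind i this hne, dB]
      exact hB
    have hm0 := hD.mean_nonneg hbn
    have hpoor : FreeOrder.maxTail O.tail (selected t) ≤ 2 * ε * O.mean b := by
      rcases le_or_gt (∑ i ∈ selected t, O.mean i) 0 with hT | hT
      · exact (hsum.trans hT).trans (by positivity)
      obtain ⟨q1, q2⟩ := hquant (by omega)
      refine hD.poor hSt q2 q1 hu (hval hT) le_rfl hγ ?_ ?_ hbn ?_
      · have g1 : κ * (1 - 2 * M * ε) ≤ 1 :=
          mul_le_one₀ hadm.1 (by linarith) (by linarith)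
        exact mul_le_one₀ g1 (by linarith) (by linarith)
      · have : ¬ _ ≤ _ := hnr
        rw [not_le, h4, ← f6] at this
        exact this.le
      · rw [f6]
        refine (quantAtOf_le_of_not_flat hR hε0 (by omega) hn' hq0 hg' hnf).trans (le_of_eq ?_)
        have hbr := hb.rank
        rw [dn, e₂.quant, e₁.quant] at hbr
        rw [← hbr, quantAtOf_eq hR hbn]
    have hins := FreeOrder.maxTail_insert_le hTt (hO b hbn) hbt
    rw [hsel]
    have hMX' : 0 ≤ FreeOrder.maxTail O.tail (insert b (selected t)) :=
      FreeOrder.maxTail_nonneg fun i hi => by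
        rcases Finset.mem_insert.1 hi with rfl | hi
        exacts [hO _ hbn, hTt i hi]
    refine le_trans ?_ hmean
    -- The prophet gets at most (1 + 2ε) times the mean of box b, and (1 - 2ε)(1 + 2ε) ≤ 1.
    have hcoef : κ - (2 * M + 10) * ε ≤ 1 - 2 * ε := by have := hadm.1; nlinarith
    calc _ ≤ (1 - 2 * ε) * FreeOrder.maxTail O.tail (insert b (selected t)) :=
          mul_le_mul_of_nonneg_right hcoef hMX'
      _ ≤ (1 - 2 * ε) * ((1 + 2 * ε) * O.mean b) :=
          mul_le_mul_of_nonneg_left (by linarith) (by linarith)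
      _ ≤ O.mean b := by nlinarith [mul_nonneg (sq_nonneg ε) hm0]

end Final

end RealRAM

namespace RealRAM

/-- What is known about the output of the main program. -/
structure MainSpec (O : Oracle) (β ε : ℝ) (M n : ℕ) (l : List (ℕ × ℝ)) : Prop where
  nodup : (l.map Prod.fst).Nodup
  lt : ∀ a ∈ l, a.1 < n
  card : ∃ J c : ℕ, l.length + c = n ∧ min n (J ^ 2) ≤ c ∧ c ≤ 5 * J ^ 2 ∧
    2 * (ε⁻¹ * Real.log ε⁻¹) ≤ J ∧ (J : ℝ) ≤ 4 * (ε⁻¹ * Real.log ε⁻¹)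
  value : 4 * M * ε ≤ 1 → 10 * ε ≤ 1 → 64 * ε ≤ β →
    (β - (2 * M + 15) * ε) * FreeOrder.maxTail O.tail (l.map Prod.fst).toFinset ≤
      FreeOrder.listVal O.tail l

theorem main_spec {O : Oracle} {s : State} {β : ℝ} {M g₀ : ℕ} (hβ : IsKertzBound β) (hM : 1 ≤ M)
    (hMβ : 1 ≤ M * (1 - β)) (hε : 0 < s.realVar 0) (hε2 : s.realVar 0 ≤ 1 / 2)
    (hO : ∀ i < s.natVar 1, FreeOrder.IsTail (O.tail i) (O.mean i))
    (h2 : ∀ i < s.natVar 1, s.natArr 2 i = 0) (hB : 1 / s.realVar 0 < s.natVar 2)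
    (hB' : 4 * (s.natVar 1 : ℝ) ^ 2 / s.realVar 0 ^ 2 < s.natVar 2) (hg : g₀ < s.natVar 2)
    (hg' : FreeOrder.geo (s.realVar 0) g₀ ≤ s.realVar 0 ^ 2) :
    ∃ l : List (ℕ × ℝ), MainSpec O β (s.realVar 0) M (s.natVar 1) l ∧
      ((main M).run O 12 s).natVar 0 = l.length ∧
      ∀ (j : ℕ) (hj : j < l.length), ((main M).run O 12 s).natArr 0 j = l[j].1 ∧
        ((main M).run O 12 s).realArr 0 j = l[j].2 := by
  obtain ⟨tq, tc, tr⟩ := quantileTables_spec O s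
  have u1 : (quantileTables.run O 12 s).natVar 1 = s.natVar 1 := quantileTables.run_natVar O 12 rfl s
  have u2 : (quantileTables.run O 12 s).natVar 2 = s.natVar 2 := quantileTables.run_natVar O 12 rfl s
  have u0 : (quantileTables.run O 12 s).realVar 0 = s.realVar 0 :=
    quantileTables.run_realVar O 12 rfl s
  have ua : (quantileTables.run O 12 s).natArr 2 = s.natArr 2 := quantileTables.run_natArr O 12 rfl s
  set s₁ := quantileTables.run O 12 s with hs₁
  obtain ⟨k, κ, g1, g2, hk, hslots, hκ0, hadm, hmax, hweight⟩ :=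
    slotTables_spec O s₁ hM (by rw [u0]; exact hε) (by rw [u0]; linarith) (by rw [u2]; exact hg)
      (by rw [u0]; exact hg')
  have v1 : ((slotTables M).run O 12 s₁).natVar 1 = s.natVar 1 :=
    ((slotTables M).run_natVar O 12 rfl s₁).trans u1
  have v2 : ((slotTables M).run O 12 s₁).natVar 2 = s.natVar 2 :=
    ((slotTables M).run_natVar O 12 rfl s₁).trans u2
  have v0 : ((slotTables M).run O 12 s₁).realVar 0 = s.realVar 0 :=
    ((slotTables M).run_realVar O 12 rfl s₁).trans u0
  have va : ((slotTables M).run O 12 s₁).natArr 2 = s.natArr 2 :=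
    ((slotTables M).run_natArr O 12 rfl s₁).trans ua
  have vq : ((slotTables M).run O 12 s₁).realArr 1 = s₁.realArr 1 :=
    (slotTables M).run_realArr O 12 rfl s₁
  have vr : ((slotTables M).run O 12 s₁).realArr 2 = s₁.realArr 2 :=
    (slotTables M).run_realArr O 12 rfl s₁
  have vc : ((slotTables M).run O 12 s₁).realArr 8 = s₁.realArr 8 :=
    (slotTables M).run_realArr O 12 rfl s₁
  rw [u0] at g1 g2 hadm hmax hweight
  rw [u2] at hk hmax hweight
  set ε := s.realVar 0 with hεdef
  set n := s.natVar 1 with hn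
  set B := s.natVar 2 with hBdef
  set s₂ := (((slotTables M).run O 12 s₁).setNat 0 0).setNat 7 0 with hs₂
  have w0 : s₂.natVar 0 = 0 := by simp [hs₂]
  have w1 : s₂.natVar 1 = n := by simp [hs₂, v1]
  have w2 : s₂.natVar 2 = B := by simp [hs₂, v2]
  have w7 : s₂.natVar 7 = 0 := by simp [hs₂]
  have w8 : s₂.realVar 8 = (k + 1 : ℕ) := by rw [← hslots]; rfl
  have wε : s₂.realVar 0 = ε := by rw [← v0]; rfl
  have wq : s₂.realArr 1 = s₁.realArr 1 := vq
  have wr : s₂.realArr 2 = s₁.realArr 2 := vr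
  have wc : s₂.realArr 8 = s₁.realArr 8 := vc
  have wa : ∀ i < s₂.natVar 1, s₂.natArr 2 i = 0 := by
    rw [w1]; intro i hi; rw [← h2 i hi, ← va]; rfl
  have ww : ∀ j < s₂.natVar 2, s₂.realArr 4 j = slotWeightOf (s₂.realVar 0) κ (k + 1) j := by
    rw [w2, wε]; exact hweight
  have hR : Ranked s₂ := by
    intro i hi
    rw [w1] at hi
    rw [wr, wq, w1, tr i hi, rankOf_eq]
  have hrun : (main M).run O 12 s = (Prog.ite (.nat 1)
      (.const 3 * (.real 8 * .real 8) + .const 1 + .real 8) .nop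
      (.seq search (.seq decideAll (.seq rescue emit)))).run O 12 s₂ := rfl
  obtain ⟨b1, b2⟩ := FreeOrder.slots_bounds hε hε2 g1 g2
  have htest : ((HExpr.nat 1).eval O 12 s₂ ≤
      (HExpr.const 3 * (.real 8 * .real 8) + .const 1 + .real 8).eval O 12 s₂) ↔
      n ≤ 3 * (k + 1) ^ 2 + 1 + (k + 1) := by
    simp only [HExpr.eval_nat, HExpr.eval_add, HExpr.eval_mul, HExpr.eval_const, HExpr.eval_real,
      w1, w8, ← pow_two]
    exact_mod_cast Iff.rfl
  rw [hrun]
  have hJ1 : k + 1 ≤ (k + 1) ^ 2 := by nlinarith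
  by_cases hsmall : n ≤ 3 * (k + 1) ^ 2 + 1 + (k + 1)
  · rw [Prog.run_ite_pos _ _ (htest.2 hsmall), Prog.run_nop]
    -- All n boxes are removed, and n ≤ 3J² + 1 + J ≤ 5J².
    refine ⟨[], ⟨List.nodup_nil, by simp, ⟨k + 1, n, by simp, min_le_left _ _, by omega, b1, b2⟩,
      fun _ _ _ => ?_⟩, by simp [w0], by simp⟩
    simp [FreeOrder.maxTail, FreeOrder.listVal]
  rw [Prog.run_ite_neg _ _ (fun h => hsmall (htest.1 h))]
  rw [not_le] at hsmall
  have hfin : (Prog.seq search (.seq decideAll (.seq rescue emit))).run O 12 s₂ =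
      emit.run O 12 (finalState O s₂) := rfl
  rw [hfin]
  obtain ⟨f0, f1, f2, f3, c, hc, hc1, hc2⟩ := finalState_spec (O := O) w8 w7 hR
    (by rw [w1]; omega) wa
  have hwr := emit_spec O (s := finalState O s₂) (f0.trans w0)
  have hsel := outputList_toFinset (s := finalState O s₂) (by rw [f1, f2]; exact f3)
  have hfst : ((outputList (finalState O s₂)).map fun i => (i, (finalState O s₂).realArr 7 i)).map
      Prod.fst = outputList (finalState O s₂) := by
    simp [List.map_map, Function.comp_def]
  refine ⟨(outputList (finalState O s₂)).map fun i => (i, (finalState O s₂).realArr 7 i),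
    ⟨by rw [hfst]; exact outputList_nodup _, ?_, ⟨k + 1, c, ?_, ?_, by omega, b1, b2⟩, ?_⟩,
    by rw [hwr.1, List.length_map], ?_⟩
  · intro a ha
    obtain ⟨i, hi, rfl⟩ := List.mem_map.1 ha
    have := lt_of_mem_selected (hsel ▸ List.mem_toFinset.2 hi)
    rwa [f1, w1] at this
  · rw [List.length_map, ← List.toFinset_card_of_nodup (outputList_nodup _), hsel, hc, w1]
    omega
  · exact (min_le_right _ _).trans hc1
  · intro m1 m2 m3
    rw [hfst, hsel]
    have hκ := scale_ge hβ hε (by linarith) hMβ hB hmax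
    have hD : FreeOrder.Data O.tail O.mean (s₂.natVar 1) (s₂.realVar 0) (s₂.natVar 2)
        (s₂.realArr 1) (s₂.realArr 8) := by
      rw [w1, wε, w2, wq, wc]
      exact ⟨hO, hε, by linarith, by omega, hB', tq, tc⟩
    have hMε : 0 ≤ (M : ℝ) * ε := by positivity
    -- Both correction factors are at least 1/2, and κ ≥ β - 5ε ≥ 59ε by the assumption 64ε ≤ β.
    have hγ : 8 * ε ≤ κ * (1 - 2 * M * ε) * (1 - 5 * ε) := by
      have h1 : κ * (1 / 2) ≤ κ * (1 - 2 * M * ε) :=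
        mul_le_mul_of_nonneg_left (by linarith) hκ0
      have h2 : κ * (1 / 2) * (1 / 2) ≤ κ * (1 - 2 * M * ε) * (1 - 5 * ε) :=
        mul_le_mul h1 (by linarith) (by norm_num) (mul_nonneg hκ0 (by linarith))
      linarith
    have hfinal := finalState_guarantee (O := O) (M := M) w8 w7 hR (by rw [w1]; exact hsmall) wa hD
      ww hκ0 (by rw [wε]; exact hadm) (by rw [w2]; exact hk) (by rw [wε]; exact g1)
      (by rw [wε]; exact g2) hM (by rw [wε]; linarith) (by rw [wε]; linarith) (by rw [wε]; exact hγ)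
    rw [wε] at hfinal
    refine le_trans (mul_le_mul_of_nonneg_right ?_ ?_) hfinal
    · linarith
    · exact FreeOrder.maxTail_nonneg fun i hi => hO i (by
        have := lt_of_mem_selected hi
        rwa [f1, w1] at this)
  · intro j hj
    rw [List.length_map] at hj
    simpa using hwr.2 j hj

/-! ### Choosing the grid -/

/-- Counts up to the first multiple of `ε` that exceeds one. -/
def invert : Cmd :=
  .loop (.realLe (.mul (.ofNat (.var 8)) (.var 0)) (.ofNat (.const 1)))
    (.setNat 8 (.add (.var 8) (.const 1)))

theorem setNat_setNat (s : State) (x a b : ℕ) : (s.setNat x a).setNat x b = s.setNat x b := by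
  simp [State.setNat]

theorem setNat_self (s : State) (x : ℕ) : s.setNat x (s.natVar x) = s := by
  simp [State.setNat]

theorem invert_exec (O : Oracle) (m : ℕ) : ∀ s : State,
    (∀ i < m, ((s.natVar 8 + i : ℕ) : ℝ) * s.realVar 0 ≤ 1) →
    1 < ((s.natVar 8 + m : ℕ) : ℝ) * s.realVar 0 →
    Exec O invert s (s.setNat 8 (s.natVar 8 + m)) (11 * m + 7) := by
  induction m with
  | zero =>
    intro s _ h
    rw [Nat.add_zero, setNat_self]
    exact Exec.loopDone _ _ _ (by simpa [Test.Holds, RExpr.eval, NExpr.eval] using h)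
  | succ m ih =>
    intro s h h'
    have h0 : (s.natVar 8 : ℝ) * s.realVar 0 ≤ 1 := by simpa using h 0 (by omega)
    have h1 := ih (s.setNat 8 (s.natVar 8 + 1)) (fun i hi => by
      have := h (i + 1) (by omega)
      simpa [add_assoc, add_comm, add_left_comm] using this)
      (by simpa [add_assoc, add_comm, add_left_comm] using h')
    have h2 := Exec.loopStep (O := O)
      (.realLe (.mul (.ofNat (.var 8)) (.var 0)) (.ofNat (.const 1)))
      (.setNat 8 (.add (.var 8) (.const 1))) s _ _ _ _
      (by simpa [Test.Holds, RExpr.eval, NExpr.eval] using h0) (Exec.setNat _ _ _) h1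
    rw [setNat_setNat] at h2
    have e1 : (s.setNat 8 (s.natVar 8 + 1)).natVar 8 + m = s.natVar 8 + (m + 1) := by
      simp; omega
    rw [e1] at h2
    have e2 : 11 * (m + 1) + 7 = (Test.realLe (.mul (.ofNat (.var 8)) (.var 0))
        (.ofNat (.const 1))).cost + ((NExpr.add (.var 8) (.const 1)).cost + 1) + (11 * m + 7) := by
      simp [Test.cost, RExpr.cost, NExpr.cost]; omega
    rw [e2]
    exact h2

/-- The program adds a function of the variable `1` to the variable `3`. -/
def Adds (O : Oracle) (p : Prog) (f : ℕ → ℕ) : Prop :=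
  ∀ s : State, (p.run O 12 s).natVar 3 = s.natVar 3 + f (s.natVar 1)

/-- Natural variables can only be added and subtracted, so the grid size is produced by nested
counting. -/
theorem Adds.loop {O : Oracle} {p : Prog} {f : ℕ → ℕ} (h : Adds O p f) {x : ℕ} (h3 : x ≠ 3)
    (h1 : x ≠ 1) (hp : p.writes (.natVar 1) = false) : Adds O (.loop x 1 p) fun Y => Y * f Y := by
  intro s
  have := iterate_induction (f := p.run O 12) (x := x) (s := s) (N := s.natVar 1)
    (fun k t => t.natVar 1 = s.natVar 1 ∧ t.natVar 3 = s.natVar 3 + k * f (s.natVar 1))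
    ⟨by simp [h1.symm], by simp [h3.symm]⟩ (by
      intro k _ t _ ⟨a, b⟩
      refine ⟨?_, ?_⟩
      · simp [h1.symm, p.run_natVar O 12 hp t, a]
      · simp only [setNat_natVar, ne_eq, h3.symm, not_false_eq_true, Function.update_of_ne, h t, a, b]
        ring)
  exact this.2

/-- The fourth power of the variable `1`. -/
def power : Prog := .loop 4 1 (.loop 5 1 (.loop 6 1 (.loop 7 1
  (.setNat 3 (.add (.var 3) (.const 1))))))

theorem power_run (O : Oracle) (s : State) (h : s.natVar 3 = 0) :
    (power.run O 12 s).natVar 3 = s.natVar 1 ^ 4 := by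
  have h0 : Adds O (.setNat 3 (.add (.var 3) (.const 1))) fun _ => 1 := fun s => by
    simp [Prog.run, NExpr.eval]
  have := (((h0.loop (x := 7) (by decide) (by decide) rfl).loop (x := 6) (by decide) (by decide)
    rfl).loop (x := 5) (by decide) (by decide) rfl).loop (x := 4) (by decide) (by decide) rfl s
  rw [power, this, h]
  ring

/-- The complete program. -/
def program (M : ℕ) : Cmd :=
  -- Variable 1 holds n + E while the loops of `power` run over it, and is reset to n for the main
  -- program.
  .seq invert <| .seq (.setNat 1 (.add (.var 0) (.var 8))) <| .seq (power.comp 12 9) <|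
  .seq (.setNat 2 (.var 3)) <| .seq (.setNat 1 (.var 0)) ((main M).comp 12 9)

/-- A bound on the number of steps of the program, where `Y = n + E`, and `E - 1 ≤ ε⁻¹`. -/
def programCost (M Y : ℕ) : ℕ := 11 * Y + 20 + power.cost Y + (main M).cost (Y ^ 4)

theorem PolyBounded.comp_pow {f : ℕ → ℕ} (h : PolyBounded f) (a : ℕ) :
    PolyBounded fun N => f (N ^ a) := by
  obtain ⟨K, d, h⟩ := h
  refine ⟨K * 2 ^ d, a * d, fun N => (h _).trans ?_⟩
  have h1 : N ^ a + 1 ≤ 2 * (N + 1) ^ a := by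
    have h2 : N ^ a ≤ (N + 1) ^ a := Nat.pow_le_pow_left (by omega) a
    have h3 : 1 ≤ (N + 1) ^ a := Nat.one_le_pow _ _ (by omega)
    omega
  calc K * (N ^ a + 1) ^ d ≤ K * (2 * (N + 1) ^ a) ^ d :=
        Nat.mul_le_mul_left _ (Nat.pow_le_pow_left h1 d)
    _ = K * 2 ^ d * (N + 1) ^ (a * d) := by rw [mul_pow, pow_mul]; ring

theorem polyBounded_programCost (M : ℕ) : PolyBounded (programCost M) := by
  have h : PolyBounded fun N => 11 * N + 20 := ⟨20, 1, fun N => by simp only [pow_one]; omega⟩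
  exact (h.add power.polyBounded_cost).add ((main M).polyBounded_cost.comp_pow 4)

theorem program_exec (O : Oracle) {n E : ℕ} {ε : ℝ} (M : ℕ) (hE : 1 < (E : ℝ) * ε)
    (hE' : ∀ i < E, (i : ℝ) * ε ≤ 1) :
    ∃ (σ s' : State) (t : ℕ), Exec O (program M) (input n ε) s' t ∧ t ≤ programCost M (n + E) ∧
      σ.natVar 1 = n ∧ σ.natVar 2 = (n + E) ^ 4 ∧ σ.realVar 0 = ε ∧ (∀ i, σ.natArr 2 i = 0) ∧
      Agree 12 9 ((main M).run O 12 σ) s' := by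
  have x₁ := invert_exec O E (input n ε) (by simpa [input] using hE') (by simpa [input] using hE)
  set s₁ := (input n ε).setNat 8 ((input n ε).natVar 8 + E) with hs₁
  set s₂ := s₁.setNat 1 (n + E) with hs₂
  have x₂ : Exec O (.setNat 1 (.add (.var 0) (.var 8))) s₁ s₂ 4 := by
    have := Exec.setNat (O := O) 1 (.add (.var 0) (.var 8)) s₁
    have e : (NExpr.add (.var 0) (.var 8)).eval s₁ = n + E := by
      simp [NExpr.eval, hs₁, input]
    rwa [e] at this
  have y1 : s₂.natVar 1 = n + E := by simp [hs₂]
  have y2 : s₂.natVar 2 = 0 := by simp [hs₂, hs₁, input]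
  obtain ⟨s₃, t₃, x₃, a₃, c₃⟩ := power.comp_exec O 12 9 (n + E) (by decide) s₂ s₂ rfl y1.le
    (by omega) (Agree.refl _ _ _)
  set r₃ := power.run O 12 s₂ with hr₃
  have z3 : r₃.natVar 3 = (n + E) ^ 4 := by
    rw [hr₃, power_run O s₂ (by simp [hs₂, hs₁, input]), y1]
  have z0 : r₃.natVar 0 = n := (power.run_natVar O 12 rfl s₂).trans (by simp [hs₂, hs₁, input])
  have zε : r₃.realVar 0 = ε :=
    (power.run_realVar O 12 rfl s₂).trans (by simp [hs₂, hs₁, input])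
  have za : r₃.natArr 2 = fun _ => 0 :=
    (power.run_natArr O 12 rfl s₂).trans (by simp [hs₂, hs₁, input])
  have w3 : s₃.natVar 3 = (n + E) ^ 4 := (a₃.natVar 3 (by decide)).symm.trans z3
  have w0 : s₃.natVar 0 = n := (a₃.natVar 0 (by decide)).symm.trans z0
  set s₄ := s₃.setNat 2 ((n + E) ^ 4) with hs₄
  set s₅ := s₄.setNat 1 n with hs₅
  have x₄ : Exec O (.setNat 2 (.var 3)) s₃ s₄ 2 := by
    have := Exec.setNat (O := O) 2 (.var 3) s₃
    simp only [NExpr.eval, w3] at this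
    exact this
  have x₅ : Exec O (.setNat 1 (.var 0)) s₄ s₅ 2 := by
    have := Exec.setNat (O := O) 1 (.var 0) s₄
    have e : (NExpr.var 0).eval s₄ = n := by simp [NExpr.eval, hs₄, w0]
    rw [e] at this
    exact this
  have hnE : n ≤ (n + E) ^ 4 := by
    have hpos : 1 ≤ n + E := by
      rcases Nat.eq_zero_or_pos E with h | h
      · rw [h] at hE; norm_num at hE
      · omega
    calc n ≤ n + E := by omega
      _ = (n + E) ^ 1 := (pow_one _).symm
      _ ≤ (n + E) ^ 4 := Nat.pow_le_pow_right hpos (by decide)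
  obtain ⟨s₆, t₆, x₆, a₆, c₆⟩ := (main M).comp_exec O 12 9 ((n + E) ^ 4) (by decide) s₅ s₅
    (main_ok M) (by simp [hs₅, hnE]) (by simp [hs₅, hs₄]) (Agree.refl _ _ _)
  refine ⟨s₅, s₆, _, Exec.seq _ _ _ _ _ _ _ x₁ (Exec.seq _ _ _ _ _ _ _ x₂ (Exec.seq _ _ _ _ _ _ _
    x₃ (Exec.seq _ _ _ _ _ _ _ x₄ (Exec.seq _ _ _ _ _ _ _ x₅ x₆)))), ?_, by simp [hs₅],
    by simp [hs₅, hs₄], ?_, fun i => ?_, a₆⟩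
  · rw [programCost]; omega
  · rw [← zε]; exact (a₃.realVar 0 (by decide)).symm
  · have : s₅.natArr = r₃.natArr := a₃.natArr.symm
    rw [this, za]

end RealRAM

namespace RealRAM

theorem exists_fin_list {n : ℕ} (l : List (ℕ × ℝ)) (h : ∀ a ∈ l, a.1 < n) :
    ∃ l' : List (Fin n × ℝ), (l'.map fun a => ((a.1 : ℕ), a.2)) = l := by
  induction l with
  | nil => exact ⟨[], rfl⟩
  | cons a l ih =>
    obtain ⟨l', hl'⟩ := ih fun b hb => h b (List.mem_cons_of_mem _ hb)
    exact ⟨(⟨a.1, h a List.mem_cons_self⟩, a.2) :: l', by rw [List.map_cons, hl']⟩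

/-- The first multiple of `ε` that exceeds one. -/
theorem exists_inverse {ε : ℝ} (hε : 0 < ε) : ∃ E : ℕ, 1 < (E : ℝ) * ε ∧
    (∀ i < E, (i : ℝ) * ε ≤ 1) ∧ (E : ℝ) ≤ ε⁻¹ + 1 := by
  have h1 : (⌊ε⁻¹⌋₊ : ℝ) ≤ ε⁻¹ := Nat.floor_le (by positivity)
  have h2 : ε⁻¹ < ⌊ε⁻¹⌋₊ + 1 := Nat.lt_floor_add_one _
  refine ⟨⌊ε⁻¹⌋₊ + 1, ?_, fun i hi => ?_, by push_cast; linarith⟩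
  · push_cast
    exact (inv_lt_iff_one_lt_mul₀ hε).1 h2
  · have : (i : ℝ) ≤ ⌊ε⁻¹⌋₊ := by exact_mod_cast Nat.lt_succ_iff.1 hi
    have := this.trans h1
    rwa [inv_eq_one_div, le_div_iff₀ hε] at this

section Grid

variable {ε : ℝ} (hε : 0 < ε) (hε2 : ε ≤ 1 / 2) {n E : ℕ} (hE : 1 < (E : ℝ) * ε)
include hε hE

/-- By Bernoulli's inequality (1 + ε)^{E³} ≥ E³ε, and ε² E³ε = (Eε)³ ≥ 1. Hence a grid of more than
E³ points contains all slots. -/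
theorem geo_cube_le : FreeOrder.geo ε (E ^ 3) ≤ ε ^ 2 := by
  have h1 := one_add_mul_le_pow (show -2 ≤ ε by linarith) (E ^ 3)
  have h2 : 1 ≤ ((E : ℝ) * ε) ^ 3 := one_le_pow₀ hE.le
  have h3 : 1 ≤ ε ^ 2 * (1 + ε) ^ (E ^ 3) := by
    have h4 := mul_le_mul_of_nonneg_left h1 (sq_nonneg ε)
    push_cast at h4
    have : ε ^ 2 * (1 + (E : ℝ) ^ 3 * ε) = ε ^ 2 + ((E : ℝ) * ε) ^ 3 := by ring
    nlinarith [sq_nonneg ε]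
  rw [FreeOrder.geo, div_pow, one_pow, div_le_iff₀ (by positivity)]
  exact h3

include hε2

omit hε in
theorem two_lt : 2 < E := by
  have : (2 : ℝ) < E := by
    have h : (0 : ℝ) ≤ E := Nat.cast_nonneg _
    nlinarith
  exact_mod_cast this

omit hε in
theorem cube_lt : E ^ 3 < (n + E) ^ 4 := by
  have h := two_lt hε2 hE
  calc E ^ 3 < E ^ 4 := Nat.pow_lt_pow_right (by omega) (by decide)
    _ ≤ _ := Nat.pow_le_pow_left (by omega) 4

theorem inv_lt_pow : 1 / ε < ((n + E) ^ 4 : ℕ) := by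
  have h := two_lt hε2 hE
  have h1 : 1 / ε < E := by rwa [div_lt_iff₀ hε]
  have h2 : E ≤ (n + E) ^ 4 := by
    calc E ≤ (n + E) ^ 1 := by rw [pow_one]; omega
      _ ≤ _ := Nat.pow_le_pow_right (by omega) (by decide)
  exact h1.trans_le (by exact_mod_cast h2)

omit hε2 in
-- By 4ab ≤ (a + b)², the fourth power of n + ε⁻¹ is at least 16 n²/ε².
theorem sq_div_lt_pow : 4 * (n : ℝ) ^ 2 / ε ^ 2 < ((n + E) ^ 4 : ℕ) := by
  have h1 : ε⁻¹ < E := by rwa [inv_eq_one_div, div_lt_iff₀ hε]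
  have h0 : 0 < ε⁻¹ := by positivity
  have hn : (0 : ℝ) ≤ n := Nat.cast_nonneg _
  have h2 : (n + ε⁻¹ : ℝ) ^ 4 < (n + E : ℝ) ^ 4 :=
    pow_lt_pow_left₀ (by linarith) (by positivity) (by decide)
  have h3 : 4 * (n : ℝ) * ε⁻¹ ≤ (n + ε⁻¹) ^ 2 := by nlinarith [sq_nonneg ((n : ℝ) - ε⁻¹)]
  have h4 : (4 * (n : ℝ) * ε⁻¹) ^ 2 ≤ ((n + ε⁻¹) ^ 2) ^ 2 :=
    pow_le_pow_left₀ (by positivity) h3 2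
  have h5 : 4 * (n : ℝ) ^ 2 / ε ^ 2 = 4 * ((n : ℝ) * ε⁻¹) ^ 2 := by
    rw [mul_pow, inv_pow, div_eq_mul_inv]; ring
  push_cast
  rw [h5]
  nlinarith [sq_nonneg ((n : ℝ) * ε⁻¹)]

end Grid

end RealRAM

theorem theorem4p7 (β : ℝ) (hβ : IsKertzBound β) :
    ∃ (prog : RealRAM.Cmd) (C c₁ c₂ K : ℝ) (d : ℕ), 0 < C ∧ 0 < c₁ ∧ 0 < c₂ ∧ 0 < K ∧
      ∀ (Ω : Type*) [MeasurableSpace Ω] (P : MeasureTheory.Measure Ω)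
        [MeasureTheory.IsProbabilityMeasure P] (n : ℕ) (X : Fin n → Ω → ℝ),
        (∀ i, Measurable (X i)) → (∀ i ω, 0 ≤ X i ω) →
        (∀ i, MeasureTheory.Integrable (X i) P) → ProbabilityTheory.iIndepFun X P →
        ∀ ε : ℝ, 0 < ε → ε ≤ 1 / 2 →
          ∃ (S : Finset (Fin n)) (l : List (Fin n × ℝ)) (s : RealRAM.State) (t : ℕ),
            -- the number of removed variables
            min (n : ℝ) (c₁ * (ε⁻¹ * Real.log ε⁻¹) ^ 2) ≤ (n : ℝ) - (S.card : ℝ) ∧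
            (n : ℝ) - (S.card : ℝ) ≤ c₂ * (ε⁻¹ * Real.log ε⁻¹) ^ 2 ∧
            -- the prophet inequality for the remaining instance
            (β - C * ε) * FreeOrder.prophet P X S ≤ FreeOrder.optFree P X S ∧
            -- the program halts in polynomial time
            RealRAM.Exec (RealRAM.boxOracle P X) prog (RealRAM.input n ε) s t ∧
            (t : ℝ) ≤ K * ((n : ℝ) + ε⁻¹) ^ d ∧
            -- its output is an order on the remaining instance with thresholds
            RealRAM.IsOutput s l ∧
            (l.map Prod.fst).Nodup ∧ (l.map Prod.fst).toFinset = S ∧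
            -- the policy so described achieves the guarantee
            (β - C * ε) * FreeOrder.prophet P X S ≤
              FreeOrder.expReward P X (FreeOrder.Policy.ofThresholds l) := by
  obtain ⟨hβ0, hβ1, -⟩ := id hβ
  have hβ' : 0 < 1 - β := by linarith
  -- The program depends on β only through M, which bounds the inverse survival probability, since
  -- survival is at least 1 - β.
  set M := ⌈1 / (1 - β)⌉₊ with hMdef
  have hM : 1 ≤ M := Nat.one_le_ceil_iff.2 (by positivity)
  have hMβ : 1 ≤ M * (1 - β) := by
    have := Nat.le_ceil (1 / (1 - β))
    rwa [div_le_iff₀ hβ'] at this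
  obtain ⟨K, d, hK⟩ := RealRAM.polyBounded_programCost M
  -- With L = ε⁻¹ log ε⁻¹ one has 2L ≤ J ≤ 4L, and the number of removed boxes is at least min(n,
  -- J²) and at most 5J²; this gives the constants 4 and 5 · 16 = 80.
  refine ⟨RealRAM.program M, 6 * M + 100, 4, 80, K * 2 ^ d + 1, d, by positivity, by norm_num,
    by norm_num, by positivity, ?_⟩
  intro Ω _ P _ n X hm h0 hi hX ε hε hε2
  obtain ⟨E, hE, hE', hE1⟩ := RealRAM.exists_inverse hε
  obtain ⟨σ, s, t, hex, ht, σ1, σ2, σε, σa, hag⟩ :=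
    RealRAM.program_exec (RealRAM.boxOracle P X) (n := n) M hE hE'
  have hO := RealRAM.isTail_boxOracle (P := P) hm h0 hi
  obtain ⟨l₀, hl₀, hlen, hout⟩ := RealRAM.main_spec (O := RealRAM.boxOracle P X) (s := σ)
    (g₀ := E ^ 3) hβ hM hMβ (by rw [σε]; exact hε) (by rw [σε]; exact hε2)
    (by rw [σ1]; exact hO) (fun i _ => σa i)
    (by rw [σε, σ2]; exact RealRAM.inv_lt_pow hε hε2 hE)
    (by rw [σε, σ1, σ2]; exact RealRAM.sq_div_lt_pow hε hE)
    (by rw [σ2]; exact RealRAM.cube_lt hε2 hE)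
    (by rw [σε]; exact RealRAM.geo_cube_le hε hE)
  rw [σε, σ1] at hl₀
  obtain ⟨l, rfl⟩ := RealRAM.exists_fin_list l₀ hl₀.lt
  have hfst : (l.map fun a => ((a.1 : ℕ), a.2)).map Prod.fst =
      (l.map Prod.fst).map (fun i : Fin n => (i : ℕ)) := by
    simp [List.map_map, Function.comp_def]
  have hnd : (l.map Prod.fst).Nodup := by
    have := hl₀.nodup
    rw [hfst] at this
    exact this.of_map _
  have hfin : ((l.map fun a => ((a.1 : ℕ), a.2)).map Prod.fst).toFinset =
      (l.map Prod.fst).toFinset.map Fin.valEmbedding := by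
    rw [hfst]
    ext i
    simp
  have hcard : (l.map Prod.fst).toFinset.card = l.length := by
    rw [List.toFinset_card_of_nodup hnd, List.length_map]
  have hp : ∀ i : Fin n, (RealRAM.boxOracle P X).tail i = FreeOrder.tailOf P (X i) :=
    RealRAM.tail_boxOracle hm
  have hvalue : (β - (6 * M + 100) * ε) * FreeOrder.prophet P X (l.map Prod.fst).toFinset ≤
      FreeOrder.expReward P X (FreeOrder.Policy.ofThresholds l) := by
    have hpr := FreeOrder.prophet_nonneg (P := P) (X := X) (l.map Prod.fst).toFinset
    have hMε : 0 ≤ (M : ℝ) * ε := by positivity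
    by_cases hs : 4 * M * ε ≤ 1 ∧ 10 * ε ≤ 1 ∧ 64 * ε ≤ β
    · have := hl₀.value hs.1 hs.2.1 hs.2.2
      rw [hfin, ← FreeOrder.prophet_eq_maxTail hm hi hX hp,
        ← FreeOrder.expReward_eq_listVal hm h0 hi hX hp l hnd] at this
      exact (mul_le_mul_of_nonneg_right (by linarith) hpr).trans this
    -- If ε is not small, then β ≤ (6M + 100)ε and the claim holds because rewards are nonnegative.
    · refine (mul_nonpos_of_nonpos_of_nonneg ?_ hpr).trans (FreeOrder.expReward_nonneg h0 hnd)
      by_contra hc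
      exact hs ⟨by linarith, by linarith, by linarith⟩
  obtain ⟨J, c, hc, hc1, hc2, hJ1, hJ2⟩ := hl₀.card
  rw [List.length_map] at hc
  have hlog : 0 ≤ ε⁻¹ * Real.log ε⁻¹ := by
    have : 1 ≤ ε⁻¹ := (one_le_inv₀ hε).2 (by linarith)
    exact mul_nonneg (by positivity) (Real.log_nonneg this)
  set L := ε⁻¹ * Real.log ε⁻¹ with hL
  have hnc : (n : ℝ) - ((l.map Prod.fst).toFinset.card : ℝ) = c := by
    have : ((l.length : ℝ) + c) = n := by exact_mod_cast hc
    rw [hcard]; linarith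
  refine ⟨(l.map Prod.fst).toFinset, l, s, t, ?_, ?_,
    hvalue.trans (FreeOrder.expReward_le_optFree hm h0 hi hnd), hex, ?_, ⟨?_, fun j hj => ?_⟩, hnd,
    rfl, hvalue⟩
  · rw [hnc]
    have : (min (n : ℝ) ((J : ℝ) ^ 2)) ≤ c := by exact_mod_cast hc1
    refine le_trans (min_le_min le_rfl ?_) this
    nlinarith
  · rw [hnc]
    have : (c : ℝ) ≤ 5 * (J : ℝ) ^ 2 := by exact_mod_cast hc2
    nlinarith [Nat.cast_nonneg (α := ℝ) J]
  · have h1 : (t : ℝ) ≤ K * ((n + E : ℕ) + 1 : ℝ) ^ d := by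
      exact_mod_cast ht.trans (hK (n + E))
    have h2 : (2 : ℝ) ≤ ε⁻¹ := by
      rw [inv_eq_one_div, le_div_iff₀ hε]; linarith
    -- Since E ≤ ε⁻¹ + 1 and 2 ≤ ε⁻¹, the additive constants are absorbed into a second ε⁻¹.
    have h3 : ((n + E : ℕ) + 1 : ℝ) ≤ 2 * (n + ε⁻¹) := by
      push_cast
      have : (0 : ℝ) ≤ n := Nat.cast_nonneg _
      linarith
    calc (t : ℝ) ≤ K * ((n + E : ℕ) + 1 : ℝ) ^ d := h1
      _ ≤ K * (2 * (n + ε⁻¹)) ^ d := by gcongr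
      _ = K * 2 ^ d * (n + ε⁻¹) ^ d := by rw [mul_pow]; ring
      _ ≤ (K * 2 ^ d + 1) * (n + ε⁻¹) ^ d := by gcongr; linarith
  · rw [← hag.natVar 0 (by decide), hlen, List.length_map]
  · have := hout j (by rwa [List.length_map])
    rw [← hag.natArr, ← hag.realArr]
    simpa using this
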